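/- Let $d\ge 2$, $\mathbb{R}^d_+=\{x\in\mathbb{R}^d: x_d>0\}$, and for $r>0$ put $B_r^+=\mathbb{R}^d_+\cap B_r(0)$, $\Gamma_r=\{x_d=0\}\cap B_r(0)$. Let $a_{ij}$ be measurable on $B_1^+$ with $a_{ij}=a_{ji}$ and $\lambda I_d\le (a_{ij})\le\Lambda I_d$ a.e. in $B_1^+$ for some $0<\lambda<\Lambda<\infty$, and suppose that there are values $a_{ij}(0)\in\mathbb{R}$ with $$\frac{1}{|B_r^+|}\int_{B_r^+}|a_{ij}-a_{ij}(0)|^2\,dx\to 0\quad\text{as } r\to 0^+ .$$ Let $p>d$, $q>d/2$, $s>d-1$ (the value $\infty$ allowed), and suppose that for every $\rho\in(0,1)$, $b_i,W_i\in L_p(B_\rho^+)$, $V\in L_q(B_\rho^+)$ and $\eta\in L_s(\Gamma_\rho)$. Let $u\in H^1(B_1^+)$ be a (real) weak solution of $$D_i(a_{ij}D_ju+b_iu)+W_iD_iu+Vu=0\ \text{ in } B_1^+,\qquad (a_{ij}D_ju+b_iu)\,\vec n_i=\eta u\ \text{ on }\Gamma_1,$$ where $\vec n$ is the outward unit normal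 and repeated indices are summed; that is, with $u$ on $\Gamma_1$ understood as a trace, for every $\varphi\in C_c^\infty(\overline{\mathbb{R}^d_+}\cap B_1)$, $$\int_{B_1^+}\Big(-(a_{ij}D_ju+b_iu)D_i\varphi+(W_iD_iu+Vu)\varphi\Big)\,dx+\int_{\Gamma_1}\eta u\varphi\,d\sigma=0 .$$ Assume that $u$ does not vanish a.e. on $B_r^+$ for any $r>0$ (so that the quotients below are defined). Let $A=(a_{ij}(0))$, let $\Theta$ be the $d\times d$ matrix that agrees with the identity except that its last column is $(-a_{1d}(0)/a_{dd}(0),\dots,-a_{d-1,d}(0)/a_{dd}(0),1)^T$, and let $\Psi_A=(\Theta A\Theta^T)^{1/2}\,\Theta$, with the positive definite square root. Write $\fint_E f=|E|^{-1}\int_E f$. Then, as $r\to0^+$, $$\log_2\left(\frac{\fint_{\Psi_A(B_{2r}^+)}|u|^2}{\fint_{\Psi_A(B_r^+)}|u|^2}\right)^{1/2}$$ either tends to $+\infty$ or converges to some $m\in\mathbb{N}=\{0,1,2,\dots\}$. -/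

import Mathlib

open MeasureTheory Filter Topology
open scoped ContDiff Matrix ENNReal

noncomputable section

namespace RobinHalfSpace

/-- The space `ℝ^d` with `d = n + 1`; the last coordinate `x_d` is `x (Fin.last n)`. -/
abbrev Space (n : ℕ) : Type := EuclideanSpace ℝ (Fin (n + 1))

/-- The boundary hyperplane `ℝ^(d-1)`; its Lebesgue measure is the surface measure. -/
abbrev Bdry (n : ℕ) : Type := EuclideanSpace ℝ (Fin n)

/-- The half ball `B_r^+ = {x_d > 0} ∩ B_r`. -/
def halfBall (n : ℕ) (r : ℝ) : Set (Space n) :=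
  {x | 0 < x (Fin.last n)} ∩ Metric.ball 0 r

/-- The flat ball `Γ_r = {x_d = 0} ∩ B_r`, in the coordinates of the hyperplane. -/
def flatBall (n : ℕ) (r : ℝ) : Set (Bdry n) := Metric.ball 0 r

/-- The inclusion `x' ↦ (x', 0)` of the boundary hyperplane. -/
def incl {n : ℕ} (x' : Bdry n) : Space n :=
  WithLp.toLp 2 (Fin.snoc (α := fun _ => ℝ) (fun i => x' i) 0)

/-- The classical partial derivative `D_i φ`. -/
def pderiv {n : ℕ} (i : Fin (n + 1)) (φ : Space n → ℝ) (x : Space n) : ℝ :=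
  fderiv ℝ φ x (EuclideanSpace.single i 1)

/-- The classical gradient `(D_1 φ, …, D_d φ)`. -/
def grad {n : ℕ} (φ : Space n → ℝ) (x : Space n) : Space n :=
  WithLp.toLp 2 fun i => pderiv i φ x

/-- Smooth functions on `ℝ^d` whose support is a compact subset of the open set `U`. -/
def IsTestFunction {n : ℕ} (U : Set (Space n)) (φ : Space n → ℝ) : Prop :=
  ContDiff ℝ ∞ φ ∧ HasCompactSupport φ ∧ tsupport φ ⊆ U

/-- `u ∈ L_2(U)` has the weak gradient `Du ∈ L_2(U)`. -/
structure HasH1Gradient {n : ℕ} (U : Set (Space n)) (u : Space n → ℝ)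
    (Du : Space n → Space n) : Prop where
  memLp : MemLp u 2 (volume.restrict U)
  memLp_grad : MemLp Du 2 (volume.restrict U)
  weak_grad : ∀ φ : Space n → ℝ, IsTestFunction U φ → ∀ i : Fin (n + 1),
    ∫ x in U, u x * pderiv i φ x = - ∫ x in U, Du x i * φ x

/-- The Sobolev space `H^1(U)`. -/
def MemH1 {n : ℕ} (U : Set (Space n)) (u : Space n → ℝ) : Prop :=
  ∃ Du : Space n → Space n, HasH1Gradient U u Du

/-- `T` is the trace on `Γ_1` of the function `u ∈ H^1(B_1^+)` with weak gradient `Du`: the limit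
in `L_2(Γ_1)` of the boundary values of functions smooth up to the boundary that converge to `u`
in `H^1(B_1^+)`. -/
def IsTrace {n : ℕ} (u : Space n → ℝ) (Du : Space n → Space n) (T : Bdry n → ℝ) : Prop :=
  MemLp T 2 (volume.restrict (flatBall n 1)) ∧
  ∃ v : ℕ → Space n → ℝ, (∀ k, ContDiff ℝ ∞ (v k)) ∧
    Tendsto (fun k => eLpNorm (v k - u) 2 (volume.restrict (halfBall n 1))) atTop (𝓝 0) ∧
    Tendsto (fun k => eLpNorm (grad (v k) - Du) 2 (volume.restrict (halfBall n 1))) atTop (𝓝 0) ∧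
    Tendsto (fun k => eLpNorm ((fun x' => v k (incl x')) - T) 2
      (volume.restrict (flatBall n 1))) atTop (𝓝 0)

/-- The coefficients `a_ij`, `b_i`, `W_i`, `V` of the operator, and the Robin potential `η`. -/
structure Coefficients (n : ℕ) where
  a : Space n → Matrix (Fin (n + 1)) (Fin (n + 1)) ℝ
  b : Space n → Space n
  W : Space n → Space n
  V : Space n → ℝ
  η : Bdry n → ℝ

namespace Coefficients

variable {n : ℕ} (c : Coefficients n)

/-- The leading coefficients are measurable, symmetric, and `lam I ≤ (a_ij) ≤ Lam I` almost
everywhere in `B_1^+`. -/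
def UniformlyElliptic (lam Lam : ℝ) : Prop :=
  (∀ i j, AEStronglyMeasurable (fun x => c.a x i j) (volume.restrict (halfBall n 1))) ∧
  ∀ᵐ x ∂(volume.restrict (halfBall n 1)), (c.a x).IsSymm ∧
    ∀ ξ : Fin (n + 1) → ℝ,
      lam * (ξ ⬝ᵥ ξ) ≤ ξ ⬝ᵥ (c.a x *ᵥ ξ) ∧ ξ ⬝ᵥ (c.a x *ᵥ ξ) ≤ Lam * (ξ ⬝ᵥ ξ)

/-- `b_i, W_i ∈ L_p`, `V ∈ L_q`, `η ∈ L_s`, locally in `B_1`, up to the flat boundary. -/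
def LowerOrderIntegrable (p q s : ℝ≥0∞) : Prop :=
  ∀ ρ : ℝ, 0 < ρ → ρ < 1 →
    MemLp c.b p (volume.restrict (halfBall n ρ)) ∧
    MemLp c.W p (volume.restrict (halfBall n ρ)) ∧
    MemLp c.V q (volume.restrict (halfBall n ρ)) ∧
    MemLp c.η s (volume.restrict (flatBall n ρ))

/-- The `a_ij` are continuous at `0` in the `L_2`-mean, with value `a_ij(0)`. -/
def MeanContinuousAtZero : Prop :=
  ∀ i j, Tendsto (fun r : ℝ => ⨍ x in halfBall n r, |c.a x i j - c.a 0 i j| ^ 2)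
    (𝓝[>] 0) (𝓝 0)

/-- `u ∈ H^1(B_1^+)` solves, in the weak sense,
`D_i (a_ij D_j u + b_i u) + W_i D_i u + V u = 0` in `B_1^+` with the Robin condition
`(a_ij D_j u + b_i u) n_i = η u` on `Γ_1`. -/
def IsWeakSolution (u : Space n → ℝ) : Prop :=
  ∃ (Du : Space n → Space n) (T : Bdry n → ℝ),
    HasH1Gradient (halfBall n 1) u Du ∧ IsTrace u Du T ∧
    ∀ φ : Space n → ℝ, IsTestFunction (Metric.ball 0 1) φ →
      (∫ x in halfBall n 1,
        (-(∑ i, ((∑ j, c.a x i j * Du x j) + c.b x i * u x) * pderiv i φ x)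
          + ((∑ i, c.W x i * Du x i) + c.V x * u x) * φ x))
      + ∫ x' in flatBall n 1, c.η x' * T x' * φ (incl x') = 0

end Coefficients

/-- The matrix `Θ`: the identity, except that the entries of the last column above the diagonal
are `-a_id / a_dd`. -/
def thetaMatrix {n : ℕ} (A : Matrix (Fin (n + 1)) (Fin (n + 1)) ℝ) :
    Matrix (Fin (n + 1)) (Fin (n + 1)) ℝ :=
  Matrix.of fun i j =>
    if i = j then 1
    else if j = Fin.last n then -(A i (Fin.last n) / A (Fin.last n) (Fin.last n))
    else 0

open scoped MatrixOrder Matrix.Norms.L2Operator in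
/-- The matrix `Ψ_A = (Θ A Θᵀ)^(1/2) Θ`, with the nonnegative square root. -/
def psiMatrix {n : ℕ} (A : Matrix (Fin (n + 1)) (Fin (n + 1)) ℝ) :
    Matrix (Fin (n + 1)) (Fin (n + 1)) ℝ :=
  CFC.sqrt (thetaMatrix A * A * (thetaMatrix A)ᵀ) * thetaMatrix A

/-- The set `Ψ_A(B_r^+)`. -/
def psiHalfBall {n : ℕ} (A : Matrix (Fin (n + 1)) (Fin (n + 1)) ℝ) (r : ℝ) : Set (Space n) :=
  Matrix.toEuclideanLin (psiMatrix A) '' halfBall n r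

/-- The logarithm to base 2 of the square root of the quotient of the averages of `|u|²` over
`Ψ_A(B_{2r}^+)` and `Ψ_A(B_r^+)`. -/
def logDoublingIndex {n : ℕ} (A : Matrix (Fin (n + 1)) (Fin (n + 1)) ℝ) (u : Space n → ℝ)
    (r : ℝ) : ℝ :=
  Real.logb 2 (Real.sqrt
    ((⨍ x in psiHalfBall A (2 * r), |u x| ^ 2) / (⨍ x in psiHalfBall A r, |u x| ^ 2)))

end RobinHalfSpace

end

/-! Blow-ups of `u` at the origin are governed by the operator with frozen coefficients. A linear
change of variables `L` with `L Lᵀ = A` preserves the half space and turns that operator into the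
Laplacian and the conormal derivative into the normal one. In these coordinates every `L_2`-bounded
sequence of rescalings subconverges to a harmonic function with vanishing normal derivative on the
hyperplane: the lower order coefficients and the Robin potential lie in scale-subcritical spaces, so
their contribution disappears, and the oscillation of `a_ij` disappears by mean continuity. This
property is `BlowupCompact`. It is obtained in `blowupCompact_of_estimates` from Caccioppoli's
inequality, the frozen-coefficient estimate and Rellich's theorem, all applied to smooth functions
that approximate the solution.

The blow-up limits extend evenly to harmonic functions `W` in a ball, where a dilation identity
takes the place of Almgren's frequency function: for a radial weight `ρ` the integral of `ρ(x) W(a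
e^t x) W(a e^{-t} x)` does not depend on `t` (`integral_rho_mul_dilate`). Put `H(t) = ∫ ρ(x) W(t
x)²`. Then `∫ ρ(x) (W(4x) - c W(x))² = H(4) - 2 c H(2) + c² H(1)`, so `H(4) ≤ c H(2)` together with
`c H(1) ≤ H(2)` forces `W(4x) = c W(x)`. Smoothness at the origin then forces `c = 4^m` and
homogeneity of degree `m`, unless `W` vanishes (`homogeneous_of_doubling_eq`).

By compactness, each `c` that is not a power of 4 is a barrier for the doubling quotients of the
solution at small scales: if a quotient is at most `c` and the preceding one is under control, then
the quotient at the next smaller dyadic scale is at most `c` (`halfMass_barrier`). Suppose that the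
quotient does not tend to infinity. Then it is bounded along some sequence, a single barrier bounds
it at all smaller dyadic scales, and since the barriers are dense it cannot oscillate, so it
converges to some `l`. A blow-up limit has exact quotients `l`; hence `l = 4^m` and the limit is
homogeneous. A homogeneous function has the same doubling quotient over all ellipsoids at all
scales, which carries the result from dyadic scales and the weight `ρ` to all radii and to the sets
`Ψ_A(B_r^+)` (`ellipMass_ratio_dichotomy`). The square root and the logarithm turn `4^m` into `m`.
-/

noncomputable section

namespace RobinHalfSpace

variable {n : ℕ}

/-! ### Distributional harmonicity, radial kernels and Weyl's lemma -/

/-- The Laplacian `∑ D_i D_i φ`. -/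
def lap (φ : Space n → ℝ) (x : Space n) : ℝ := ∑ i, pderiv i (pderiv i φ) x

/-- `w` is harmonic in `U` in the sense of distributions. -/
def WeaklyHarmonic (U : Set (Space n)) (w : Space n → ℝ) : Prop :=
  ∀ φ : Space n → ℝ, IsTestFunction U φ → ∫ x in U, w x * lap φ x = 0

theorem contDiff_pderiv {φ : Space n → ℝ} (hφ : ContDiff ℝ ∞ φ) (i : Fin (n + 1)) :
    ContDiff ℝ ∞ (pderiv i φ) :=
  (contDiff_infty_iff_fderiv.1 hφ).2.clm_apply contDiff_const

theorem contDiff_lap {φ : Space n → ℝ} (hφ : ContDiff ℝ ∞ φ) : ContDiff ℝ ∞ (lap φ) :=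
  ContDiff.sum fun i _ => contDiff_pderiv (contDiff_pderiv hφ i) i

theorem tsupport_pderiv_subset (φ : Space n → ℝ) (i : Fin (n + 1)) :
    tsupport (pderiv i φ) ⊆ tsupport φ := by
  refine closure_minimal (fun x hx => ?_) (isClosed_tsupport _)
  by_contra h
  exact hx (by simp [pderiv, fderiv_of_notMem_tsupport ℝ h])

theorem IsTestFunction.pderiv {U : Set (Space n)} {φ : Space n → ℝ} (hφ : IsTestFunction U φ)
    (i : Fin (n + 1)) : IsTestFunction U (pderiv i φ) :=
  ⟨contDiff_pderiv hφ.1 i, hφ.2.1.mono' ((subset_tsupport _).trans (tsupport_pderiv_subset φ i)),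
    (tsupport_pderiv_subset φ i).trans hφ.2.2⟩

theorem tsupport_lap_subset (φ : Space n → ℝ) : tsupport (lap φ) ⊆ tsupport φ := by
  refine closure_minimal (fun x hx => ?_) (isClosed_tsupport _)
  by_contra h
  refine hx (Finset.sum_eq_zero fun i _ => ?_)
  exact image_eq_zero_of_notMem_tsupport fun h' =>
    h (tsupport_pderiv_subset _ i (tsupport_pderiv_subset _ i h'))

/-- The compact set `K` yields a dominating multiple of `‖w‖` that is uniform for `t` near `t₀`. It
serves twice: with `w` merely integrable in Weyl's lemma, and with `w = rho` in the dilation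
identity. -/
theorem hasDerivAt_integral_mul {w : Space n → ℝ} (hw : Integrable w) {K : Set (Space n)}
    (hK : IsCompact K) (hwK : ∀ z ∉ K, w z = 0) {Φ Φ' : ℝ → Space n → ℝ}
    (hΦ : Continuous (Function.uncurry Φ)) (hΦ' : Continuous (Function.uncurry Φ'))
    (hd : ∀ t z, HasDerivAt (fun t => Φ t z) (Φ' t z) t) (t₀ : ℝ) :
    HasDerivAt (fun t => ∫ z, w z * Φ t z) (∫ z, w z * Φ' t₀ z) t₀ := by
  have bdd : ∀ Ψ : ℝ → Space n → ℝ, Continuous (Function.uncurry Ψ) → ∃ C, ∀ t ∈ Set.Icc (t₀ - 1) (t₀ + 1),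
      ∀ z, ‖w z * Ψ t z‖ ≤ C * ‖w z‖ := by
    intro Ψ hΨ
    obtain ⟨C, hC⟩ := (isCompact_Icc.prod hK).exists_bound_of_continuousOn
      (s := Set.Icc (t₀ - 1) (t₀ + 1) ×ˢ K) hΨ.continuousOn
    refine ⟨C, fun t ht z => ?_⟩
    by_cases hz : z ∈ K
    · rw [norm_mul, mul_comm]
      exact mul_le_mul_of_nonneg_right (hC (t, z) ⟨ht, hz⟩) (norm_nonneg _)
    · simp [hwK z hz]
  have cont : ∀ Ψ : ℝ → Space n → ℝ, Continuous (Function.uncurry Ψ) → ∀ t, Continuous (Ψ t) :=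
    fun Ψ h t => h.comp (Continuous.prodMk_right t)
  obtain ⟨C, hC⟩ := bdd Φ' hΦ'
  obtain ⟨C', hC'⟩ := bdd Φ hΦ
  have hmem : Set.Icc (t₀ - 1) (t₀ + 1) ∈ 𝓝 t₀ := Icc_mem_nhds (by linarith) (by linarith)
  refine (hasDerivAt_integral_of_dominated_loc_of_deriv_le (bound := fun z => C * ‖w z‖) hmem
    (Eventually.of_forall fun t => hw.1.mul (cont Φ hΦ t).aestronglyMeasurable) ?_
    (hw.1.mul (cont Φ' hΦ' t₀).aestronglyMeasurable)
    (Eventually.of_forall fun z t ht => hC t ht z) (hw.norm.const_mul C)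
    (Eventually.of_forall fun z t _ => (hd t z).const_mul (w z))).2
  exact (hw.norm.const_mul C').mono' (hw.1.mul (cont Φ hΦ t₀).aestronglyMeasurable)
    (Eventually.of_forall fun z => hC' t₀ (mem_of_mem_nhds hmem) z)

/-- The profile of the radial weight. -/
def profile (t : ℝ) : ℝ := expNegInvGlue (1 - t)

/-- The primitive of `profile` that vanishes on `[1, ∞)`. -/
def primProfile (t : ℝ) : ℝ := ∫ s in (1 : ℝ)..t, profile s

theorem contDiff_profile : ContDiff ℝ ∞ profile :=
  (expNegInvGlue.contDiff (n := ⊤)).comp (contDiff_const.sub contDiff_id)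

theorem profile_eq_zero {t : ℝ} (ht : 1 ≤ t) : profile t = 0 :=
  expNegInvGlue.zero_of_nonpos (by linarith)

theorem profile_nonneg (t : ℝ) : 0 ≤ profile t := expNegInvGlue.nonneg _

theorem profile_pos {t : ℝ} (ht : t < 1) : 0 < profile t :=
  expNegInvGlue.pos_of_pos (by linarith)

theorem antitone_profile : Antitone profile := fun _ _ h =>
  expNegInvGlue.monotone (by linarith)

theorem hasDerivAt_primProfile (t : ℝ) : HasDerivAt primProfile (profile t) t :=
  intervalIntegral.integral_hasDerivAt_right (contDiff_profile.continuous.intervalIntegrable _ _)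
    (contDiff_profile.continuous.stronglyMeasurableAtFilter _ _) contDiff_profile.continuous.continuousAt

theorem contDiff_primProfile : ContDiff ℝ ∞ primProfile := by
  refine contDiff_infty_iff_deriv.2 ⟨fun t => (hasDerivAt_primProfile t).differentiableAt, ?_⟩
  have : deriv primProfile = profile := funext fun t => (hasDerivAt_primProfile t).deriv
  rw [this]
  exact contDiff_profile

theorem primProfile_eq_zero {t : ℝ} (ht : 1 ≤ t) : primProfile t = 0 := by
  rw [primProfile, intervalIntegral.integral_congr (g := fun _ => 0)]
  · simp
  · intro s hs
    rw [Set.uIcc_of_le ht] at hs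
    exact profile_eq_zero hs.1

theorem pderiv_radial {Γ Γ' : ℝ → ℝ} (hΓ : ∀ s, HasDerivAt Γ (Γ' s) s) (x : Space n)
    (i : Fin (n + 1)) (z : Space n) :
    pderiv i (fun z => Γ (‖z - x‖ ^ 2)) z = 2 * Γ' (‖z - x‖ ^ 2) * (z i - x i) := by
  have h1 : HasFDerivAt (fun z : Space n => ‖z - x‖ ^ 2) (2 • (innerSL ℝ (z - x))) z := by
    simpa using ((hasFDerivAt_id z).sub_const x).norm_sq
  have h2 := (hΓ (‖z - x‖ ^ 2)).comp_hasFDerivAt z h1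
  rw [pderiv]
  erw [h2.fderiv]
  simp [EuclideanSpace.inner_single_right]
  ring

theorem lap_radial {Γ Γ' Γ'' : ℝ → ℝ} (hΓ : ∀ s, HasDerivAt Γ (Γ' s) s)
    (hΓ' : ∀ s, HasDerivAt Γ' (Γ'' s) s) (x z : Space n) :
    lap (fun z => Γ (‖z - x‖ ^ 2)) z =
      2 * (n + 1) * Γ' (‖z - x‖ ^ 2) + 4 * Γ'' (‖z - x‖ ^ 2) * ‖z - x‖ ^ 2 := by
  have key : ∀ i, pderiv i (pderiv i (fun z => Γ (‖z - x‖ ^ 2))) z =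
      2 * Γ' (‖z - x‖ ^ 2) + 4 * Γ'' (‖z - x‖ ^ 2) * (z i - x i) ^ 2 := by
    intro i
    rw [funext (pderiv_radial hΓ x i), pderiv]
    have h1 : HasFDerivAt (fun z : Space n => ‖z - x‖ ^ 2) (2 • (innerSL ℝ (z - x))) z := by
      simpa using ((hasFDerivAt_id z).sub_const x).norm_sq
    have h2 := ((hΓ' (‖z - x‖ ^ 2)).comp_hasFDerivAt z h1).const_mul 2
    have h3 : HasFDerivAt (fun z : Space n => z i - x i)
        (EuclideanSpace.proj (𝕜 := ℝ) i) z :=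
      (EuclideanSpace.proj (𝕜 := ℝ) (ι := Fin (n + 1)) i).hasFDerivAt.sub_const _
    have h4 := h2.mul h3
    erw [h4.fderiv]
    simp [EuclideanSpace.inner_single_right]
    ring
  have hn : ‖z - x‖ ^ 2 = ∑ i, (z i - x i) ^ 2 := by
    simp [EuclideanSpace.norm_sq_eq]
  simp only [lap, key, Finset.sum_add_distrib, ← Finset.mul_sum]
  rw [← hn]
  simp
  ring

theorem integral_mul_pderiv {f g : Space n → ℝ} (hf : ContDiff ℝ ∞ f) (hg : ContDiff ℝ ∞ g)
    (hc : HasCompactSupport g) (i : Fin (n + 1)) :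
    ∫ x, f x * pderiv i g x = - ∫ x, pderiv i f x * g x := by
  have hgt : IsTestFunction Set.univ g := ⟨hg, hc, Set.subset_univ _⟩
  refine integral_mul_fderiv_eq_neg_fderiv_mul_of_integrable ?_ ?_ ?_
    (fun x _ => hf.differentiable (by simp) x) (fun x _ => hg.differentiable (by simp) x)
  · exact ((contDiff_pderiv hf i).continuous.mul hg.continuous).integrable_of_hasCompactSupport
      hc.mul_left
  · exact (hf.continuous.mul (contDiff_pderiv hg i).continuous).integrable_of_hasCompactSupport
      (hgt.pderiv i).2.1.mul_left
  · exact (hf.continuous.mul hg.continuous).integrable_of_hasCompactSupport hc.mul_left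

theorem integral_lap_mul {f g : Space n → ℝ} (hf : ContDiff ℝ ∞ f) (hg : ContDiff ℝ ∞ g)
    (hc : HasCompactSupport g) :
    ∫ x, lap f x * g x = - ∫ x, ∑ i, pderiv i f x * pderiv i g x := by
  have hgt : IsTestFunction Set.univ g := ⟨hg, hc, Set.subset_univ _⟩
  simp only [lap, Finset.sum_mul]
  rw [integral_finsetSum, integral_finsetSum, ← Finset.sum_neg_distrib]
  · refine Finset.sum_congr rfl fun i _ => ?_
    rw [integral_mul_pderiv (contDiff_pderiv hf i) hg hc, neg_neg]
  · exact fun i _ => ((contDiff_pderiv hf i).continuous.mul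
      (contDiff_pderiv hg i).continuous).integrable_of_hasCompactSupport (hgt.pderiv i).2.1.mul_left
  · exact fun i _ => ((contDiff_pderiv (contDiff_pderiv hf i) i).continuous.mul
      hg.continuous).integrable_of_hasCompactSupport hc.mul_left

theorem integral_mul_lap {f g : Space n → ℝ} (hf : ContDiff ℝ ∞ f) (hg : ContDiff ℝ ∞ g)
    (hc : HasCompactSupport g) :
    ∫ x, f x * lap g x = - ∫ x, ∑ i, pderiv i f x * pderiv i g x := by
  have hgt : IsTestFunction Set.univ g := ⟨hg, hc, Set.subset_univ _⟩
  simp only [lap, Finset.mul_sum]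
  rw [integral_finsetSum, integral_finsetSum, ← Finset.sum_neg_distrib]
  · exact Finset.sum_congr rfl fun i _ =>
      integral_mul_pderiv hf (contDiff_pderiv hg i) (hgt.pderiv i).2.1 i
  · exact fun i _ => ((contDiff_pderiv hf i).continuous.mul
      (contDiff_pderiv hg i).continuous).integrable_of_hasCompactSupport (hgt.pderiv i).2.1.mul_left
  · exact fun i _ => (hf.continuous.mul
      (contDiff_pderiv (contDiff_pderiv hg i) i).continuous).integrable_of_hasCompactSupport
      ((hgt.pderiv i).pderiv i).2.1.mul_left

/-- Two integrations by parts move the Laplacian onto `W`, the fundamental lemma of the calculus of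
variations gives vanishing almost everywhere, and continuity removes the exceptional set. -/
theorem lap_eq_zero_of_weaklyHarmonic {U : Set (Space n)} (hU : IsOpen U) {W : Space n → ℝ}
    (hW : ContDiff ℝ ∞ W) (h : WeaklyHarmonic U W) {x : Space n} (hx : x ∈ U) : lap W x = 0 := by
  have hae : ∀ᵐ x, x ∈ U → lap W x = 0 := by
    refine hU.ae_eq_zero_of_integral_contDiff_smul_eq_zero
      ((contDiff_lap hW).continuous.locallyIntegrable.locallyIntegrableOn _) ?_
    intro g hg hgc hgU
    have h1 := h g ⟨hg, hgc, hgU⟩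
    rw [setIntegral_eq_integral_of_forall_compl_eq_zero] at h1
    · rw [integral_mul_lap hW hg hgc, ← integral_lap_mul hW hg hgc] at h1
      simpa [mul_comm] using h1
    · intro z hz
      rw [image_eq_zero_of_notMem_tsupport fun h' => hz (hgU (tsupport_lap_subset g h')), mul_zero]
  have hae' : lap W =ᵐ[volume.restrict U] fun _ => 0 :=
    (ae_restrict_iff' hU.measurableSet).2 hae
  exact Measure.eqOn_open_of_ae_eq hae' hU (contDiff_lap hW).continuous.continuousOn
    continuousOn_const hx

/-- The scaled radial kernel, at scale `exp (-t)`. -/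
def kern (n : ℕ) (t : ℝ) (y : Space n) : ℝ :=
  Real.exp ((n + 1) * t) * profile (‖y‖ ^ 2 * Real.exp (2 * t))

theorem kern_eq_zero {t : ℝ} {y : Space n} (h : Real.exp (-t) ≤ ‖y‖) : kern n t y = 0 := by
  rw [kern, profile_eq_zero, mul_zero]
  have h1 : Real.exp (-t) ^ 2 ≤ ‖y‖ ^ 2 := by gcongr
  have h2 : Real.exp (-t) ^ 2 * Real.exp (2 * t) = 1 := by
    rw [pow_two, ← Real.exp_add, ← Real.exp_add]; simp; ring
  rw [← h2]
  gcongr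

theorem contDiff_kern (t : ℝ) : ContDiff ℝ ∞ (kern n t) :=
  contDiff_const.mul (contDiff_profile.comp ((contDiff_norm_sq ℝ).mul contDiff_const))

theorem hasCompactSupport_kern (t : ℝ) : HasCompactSupport (kern n t) :=
  HasCompactSupport.intro (isCompact_closedBall 0 (Real.exp (-t))) fun y hy => kern_eq_zero <| by
    have : ¬ ‖y‖ ≤ Real.exp (-t) := by simpa using hy
    linarith

/-- The derivative in `t` of a mass-preserving dilation of a radial function is the divergence of a
radial field, hence a Laplacian. The potential is compactly supported because `primProfile` vanishes
on `[1, ∞)`, so it may be tested against a weakly harmonic function. -/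
theorem kern_eq_lap (t : ℝ) (x z : Space n) :
    HasDerivAt (fun t => kern n t (z - x)) (Real.exp ((n + 1) * t) *
      lap (fun z => Real.exp (-2 * t) / 2 * primProfile (‖z - x‖ ^ 2 * Real.exp (2 * t))) z) t := by
  set e := Real.exp (2 * t) with he
  have hee : Real.exp (-2 * t) * e = 1 := by
    rw [he, ← Real.exp_add]; simp
  have hp : ∀ s, HasDerivAt profile (deriv profile s) s := fun s =>
    (contDiff_profile.differentiable (by simp) s).hasDerivAt
  have hlin : ∀ s, HasDerivAt (fun s : ℝ => s * e) e s := fun s => by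
    simpa using (hasDerivAt_id s).mul_const e
  rw [lap_radial (Γ := fun s => Real.exp (-2 * t) / 2 * primProfile (s * e))
    (Γ' := fun s => profile (s * e) / 2) (Γ'' := fun s => deriv profile (s * e) * e / 2)]
  · have h1 : HasDerivAt (fun t : ℝ => Real.exp ((n + 1) * t))
        (Real.exp ((n + 1) * t) * (n + 1)) t := by
      simpa using ((hasDerivAt_id t).const_mul ((n : ℝ) + 1)).exp
    have h2 : HasDerivAt (fun t : ℝ => ‖z - x‖ ^ 2 * Real.exp (2 * t))
        (‖z - x‖ ^ 2 * (e * 2)) t := by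
      simpa using (((hasDerivAt_id t).const_mul (2 : ℝ)).exp).const_mul (‖z - x‖ ^ 2)
    have h3 := h1.mul ((hp _).comp t h2)
    refine h3.congr_deriv ?_
    simp only [Function.comp]
    ring
  · intro s
    refine (((hasDerivAt_primProfile _).comp s (hlin s)).const_mul _).congr_deriv ?_
    linear_combination (profile (s * e) / 2) * hee
  · intro s
    exact (((hp _).comp s (hlin s)).div_const 2).congr_deriv (by ring)

theorem isTestFunction_primProfile (t : ℝ) (x : Space n) {U : Set (Space n)}
    (hU : Metric.closedBall x (Real.exp (-t)) ⊆ U) :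
    IsTestFunction U
      (fun z => Real.exp (-2 * t) / 2 * primProfile (‖z - x‖ ^ 2 * Real.exp (2 * t))) := by
  have hzero : ∀ z ∉ Metric.closedBall x (Real.exp (-t)),
      Real.exp (-2 * t) / 2 * primProfile (‖z - x‖ ^ 2 * Real.exp (2 * t)) = 0 := by
    intro z hz
    have hz' : Real.exp (-t) < ‖z - x‖ := by simpa [dist_eq_norm] using hz
    rw [primProfile_eq_zero, mul_zero]
    have h2 : Real.exp (-t) ^ 2 * Real.exp (2 * t) = 1 := by
      rw [pow_two, ← Real.exp_add, ← Real.exp_add]; simp; ring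
    rw [← h2]
    gcongr
  refine ⟨contDiff_const.mul (contDiff_primProfile.comp
    (((contDiff_id.sub contDiff_const).norm_sq ℝ).mul contDiff_const)),
    HasCompactSupport.intro (isCompact_closedBall x (Real.exp (-t))) hzero, ?_⟩
  refine (closure_minimal (fun z hz => ?_) Metric.isClosed_closedBall).trans hU
  by_contra h
  exact hz (hzero z h)

/-- By `kern_eq_lap` the derivative in `t` is `w` tested against the Laplacian of a function
supported in the ball of radius `exp (-t)` about `x`. For `t ≥ T` this ball lies in `U`, so the
derivative vanishes. -/
theorem integral_mul_kern_const {U : Set (Space n)} (hUo : MeasurableSet U)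
    {K : Set (Space n)} (hK : IsCompact K) (hUK : U ⊆ K) {w : Space n → ℝ}
    (hw : IntegrableOn w U) (h : WeaklyHarmonic U w) {x : Space n} {T : ℝ}
    (hT : Metric.closedBall x (Real.exp (-T)) ⊆ U) {t : ℝ} (ht : T ≤ t) :
    ∫ z, U.indicator w z * kern n t (z - x) = ∫ z, U.indicator w z * kern n T (z - x) := by
  set w0 := U.indicator w
  have hw0 : Integrable w0 := (integrable_indicator_iff hUo).2 hw
  have hk : Continuous (Function.uncurry fun t z => kern n t (z - x)) := by
    have := contDiff_profile.continuous
    unfold kern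
    fun_prop
  set Φ' : ℝ → Space n → ℝ := fun t z => Real.exp ((n + 1) * t) *
      lap (fun z => Real.exp (-2 * t) / 2 * primProfile (‖z - x‖ ^ 2 * Real.exp (2 * t))) z with hΦ'
  have hformula : Φ' = fun t z => deriv (fun t => kern n t (z - x)) t :=
    funext fun t => funext fun z => (kern_eq_lap t x z).deriv.symm
  -- The explicit formula is needed only to see that `Φ'` is jointly continuous.
  have hform2 : Φ' = fun t z => Real.exp ((n + 1) * t) * (n + 1) *
        profile (‖z - x‖ ^ 2 * Real.exp (2 * t)) + Real.exp ((n + 1) * t) *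
        (deriv profile (‖z - x‖ ^ 2 * Real.exp (2 * t)) * (‖z - x‖ ^ 2 * (Real.exp (2 * t) * 2))) := by
    rw [hformula]
    funext t z
    have hp : ∀ s, HasDerivAt profile (deriv profile s) s := fun s =>
      (contDiff_profile.differentiable (by simp) s).hasDerivAt
    have h1 : HasDerivAt (fun t : ℝ => Real.exp ((n + 1) * t))
        (Real.exp ((n + 1) * t) * (n + 1)) t := by
      simpa using ((hasDerivAt_id t).const_mul ((n : ℝ) + 1)).exp
    have h2 : HasDerivAt (fun t : ℝ => ‖z - x‖ ^ 2 * Real.exp (2 * t))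
        (‖z - x‖ ^ 2 * (Real.exp (2 * t) * 2)) t := by
      simpa using (((hasDerivAt_id t).const_mul (2 : ℝ)).exp).const_mul (‖z - x‖ ^ 2)
    exact (h1.mul ((hp _).comp t h2)).deriv
  have hΦ'c : Continuous (Function.uncurry Φ') := by
    have h1 := contDiff_profile.continuous
    have h2 := (contDiff_infty_iff_deriv.1 contDiff_profile).2.continuous
    rw [hform2]
    fun_prop
  have hder := hasDerivAt_integral_mul hw0 hK
    (fun z hz => Set.indicator_of_notMem (fun h => hz (hUK h)) _) hk hΦ'c
    (fun t z => kern_eq_lap t x z)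
  have hzero : ∀ t, T ≤ t → ∫ z, w0 z * Φ' t z = 0 := by
    intro t ht
    have := h _ (isTestFunction_primProfile t x
      ((Metric.closedBall_subset_closedBall (Real.exp_le_exp.2 (by linarith))).trans hT))
    rw [← integral_indicator hUo] at this
    have h2 : ∀ z, w0 z * Φ' t z = Real.exp ((n + 1) * t) * U.indicator (fun z => w z *
        lap (fun z => Real.exp (-2 * t) / 2 * primProfile (‖z - x‖ ^ 2 * Real.exp (2 * t))) z) z := by
      intro z
      by_cases hz : z ∈ U
      · simp only [w0, Set.indicator_of_mem hz, hΦ']; ring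
      · simp [w0, Set.indicator_of_notMem hz]
    simp only [h2]
    rw [integral_const_mul, this, mul_zero]
  refine constant_of_has_deriv_right_zero (f := fun t => ∫ z, w0 z * kern n t (z - x)) (b := t)
    (fun s _ => (hder s).continuousAt.continuousWithinAt)
    (fun s hs => ?_) t ⟨ht, le_rfl⟩
  have := hder s
  rw [hzero s hs.1] at this
  exact this.hasDerivWithinAt

/-- The radial weight, positive exactly in the unit ball. -/
def rho (y : Space n) : ℝ := profile (‖y‖ ^ 2)

theorem contDiff_rho : ContDiff ℝ ∞ (rho (n := n)) := contDiff_profile.comp (contDiff_norm_sq ℝ)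

theorem rho_nonneg (y : Space n) : 0 ≤ rho y := profile_nonneg _

theorem rho_eq_zero {y : Space n} (hy : 1 ≤ ‖y‖) : rho y = 0 := profile_eq_zero (by nlinarith)

theorem rho_pos {y : Space n} (hy : ‖y‖ < 1) : 0 < rho y :=
  profile_pos (by nlinarith [norm_nonneg y])

theorem rho_le (y : Space n) : rho y ≤ profile 0 := antitone_profile (by positivity)

theorem hasCompactSupport_rho : HasCompactSupport (rho (n := n)) :=
  HasCompactSupport.intro (isCompact_closedBall 0 1) fun y hy => rho_eq_zero <| by
    have : ¬ ‖y‖ ≤ 1 := by simpa using hy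
    linarith

theorem integrable_rho : Integrable (rho (n := n)) :=
  contDiff_rho.continuous.integrable_of_hasCompactSupport hasCompactSupport_rho

theorem integral_rho_pos : 0 < ∫ y : Space n, rho y :=
  contDiff_rho.continuous.integral_pos_of_hasCompactSupport_nonneg_nonzero hasCompactSupport_rho
    rho_nonneg (x := 0) (rho_pos (by simp)).ne'

theorem integral_kern (t : ℝ) (x : Space n) :
    ∫ z, kern n t (z - x) = ∫ y : Space n, rho y := by
  rw [integral_sub_right_eq_self (fun z => kern n t z)]
  have h : ∀ z : Space n, kern n t z = Real.exp ((n + 1) * t) * rho (Real.exp t • z) := by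
    intro z
    have he : Real.exp (2 * t) = Real.exp t ^ 2 := by rw [← Real.exp_nat_mul]; norm_num
    rw [kern, rho, norm_smul, mul_pow, Real.norm_eq_abs, abs_of_pos (Real.exp_pos t), he,
      mul_comm (‖z‖ ^ 2)]
  simp only [h]
  rw [integral_const_mul, Measure.integral_comp_smul, finrank_euclideanSpace_fin, smul_eq_mul,
    ← mul_assoc, abs_of_pos (by positivity), mul_comm ((n : ℝ) + 1), Real.exp_mul]
  have : Real.exp t ^ ((n : ℝ) + 1) = Real.exp t ^ (n + 1) := by
    rw [← Real.rpow_natCast]; norm_cast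
  rw [this, mul_inv_cancel₀ (by positivity), one_mul]

/-- Lebesgue differentiation: the kernel lives on the ball of radius `exp (-t)` and its height is at
most a fixed multiple of the inverse volume of that ball, so the error is bounded by the mean
deviation of `w` from `w x`. -/
theorem tendsto_integral_mul_kern {w : Space n → ℝ} (hw : Integrable w) :
    ∀ᵐ x, Tendsto (fun t => ∫ z, w z * kern n t (z - x)) atTop
      (𝓝 (w x * ∫ y : Space n, rho y)) := by
  filter_upwards [IsUnifLocDoublingMeasure.ae_tendsto_average_norm_sub volume
    hw.locallyIntegrable 1] with x hx
  have h1 := hx (l := atTop) (fun _ : ℝ => x) (fun t => Real.exp (-t))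
    (tendsto_nhdsWithin_iff.2 ⟨Real.tendsto_exp_neg_atTop_nhds_zero,
      Eventually.of_forall fun t => Real.exp_pos _⟩)
    (Eventually.of_forall fun t => by simp; positivity)
  rw [tendsto_iff_norm_sub_tendsto_zero]
  set c := profile 0 * volume.real (Metric.ball (0 : Space n) 1)
  have h2 := h1.const_mul c
  rw [mul_zero] at h2
  have hkc : ∀ t, Continuous fun z : Space n => kern n t (z - x) := fun t =>
    (contDiff_kern t).continuous.comp (continuous_id.sub continuous_const)
  have hkle : ∀ t (y : Space n), ‖kern n t y‖ ≤ Real.exp ((n + 1) * t) * profile 0 := by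
    intro t y
    rw [kern, norm_mul, Real.norm_eq_abs, Real.norm_eq_abs, abs_of_nonneg (profile_nonneg _),
      abs_of_pos (Real.exp_pos _)]
    gcongr
    exact antitone_profile (by positivity)
  have hki : ∀ t, Integrable fun z : Space n => kern n t (z - x) := fun t =>
    ((contDiff_kern t).continuous.integrable_of_hasCompactSupport
      (hasCompactSupport_kern t)).comp_sub_right x
  have hwk : ∀ t, Integrable fun z : Space n => w z * kern n t (z - x) := fun t =>
    hw.mul_bdd (c := Real.exp ((n + 1) * t) * profile 0) (hkc t).aestronglyMeasurable
      (Eventually.of_forall fun z => hkle t _)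
  refine squeeze_zero (fun _ => norm_nonneg _) (fun t => ?_) h2
  have hsub : (∫ z, w z * kern n t (z - x)) - w x * ∫ y : Space n, rho y
      = ∫ z in Metric.closedBall x (Real.exp (-t)), (w z - w x) * kern n t (z - x) := by
    rw [← integral_kern t x, ← integral_const_mul, ← integral_sub (hwk t) ((hki t).const_mul _),
      setIntegral_eq_integral_of_forall_compl_eq_zero]
    · simp [sub_mul]
    · intro z hz
      rw [kern_eq_zero, mul_zero]
      have : ¬ ‖z - x‖ ≤ Real.exp (-t) := by simpa [dist_eq_norm] using hz
      linarith
  rw [hsub]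
  have hint : IntegrableOn (fun z => ‖w z - w x‖) (Metric.closedBall x (Real.exp (-t))) :=
    (hw.integrableOn.sub (integrableOn_const measure_closedBall_lt_top.ne)).norm
  calc ‖∫ z in Metric.closedBall x (Real.exp (-t)), (w z - w x) * kern n t (z - x)‖
      ≤ ∫ z in Metric.closedBall x (Real.exp (-t)),
        ‖w z - w x‖ * (Real.exp ((n + 1) * t) * profile 0) := by
        refine norm_integral_le_of_norm_le (hint.mul_const _) (Eventually.of_forall fun z => ?_)
        rw [norm_mul]
        gcongr
        exact hkle t _
    _ = c * ⨍ z in Metric.closedBall x (Real.exp (-t)), ‖w z - w x‖ := by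
        rw [integral_mul_const, setAverage_eq, smul_eq_mul,
          Measure.addHaar_real_closedBall _ _ (Real.exp_pos _).le, finrank_euclideanSpace_fin]
        have hv : volume.real (Metric.ball (0 : Space n) 1) ≠ 0 :=
          (ENNReal.toReal_pos (Metric.measure_ball_pos _ _ one_pos).ne' measure_ball_lt_top.ne).ne'
        have : Real.exp ((n + 1) * t) = (Real.exp (-t) ^ (n + 1))⁻¹ := by
          rw [← Real.exp_nat_mul, ← Real.exp_neg]; push_cast; ring_nf
        rw [this]
        simp only [c]
        field_simp

/-- Weyl's lemma. The convolution with `kern` does not depend on the scale as long as the kernel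
fits into the ball, and it tends to a multiple of `w` as the scale shrinks; so `w` agrees almost
everywhere with one fixed smooth convolution. -/
theorem exists_contDiff_of_weaklyHarmonic {x₀ : Space n} {R R' : ℝ} (hR : R' < R)
    {w : Space n → ℝ} (hw : IntegrableOn w (Metric.ball x₀ R))
    (h : WeaklyHarmonic (Metric.ball x₀ R) w) :
    ∃ W : Space n → ℝ, ContDiff ℝ ∞ W ∧ ∀ᵐ x, x ∈ Metric.ball x₀ R' → W x = w x := by
  set w0 := (Metric.ball x₀ R).indicator w with hw0d
  have hw0 : Integrable w0 := (integrable_indicator_iff measurableSet_ball).2 hw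
  -- The kernel radius `exp (-T)` is half the gap between the two balls, so that kernels centred in
  -- the smaller ball stay inside the larger one.
  set T := -Real.log ((R - R') / 2)
  have hT : Real.exp (-T) = (R - R') / 2 := by
    simp only [T, neg_neg]; exact Real.exp_log (by linarith)
  set c := ∫ y : Space n, rho y
  have hc : 0 < c := integral_rho_pos
  refine ⟨fun x => c⁻¹ * ∫ z, w0 z * kern n T (z - x), ?_, ?_⟩
  · refine contDiff_const.mul ?_
    have := (hasCompactSupport_kern (n := n) T).contDiff_convolution_right (n := ⊤) (μ := volume)
      (ContinuousLinearMap.mul ℝ ℝ) hw0.locallyIntegrable (contDiff_kern T)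
    have heq : (fun x => ∫ z, w0 z * kern n T (z - x)) =
        convolution w0 (kern n T) (ContinuousLinearMap.mul ℝ ℝ) volume := by
      funext x
      rw [convolution_def]
      simp only [ContinuousLinearMap.mul_apply', kern, norm_sub_rev _ x]
    rw [heq]
    exact this
  · filter_upwards [tendsto_integral_mul_kern hw0] with x hx hxR
    have hsub : Metric.closedBall x (Real.exp (-T)) ⊆ Metric.ball x₀ R := by
      rw [hT]
      refine Metric.closedBall_subset_ball' ?_
      have := Metric.mem_ball.1 hxR
      linarith
    have hconst : Tendsto (fun t => ∫ z, w0 z * kern n t (z - x)) atTop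
        (𝓝 (∫ z, w0 z * kern n T (z - x))) := by
      refine tendsto_const_nhds.congr' ?_
      filter_upwards [eventually_ge_atTop T] with t ht
      exact (integral_mul_kern_const measurableSet_ball (isCompact_closedBall x₀ R)
        Metric.ball_subset_closedBall hw h hsub ht).symm
    rw [tendsto_nhds_unique hconst hx, hw0d,
      Set.indicator_of_mem (Metric.ball_subset_ball hR.le hxR), mul_comm (w x),
      inv_mul_cancel_left₀ hc.ne']

/-! ### The dilation identity and homogeneity of harmonic functions -/

theorem pderiv_comp_smul {W : Space n → ℝ} (hW : Differentiable ℝ W) (α : ℝ) (i : Fin (n + 1))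
    (x : Space n) : pderiv i (fun x => W (α • x)) x = α * pderiv i W (α • x) := by
  have h := (hW (α • x)).hasFDerivAt.comp x ((hasFDerivAt_id x).const_smul α)
  rw [pderiv]
  erw [h.fderiv]
  simp [pderiv]

theorem contDiff_comp_smul {W : Space n → ℝ} (hW : ContDiff ℝ ∞ W) (α : ℝ) :
    ContDiff ℝ ∞ (fun x => W (α • x)) := hW.comp (contDiff_const_smul α)

theorem lap_comp_smul {W : Space n → ℝ} (hW : ContDiff ℝ ∞ W) (α : ℝ) (x : Space n) :
    lap (fun x => W (α • x)) x = α ^ 2 * lap W (α • x) := by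
  simp only [lap, Finset.mul_sum]
  refine Finset.sum_congr rfl fun i _ => ?_
  rw [funext (pderiv_comp_smul (hW.differentiable (by simp)) α i)]
  have h : Differentiable ℝ (fun x => α * pderiv i W x) :=
    ((contDiff_pderiv hW i).differentiable (by simp)).const_mul α
  rw [pderiv_comp_smul (W := fun x => α * pderiv i W x) h α i x, pderiv,
    fderiv_const_mul ((contDiff_pderiv hW i).differentiable (by simp) _)]
  simp [pderiv]
  ring

theorem pderiv_mul {f g : Space n → ℝ} (hf : Differentiable ℝ f) (hg : Differentiable ℝ g)
    (i : Fin (n + 1)) (x : Space n) :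
    pderiv i (fun x => f x * g x) x = pderiv i f x * g x + f x * pderiv i g x := by
  rw [pderiv, fderiv_fun_mul (hf x) (hg x)]
  simp [pderiv]
  ring

theorem fderiv_apply_eq_sum (f : Space n → ℝ) (x v : Space n) :
    fderiv ℝ f x v = ∑ i, v i * pderiv i f x := by
  conv_lhs => rw [← (EuclideanSpace.basisFun (Fin (n + 1)) ℝ).sum_repr v]
  simp [pderiv, map_sum]

/-- The field `rho x • x` is the gradient of the compactly supported function `ψ = primProfile
(‖x‖²) / 2`. The integrand is therefore `∇ψ · (g ∇f - f ∇g)`, and Green's formula turns it into `ψ`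
times Laplacians, which vanish where `ψ` does not. -/
theorem integral_rho_fderiv_mul {f g : Space n → ℝ} (hf : ContDiff ℝ ∞ f) (hg : ContDiff ℝ ∞ g)
    (hf0 : ∀ x, ‖x‖ ≤ 1 → lap f x = 0) (hg0 : ∀ x, ‖x‖ ≤ 1 → lap g x = 0) :
    ∫ x, rho x * (fderiv ℝ f x x * g x - f x * fderiv ℝ g x x) = 0 := by
  set ψ : Space n → ℝ := fun x => primProfile (‖x‖ ^ 2) / 2 with hψ
  have hψs : ContDiff ℝ ∞ ψ := (contDiff_primProfile.comp (contDiff_norm_sq ℝ)).div_const 2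
  have hψ0 : ∀ x, 1 ≤ ‖x‖ → ψ x = 0 := fun x hx => by
    simp only [ψ]; rw [primProfile_eq_zero (by nlinarith), zero_div]
  have hψc : HasCompactSupport ψ := HasCompactSupport.intro (isCompact_closedBall 0 1)
    fun y hy => hψ0 y <| by
      have : ¬ ‖y‖ ≤ 1 := by simpa using hy
      linarith
  have hψd : ∀ i x, pderiv i ψ x = rho x * x i := by
    intro i x
    have := pderiv_radial (Γ := fun s => primProfile s / 2) (Γ' := fun s => profile s / 2)
      (fun s => (hasDerivAt_primProfile s).div_const 2) (0 : Space n) i x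
    simp only [sub_zero] at this
    rw [hψ, this, rho, show (0 : Space n) i = 0 from rfl]
    ring
  have key : ∀ {f g : Space n → ℝ}, ContDiff ℝ ∞ f → ContDiff ℝ ∞ g →
      (∀ x, ‖x‖ ≤ 1 → lap f x = 0) →
      ∫ x, ∑ i, pderiv i f x * pderiv i (fun x => ψ x * g x) x = 0 := by
    intro f g hf hg hf0
    have h := integral_lap_mul hf (hψs.mul hg) hψc.mul_right
    rw [← neg_eq_zero, ← h]
    refine integral_eq_zero_of_ae (Eventually.of_forall fun x => ?_)
    rcases le_total ‖x‖ 1 with hx | hx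
    · simp [hf0 x hx]
    · simp [hψ0 x hx]
  have hint : ∀ {f g : Space n → ℝ}, ContDiff ℝ ∞ f → ContDiff ℝ ∞ g →
      Integrable fun x => ∑ i, pderiv i f x * pderiv i (fun x => ψ x * g x) x := by
    intro f g hf hg
    refine integrable_finsetSum _ fun i _ => ?_
    have ht : IsTestFunction Set.univ fun x => ψ x * g x :=
      ⟨hψs.mul hg, hψc.mul_right, Set.subset_univ _⟩
    exact ((contDiff_pderiv hf i).continuous.mul
      (ht.pderiv i).1.continuous).integrable_of_hasCompactSupport (ht.pderiv i).2.1.mul_left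
  have h := integral_sub (hint hf hg) (hint hg hf)
  rw [key hf hg hf0, key hg hf hg0, sub_zero] at h
  rw [← h]
  refine integral_congr_ae (Eventually.of_forall fun x => ?_)
  simp only [fderiv_apply_eq_sum f x x, fderiv_apply_eq_sum g x x, Finset.sum_mul, Finset.mul_sum,
    ← Finset.sum_sub_distrib]
  refine Finset.sum_congr rfl fun i _ => ?_
  rw [pderiv_mul (hψs.differentiable (by simp)) (hg.differentiable (by simp)),
    pderiv_mul (hψs.differentiable (by simp)) (hf.differentiable (by simp)), hψd]
  ring

/-- The derivative in `t` is the integral of `integral_rho_fderiv_mul` for the dilates of `W` by `a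
e^t` and `a e^{-t}`, both harmonic on the unit ball because `a e^t < R`. By Cauchy–Schwarz the
identity contains the logarithmic convexity of the mass (the three-spheres inequality). -/
theorem integral_rho_mul_dilate {W : Space n → ℝ} (hW : ContDiff ℝ ∞ W) {R : ℝ}
    (h0 : ∀ x ∈ Metric.ball 0 R, lap W x = 0) {a t : ℝ} (ha : 0 < a) (ht : 0 ≤ t)
    (hR : a * Real.exp t < R) :
    ∫ x, rho x * (W ((a * Real.exp t) • x) * W ((a * Real.exp (-t)) • x)) =
      ∫ x, rho x * W (a • x) ^ 2 := by
  set D : Space n → Space n → ℝ := fun y v => fderiv ℝ W y v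
  have hWd := hW.differentiable (by simp)
  have hc := hW.continuous
  have hc' : Continuous fun p : Space n × Space n => fderiv ℝ W p.1 p.2 :=
    hW.continuous_fderiv_apply (by simp)
  have he : ∀ t : ℝ, HasDerivAt (fun t => a * Real.exp t) (a * Real.exp t) t := fun t =>
    (Real.hasDerivAt_exp t).const_mul a
  have he' : ∀ t : ℝ, HasDerivAt (fun t => a * Real.exp (-t)) (-(a * Real.exp (-t))) t := fun t =>
    ((hasDerivAt_neg t).exp.const_mul a).congr_deriv (by ring)
  have hder := hasDerivAt_integral_mul (integrable_rho (n := n)) (isCompact_closedBall 0 1)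
    (fun z hz => rho_eq_zero (by
      have : ¬ ‖z‖ ≤ 1 := by simpa using hz
      linarith))
    (Φ := fun t x => W ((a * Real.exp t) • x) * W ((a * Real.exp (-t)) • x))
    (Φ' := fun t x => fderiv ℝ W ((a * Real.exp t) • x) ((a * Real.exp t) • x) *
        W ((a * Real.exp (-t)) • x) - W ((a * Real.exp t) • x) *
        fderiv ℝ W ((a * Real.exp (-t)) • x) ((a * Real.exp (-t)) • x))
    (by fun_prop) (by
      refine ((hc'.comp (f := fun p : ℝ × Space n =>
        ((a * Real.exp p.1) • p.2, (a * Real.exp p.1) • p.2)) (by fun_prop)).mul (by fun_prop)).sub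
        (Continuous.mul (by fun_prop) (hc'.comp (f := fun p : ℝ × Space n =>
        ((a * Real.exp (-p.1)) • p.2, (a * Real.exp (-p.1)) • p.2)) (by fun_prop))))
    (fun t x => by
      have h1 : HasDerivAt (fun t => W ((a * Real.exp t) • x)) _ t :=
        (hWd _).hasFDerivAt.comp_hasDerivAt t ((he t).smul_const x)
      have h2 : HasDerivAt (fun t => W ((a * Real.exp (-t)) • x)) _ t :=
        (hWd _).hasFDerivAt.comp_hasDerivAt t ((he' t).smul_const x)
      refine (h1.mul h2).congr_deriv ?_
      simp only [neg_smul, map_neg]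
      ring)
  have hzero : ∀ s ∈ Set.Ico 0 t, ∫ x : Space n, rho x *
      (fderiv ℝ W ((a * Real.exp s) • x) ((a * Real.exp s) • x) *
        W ((a * Real.exp (-s)) • x) - W ((a * Real.exp s) • x) *
        fderiv ℝ W ((a * Real.exp (-s)) • x) ((a * Real.exp (-s)) • x)) = 0 := by
    intro s hs
    have hlap : ∀ r, 0 ≤ r → r < R → ∀ x : Space n, ‖x‖ ≤ 1 → lap (fun x => W (r • x)) x = 0 := by
      intro r hr0 hr x hx
      rw [lap_comp_smul hW, h0, mul_zero]
      rw [mem_ball_zero_iff, norm_smul, Real.norm_eq_abs, abs_of_nonneg hr0]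
      nlinarith
    have e1 : Real.exp s ≤ Real.exp t := Real.exp_le_exp.2 hs.2.le
    have e2 : Real.exp (-s) ≤ Real.exp t := Real.exp_le_exp.2 (by linarith [hs.1])
    have h := integral_rho_fderiv_mul (contDiff_comp_smul hW (a * Real.exp s))
      (contDiff_comp_smul hW (a * Real.exp (-s)))
      (hlap _ (by positivity) (by nlinarith)) (hlap _ (by positivity) (by nlinarith))
    have hfd : ∀ (α : ℝ) (x : Space n), fderiv ℝ (fun x => W (α • x)) x x
        = fderiv ℝ W (α • x) (α • x) := by
      intro α x
      have h := (hWd (α • x)).hasFDerivAt.comp x ((hasFDerivAt_id x).const_smul α)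
      erw [h.fderiv]
      simp
    simpa only [hfd] using h
  have hconst := constant_of_has_deriv_right_zero
    (f := fun t => ∫ x, rho x * (W ((a * Real.exp t) • x) * W ((a * Real.exp (-t)) • x)))
    (a := 0) (b := t) (fun s _ => (hder s).continuousAt.continuousWithinAt)
    (fun s hs => by
      have := hder s
      rw [hzero s hs] at this
      exact this.hasDerivWithinAt) t ⟨ht, le_rfl⟩
  simpa [← pow_two] using hconst

/-- Differentiation divides `c` by 4, which gives an induction on `k`; having the relation for `|t|
< 2` allows differentiating at both ends of `[0, 1]`. For `c < 1` iteration gives `f t = c^j f (t /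
4^j)`, which tends to zero. Integrating back raises the degree by one, and the constant of
integration satisfies `f 0 = c * f 0`, so it survives only for `c = 1`. -/
theorem pow_of_four_scaling (k : ℕ) : ∀ (c : ℝ), 0 ≤ c → c < 4 ^ k → ∀ f : ℝ → ℝ, ContDiff ℝ ∞ f →
    (∀ t, |t| < 2 → f t = c * f (t / 4)) →
    (∃ m : ℕ, c = 4 ^ m ∧ ∀ t ∈ Set.Icc (0 : ℝ) 1, f t = t ^ m * f 1) ∨
      ∀ t ∈ Set.Icc (0 : ℝ) 1, f t = 0 := by
  induction k with
  | zero =>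
    intro c hc0 hc f hf h
    right
    intro t ht
    obtain ⟨M, hM⟩ := (isCompact_Icc (a := (0 : ℝ)) (b := 1)).exists_bound_of_continuousOn
      hf.continuous.continuousOn
    have hit : ∀ j : ℕ, ∀ t ∈ Set.Icc (0 : ℝ) 1, |f t| ≤ c ^ j * M := by
      intro j
      induction j with
      | zero => intro t ht; simpa using hM t ht
      | succ j ih =>
        intro t ht
        rw [h t (by rw [abs_of_nonneg ht.1]; linarith [ht.2]), abs_mul, abs_of_nonneg hc0, pow_succ']
        rw [mul_assoc]
        gcongr
        exact ih _ ⟨by linarith [ht.1], by linarith [ht.2]⟩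
    have hlim : Tendsto (fun j : ℕ => c ^ j * M) atTop (𝓝 0) := by
      simpa using (tendsto_pow_atTop_nhds_zero_of_lt_one hc0 (by simpa using hc)).mul_const M
    have := ge_of_tendsto' hlim fun j => hit j t ht
    exact abs_nonpos_iff.1 this
  | succ k ih =>
    intro c hc0 hc f hf h
    have hfd := hf.differentiable (by simp)
    have hder : ∀ t, |t| < 2 → deriv f t = c / 4 * deriv f (t / 4) := by
      intro t ht
      have hev : f =ᶠ[𝓝 t] fun t => c * f (t / 4) := by
        filter_upwards [(isOpen_lt continuous_abs continuous_const).mem_nhds ht] with s hs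
        exact h s hs
      rw [hev.deriv_eq]
      have := ((hfd (t / 4)).hasDerivAt.comp t ((hasDerivAt_id t).div_const 4)).const_mul c
      simp only [Function.comp_def] at this
      erw [this.deriv]
      ring
    have hzero : f 0 = c * f 0 := by simpa using h 0 (by simp)
    have hprim : ∀ (m : ℕ) (b : ℝ), (∀ t ∈ Set.Icc (0 : ℝ) 1, deriv f t = t ^ m * b) →
        ∀ t ∈ Set.Icc (0 : ℝ) 1, f t = f 0 + t ^ (m + 1) * (b / (m + 1)) := by
      intro m b hb t ht
      have h1 : ∀ s, HasDerivAt (fun s => f s - s ^ (m + 1) * (b / (m + 1)))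
          (deriv f s - s ^ m * b) s := by
        intro s
        refine ((hfd s).hasDerivAt.sub ((hasDerivAt_pow (m + 1) s).mul_const _)).congr_deriv ?_
        push_cast
        field_simp
      have := constant_of_has_deriv_right_zero (fun s _ => (h1 s).continuousAt.continuousWithinAt)
        (fun s hs => by
          have := h1 s
          rw [hb s ⟨hs.1, hs.2.le⟩, sub_self] at this
          exact this.hasDerivWithinAt) t ht
      simp at this
      linarith
    rcases ih (c / 4) (by positivity) (by rw [pow_succ] at hc; linarith) (deriv f)
      (contDiff_infty_iff_deriv.1 hf).2 hder with ⟨m, hm, hfm⟩ | hz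
    · left
      have hcm : c = 4 ^ (m + 1) := by rw [pow_succ, ← hm]; ring
      have hf0 : f 0 = 0 := by
        have : (1 : ℝ) < c := by rw [hcm]; exact one_lt_pow₀ (by norm_num) (by simp)
        have : (c - 1) * f 0 = 0 := by linarith
        rcases mul_eq_zero.1 this with h | h
        · linarith
        · exact h
      refine ⟨m + 1, hcm, fun t ht => ?_⟩
      rw [hprim m _ hfm t ht, hprim m _ hfm 1 (by simp), hf0]
      simp
    -- Here `f'` vanishes on `[0, 1]`, so `f` is constant there: degree zero with `c = 1`, or
    -- identically zero.
    · have hp := hprim 0 0 (fun t ht => by simp [hz t ht])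
      rcases eq_or_ne (f 0) 0 with hf0 | hf0
      · right
        intro t ht
        simp [hp t ht, hf0]
      · left
        refine ⟨0, ?_, fun t ht => ?_⟩
        · have : f 0 * (c - 1) = 0 := by linarith
          rcases mul_eq_zero.1 this with h | h
          · exact absurd h hf0
          · simpa using (by linarith : c = 1)
        · rw [hp t ht, hp 1 (by simp)]
          simp

theorem eq_zero_of_integral_rho_sq {g : Space n → ℝ} (hg : Continuous g)
    (h : ∫ x, rho x * g x ^ 2 = 0) {x : Space n} (hx : ‖x‖ < 1) : g x = 0 := by
  by_contra hne
  have := (contDiff_rho.continuous.mul (hg.pow 2)).integral_pos_of_hasCompactSupport_nonneg_nonzero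
    (μ := volume) hasCompactSupport_rho.mul_right
    (fun x => mul_nonneg (rho_nonneg x) (sq_nonneg (g x))) (x := x)
    (mul_ne_zero (rho_pos hx).ne' (pow_ne_zero 2 hne))
  exact this.ne' h

/-- The dilation identity evaluates the mixed term in `∫ ρ (W(4x) - c W(x))²`, and the two doubling
inequalities make the sum nonpositive. Hence `W(4x) = c W(x)` on the unit ball, and each ray is
handled by `pow_of_four_scaling`. A ray on which `W` does not vanish determines `m`, which is then
common to all rays. -/
theorem homogeneous_of_doubling_eq {W : Space n → ℝ} (hW : ContDiff ℝ ∞ W) {R : ℝ} (hR : 4 < R)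
    (h0 : ∀ x ∈ Metric.ball 0 R, lap W x = 0) {c : ℝ} (hc : 0 ≤ c)
    (h42 : ∫ x, rho x * W ((4 : ℝ) • x) ^ 2 ≤ c * ∫ x, rho x * W ((2 : ℝ) • x) ^ 2)
    (h21 : c * ∫ x, rho x * W ((1 : ℝ) • x) ^ 2 ≤ ∫ x, rho x * W ((2 : ℝ) • x) ^ 2)
    (h2 : 0 < ∫ x, rho x * W ((2 : ℝ) • x) ^ 2) :
    ∃ m : ℕ, c = 4 ^ m ∧ ∀ x : Space n, ‖x‖ < 1 → ∀ t ∈ Set.Icc (0 : ℝ) 1,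
      W (t • x) = t ^ m * W x := by
  have hid := integral_rho_mul_dilate hW h0 (a := 2) (t := Real.log 2) (by norm_num)
    (Real.log_nonneg (by norm_num)) (by rw [Real.exp_log (by norm_num)]; linarith)
  rw [Real.exp_neg, Real.exp_log (by norm_num)] at hid
  norm_num only [] at hid
  have hcont : ∀ a : ℝ, Continuous fun x : Space n => W (a • x) := fun a =>
    (contDiff_comp_smul hW a).continuous
  have hint : ∀ g : Space n → ℝ, Continuous g → Integrable fun x => rho x * g x := fun g hg =>
    (contDiff_rho.continuous.mul hg).integrable_of_hasCompactSupport hasCompactSupport_rho.mul_right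
  have hsq : ∫ x, rho x * (W ((4 : ℝ) • x) - c * W ((1 : ℝ) • x)) ^ 2 = 0 := by
    refine le_antisymm ?_ (integral_nonneg fun x => mul_nonneg (rho_nonneg x) (sq_nonneg _))
    have hexp : ∀ x : Space n, rho x * (W ((4 : ℝ) • x) - c * W ((1 : ℝ) • x)) ^ 2 =
        rho x * W ((4 : ℝ) • x) ^ 2 - 2 * c * (rho x * (W ((4 : ℝ) • x) * W ((1 : ℝ) • x))) +
        c ^ 2 * (rho x * W ((1 : ℝ) • x) ^ 2) := fun x => by ring
    simp only [hexp]
    rw [integral_add, integral_sub, integral_const_mul, integral_const_mul, hid]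
    · nlinarith
    · exact hint _ ((hcont 4).pow 2)
    · exact (hint _ ((hcont 4).mul (hcont 1))).const_mul _
    · exact (hint _ ((hcont 4).pow 2)).sub ((hint _ ((hcont 4).mul (hcont 1))).const_mul _)
    · exact (hint _ ((hcont 1).pow 2)).const_mul _
  have hscale : ∀ x : Space n, ‖x‖ < 1 → W ((4 : ℝ) • x) = c * W x := by
    intro x hx
    have := eq_zero_of_integral_rho_sq ((hcont 4).sub (continuous_const.mul (hcont 1))) hsq hx
    simp only [one_smul, Pi.sub_apply, Pi.mul_apply] at this
    linarith
  obtain ⟨k, hk⟩ := pow_unbounded_of_one_lt c (by norm_num : (1 : ℝ) < 4)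
  have hray : ∀ x : Space n, ‖x‖ < 1 →
      (∃ m : ℕ, c = 4 ^ m ∧ ∀ t ∈ Set.Icc (0 : ℝ) 1, W (t • x) = t ^ m * W x) ∨
        ∀ t ∈ Set.Icc (0 : ℝ) 1, W (t • x) = 0 := by
    intro x hx
    rcases pow_of_four_scaling k c hc hk (fun t => W (t • x))
      (hW.comp (contDiff_id.smul contDiff_const)) (fun t ht => by
        have := hscale ((t / 4) • x) (by
          rw [norm_smul, Real.norm_eq_abs, abs_div, abs_of_pos (by norm_num : (0 : ℝ) < 4)]
          nlinarith [norm_nonneg x])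
        rw [smul_smul] at this
        rw [← this]
        congr 2
        ring) with ⟨m, hm, h⟩ | h
    · left
      exact ⟨m, hm, by simpa using h⟩
    · exact Or.inr h
  have hne : ∃ x : Space n, ‖x‖ < 1 ∧ W x ≠ 0 := by
    by_contra hall
    push Not at hall
    -- By the dilation identity the mass at 2 is `∫ ρ W(4x) W(x)`, so it would vanish if `W`
    -- vanished on the unit ball.
    rw [← hid] at h2
    refine h2.ne' (integral_eq_zero_of_ae (Eventually.of_forall fun x => ?_))
    rcases lt_or_ge ‖x‖ 1 with hx | hx
    · simp [hall x hx]
    · simp [rho_eq_zero hx]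
  obtain ⟨x₁, hx₁, hWx₁⟩ := hne
  obtain ⟨m, hm, -⟩ := (hray x₁ hx₁).resolve_right fun h => hWx₁ (by simpa using h 1 (by simp))
  refine ⟨m, hm, fun x hx t ht => ?_⟩
  rcases hray x hx with ⟨m', hm', h⟩ | h
  · have : m' = m := by
      have := hm'.symm.trans hm
      exact Nat.pow_right_injective (le_refl 2 |>.trans (by norm_num : 2 ≤ 4)) (by exact_mod_cast this)
    exact this ▸ h t ht
  · have h1 := h 1 (by simp)
    rw [one_smul] at h1
    rw [h t ht, h1, mul_zero]

/-! ### Unique continuation -/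

theorem WeaklyHarmonic.mono {U V : Set (Space n)} {w : Space n → ℝ} (h : WeaklyHarmonic U w)
    (hVU : V ⊆ U) : WeaklyHarmonic V w := by
  intro φ hφ
  have h1 := h φ ⟨hφ.1, hφ.2.1, hφ.2.2.trans hVU⟩
  have h0 : ∀ x ∉ V, w x * lap φ x = 0 := fun x hx => by
    rw [image_eq_zero_of_notMem_tsupport fun h' => hx (hφ.2.2 (tsupport_lap_subset φ h')), mul_zero]
  rw [setIntegral_eq_integral_of_forall_compl_eq_zero h0]
  rwa [setIntegral_eq_integral_of_forall_compl_eq_zero fun x hx => h0 x fun h => hx (hVU h)] at h1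

theorem WeaklyHarmonic.congr_ae {U : Set (Space n)} {w w' : Space n → ℝ} (hU : MeasurableSet U)
    (h : WeaklyHarmonic U w) (hw : ∀ᵐ x, x ∈ U → w' x = w x) : WeaklyHarmonic U w' := by
  intro φ hφ
  rw [← h φ hφ]
  refine setIntegral_congr_ae hU ?_
  filter_upwards [hw] with x hx hxU
  rw [hx hxU]

theorem eqOn_zero_of_ae {W : Space n → ℝ} (hW : Continuous W) {U : Set (Space n)} (hU : IsOpen U)
    (h : ∀ᵐ x, x ∈ U → W x = 0) {x : Space n} (hx : x ∈ U) : W x = 0 :=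
  Measure.eqOn_open_of_ae_eq (f := W) (g := fun _ => 0)
    ((ae_restrict_iff' hU.measurableSet).2 h) hU hW.continuousOn continuousOn_const hx

/-- If `V` vanishes on the ball of radius `r` and `r < q < R`, the dilation identity with `a = √(r
q)` reads `∫ ρ V(a x)² = ∫ ρ V(q x) V(r x) = 0`. So `V` vanishes on the larger ball of radius `a`,
and the supremum of the radii of vanishing must be `R`. -/
theorem harmonic_eq_zero_of_eq_zero_near {V : Space n → ℝ} (hV : ContDiff ℝ ∞ V) {R : ℝ}
    (h0 : ∀ x ∈ Metric.ball 0 R, lap V x = 0) {δ : ℝ} (hδ : 0 < δ) (hδR : δ ≤ R)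
    (hz : ∀ x ∈ Metric.ball (0 : Space n) δ, V x = 0) :
    ∀ x ∈ Metric.ball (0 : Space n) R, V x = 0 := by
  set S : Set ℝ := {r | r ≤ R ∧ ∀ x ∈ Metric.ball (0 : Space n) r, V x = 0} with hS
  have hSb : BddAbove S := ⟨R, fun r hr => hr.1⟩
  have hSδ : δ ∈ S := ⟨hδR, hz⟩
  set r := sSup S with hr
  have hδr : δ ≤ r := le_csSup hSb hSδ
  have hrR : r ≤ R := csSup_le ⟨δ, hSδ⟩ fun s hs => hs.1
  have hrz : ∀ x ∈ Metric.ball (0 : Space n) r, V x = 0 := by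
    intro x hx
    obtain ⟨s, hs, hxs⟩ := exists_lt_of_lt_csSup ⟨δ, hSδ⟩ (mem_ball_zero_iff.1 hx)
    exact hs.2 x (mem_ball_zero_iff.2 hxs)
  rcases eq_or_lt_of_le hrR with h | hlt
  · rwa [h] at hrz
  exfalso
  have hr0 : 0 < r := hδ.trans_le hδr
  set q := (r + R) / 2
  have hq1 : r < q := by simp only [q]; linarith
  have hq2 : q < R := by simp only [q]; linarith
  have hq0 : 0 < q := hr0.trans hq1
  set a := Real.sqrt (r * q) with ha
  have haa : a * a = r * q := Real.mul_self_sqrt (by positivity)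
  have ha0 : 0 < a := Real.sqrt_pos.2 (by positivity)
  have har : r < a := by
    rw [ha]; exact Real.lt_sqrt_of_sq_lt (by nlinarith)
  have haq : a < q := by
    by_contra h
    nlinarith
  set t := Real.log (a / r)
  have het : Real.exp t = a / r := Real.exp_log (by positivity)
  have hid := integral_rho_mul_dilate hV h0 (a := a) (t := t) ha0
    (Real.log_nonneg (by rw [le_div_iff₀ hr0]; linarith))
    (by rw [het, ← mul_div_assoc, haa]; rw [mul_div_cancel_left₀ _ hr0.ne']; exact hq2)
  rw [Real.exp_neg, het, inv_div, mul_div_cancel₀ _ ha0.ne'] at hid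
  have hzero : ∫ x : Space n, rho x * V (a • x) ^ 2 = 0 := by
    rw [← hid]
    refine integral_eq_zero_of_ae (Eventually.of_forall fun x => ?_)
    rcases lt_or_ge ‖x‖ 1 with hx | hx
    · have : V (r • x) = 0 := hrz _ (by
        rw [mem_ball_zero_iff, norm_smul, Real.norm_eq_abs, abs_of_pos hr0]
        nlinarith)
      simp [this]
    · simp [rho_eq_zero hx]
  have haS : a ∈ S := by
    refine ⟨by linarith, fun x hx => ?_⟩
    have := eq_zero_of_integral_rho_sq (g := fun x => V (a • x))
      (contDiff_comp_smul hV a).continuous hzero (x := a⁻¹ • x) (by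
        rw [norm_smul, Real.norm_eq_abs, abs_of_pos (by positivity), inv_mul_lt_iff₀ ha0, mul_one]
        simpa using hx)
    simpa [smul_smul, mul_inv_cancel₀ ha0.ne'] using this
  have := le_csSup hSb haS
  linarith

theorem pderiv_comp_add (W : Space n → ℝ) (x₀ : Space n) (i : Fin (n + 1)) (x : Space n) :
    pderiv i (fun x => W (x₀ + x)) x = pderiv i W (x₀ + x) := by
  rw [pderiv, fderiv_comp_add_left, pderiv]

theorem lap_comp_add (W : Space n → ℝ) (x₀ : Space n) (x : Space n) :
    lap (fun x => W (x₀ + x)) x = lap W (x₀ + x) := by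
  simp only [lap, funext (pderiv_comp_add W x₀ _), pderiv_comp_add]

theorem weaklyHarmonic_ball_eq_zero {x₀ : Space n} {R R' δ : ℝ} (hR : R' < R) (hδ : 0 < δ)
    (hδR : δ ≤ R') {w : Space n → ℝ} (hw : IntegrableOn w (Metric.ball x₀ R))
    (h : WeaklyHarmonic (Metric.ball x₀ R) w)
    (hz : ∀ᵐ x, x ∈ Metric.ball x₀ δ → w x = 0) :
    ∀ᵐ x, x ∈ Metric.ball x₀ R' → w x = 0 := by
  obtain ⟨W, hW, hWw⟩ := exists_contDiff_of_weaklyHarmonic hR hw h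
  have hlap : ∀ x ∈ Metric.ball x₀ R', lap W x = 0 := fun x hx =>
    lap_eq_zero_of_weaklyHarmonic Metric.isOpen_ball hW
      ((h.mono (Metric.ball_subset_ball hR.le)).congr_ae measurableSet_ball hWw) hx
  have hWz : ∀ x ∈ Metric.ball x₀ δ, W x = 0 := fun x hx =>
    eqOn_zero_of_ae hW.continuous Metric.isOpen_ball (by
      filter_upwards [hz, hWw] with x h1 h2 h3
      rw [h2 (Metric.ball_subset_ball hδR h3), h1 h3]) hx
  have hV := harmonic_eq_zero_of_eq_zero_near (V := fun x => W (x₀ + x)) (R := R')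
    (hW.comp (contDiff_const.add contDiff_id))
    (fun x hx => by
      rw [lap_comp_add]; exact hlap _ (by simpa using hx)) hδ hδR
    (fun x hx => hWz _ (by simpa using hx))
  filter_upwards [hWw] with x hx hxR
  rw [← hx hxR]
  have := hV (x - x₀) (by simpa [dist_eq_norm] using hxR)
  simpa using this

/-- The points near which `w` vanishes form an open set. It is relatively closed: near a limit point
`x` there is such a point `y` within `R / 4`, the ball of radius `3R/4` about `y` still lies in `U`,
and vanishing spreads to the ball of radius `R / 2` about `y`, which covers a neighbourhood of `x`.
-/
theorem weaklyHarmonic_eq_zero {U : Set (Space n)} (hU : IsOpen U) (hUc : IsPreconnected U)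
    {w : Space n → ℝ} (hw : IntegrableOn w U) (h : WeaklyHarmonic U w) {z : Space n} {δ : ℝ}
    (hzU : z ∈ U) (hδ : 0 < δ) (hz : ∀ᵐ x, x ∈ Metric.ball z δ → w x = 0) :
    ∀ᵐ x, x ∈ U → w x = 0 := by
  set Z : Set (Space n) := {x | ∃ ε > 0, ∀ᵐ y, y ∈ Metric.ball x ε → w y = 0} with hZ
  have hZo : IsOpen Z := by
    rw [Metric.isOpen_iff]
    rintro x ⟨ε, hε, hx⟩
    refine ⟨ε / 2, by positivity, fun y hy => ⟨ε / 2, by positivity, ?_⟩⟩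
    filter_upwards [hx] with v hv hvy
    refine hv (Metric.ball_subset_ball' ?_ hvy)
    have := Metric.mem_ball.1 hy
    linarith
  have hUZ : U ⊆ Z := by
    refine hUc.subset_of_closure_inter_subset hZo ⟨z, hzU, δ, hδ, hz⟩ ?_
    rintro x ⟨hxZ, hxU⟩
    obtain ⟨R, hR, hRU⟩ := Metric.isOpen_iff.1 hU x hxU
    obtain ⟨y, ⟨ε, hε, hy⟩, hxy⟩ := Metric.mem_closure_iff.1 hxZ (R / 4) (by positivity)
    have hsub : Metric.ball y (3 * R / 4) ⊆ U :=
      (Metric.ball_subset_ball' (by rw [dist_comm]; linarith)).trans hRU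
    have := weaklyHarmonic_ball_eq_zero (x₀ := y) (R := 3 * R / 4) (R' := R / 2)
      (δ := min ε (R / 2)) (by linarith) (by positivity) (min_le_right _ _) (hw.mono_set hsub)
      (h.mono hsub) (by
        filter_upwards [hy] with v hv hvy
        exact hv (Metric.ball_subset_ball (min_le_left _ _) hvy))
    refine ⟨R / 4, by positivity, ?_⟩
    filter_upwards [this] with v hv hvx
    exact hv (Metric.ball_subset_ball' (by linarith) hvx)
  have : volume {x | ¬ (x ∈ U → w x = 0)} = 0 := by
    refine measure_null_of_locally_null _ fun x hx => ?_
    obtain ⟨hxU, -⟩ := Classical.not_imp.1 hx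
    obtain ⟨ε, hε, hy⟩ := hUZ hxU
    refine ⟨Metric.ball x ε ∩ {x | ¬ (x ∈ U → w x = 0)}, ?_, ?_⟩
    · exact inter_mem (mem_nhdsWithin_of_mem_nhds (Metric.ball_mem_nhds x hε)) self_mem_nhdsWithin
    · refine measure_mono_null (fun y hy => ?_) hy
      intro hcon
      exact hy.2 fun _ => hcon hy.1
  exact this

/-! ### The Neumann condition and even reflection -/

/-- The open upper half space. -/
def upperHalf (n : ℕ) : Set (Space n) := {x | 0 < x (Fin.last n)}

/-- `h` is harmonic in the part of `U` above the hyperplane, with vanishing normal derivative on the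
hyperplane, in the sense of distributions. -/
def NeumannHarmonic (U : Set (Space n)) (h : Space n → ℝ) : Prop :=
  ∀ φ : Space n → ℝ, IsTestFunction U φ → (∀ x, x (Fin.last n) = 0 → pderiv (Fin.last n) φ x = 0) →
    ∫ x in upperHalf n ∩ U, h x * lap φ x = 0

theorem continuous_coord (i : Fin (n + 1)) : Continuous fun x : Space n => x i :=
  (EuclideanSpace.proj (𝕜 := ℝ) (ι := Fin (n + 1)) i).continuous

theorem isOpen_upperHalf : IsOpen (upperHalf n) :=
  isOpen_lt continuous_const (continuous_coord _)

theorem measurableSet_upperHalf : MeasurableSet (upperHalf n) := isOpen_upperHalf.measurableSet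

theorem smul_mem_upperHalf {t : ℝ} (ht : 0 < t) {x : Space n} :
    t • x ∈ upperHalf n ↔ x ∈ upperHalf n := by
  simp [upperHalf, ht]

theorem convex_upperHalf : Convex ℝ (upperHalf n) :=
  convex_halfSpace_gt (f := fun x : Space n => x (Fin.last n))
    (EuclideanSpace.proj (𝕜 := ℝ) (ι := Fin (n + 1)) (Fin.last n)).isLinear 0

theorem volume_hyperplane : volume {x : Space n | x (Fin.last n) = 0} = 0 := by
  have := Measure.addHaar_submodule (volume : Measure (Space n))
    (LinearMap.ker (EuclideanSpace.proj (𝕜 := ℝ) (ι := Fin (n + 1)) (Fin.last n)).toLinearMap) (by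
      intro h
      have : EuclideanSpace.single (Fin.last n) (1 : ℝ) ∈ (⊤ : Submodule ℝ (Space n)) := trivial
      rw [← h] at this
      simp at this)
  convert this using 2
  ext x
  simp

/-- The reflection in the hyperplane `x_d = 0`. -/
def refl (n : ℕ) : Space n ≃ₗᵢ[ℝ] Space n :=
  LinearIsometryEquiv.piLpCongrRight 2 fun i =>
    if i = Fin.last n then LinearIsometryEquiv.neg ℝ else LinearIsometryEquiv.refl ℝ ℝ

theorem refl_apply (x : Space n) (i : Fin (n + 1)) :
    refl n x i = if i = Fin.last n then -x i else x i := by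
  rw [refl, LinearIsometryEquiv.piLpCongrRight_apply]
  simp only
  split_ifs <;> rfl

theorem refl_refl (x : Space n) : refl n (refl n x) = x := by
  ext i
  simp only [refl_apply]
  split_ifs <;> simp

theorem pderiv_comp_refl {φ : Space n → ℝ} (hφ : Differentiable ℝ φ) (i : Fin (n + 1))
    (x : Space n) : pderiv i (fun x => φ (refl n x)) x =
      (if i = Fin.last n then -1 else 1) * pderiv i φ (refl n x) := by
  have h := (hφ (refl n x)).hasFDerivAt.comp x (refl n).toContinuousLinearEquiv.hasFDerivAt
  have hs : refl n (EuclideanSpace.single i 1) =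
      (if i = Fin.last n then (-1 : ℝ) else 1) • EuclideanSpace.single i 1 := by
    ext j
    rw [refl_apply]
    by_cases hij : j = i
    · subst hij; split_ifs <;> simp
    · split_ifs <;> simp [hij]
  rw [pderiv]
  erw [h.fderiv]
  simp only [ContinuousLinearMap.comp_apply]
  erw [hs]
  rw [map_smul, smul_eq_mul]
  rfl

theorem lap_comp_refl {φ : Space n → ℝ} (hφ : ContDiff ℝ ∞ φ) (x : Space n) :
    lap (fun x => φ (refl n x)) x = lap φ (refl n x) := by
  refine Finset.sum_congr rfl fun i _ => ?_
  rw [funext (pderiv_comp_refl (hφ.differentiable (by simp)) i)]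
  set s : ℝ := if i = Fin.last n then -1 else 1 with hs
  have hd : Differentiable ℝ fun x => s * pderiv i φ x :=
    ((contDiff_pderiv hφ i).differentiable (by simp)).const_mul s
  rw [pderiv_comp_refl (φ := fun x => s * pderiv i φ x) hd, pderiv,
    fderiv_const_mul ((contDiff_pderiv hφ i).differentiable (by simp) _), ← hs]
  have hss : s * s = 1 := by simp only [hs]; split_ifs <;> norm_num
  simp only [smul_apply, smul_eq_mul]
  rw [← mul_assoc, hss, one_mul, pderiv]

theorem measurePreserving_refl : MeasurePreserving (refl n) := (refl n).measurePreserving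

theorem preimage_refl_upperHalf :
    refl n ⁻¹' upperHalf n = {x : Space n | x (Fin.last n) < 0} := by
  ext x
  simp [upperHalf, refl_apply]

theorem ae_restrict_compl_upperHalf :
    volume.restrict (upperHalf n)ᶜ = volume.restrict (refl n ⁻¹' upperHalf n) := by
  refine Measure.restrict_congr_set ?_
  rw [preimage_refl_upperHalf]
  have h : ∀ᵐ x : Space n, x (Fin.last n) ≠ 0 := by
    have := volume_hyperplane (n := n)
    rw [ae_iff]
    simpa using this
  filter_upwards [h] with x hx
  simp only [eq_iff_iff]
  change ¬ (0 < x (Fin.last n)) ↔ x (Fin.last n) < 0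
  rw [not_lt]
  exact ⟨fun h => lt_of_le_of_ne h hx, le_of_lt⟩

theorem integrable_of_upperHalf {F : Space n → ℝ} (h₁ : IntegrableOn F (upperHalf n))
    (h₂ : IntegrableOn (fun x => F (refl n x)) (upperHalf n)) : Integrable F := by
  rw [← integrableOn_univ, ← Set.union_compl_self (upperHalf n)]
  refine h₁.union ?_
  rw [IntegrableOn, ae_restrict_compl_upperHalf]
  have := (measurePreserving_refl.integrableOn_comp_preimage
    (refl n).toHomeomorph.measurableEmbedding (s := upperHalf n)
    (f := fun x => F (refl n x))).2 h₂
  simp only [Function.comp_def, refl_refl] at this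
  exact this

theorem integral_eq_upperHalf {F : Space n → ℝ} (hF : Integrable F) :
    ∫ x, F x = (∫ x in upperHalf n, F x) + ∫ x in upperHalf n, F (refl n x) := by
  rw [← integral_add_compl measurableSet_upperHalf hF, ae_restrict_compl_upperHalf]
  congr 1
  have := measurePreserving_refl.setIntegral_preimage_emb
    (refl n).toHomeomorph.measurableEmbedding (fun x => F (refl n x)) (upperHalf n)
  simpa [refl_refl] using this

/-- The even extension across the hyperplane. -/
def evenExt (h : Space n → ℝ) (x : Space n) : ℝ :=
  if 0 < x (Fin.last n) then h x else h (refl n x)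

theorem evenExt_of_mem {h : Space n → ℝ} {x : Space n} (hx : x ∈ upperHalf n) :
    evenExt h x = h x := if_pos hx

theorem evenExt_refl_of_mem {h : Space n → ℝ} {x : Space n} (hx : x ∈ upperHalf n) :
    evenExt h (refl n x) = h x := by
  have : ¬ 0 < refl n x (Fin.last n) := by
    have : 0 < x (Fin.last n) := hx
    simp [refl_apply]; linarith
  rw [evenExt, if_neg this, refl_refl]

theorem integrableOn_evenExt {R : ℝ} {h : Space n → ℝ}
    (hh : IntegrableOn h (upperHalf n ∩ Metric.ball 0 R)) :
    IntegrableOn (evenExt h) (Metric.ball 0 R) := by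
  have hh' : IntegrableOn ((Metric.ball 0 R).indicator h) (upperHalf n) := by
    rw [IntegrableOn, integrable_indicator_iff measurableSet_ball, IntegrableOn,
      Measure.restrict_restrict measurableSet_ball, Set.inter_comm]
    exact hh
  rw [← integrable_indicator_iff measurableSet_ball]
  refine integrable_of_upperHalf (hh'.congr_fun (fun x hx => ?_) measurableSet_upperHalf)
    (hh'.congr_fun (fun x hx => ?_) measurableSet_upperHalf)
  · by_cases hxb : x ∈ Metric.ball (0 : Space n) R
    · simp only [Set.indicator_of_mem hxb, evenExt_of_mem hx]
    · simp only [Set.indicator_of_notMem hxb]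
  · by_cases hxb : x ∈ Metric.ball (0 : Space n) R
    · have : refl n x ∈ Metric.ball (0 : Space n) R := by simpa using hxb
      simp only [Set.indicator_of_mem hxb, Set.indicator_of_mem this, evenExt_refl_of_mem hx]
    · have : refl n x ∉ Metric.ball (0 : Space n) R := by simpa using hxb
      simp only [Set.indicator_of_notMem hxb, Set.indicator_of_notMem this]

/-- Folding the lower half space onto the upper one replaces the test function `φ` by `φ + φ ∘
refl`. The normal derivative of this sum vanishes on the hyperplane, so it is admissible in
`NeumannHarmonic`. -/
theorem NeumannHarmonic.evenExt {R : ℝ} {h : Space n → ℝ}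
    (hh : IntegrableOn h (upperHalf n ∩ Metric.ball 0 R))
    (H : NeumannHarmonic (Metric.ball 0 R) h) :
    WeaklyHarmonic (Metric.ball 0 R) (evenExt h) := by
  intro φ hφ
  have hφr : ContDiff ℝ ∞ fun x => φ (refl n x) := hφ.1.comp (refl n).contDiff
  have hd : Differentiable ℝ φ := hφ.1.differentiable (by simp)
  have hdr : Differentiable ℝ fun x => φ (refl n x) := hφr.differentiable (by simp)
  have hadd : ∀ (f g : Space n → ℝ), Differentiable ℝ f → Differentiable ℝ g → ∀ i,
      pderiv i (fun x => f x + g x) = fun x => pderiv i f x + pderiv i g x := by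
    intro f g hf hg i
    funext x
    rw [pderiv, fderiv_fun_add (hf x) (hg x)]
    rfl
  have hlap : ∀ x, lap (fun x => φ x + φ (refl n x)) x = lap φ x + lap φ (refl n x) := by
    intro x
    rw [← lap_comp_refl hφ.1]
    simp only [lap, ← Finset.sum_add_distrib]
    refine Finset.sum_congr rfl fun i _ => ?_
    rw [hadd _ _ hd hdr, hadd _ _ ((contDiff_pderiv hφ.1 i).differentiable (by simp))
      ((contDiff_pderiv hφr i).differentiable (by simp))]
  have hcr : HasCompactSupport fun x => φ (refl n x) :=
    hφ.2.1.comp_homeomorph (refl n).toHomeomorph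
  have htest : IsTestFunction (Metric.ball 0 R) fun x => φ x + φ (refl n x) := by
    refine ⟨hφ.1.add hφr, hφ.2.1.add hcr, ?_⟩
    refine (tsupport_add _ _).trans (Set.union_subset hφ.2.2 ?_)
    intro x hx
    have : refl n x ∈ tsupport φ := tsupport_comp_subset_preimage φ (refl n).continuous hx
    simpa using hφ.2.2 this
  have key := H _ htest (fun x hx => by
    have hx' : refl n x = x := by
      ext i
      rw [refl_apply]
      split_ifs with hi
      · subst hi; rw [hx, neg_zero]
      · rfl
    rw [hadd _ _ hd hdr]
    beta_reduce
    rw [pderiv_comp_refl hd, if_pos rfl, hx']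
    ring)
  have hint := integrableOn_evenExt hh
  have hzero : ∀ x ∉ Metric.ball (0 : Space n) R, lap φ x = 0 := fun x hx =>
    image_eq_zero_of_notMem_tsupport fun h' => hx (hφ.2.2 (tsupport_lap_subset φ h'))
  have hlc : HasCompactSupport (lap φ) :=
    hφ.2.1.mono' ((subset_tsupport _).trans (tsupport_lap_subset φ))
  obtain ⟨C, hC⟩ := (contDiff_lap hφ.1).continuous.bounded_above_of_compact_support hlc
  have hInt : Integrable fun x => RobinHalfSpace.evenExt h x * lap φ x := by
    rw [← integrableOn_iff_integrable_of_support_subset (s := Metric.ball 0 R)]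
    · exact Integrable.mul_bdd hint (contDiff_lap hφ.1).continuous.aestronglyMeasurable
        (Eventually.of_forall hC)
    · intro x hx
      by_contra hxb
      exact hx (by simp [hzero x hxb])
  rw [setIntegral_eq_integral_of_forall_compl_eq_zero fun x hx => by rw [hzero x hx, mul_zero],
    integral_eq_upperHalf hInt]
  have hr : ∀ x, x ∉ Metric.ball (0 : Space n) R → refl n x ∉ Metric.ball (0 : Space n) R :=
    fun x hx => by simpa using hx
  have hInt' : Integrable fun x => RobinHalfSpace.evenExt h (refl n x) * lap φ (refl n x) :=
    (measurePreserving_refl.integrable_comp_emb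
      (refl n).toHomeomorph.measurableEmbedding).2 hInt
  rw [← integral_add hInt.integrableOn hInt'.integrableOn, ← key]
  rw [← setIntegral_eq_of_subset_of_forall_sdiff_eq_zero measurableSet_upperHalf
    Set.inter_subset_left]
  · refine setIntegral_congr_fun measurableSet_upperHalf fun x hx => ?_
    simp only [evenExt_of_mem hx, evenExt_refl_of_mem hx, hlap]
    ring
  · intro x hx
    have hxb : x ∉ Metric.ball (0 : Space n) R := fun h => hx.2 ⟨hx.1, h⟩
    rw [hlap, hzero _ hxb, hzero _ (hr x hxb)]
    ring

/-- The weighted mass of `h²` in the upper half ball of radius `t`. -/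
def halfMass (h : Space n → ℝ) (t : ℝ) : ℝ := ∫ x in upperHalf n, rho x * h (t • x) ^ 2

theorem ae_smul {p : Space n → Prop} (h : ∀ᵐ x, p x) {t : ℝ} (ht : t ≠ 0) :
    ∀ᵐ x, p (t • x) := by
  have h1 := Measure.addHaar_preimage_smul (volume : Measure (Space n)) ht {x | ¬ p x}
  rw [ae_iff.1 h, mul_zero] at h1
  exact h1

theorem ae_refl {p : Space n → Prop} (h : ∀ᵐ x, p x) : ∀ᵐ x, p (refl n x) :=
  measurePreserving_refl.quasiMeasurePreserving.ae h

/-- Weyl's lemma for the even extension. Both halves contribute equally to the mass because `rho` is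
radial, whence the factor 2. -/
theorem NeumannHarmonic.exists_contDiff {R R' : ℝ} (hR : R' < R) {h : Space n → ℝ}
    (hh : IntegrableOn h (upperHalf n ∩ Metric.ball 0 R))
    (H : NeumannHarmonic (Metric.ball 0 R) h) :
    ∃ W : Space n → ℝ, ContDiff ℝ ∞ W ∧ (∀ x ∈ Metric.ball 0 R', lap W x = 0) ∧
      (∀ᵐ x, x ∈ upperHalf n → x ∈ Metric.ball 0 R' → W x = h x) ∧
      ∀ t, 0 < t → t ≤ R' → ∫ x, rho x * W (t • x) ^ 2 = 2 * halfMass h t := by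
  have Hw := H.evenExt hh
  obtain ⟨W, hW, hWw⟩ := exists_contDiff_of_weaklyHarmonic hR (integrableOn_evenExt hh) Hw
  refine ⟨W, hW, fun x hx => lap_eq_zero_of_weaklyHarmonic Metric.isOpen_ball hW
      ((Hw.mono (Metric.ball_subset_ball hR.le)).congr_ae measurableSet_ball hWw) hx, ?_, ?_⟩
  · filter_upwards [hWw] with x hx hxu hxb
    rw [hx hxb, evenExt_of_mem hxu]
  · intro t ht htR
    have hmem : ∀ x : Space n, ‖x‖ < 1 → t • x ∈ Metric.ball (0 : Space n) R' := fun x hx => by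
      rw [mem_ball_zero_iff, norm_smul, Real.norm_eq_abs, abs_of_pos ht]
      nlinarith
    rw [integral_eq_upperHalf, two_mul]
    · congr 1
      · refine setIntegral_congr_ae measurableSet_upperHalf ?_
        filter_upwards [ae_smul hWw ht.ne'] with x hx hxu
        rcases lt_or_ge ‖x‖ 1 with h1 | h1
        · rw [hx (hmem x h1), evenExt_of_mem ((smul_mem_upperHalf ht).2 hxu)]
        · rw [rho_eq_zero h1, zero_mul, zero_mul]
      · refine setIntegral_congr_ae measurableSet_upperHalf ?_
        filter_upwards [ae_refl (ae_smul hWw ht.ne')] with x hx hxu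
        rcases lt_or_ge ‖x‖ 1 with h1 | h1
        · rw [hx (hmem _ (by simpa using h1)), ← map_smul,
            evenExt_refl_of_mem ((smul_mem_upperHalf ht).2 hxu)]
          simp [rho]
        · rw [rho_eq_zero h1, rho_eq_zero (by simpa using h1), zero_mul, zero_mul]
    · exact (contDiff_rho.continuous.mul
        ((contDiff_comp_smul hW t).continuous.pow 2)).integrable_of_hasCompactSupport
        hasCompactSupport_rho.mul_right

theorem NeumannHarmonic.homogeneous {R : ℝ} (hR : 4 < R) {h : Space n → ℝ}
    (hh : IntegrableOn h (upperHalf n ∩ Metric.ball 0 R))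
    (H : NeumannHarmonic (Metric.ball 0 R) h) {c : ℝ} (hc : 0 ≤ c)
    (h42 : halfMass h 4 ≤ c * halfMass h 2) (h21 : c * halfMass h 1 ≤ halfMass h 2)
    (h2 : 0 < halfMass h 2) :
    ∃ (m : ℕ) (W : Space n → ℝ), c = 4 ^ m ∧ Continuous W ∧
      (∀ᵐ x, x ∈ upperHalf n → x ∈ Metric.ball 0 1 → W x = h x) ∧
      ∀ x : Space n, ‖x‖ < 1 → ∀ t ∈ Set.Icc (0 : ℝ) 1, W (t • x) = t ^ m * W x := by
  -- The radius halfway between 4 and `R` keeps `W` harmonic beyond radius 4, as dilation by 4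
  -- requires.
  obtain ⟨W, hW, hlap, hWh, hmass⟩ := H.exists_contDiff (R' := (4 + R) / 2) (by linarith) hh
  have e4 := hmass 4 (by norm_num) (by linarith)
  have e2 := hmass 2 (by norm_num) (by linarith)
  have e1 := hmass 1 (by norm_num) (by linarith)
  obtain ⟨m, hm, hom⟩ := homogeneous_of_doubling_eq hW (by linarith) hlap hc
    (by rw [e4, e2]; linarith) (by rw [e1, e2]; linarith) (by rw [e2]; linarith)
  refine ⟨m, W, hm, hW.continuous, ?_, hom⟩
  filter_upwards [hWh] with x hx hxu hxb
  exact hx hxu (Metric.ball_subset_ball (by linarith) hxb)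

theorem NeumannHarmonic.weaklyHarmonic {U : Set (Space n)} {h : Space n → ℝ}
    (H : NeumannHarmonic U h) : WeaklyHarmonic (upperHalf n ∩ U) h := by
  intro φ hφ
  refine H φ ⟨hφ.1, hφ.2.1, hφ.2.2.trans Set.inter_subset_right⟩ fun x hx => ?_
  refine image_eq_zero_of_notMem_tsupport fun h' => ?_
  have h1 : 0 < x (Fin.last n) := (hφ.2.2 (tsupport_pderiv_subset φ _ h')).1
  exact h1.ne' hx

theorem integrable_rho_mul_sq {h : Space n → ℝ} {R t : ℝ} (ht : 0 < t) (htR : t ≤ R)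
    (hh : MemLp h 2 (volume.restrict (upperHalf n ∩ Metric.ball 0 R))) :
    IntegrableOn (fun x => rho x * h (t • x) ^ 2) (upperHalf n) := by
  have h1 : Integrable ((upperHalf n ∩ Metric.ball 0 R).indicator fun x => h x ^ 2) :=
    (integrable_indicator_iff (measurableSet_upperHalf.inter measurableSet_ball)).2 hh.integrable_sq
  have h2 := (h1.comp_smul ht.ne').bdd_mul (c := profile 0)
    contDiff_rho.continuous.aestronglyMeasurable
    (Eventually.of_forall fun x => by
      rw [Real.norm_eq_abs, abs_of_nonneg (rho_nonneg x)]; exact rho_le x)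
  refine (h2.integrableOn (s := upperHalf n)).congr_fun (fun x hx => ?_) measurableSet_upperHalf
  rcases lt_or_ge ‖x‖ 1 with h1 | h1
  · simp only
    rw [Set.indicator_of_mem]
    refine ⟨(smul_mem_upperHalf ht).2 hx, ?_⟩
    rw [mem_ball_zero_iff, norm_smul, Real.norm_eq_abs, abs_of_pos ht]
    nlinarith
  · simp [rho_eq_zero h1]

theorem halfMass_nonneg (h : Space n → ℝ) (t : ℝ) : 0 ≤ halfMass h t :=
  integral_nonneg fun x => mul_nonneg (rho_nonneg x) (sq_nonneg _)

theorem ae_eq_zero_of_halfMass {h : Space n → ℝ} {R t : ℝ} (ht : 0 < t) (htR : t ≤ R)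
    (hh : MemLp h 2 (volume.restrict (upperHalf n ∩ Metric.ball 0 R))) (h0 : halfMass h t = 0) :
    ∀ᵐ x, x ∈ upperHalf n → x ∈ Metric.ball 0 t → h x = 0 := by
  have h1 := (setIntegral_eq_zero_iff_of_nonneg_ae
    (Eventually.of_forall fun x => mul_nonneg (rho_nonneg x) (sq_nonneg _))
    (integrable_rho_mul_sq ht htR hh)).1 h0
  have h2 := (ae_restrict_iff' measurableSet_upperHalf).1 h1
  have h3 := ae_smul h2 (inv_ne_zero ht.ne')
  filter_upwards [h3] with x hx hxu hxb
  have h4 := hx ((smul_mem_upperHalf (inv_pos.2 ht)).2 hxu)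
  have h5 : 0 < rho (t⁻¹ • x) := rho_pos (by
    rw [norm_smul, Real.norm_eq_abs, abs_of_pos (inv_pos.2 ht), inv_mul_lt_iff₀ ht, mul_one]
    simpa using hxb)
  simp only [smul_smul, mul_inv_cancel₀ ht.ne', one_smul, Pi.zero_apply, mul_eq_zero] at h4
  rcases h4 with h4 | h4
  · exact absurd h4 h5.ne'
  · exact pow_eq_zero_iff (two_ne_zero) |>.1 h4

/-- Unique continuation inside the convex open set `upperHalf n ∩ U`, started from a small ball
about the point `z` on the vertical axis. No reflection is involved, so `U` may be an ellipsoid that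
is not symmetric in the hyperplane. -/
theorem NeumannHarmonic.eq_zero_of_halfMass {U : Set (Space n)} (hU : IsOpen U) (hUc : Convex ℝ U)
    {h : Space n → ℝ} (hUf : volume U ≠ ⊤) (hh : MemLp h 2 (volume.restrict (upperHalf n ∩ U)))
    (H : NeumannHarmonic U h) {R t : ℝ} (hRU : Metric.ball 0 R ⊆ U) (ht : 0 < t) (htR : t ≤ R)
    (h0 : halfMass h t = 0) : ∀ᵐ x, x ∈ upperHalf n ∩ U → h x = 0 := by
  have hhR : MemLp h 2 (volume.restrict (upperHalf n ∩ Metric.ball 0 R)) :=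
    hh.mono_measure (Measure.restrict_mono (Set.inter_subset_inter_right _ hRU) le_rfl)
  have hz := ae_eq_zero_of_halfMass ht htR hhR h0
  have : IsFiniteMeasure (volume.restrict (upperHalf n ∩ U)) :=
    ⟨by
      rw [Measure.restrict_apply_univ]
      exact (measure_mono Set.inter_subset_right).trans_lt (lt_top_iff_ne_top.2 hUf)⟩
  set z : Space n := EuclideanSpace.single (Fin.last n) (t / 2) with hzdef
  have hzl : z (Fin.last n) = t / 2 := by simp [hzdef]
  have hzu : z ∈ upperHalf n ∩ U := by
    refine ⟨?_, hRU ?_⟩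
    · change 0 < z (Fin.last n)
      rw [hzl]; positivity
    · rw [mem_ball_zero_iff, hzdef, PiLp.norm_single, Real.norm_eq_abs,
        abs_of_pos (by positivity)]
      linarith
  have hzt : z ∈ upperHalf n ∩ Metric.ball (0 : Space n) t := by
    refine ⟨hzu.1, ?_⟩
    rw [mem_ball_zero_iff, hzdef, PiLp.norm_single, Real.norm_eq_abs,
        abs_of_pos (by positivity)]
    linarith
  obtain ⟨δ, hδ, hδs⟩ := Metric.isOpen_iff.1 (isOpen_upperHalf.inter Metric.isOpen_ball) z hzt
  refine weaklyHarmonic_eq_zero (isOpen_upperHalf.inter hU) (convex_upperHalf.inter hUc).isPreconnected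
    (hh.integrable (by norm_num)) H.weaklyHarmonic hzu hδ ?_
  filter_upwards [hz] with x hx hxb
  exact hx (hδs hxb).1 (hδs hxb).2

/-! ### Blow-up limits and the barrier for doubling quotients -/

/-- Blow-ups of `f` at the origin that are bounded in `L_2` of a neighbourhood subconverge, in
smaller neighbourhoods, to harmonic functions with vanishing normal derivative. -/
def BlowupCompact (f : Space n → ℝ) : Prop :=
  ∀ (r N : ℕ → ℝ) (U U' : Set (Space n)) (C : ℝ), (∀ k, 0 < r k) → Tendsto r atTop (𝓝 0) →
    (∀ k, 0 < N k) → IsOpen U → Bornology.IsBounded U → IsOpen U' → closure U' ⊆ U →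
    (∀ k, ∫ x in upperHalf n ∩ U, f (r k • x) ^ 2 ≤ C * N k ^ 2) →
    ∃ σ : ℕ → ℕ, StrictMono σ ∧ ∃ h : Space n → ℝ,
      MemLp h 2 (volume.restrict (upperHalf n ∩ U')) ∧
      Tendsto (fun k => ∫ x in upperHalf n ∩ U', (f (r (σ k) • x) / N (σ k) - h x) ^ 2)
        atTop (𝓝 0) ∧
      NeumannHarmonic U' h

/-- The mass of `h²`, dilated by `t`, with respect to the weight `θ` in the upper half space. -/
def wMass (θ h : Space n → ℝ) (t : ℝ) : ℝ := ∫ x in upperHalf n, θ x * h (t • x) ^ 2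

theorem wMass_comp_smul_div (θ h : Space n → ℝ) (r N t : ℝ) :
    wMass θ (fun x => h (r • x) / N) t = wMass θ h (r * t) / N ^ 2 := by
  simp only [wMass, smul_smul, div_pow, ← mul_div_assoc, integral_div]

theorem memLp_comp_smul {f : Space n → ℝ} (hf : MemLp f 2) {r : ℝ} (hr : r ≠ 0) :
    MemLp (fun x => f (r • x)) 2 := by
  have hq : Measure.QuasiMeasurePreserving (fun x : Space n => r • x) :=
    ⟨measurable_const_smul r, by
      rw [Measure.map_addHaar_smul _ hr]
      exact Measure.smul_absolutelyContinuous⟩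
  have hm : AEStronglyMeasurable (fun x => f (r • x)) := hf.1.comp_quasiMeasurePreserving hq
  rw [memLp_two_iff_integrable_sq hm]
  exact hf.integrable_sq.comp_smul hr

section

variable {θ : Space n → ℝ} {M : ℝ} {U : Set (Space n)}

theorem integral_comp_smul_le {F : Space n → ℝ} (hF : IntegrableOn F (upperHalf n ∩ U))
    (hF0 : ∀ x, 0 ≤ F x) (hU : MeasurableSet U) (hM : 0 ≤ M) {t : ℝ} (ht : 0 < t) {g : Space n → ℝ}
    (hθU : ∀ x ∈ upperHalf n, t • x ∉ U → g x = 0)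
    (hg : ∀ x ∈ upperHalf n, t • x ∈ U → |g x| ≤ M * F (t • x)) :
    |∫ x in upperHalf n, g x| ≤ M * ((t ^ (n + 1))⁻¹ * ∫ x in upperHalf n ∩ U, F x) := by
  have hm : MeasurableSet (upperHalf n ∩ U) := measurableSet_upperHalf.inter hU
  have hFi : Integrable ((upperHalf n ∩ U).indicator F) := (integrable_indicator_iff hm).2 hF
  have h1 := Measure.integral_comp_smul volume ((upperHalf n ∩ U).indicator F) t
  rw [integral_indicator hm, finrank_euclideanSpace_fin, abs_of_pos (by positivity),
    smul_eq_mul] at h1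
  rw [← h1, ← integral_const_mul]
  have hcomp := (hFi.comp_smul ht.ne').const_mul M
  calc |∫ x in upperHalf n, g x| ≤
      ∫ x in upperHalf n, M * (upperHalf n ∩ U).indicator F (t • x) := by
        rw [← Real.norm_eq_abs]
        refine norm_integral_le_of_norm_le hcomp.integrableOn ?_
        refine (ae_restrict_iff' measurableSet_upperHalf).2 (Eventually.of_forall fun x hx => ?_)
        by_cases hxU : t • x ∈ U
        · rw [Set.indicator_of_mem (show t • x ∈ upperHalf n ∩ U from ⟨(smul_mem_upperHalf ht).2 hx, hxU⟩)]
          exact hg x hx hxU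
        · rw [Set.indicator_of_notMem fun h => hxU h.2, hθU x hx hxU]
          simp
    _ ≤ ∫ x, M * (upperHalf n ∩ U).indicator F (t • x) := by
        refine setIntegral_le_integral hcomp (Eventually.of_forall fun x => ?_)
        exact mul_nonneg hM (Set.indicator_nonneg (fun x _ => hF0 x) _)

theorem integrableOn_wMass (hθm : Measurable θ) (hθ : ∀ x, |θ x| ≤ M) (hU : MeasurableSet U)
    {t : ℝ} (ht : 0 < t) (hθU : ∀ x, t • x ∉ U → θ x = 0) {h : Space n → ℝ}
    (hh : MemLp h 2 (volume.restrict (upperHalf n ∩ U))) :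
    IntegrableOn (fun x => θ x * h (t • x) ^ 2) (upperHalf n) := by
  have h1 : Integrable ((upperHalf n ∩ U).indicator fun x => h x ^ 2) :=
    (integrable_indicator_iff (measurableSet_upperHalf.inter hU)).2 hh.integrable_sq
  have h2 := (h1.comp_smul ht.ne').bdd_mul (c := M) hθm.aestronglyMeasurable
    (Eventually.of_forall fun x => hθ x)
  refine (h2.integrableOn (s := upperHalf n)).congr_fun (fun x hx => ?_) measurableSet_upperHalf
  by_cases hxU : t • x ∈ U
  · simp only
    rw [Set.indicator_of_mem]
    exact ⟨(smul_mem_upperHalf ht).2 hx, hxU⟩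
  · simp [hθU x hxU]

/-- The dilation factors `t k` may vary with `k`; they are only bounded below by `δ`. The estimate
rests on `|a² - b²| ≤ (1 + 1/ε) (a - b)² + ε b²`. -/
theorem wMass_sub_tendsto (hθm : Measurable θ) (hθ : ∀ x, |θ x| ≤ M) (hU : MeasurableSet U)
    {t : ℕ → ℝ} {δ : ℝ} (hδ : 0 < δ) (ht : ∀ k, δ ≤ t k)
    (hθU : ∀ k x, t k • x ∉ U → θ x = 0) {g : ℕ → Space n → ℝ} {h : Space n → ℝ}
    (hg : ∀ k, MemLp (g k) 2 (volume.restrict (upperHalf n ∩ U)))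
    (hh : MemLp h 2 (volume.restrict (upperHalf n ∩ U)))
    (hlim : Tendsto (fun k => ∫ x in upperHalf n ∩ U, (g k x - h x) ^ 2) atTop (𝓝 0)) :
    Tendsto (fun k => wMass θ (g k) (t k) - wMass θ h (t k)) atTop (𝓝 0) := by
  have hM : 0 ≤ M := (abs_nonneg _).trans (hθ 0)
  set e : ℕ → ℝ := fun k => ∫ x in upperHalf n ∩ U, (g k x - h x) ^ 2
  have he : ∀ k, 0 ≤ e k := fun k => integral_nonneg fun x => sq_nonneg _
  set A := ∫ x in upperHalf n ∩ U, h x ^ 2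
  -- Positive, tending to zero and at least `√(e k)`, so that `e k / ε k ≤ √(e k)` tends to zero as
  -- well.
  set ε : ℕ → ℝ := fun k => Real.sqrt (e k) + 1 / (k + 1)
  have hε : ∀ k, 0 < ε k := fun k => by positivity
  have hs : Tendsto (fun k => Real.sqrt (e k)) atTop (𝓝 0) := by
    have := (Real.continuous_sqrt.tendsto 0).comp hlim
    rw [Real.sqrt_zero] at this
    exact this
  have hεl : Tendsto ε atTop (𝓝 0) := by
    have := hs.add tendsto_one_div_add_atTop_nhds_zero_nat
    rw [add_zero] at this
    exact this
  have hb : Tendsto (fun k => M * ((δ ^ (n + 1))⁻¹ * (e k + Real.sqrt (e k) + ε k * A))) atTop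
      (𝓝 0) := by
    simpa using (((hlim.add hs).add (hεl.mul_const A)).const_mul ((δ ^ (n + 1))⁻¹)).const_mul M
  refine squeeze_zero_norm (fun k => ?_) hb
  have htk : 0 < t k := hδ.trans_le (ht k)
  have hsub := (hg k).sub hh
  have i1 : IntegrableOn (fun x => (g k x - h x) ^ 2) (upperHalf n ∩ U) := hsub.integrable_sq
  have i2 : IntegrableOn (fun x => h x ^ 2) (upperHalf n ∩ U) := hh.integrable_sq
  have i3 : IntegrableOn (fun x => (1 + 1 / ε k) * (g k x - h x) ^ 2 + ε k * h x ^ 2)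
      (upperHalf n ∩ U) := (i1.const_mul _).add (i2.const_mul _)
  rw [wMass, wMass, ← integral_sub (integrableOn_wMass hθm hθ hU htk (hθU k) (hg k))
    (integrableOn_wMass hθm hθ hU htk (hθU k) hh), Real.norm_eq_abs]
  refine (integral_comp_smul_le (M := M)
    (F := fun x => (1 + 1 / ε k) * (g k x - h x) ^ 2 + ε k * h x ^ 2) i3
    (fun x => by have := hε k; positivity) hU hM htk (fun x _ hx => ?_) fun x _ _ => ?_).trans ?_
  · simp [hθU k x hx]
  · rw [← mul_sub, abs_mul]
    refine mul_le_mul (hθ x) ?_ (abs_nonneg _) hM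
    set a := g k (t k • x)
    set b := h (t k • x)
    have hε' := hε k
    have h1 : 2 * |b * (a - b)| ≤ ε k * b ^ 2 + 1 / ε k * (a - b) ^ 2 := by
      have h2 : 0 ≤ (ε k * |b| - |a - b|) ^ 2 / ε k := by positivity
      have h3 : (ε k * |b| - |a - b|) ^ 2 / ε k =
          ε k * b ^ 2 + 1 / ε k * (a - b) ^ 2 - 2 * |b * (a - b)| := by
        rw [abs_mul, ← sq_abs b, ← sq_abs (a - b)]
        field_simp
        ring
      linarith
    have h2 : a ^ 2 - b ^ 2 = (a - b) ^ 2 + 2 * (b * (a - b)) := by ring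
    rw [h2]
    refine (abs_add_le _ _).trans ?_
    rw [abs_of_nonneg (sq_nonneg _), abs_mul, abs_of_pos (by norm_num : (0 : ℝ) < 2)]
    linarith
  · rw [integral_add (i1.const_mul _) (i2.const_mul _), integral_const_mul, integral_const_mul]
    have hle : (1 + 1 / ε k) * e k ≤ e k + Real.sqrt (e k) := by
      have h1 : Real.sqrt (e k) ≤ ε k := by simp only [ε]; linarith [show (0 : ℝ) ≤ 1 / (k + 1) by positivity]
      have h2 : e k = Real.sqrt (e k) * Real.sqrt (e k) := (Real.mul_self_sqrt (he k)).symm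
      have h3 : 1 / ε k * e k ≤ Real.sqrt (e k) := by
        rw [one_div, inv_mul_le_iff₀ (hε k)]
        nlinarith [Real.sqrt_nonneg (e k)]
      linarith
    have hA : 0 ≤ A := integral_nonneg fun x => sq_nonneg _
    have hpow : (t k ^ (n + 1))⁻¹ ≤ (δ ^ (n + 1))⁻¹ := by
      gcongr
      exact ht k
    have hεA := mul_nonneg (hε k).le hA
    gcongr

end

theorem measurable_rho : Measurable (rho (n := n)) := contDiff_rho.continuous.measurable

theorem abs_rho_le (x : Space n) : |rho x| ≤ profile 0 := by
  rw [abs_of_nonneg (rho_nonneg x)]; exact rho_le x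

theorem rho_eq_zero_of_notMem {R t : ℝ} (ht : 0 < t) (htR : t ≤ R) {U : Set (Space n)}
    (hU : Metric.ball 0 R ⊆ U) {x : Space n} (hx : t • x ∉ U) : rho x = 0 := by
  refine rho_eq_zero ?_
  by_contra hlt
  refine hx (hU ?_)
  rw [mem_ball_zero_iff, norm_smul, Real.norm_eq_abs, abs_of_pos ht]
  nlinarith

theorem tendsto_halfMass {f : Space n → ℝ} (hf : MemLp f 2) {r N : ℕ → ℝ} (hr : ∀ k, 0 < r k)
    {U : Set (Space n)} (hU : MeasurableSet U) {R t : ℝ} (ht : 0 < t) (htR : t ≤ R)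
    (hRU : Metric.ball 0 R ⊆ U)
    {h : Space n → ℝ} (hh : MemLp h 2 (volume.restrict (upperHalf n ∩ U)))
    (hlim : Tendsto (fun k => ∫ x in upperHalf n ∩ U, (f (r k • x) / N k - h x) ^ 2)
      atTop (𝓝 0)) :
    Tendsto (fun k => halfMass f (r k * t) / N k ^ 2) atTop (𝓝 (halfMass h t)) := by
  have := wMass_sub_tendsto (t := fun _ => t) measurable_rho abs_rho_le hU ht (fun _ => le_rfl)
    (fun _ x hx => rho_eq_zero_of_notMem ht htR hRU hx)
    (g := fun k x => f (r k • x) / N k)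
    (fun k => (((memLp_comp_smul hf (hr k).ne').mul_const (N k)⁻¹).restrict _)) hh hlim
  simp only [wMass_comp_smul_div] at this
  have h2 := this.add_const (wMass rho h t)
  simpa [wMass, halfMass] using h2

theorem halfMass_pos {f : Space n → ℝ} (hf : MemLp f 2)
    (hne : ∀ r, 0 < r → ¬ ∀ᵐ x, x ∈ upperHalf n → x ∈ Metric.ball 0 r → f x = 0)
    {t : ℝ} (ht : 0 < t) : 0 < halfMass f t :=
  lt_of_le_of_ne (halfMass_nonneg f t) fun h =>
    hne t ht (ae_eq_zero_of_halfMass ht le_rfl (hf.restrict _) h.symm)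

/-- Points of the ball of radius 5, divided by 8, have norm at most `5/8`, where the weight `rho` is
at least `profile (25/64)`. The power of 8 is the Jacobian. -/
theorem setIntegral_ball_le_halfMass {f : Space n → ℝ} (hf : MemLp f 2) {r : ℝ} (hr : 0 < r) :
    ∫ x in upperHalf n ∩ Metric.ball 0 5, f (r • x) ^ 2 ≤
      8 ^ (n + 1) * (profile (25 / 64))⁻¹ * halfMass f (8 * r) := by
  have hp : 0 < profile (25 / 64) := profile_pos (by norm_num)
  have hm : MeasurableSet (upperHalf n ∩ Metric.ball (0 : Space n) 5) :=
    measurableSet_upperHalf.inter measurableSet_ball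
  set S := upperHalf n ∩ Metric.ball (0 : Space n) 5
  have h1 := Measure.integral_comp_smul volume (S.indicator fun x => f (r • x) ^ 2) 8
  rw [integral_indicator hm, finrank_euclideanSpace_fin, abs_of_pos (by positivity),
    smul_eq_mul] at h1
  have h2 : ∫ x in S, f (r • x) ^ 2 = 8 ^ (n + 1) *
      ∫ x : Space n, S.indicator (fun x => f (r • x) ^ 2) ((8 : ℝ) • x) := by
    rw [h1, mul_inv_cancel_left₀ (by positivity)]
  rw [h2, mul_assoc]
  gcongr
  rw [halfMass, ← integral_const_mul, ← integral_indicator measurableSet_upperHalf]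
  have hint := (integrable_rho_mul_sq (R := 8 * r) (by positivity : 0 < 8 * r) le_rfl
    (hf.restrict _)).const_mul (profile (25 / 64))⁻¹
  refine integral_mono_of_nonneg (Eventually.of_forall fun x => ?_)
    ((integrable_indicator_iff measurableSet_upperHalf).2 hint)
    (Eventually.of_forall fun x => ?_)
  · exact Set.indicator_nonneg (fun x _ => sq_nonneg _) _
  · by_cases hx : (8 : ℝ) • x ∈ S
    · have hxu : x ∈ upperHalf n := (smul_mem_upperHalf (by norm_num)).1 hx.1
      simp only [Set.indicator_of_mem hx, Set.indicator_of_mem hxu, smul_smul, mul_comm r 8]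
      have hx5 : ‖x‖ ≤ 5 / 8 := by
        have := mem_ball_zero_iff.1 hx.2
        rw [norm_smul, Real.norm_eq_abs, abs_of_pos (by norm_num)] at this
        linarith
      have h3 : profile (25 / 64) ≤ rho x := antitone_profile (by nlinarith [norm_nonneg x])
      rw [← mul_assoc]
      refine le_mul_of_one_le_left (sq_nonneg _) ?_
      rw [inv_mul_eq_div, one_le_div hp]
      exact h3
    · beta_reduce
      rw [Set.indicator_of_notMem hx]
      exact Set.indicator_nonneg (fun x _ => mul_nonneg (by positivity)
        (mul_nonneg (rho_nonneg x) (sq_nonneg _))) _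

/-- Normalising by the mass at `2r` makes the limit nonzero, and the mass at `8r` bounds the
blow-ups on the ball of radius 5. Convergence on the ball of radius `9/2` leaves room for the
dilation by 4 in the homogeneity argument. -/
theorem BlowupCompact.dyadic {f : Space n → ℝ} (hf : MemLp f 2) (hbc : BlowupCompact f)
    (hpos : ∀ t, 0 < t → 0 < halfMass f t) {r : ℕ → ℝ} (hr : ∀ k, 0 < r k)
    (hr0 : Tendsto r atTop (𝓝 0)) {C : ℝ}
    (hC : ∀ k, halfMass f (8 * r k) ≤ C * halfMass f (2 * r k)) :
    ∃ σ : ℕ → ℕ, StrictMono σ ∧ ∃ h : Space n → ℝ,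
      MemLp h 2 (volume.restrict (upperHalf n ∩ Metric.ball 0 (9 / 2))) ∧
      NeumannHarmonic (Metric.ball 0 (9 / 2)) h ∧
      Tendsto (fun k => ∫ x in upperHalf n ∩ Metric.ball 0 (9 / 2),
        (f (r (σ k) • x) / Real.sqrt (halfMass f (2 * r (σ k))) - h x) ^ 2) atTop (𝓝 0) ∧
      halfMass h 2 = 1 ∧
      ∀ t, 0 < t → t ≤ 9 / 2 → Tendsto (fun k => halfMass f (t * r (σ k)) /
        halfMass f (2 * r (σ k))) atTop (𝓝 (halfMass h t)) := by
  have hN : ∀ k, 0 < Real.sqrt (halfMass f (2 * r k)) := fun k =>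
    Real.sqrt_pos.2 (hpos _ (by have := hr k; positivity))
  have hN2 : ∀ k, Real.sqrt (halfMass f (2 * r k)) ^ 2 = halfMass f (2 * r k) := fun k =>
    Real.sq_sqrt (halfMass_nonneg _ _)
  obtain ⟨σ, hσ, h, hh, hlim, hharm⟩ := hbc r (fun k => Real.sqrt (halfMass f (2 * r k)))
    (Metric.ball 0 5) (Metric.ball 0 (9 / 2)) (8 ^ (n + 1) * (profile (25 / 64))⁻¹ * C) hr hr0 hN
    Metric.isOpen_ball Metric.isBounded_ball Metric.isOpen_ball
    (Metric.closure_ball_subset_closedBall.trans (Metric.closedBall_subset_ball (by norm_num)))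
    (fun k => by
      rw [hN2, mul_assoc _ C]
      refine (setIntegral_ball_le_halfMass hf (hr k)).trans ?_
      have hp : 0 < profile (25 / 64) := profile_pos (by norm_num)
      gcongr
      exact hC k)
  have hconv : ∀ t, 0 < t → t ≤ 9 / 2 → Tendsto (fun k => halfMass f (t * r (σ k)) /
        halfMass f (2 * r (σ k))) atTop (𝓝 (halfMass h t)) := by
    intro t ht ht2
    have := tendsto_halfMass hf (fun k => hr (σ k)) measurableSet_ball ht ht2 subset_rfl hh hlim
    simpa only [hN2, mul_comm _ t] using this
  refine ⟨σ, hσ, h, hh, hharm, hlim, ?_, hconv⟩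
  refine tendsto_nhds_unique (hconv 2 (by norm_num) (by norm_num)) ?_
  refine tendsto_const_nhds.congr fun k => (div_self (hpos _ ?_).ne').symm
  have := hr (σ k)
  positivity

/-- If this failed at scales tending to zero, the blow-up limit would satisfy both doubling
inequalities of `NeumannHarmonic.homogeneous`, and `c` would be a power of 4. The bound by `c₁` at
the outermost scale only serves compactness. -/
theorem halfMass_barrier {f : Space n → ℝ} (hf : MemLp f 2) (hbc : BlowupCompact f)
    (hpos : ∀ t, 0 < t → 0 < halfMass f t) {c₁ c : ℝ} (hc₁ : 0 ≤ c₁) (hc : 0 < c)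
    (hcm : ∀ m : ℕ, c ≠ 4 ^ m) :
    ∃ r₀ > 0, ∀ r, 0 < r → r < r₀ → halfMass f (8 * r) ≤ c₁ * halfMass f (4 * r) →
      halfMass f (4 * r) ≤ c * halfMass f (2 * r) → halfMass f (2 * r) ≤ c * halfMass f (1 * r) := by
  by_contra hcon
  push Not at hcon
  choose r hr hrk h8 h4 h2 using fun k : ℕ => hcon (1 / ((k : ℝ) + 1)) (by positivity)
  have hr0 : Tendsto r atTop (𝓝 0) :=
    squeeze_zero (fun k => (hr k).le) (fun k => (hrk k).le) tendsto_one_div_add_atTop_nhds_zero_nat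
  obtain ⟨σ, hσ, h, hh, hharm, -, hone, hconv⟩ := hbc.dyadic hf hpos hr hr0 (C := c₁ * c)
    (fun k => (h8 k).trans (by rw [mul_assoc]; gcongr; exact h4 k))
  have hp : ∀ k, 0 < halfMass f (2 * r (σ k)) := fun k => hpos _ (by have := hr (σ k); positivity)
  have hfin : IsFiniteMeasure (volume.restrict (upperHalf n ∩ Metric.ball (0 : Space n) (9 / 2))) :=
    ⟨by
      rw [Measure.restrict_apply_univ]
      exact (measure_mono Set.inter_subset_right).trans_lt measure_ball_lt_top⟩
  obtain ⟨m, -, hm, -⟩ := hharm.homogeneous (by norm_num) (hh.integrable (by norm_num)) hc.le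
    (by
      rw [hone, mul_one]
      refine le_of_tendsto' (hconv 4 (by norm_num) (by norm_num)) fun k => ?_
      rw [div_le_iff₀ (hp k)]
      exact h4 _)
    (by
      rw [hone]
      refine le_of_tendsto' ((hconv 1 (by norm_num) (by norm_num)).const_mul c) fun k => ?_
      rw [← mul_div_assoc, div_le_one (hp k)]
      exact (h2 _).le)
    (by rw [hone]; norm_num)
  exact hcm m hm

/-! ### Ellipsoids and the dichotomy for doubling quotients -/

/-- The ellipsoid `{|B x| < r}`. -/
def ellip (B : Space n ≃L[ℝ] Space n) (r : ℝ) : Set (Space n) := {x | ‖B x‖ < r}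

section

variable (B : Space n ≃L[ℝ] Space n)

theorem isOpen_ellip (r : ℝ) : IsOpen (ellip B r) :=
  isOpen_lt B.continuous.norm continuous_const

theorem convex_ellip (r : ℝ) : Convex ℝ (ellip B r) := by
  have h : ellip B r = B.toLinearEquiv.toLinearMap ⁻¹' Metric.ball 0 r := by
    ext x; simp [ellip]
  rw [h]
  exact (convex_ball (0 : Space n) r).linear_preimage B.toLinearEquiv.toLinearMap

theorem norm_le_of_mem_ellip {r : ℝ} {x : Space n} (hx : x ∈ ellip B r) :
    ‖x‖ ≤ ‖(B.symm : Space n →L[ℝ] Space n)‖ * r := by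
  have h := (B.symm : Space n →L[ℝ] Space n).le_opNorm (B x)
  have hx' : ‖B x‖ < r := hx
  simp only [ContinuousLinearEquiv.coe_coe, ContinuousLinearEquiv.symm_apply_apply] at h
  exact h.trans (by gcongr)

theorem isBounded_ellip (r : ℝ) : Bornology.IsBounded (ellip B r) :=
  (Metric.isBounded_closedBall (x := (0 : Space n))
    (r := ‖(B.symm : Space n →L[ℝ] Space n)‖ * r)).subset fun x hx => by
      simpa using norm_le_of_mem_ellip B hx

theorem closure_ellip_subset {r s : ℝ} (hrs : r < s) : closure (ellip B r) ⊆ ellip B s := by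
  have h : closure (ellip B r) ⊆ {x | ‖B x‖ ≤ r} :=
    closure_minimal (fun x (hx : ‖B x‖ < r) => hx.le)
      (isClosed_le B.continuous.norm continuous_const)
  exact h.trans fun x (hx : ‖B x‖ ≤ r) => hx.trans_lt hrs

theorem exists_ball_subset_ellip {r : ℝ} (hr : 0 < r) :
    ∃ R > 0, Metric.ball 0 R ⊆ ellip B r :=
  Metric.isOpen_iff.1 (isOpen_ellip B r) 0 (by simpa [ellip] using hr)

theorem smul_mem_ellip {t r : ℝ} (ht : 0 < t) {x : Space n} :
    t • x ∈ ellip B (t * r) ↔ x ∈ ellip B r := by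
  simp [ellip, norm_smul, abs_of_pos ht, ht]

/-- The mass of `h²` over the part of the ellipsoid above the hyperplane, dilated by `t`. -/
def ellipMass (h : Space n → ℝ) (t : ℝ) : ℝ := wMass ((ellip B 1).indicator 1) h t

theorem measurable_ellip_indicator : Measurable ((ellip B 1).indicator (1 : Space n → ℝ)) :=
  measurable_one.indicator (isOpen_ellip B 1).measurableSet

theorem abs_ellip_indicator_le (x : Space n) : |(ellip B 1).indicator (1 : Space n → ℝ) x| ≤ 1 := by
  by_cases hx : x ∈ ellip B 1 <;> simp [hx]

theorem setIntegral_ellip_eq (f : Space n → ℝ) {s : ℝ} (hs : 0 < s) (r : ℝ) :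
    ∫ x in upperHalf n ∩ ellip B s, f (r • x) ^ 2 = s ^ (n + 1) * ellipMass B f (s * r) := by
  have hm : MeasurableSet (upperHalf n ∩ ellip B s) :=
    measurableSet_upperHalf.inter (isOpen_ellip B s).measurableSet
  have h1 := Measure.integral_comp_smul volume
    ((upperHalf n ∩ ellip B s).indicator fun x => f (r • x) ^ 2) s
  rw [integral_indicator hm, finrank_euclideanSpace_fin, abs_of_pos (by positivity),
    smul_eq_mul] at h1
  have h2 : ellipMass B f (s * r) =
      ∫ x, (upperHalf n ∩ ellip B s).indicator (fun x => f (r • x) ^ 2) (s • x) := by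
    rw [ellipMass, wMass, ← integral_indicator measurableSet_upperHalf]
    congr 1
    funext x
    by_cases hu : x ∈ upperHalf n
    · by_cases he : x ∈ ellip B 1
      · have hx : s • x ∈ upperHalf n ∩ ellip B s :=
          ⟨(smul_mem_upperHalf hs).2 hu, by simpa using (smul_mem_ellip B (r := 1) hs).2 he⟩
        rw [Set.indicator_of_mem hu, Set.indicator_of_mem hx, Set.indicator_of_mem he, smul_smul,
          mul_comm s r]
        simp
      · have hx : s • x ∉ upperHalf n ∩ ellip B s := fun h =>
          he ((smul_mem_ellip B (r := 1) hs).1 (by simpa using h.2))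
        rw [Set.indicator_of_mem hu, Set.indicator_of_notMem hx, Set.indicator_of_notMem he]
        simp
    · have hx : s • x ∉ upperHalf n ∩ ellip B s := fun h => hu ((smul_mem_upperHalf hs).1 h.1)
      rw [Set.indicator_of_notMem hu, Set.indicator_of_notMem hx]
  rw [h2, h1, mul_inv_cancel_left₀ (by positivity)]

theorem ellipMass_nonneg (h : Space n → ℝ) (t : ℝ) : 0 ≤ ellipMass B h t :=
  integral_nonneg fun _ => mul_nonneg (Set.indicator_nonneg (fun _ _ => zero_le_one) _) (sq_nonneg _)

theorem halfMass_eq_zero_of_ellipMass {h : Space n → ℝ} {U : Set (Space n)} (hU : MeasurableSet U)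
    (hh : MemLp h 2 (volume.restrict (upperHalf n ∩ U))) {t : ℝ} (ht : 0 < t)
    (htU : ∀ x, t • x ∉ U → (ellip B 1).indicator (1 : Space n → ℝ) x = 0)
    {R : ℝ} (hR : 0 < R) (hRB : Metric.ball 0 R ⊆ ellip B 1) (h0 : ellipMass B h t = 0) :
    halfMass h (t * R) = 0 := by
  have h1 := (setIntegral_eq_zero_iff_of_nonneg_ae
    (Eventually.of_forall fun x => mul_nonneg (Set.indicator_nonneg (fun _ _ => zero_le_one) _)
      (sq_nonneg _))
    (integrableOn_wMass (measurable_ellip_indicator B) (abs_ellip_indicator_le B) hU ht htU hh)).1 h0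
  have h2 := ae_smul ((ae_restrict_iff' measurableSet_upperHalf).1 h1) hR.ne'
  refine setIntegral_eq_zero_of_ae_eq_zero ?_
  filter_upwards [h2] with x hx hxu
  rcases lt_or_ge ‖x‖ 1 with h3 | h3
  · have h4 := hx ((smul_mem_upperHalf hR).2 hxu)
    rw [Set.indicator_of_mem (hRB (by
      rw [mem_ball_zero_iff, norm_smul, Real.norm_eq_abs, abs_of_pos hR]; nlinarith)), smul_smul] at h4
    have h5 : h ((t * R) • x) ^ 2 = 0 := by simpa using h4
    rw [h5, mul_zero]
  · rw [rho_eq_zero h3, zero_mul]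

theorem ellipMass_pos {f : Space n → ℝ} (hf : MemLp f 2)
    (hpos : ∀ t, 0 < t → 0 < halfMass f t) {t : ℝ} (ht : 0 < t) : 0 < ellipMass B f t := by
  refine lt_of_le_of_ne (ellipMass_nonneg B f t) fun h => ?_
  obtain ⟨R, hR, hRB⟩ := exists_ball_subset_ellip B one_pos
  have := halfMass_eq_zero_of_ellipMass B (U := Set.univ) MeasurableSet.univ (hf.restrict _) ht
    (fun x hx => absurd trivial hx) hR hRB h.symm
  exact (hpos _ (by positivity)).ne' this

end

theorem exists_not_pow_gt (a : ℝ) : ∃ c : ℝ, a < c ∧ 0 < c ∧ ∀ m : ℕ, c ≠ 4 ^ m := by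
  have hd : Dense {c : ℝ | ∀ m : ℕ, c ≠ 4 ^ m} := by
    have h := Set.Countable.dense_compl ℝ (Set.countable_range fun m : ℕ => (4 : ℝ) ^ m)
    convert h using 1
    ext c
    simp [eq_comm]
  obtain ⟨c, hc, hac⟩ := hd.exists_gt (max a 0)
  exact ⟨c, (le_max_left _ _).trans_lt hac, (le_max_right _ _).trans_lt hac, hc⟩

/-- Once the sequence is below a level that is not a power of 4, it eventually stays there, so it
cannot pass infinitely often from below one such level to above another. These levels are dense
because their complement is countable. -/
theorem exists_tendsto_of_barriers {q : ℕ → ℝ} {C : ℝ} (hq0 : ∀ j, 0 ≤ q j) (hqC : ∀ j, q j ≤ C)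
    (hb : ∀ c : ℝ, 0 < c → (∀ m : ℕ, c ≠ 4 ^ m) → ∀ᶠ j in atTop, q j ≤ c → q (j + 1) ≤ c) :
    ∃ l, Tendsto q atTop (𝓝 l) := by
  have hd : Dense {c : ℝ | ∀ m : ℕ, c ≠ 4 ^ m} := by
    have h := Set.Countable.dense_compl ℝ (Set.countable_range fun m : ℕ => (4 : ℝ) ^ m)
    convert h using 1
    ext c
    simp [eq_comm]
  refine tendsto_of_no_upcrossings hd ?_ ?_ ?_
  · intro a ha b hb' hab ⟨h1, h2⟩
    have ha0 : 0 < a := by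
      obtain ⟨j, hj⟩ := h1.exists
      exact (hq0 j).trans_lt hj
    obtain ⟨J, hJ⟩ := eventually_atTop.1 (hb a ha0 ha)
    obtain ⟨j, hj, hja⟩ := (frequently_atTop.1 h1) J
    have hall : ∀ i, q (j + i) ≤ a := by
      intro i
      induction i with
      | zero => exact hja.le
      | succ i ih => exact hJ (j + i) (by omega) ih
    obtain ⟨i, hi, hib⟩ := (frequently_atTop.1 h2) j
    have := hall (i - j)
    rw [Nat.add_sub_cancel' hi] at this
    linarith
  · exact isBoundedUnder_of ⟨C, hqC⟩
  · exact isBoundedUnder_of ⟨0, hq0⟩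

/-- If the quotient does not tend to infinity, it is below some `b` along scales tending to zero.
The blow-up limit there is nonzero with finite doubling quotients, and any `c` above two of them
that is not a power of 4 is a barrier. `halfMass_barrier` then carries the bound down to all smaller
dyadic scales. -/
theorem exists_dyadic_doubling {f : Space n → ℝ} (hf : MemLp f 2) (hbc : BlowupCompact f)
    (hpos : ∀ t, 0 < t → 0 < halfMass f t) (B : Space n ≃L[ℝ] Space n)
    (hnot : ¬ Tendsto (fun r => ellipMass B f (2 * r) / ellipMass B f r) (𝓝[>] 0) atTop) :
    ∃ s > 0, ∃ c, 0 < c ∧ ∀ j : ℕ, halfMass f (2 * (s / 2 ^ j)) ≤ c * halfMass f (s / 2 ^ j) := by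
  have hJpos : ∀ t, 0 < t → 0 < ellipMass B f t := fun t ht => ellipMass_pos B hf hpos ht
  rw [tendsto_atTop] at hnot
  push Not at hnot
  obtain ⟨b, hb⟩ := hnot
  have hfreq : ∃ᶠ r in 𝓝[>] (0 : ℝ), ellipMass B f (2 * r) / ellipMass B f r < b ∧ 0 < r := by
    refine (hb.and_eventually self_mem_nhdsWithin).mono fun r hr => ⟨?_, hr.2⟩
    simpa using hr.1
  obtain ⟨r, hr, hrb⟩ := exists_seq_forall_of_frequently hfreq
  have hr0 : Tendsto r atTop (𝓝 0) := hr.mono_right nhdsWithin_le_nhds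
  have hN : ∀ k, Real.sqrt (ellipMass B f (r k)) ^ 2 = ellipMass B f (r k) := fun k =>
    Real.sq_sqrt (ellipMass_nonneg B _ _)
  obtain ⟨σ, hσ, h, hh, hlim, hharm⟩ := hbc r (fun k => Real.sqrt (ellipMass B f (r k)))
    (ellip B 2) (ellip B (3 / 2)) (2 ^ (n + 1) * b) (fun k => (hrb k).2) hr0
    (fun k => Real.sqrt_pos.2 (hJpos _ (hrb k).2)) (isOpen_ellip B 2) (isBounded_ellip B 2)
    (isOpen_ellip B _) (closure_ellip_subset B (by norm_num)) (fun k => by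
      rw [hN, setIntegral_ellip_eq B f two_pos, mul_assoc]
      gcongr
      exact ((div_lt_iff₀ (hJpos _ (hrb k).2)).1 (hrb k).1).le)
  have hUm : MeasurableSet (ellip B (3 / 2)) := (isOpen_ellip B _).measurableSet
  have hsub1 : ∀ x, (1 : ℝ) • x ∉ ellip B (3 / 2) →
      (ellip B 1).indicator (1 : Space n → ℝ) x = 0 := fun x hx => by
    refine Set.indicator_of_notMem (fun h => hx ?_) _
    have h' : ‖B x‖ < 1 := h
    rw [one_smul]
    change ‖B x‖ < 3 / 2
    linarith
  -- The normalisation passes to the limit, so `h` is not zero.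
  have hJh : ellipMass B h 1 = 1 := by
    have h1 := wMass_sub_tendsto (t := fun _ => 1) (measurable_ellip_indicator B)
      (abs_ellip_indicator_le B) hUm one_pos (fun _ => le_rfl) (fun _ x hx => hsub1 x hx)
      (g := fun k x => f (r (σ k) • x) / Real.sqrt (ellipMass B f (r (σ k))))
      (fun k => (((memLp_comp_smul hf (hrb (σ k)).2.ne').mul_const _).restrict _)) hh hlim
    have h2 : ∀ k, wMass ((ellip B 1).indicator 1)
        (fun x => f (r (σ k) • x) / Real.sqrt (ellipMass B f (r (σ k)))) 1 = 1 := fun k => by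
      rw [wMass_comp_smul_div, mul_one, hN]
      exact div_self (hJpos _ (hrb _).2).ne'
    simp only [h2] at h1
    have h3 := tendsto_nhds_unique tendsto_const_nhds h1
    rw [ellipMass]
    linarith
  obtain ⟨R, hR, hRB⟩ := exists_ball_subset_ellip B (r := 3 / 2) (by norm_num)
  -- By unique continuation a nonzero `h` has positive mass at every small radius, so its doubling
  -- quotients are defined.
  have hhpos : ∀ t, 0 < t → t ≤ R → 0 < halfMass h t := by
    intro t ht htR
    refine lt_of_le_of_ne (halfMass_nonneg h t) fun h0 => ?_
    have hz := hharm.eq_zero_of_halfMass (isOpen_ellip B _) (convex_ellip B _)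
      (isBounded_ellip B _).measure_lt_top.ne hh hRB ht htR h0.symm
    have : ellipMass B h 1 = 0 := by
      refine setIntegral_eq_zero_of_ae_eq_zero ?_
      filter_upwards [hz] with x hx hxu
      by_cases hxe : x ∈ ellip B (3 / 2)
      · rw [one_smul, hx ⟨hxu, hxe⟩]; simp
      · rw [hsub1 x (by simpa using hxe), zero_mul]
    rw [hJh] at this
    exact one_ne_zero this
  have hconv : ∀ t, 0 < t → t ≤ R → Tendsto (fun k => halfMass f (r (σ k) * t) /
      ellipMass B f (r (σ k))) atTop (𝓝 (halfMass h t)) := by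
    intro t ht htR
    have := tendsto_halfMass hf (fun k => (hrb (σ k)).2) hUm ht htR hRB hh hlim
    simpa only [hN] using this
  have hratio : ∀ t, 0 < t → 2 * t ≤ R → Tendsto (fun k => halfMass f (r (σ k) * (2 * t)) /
      halfMass f (r (σ k) * t)) atTop (𝓝 (halfMass h (2 * t) / halfMass h t)) := by
    intro t ht htR
    refine ((hconv (2 * t) (by positivity) htR).div (hconv t ht (by linarith))
      (hhpos t ht (by linarith)).ne').congr fun k => ?_
    exact div_div_div_cancel_right₀ (hJpos _ (hrb _).2).ne' _ _
  -- The quotients at `t` and `2t` involve radii up to `4t = R`, the largest at which convergence is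
  -- known.
  set t := R / 4
  have ht : 0 < t := by positivity
  obtain ⟨c, hc, hc0, hcm⟩ := exists_not_pow_gt
    (max (halfMass h (2 * t) / halfMass h t) (halfMass h (2 * (2 * t)) / halfMass h (2 * t)))
  have e1 := (hratio t ht (by simp only [t]; linarith)).eventually_le_const
    ((le_max_left _ _).trans_lt hc)
  have e2 := (hratio (2 * t) (by positivity) (by simp only [t]; linarith)).eventually_le_const
    ((le_max_right _ _).trans_lt hc)
  obtain ⟨r₀, hr₀, hbar⟩ := halfMass_barrier hf hbc hpos hc0.le hc0 hcm
  have e3 : ∀ᶠ k in atTop, r (σ k) * t < r₀ := by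
    have : Tendsto (fun k => r (σ k) * t) atTop (𝓝 0) := by
      simpa using (hr0.comp hσ.tendsto_atTop).mul_const t
    exact this.eventually_lt_const hr₀
  obtain ⟨k, h1, h2, h3⟩ := (e1.and (e2.and e3)).exists
  set s := r (σ k) * t
  have hs : 0 < s := mul_pos (hrb _).2 ht
  rw [div_le_iff₀ (hpos _ hs), show r (σ k) * (2 * t) = 2 * s by simp only [s]; ring] at h1
  rw [show r (σ k) * (2 * (2 * t)) = 4 * s by simp only [s]; ring,
    show r (σ k) * (2 * t) = 2 * s by simp only [s]; ring, div_le_iff₀ (hpos _ (by positivity))] at h2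
  -- Two consecutive quotients are carried along, because the barrier uses the outer one for
  -- compactness and the inner one for propagation.
  have hind : ∀ j : ℕ, halfMass f (4 * (s / 2 ^ j)) ≤ c * halfMass f (2 * (s / 2 ^ j)) ∧
      halfMass f (2 * (s / 2 ^ j)) ≤ c * halfMass f (s / 2 ^ j) := by
    intro j
    induction j with
    | zero => simpa using ⟨h2, h1⟩
    | succ j ih =>
      have a1 : s / 2 ^ j = 2 * (s / 2 ^ (j + 1)) := by rw [pow_succ]; field_simp
      have a2 : 2 * (s / 2 ^ j) = 4 * (s / 2 ^ (j + 1)) := by rw [a1]; ring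
      have a3 : 4 * (s / 2 ^ j) = 8 * (s / 2 ^ (j + 1)) := by rw [a1]; ring
      rw [a2, a3, a1] at ih
      refine ⟨ih.2, ?_⟩
      have := hbar (s / 2 ^ (j + 1)) (by positivity) (lt_of_le_of_lt
        (div_le_self hs.le (one_le_pow₀ (by norm_num))) h3) ih.1 ih.2
      rwa [one_mul] at this
  exact ⟨s, hs, c, hc0, fun j => (hind j).2⟩

/-- The quantities `A k` need not converge; a positive lower bound suffices. This is needed because
the radii sit at varying positions between dyadic scales. -/
theorem tendsto_ratio_of_close {A a b : ℕ → ℝ} {β l : ℝ} (hβ : 0 < β) (hA : ∀ k, β ≤ A k)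
    (ha : Tendsto (fun k => a k - A k) atTop (𝓝 0))
    (hb : Tendsto (fun k => b k - l * A k) atTop (𝓝 0)) :
    Tendsto (fun k => b k / a k) atTop (𝓝 l) := by
  have h1 : Tendsto (fun k => |(b k - l * A k) - l * (a k - A k)| * (2 / β)) atTop (𝓝 0) := by
    simpa using (hb.sub (ha.const_mul l)).abs.mul_const (2 / β)
  rw [tendsto_iff_norm_sub_tendsto_zero]
  refine squeeze_zero' (Eventually.of_forall fun _ => norm_nonneg _) ?_ h1
  have hev : ∀ᶠ k in atTop, -(β / 2) < a k - A k := ha.eventually_const_lt (by linarith)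
  filter_upwards [hev] with k hk
  have hak : β / 2 ≤ a k := by linarith [hA k]
  have hak0 : 0 < a k := by linarith
  have : b k / a k - l = ((b k - l * A k) - l * (a k - A k)) / a k := by
    field_simp
    ring
  rw [this, Real.norm_eq_abs, abs_div, abs_of_pos hak0, div_eq_mul_inv]
  gcongr
  rw [show 2 / β = (β / 2)⁻¹ by simp]
  gcongr

theorem exists_dyadic_near {ρ : ℝ} {x : ℕ → ℝ} (hρ : 0 < ρ) (hx : ∀ k, 0 < x k)
    (hx0 : Tendsto x atTop (𝓝 0)) (hx1 : ∀ k, x k ≤ ρ) :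
    ∃ j : ℕ → ℕ, Tendsto j atTop atTop ∧
      ∀ k, ρ / 2 < x k * 2 ^ j k ∧ x k * 2 ^ j k ≤ ρ := by
  choose j hj1 hj2 using fun k => exists_nat_pow_near (x := ρ / x k) (y := 2)
    ((one_le_div (hx k)).2 (hx1 k)) (by norm_num)
  refine ⟨j, ?_, fun k => ⟨?_, ?_⟩⟩
  · refine tendsto_atTop.2 fun J => ?_
    have hpos : 0 < ρ / 2 ^ J := by positivity
    filter_upwards [hx0.eventually_lt_const hpos] with k hk
    have h1 : (2 : ℝ) ^ J < ρ / x k := by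
      rw [lt_div_iff₀ (hx k)]
      rw [lt_div_iff₀ (by positivity)] at hk
      linarith
    have := (pow_lt_pow_iff_right₀ (by norm_num : (1 : ℝ) < 2)).1 (h1.trans (hj2 k))
    omega
  · have := hj2 k
    rw [div_lt_iff₀ (hx k), pow_succ] at this
    linarith
  · have := hj1 k
    rw [le_div_iff₀ (hx k)] at this
    linarith

/-- Bounded dyadic quotients and the barriers give convergence of the quotients `q` to some `l`;
blow-ups along dyadic scales then have exact quotients `l` and are homogeneous. An arbitrary radius
differs from a dyadic one by a factor in a compact interval, and a homogeneous limit has quotient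
`l` over the ellipsoid for every such factor. -/
theorem ellipMass_ratio_dichotomy {f : Space n → ℝ} (hf : MemLp f 2) (hbc : BlowupCompact f)
    (hne : ∀ r, 0 < r → ¬ ∀ᵐ x, x ∈ upperHalf n → x ∈ Metric.ball 0 r → f x = 0)
    (B : Space n ≃L[ℝ] Space n) :
    Tendsto (fun r => ellipMass B f (2 * r) / ellipMass B f r) (𝓝[>] 0) atTop ∨
      ∃ m : ℕ, Tendsto (fun r => ellipMass B f (2 * r) / ellipMass B f r) (𝓝[>] 0)
        (𝓝 (4 ^ m)) := by
  have hpos : ∀ t, 0 < t → 0 < halfMass f t := fun t ht => halfMass_pos hf hne ht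
  refine or_iff_not_imp_left.2 fun hnot => ?_
  obtain ⟨s, hs, c, hc, hdoub⟩ := exists_dyadic_doubling hf hbc hpos B hnot
  set q : ℕ → ℝ := fun j => halfMass f (2 * (s / 2 ^ j)) / halfMass f (s / 2 ^ j) with hq
  have hsj : ∀ j : ℕ, 0 < s / 2 ^ j := fun j => by positivity
  have hqC : ∀ j, q j ≤ c := fun j => (div_le_iff₀ (hpos _ (hsj j))).2 (hdoub j)
  have hq0 : ∀ j, 0 ≤ q j := fun j => div_nonneg (halfMass_nonneg _ _) (halfMass_nonneg _ _)
  have hstep : ∀ j : ℕ, s / 2 ^ j = 2 * (s / 2 ^ (j + 1)) := fun j => by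
    rw [pow_succ]; field_simp
  -- A blow-up at scale `s / 2^(i+2)` sees the masses at 8, 4, 2 and 1 times this scale. The shift
  -- by 2 makes the largest radius `2 * (s / 2^i)`, which `hdoub` controls.
  have e8 : ∀ i : ℕ, 8 * (s / 2 ^ (i + 2)) = 2 * (s / 2 ^ i) := fun i => by
    rw [hstep i, hstep (i + 1)]; ring
  have e4 : ∀ i : ℕ, 4 * (s / 2 ^ (i + 2)) = 2 * (s / 2 ^ (i + 1)) := fun i => by
    rw [hstep (i + 1)]; ring
  have e2 : ∀ i : ℕ, 2 * (s / 2 ^ (i + 2)) = s / 2 ^ (i + 1) := fun i => (hstep (i + 1)).symm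
  have hsj0 : Tendsto (fun j : ℕ => s / 2 ^ j) atTop (𝓝 0) := by
    have := (tendsto_pow_atTop_nhds_zero_of_lt_one (r := (1 / 2 : ℝ)) (by norm_num)
      (by norm_num)).const_mul s
    simpa [div_eq_mul_inv] using this
  obtain ⟨l, hl⟩ : ∃ l, Tendsto q atTop (𝓝 l) := by
    refine exists_tendsto_of_barriers hq0 hqC fun c' hc' hcm => ?_
    obtain ⟨r₀, hr₀, hbar⟩ := halfMass_barrier hf hbc hpos hc.le hc' hcm
    filter_upwards [eventually_ge_atTop 1, hsj0.eventually_lt_const hr₀] with j hj1 hj2 hqj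
    -- The barrier needs a bound for the preceding quotient, so the index cannot be 0.
    obtain ⟨i, rfl⟩ : ∃ i, j = i + 1 := ⟨j - 1, by omega⟩
    rw [hq, div_le_iff₀ (hpos _ (hsj _))] at hqj ⊢
    have := hbar (s / 2 ^ (i + 2)) (hsj _) (by
      rw [hstep (i + 1)] at hj2
      linarith [hsj (i + 1 + 1)])
      (by
        rw [e8, e4, ← hstep i]
        exact hdoub i)
      (by
        rw [e4, e2]
        exact hqj)
    rwa [one_mul] at this
  have hl0 : 0 ≤ l := ge_of_tendsto' hl hq0
  have hblow : ∀ j : ℕ → ℕ, Tendsto j atTop atTop → ∃ σ : ℕ → ℕ, StrictMono σ ∧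
      ∃ (h W : Space n → ℝ) (m : ℕ), l = 4 ^ m ∧
        MemLp h 2 (volume.restrict (upperHalf n ∩ Metric.ball 0 (9 / 2))) ∧
        NeumannHarmonic (Metric.ball 0 (9 / 2)) h ∧
        Tendsto (fun k => ∫ x in upperHalf n ∩ Metric.ball 0 (9 / 2),
          (f ((s / 2 ^ (j (σ k) + 2)) • x) /
            Real.sqrt (halfMass f (2 * (s / 2 ^ (j (σ k) + 2)))) - h x) ^ 2) atTop (𝓝 0) ∧
        halfMass h 2 = 1 ∧ (∀ᵐ x, x ∈ upperHalf n → x ∈ Metric.ball 0 1 → W x = h x) ∧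
        ∀ x : Space n, ‖x‖ < 1 → ∀ t ∈ Set.Icc (0 : ℝ) 1, W (t • x) = t ^ m * W x := by
    intro j hj
    obtain ⟨σ, hσ, h, hh, hharm, hlim, hone, hconv⟩ := hbc.dyadic hf hpos
      (r := fun k => s / 2 ^ (j k + 2)) (fun k => hsj _)
      (hsj0.comp ((tendsto_add_atTop_nat 2).comp hj)) (C := c * c) (fun k => by
        rw [e8, e2]
        refine (hdoub (j k)).trans ?_
        rw [hstep (j k), mul_assoc]
        gcongr
        exact hdoub (j k + 1))
    have hjσ := hj.comp hσ.tendsto_atTop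
    have h4 : halfMass h 4 = l := by
      refine tendsto_nhds_unique (hconv 4 (by norm_num) (by norm_num)) ?_
      refine (hl.comp ((tendsto_add_atTop_nat 1).comp hjσ)).congr fun k => ?_
      simp only [hq, Function.comp, e4, e2]
    have h1 : l * halfMass h 1 = 1 := by
      have t1 := (hl.comp ((tendsto_add_atTop_nat 2).comp hjσ)).mul
        (hconv 1 (by norm_num) (by norm_num))
      refine tendsto_nhds_unique t1 (tendsto_const_nhds.congr fun k => ?_)
      simp only [hq, Function.comp, one_mul]
      have p1 := hpos _ (hsj (j (σ k) + 2))
      have p2 := hpos (2 * (s / 2 ^ (j (σ k) + 2))) (by have := hsj (j (σ k) + 2); positivity)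
      rw [eq_comm, div_mul_div_comm]
      exact (div_eq_one_iff_eq (mul_pos p1 p2).ne').2 (mul_comm _ _)
    have hfin : IsFiniteMeasure
        (volume.restrict (upperHalf n ∩ Metric.ball (0 : Space n) (9 / 2))) :=
      ⟨by
        rw [Measure.restrict_apply_univ]
        exact (measure_mono Set.inter_subset_right).trans_lt measure_ball_lt_top⟩
    obtain ⟨m, W, hm, -, hWh, hhom⟩ := hharm.homogeneous (by norm_num)
      (hh.integrable (by norm_num)) hl0 (by rw [h4, hone, mul_one]) (by rw [h1, hone])
      (by rw [hone]; norm_num)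
    exact ⟨σ, hσ, h, W, m, hm, hh, hharm, hlim, hone, hWh, hhom⟩
  obtain ⟨-, -, -, -, m₀, hm₀, -⟩ := hblow id tendsto_id
  refine ⟨m₀, ?_⟩
  rw [← hm₀]
  set M := ‖(B.symm : Space n →L[ℝ] Space n)‖
  have hM : 0 ≤ M := norm_nonneg _
  -- The unit ellipsoid lies in the closed ball of radius `M`; dilated by at most `4 * δ` it stays
  -- in the unit ball, where the limit is homogeneous.
  set δ : ℝ := 1 / (4 * (M + 1)) with hδd
  have hδ : 0 < δ := by positivity
  have hδM : 4 * δ * M < 1 := by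
    rw [hδd]
    have : 4 * (1 / (4 * (M + 1))) * M = M / (M + 1) := by field_simp
    rw [this, div_lt_one (by positivity)]
    linarith
  have hδ1 : 4 * δ ≤ 1 := by
    rw [hδd]
    have : 4 * (1 / (4 * (M + 1))) = 1 / (M + 1) := by field_simp
    rw [this, div_le_one (by positivity)]
    linarith
  -- Since `l` is already fixed, it is enough that every sequence of radii has a subsequence along
  -- which the quotient tends to `l`.
  refine tendsto_of_subseq_tendsto fun ns hns => ?_
  have hns0 : Tendsto ns atTop (𝓝 0) := hns.mono_right nhdsWithin_le_nhds
  have hnspos : ∀ᶠ k in atTop, 0 < ns k := hns.eventually self_mem_nhdsWithin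
  obtain ⟨K, hK⟩ := eventually_atTop.1 (hnspos.and
    (hns0.eventually_lt_const (show 0 < 2 * δ * (s / 4) by positivity)))
  obtain ⟨j, hj, hjb⟩ := exists_dyadic_near (ρ := 2 * δ * (s / 4)) (x := fun k => ns (k + K))
    (by positivity) (fun k => (hK _ (by omega)).1) (hns0.comp (tendsto_add_atTop_nat K))
    (fun k => (hK _ (by omega)).2.le)
  obtain ⟨σ, hσ, h, W, m, hm, hh, hharm, hlim, hone, hWh, hhom⟩ := hblow j hj
  refine ⟨fun k => σ k + K, ?_⟩
  set ρ : ℕ → ℝ := fun k => s / 2 ^ (j (σ k) + 2)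
  have hρ : ∀ k, 0 < ρ k := fun k => hsj _
  -- The position of the radius relative to its dyadic scale. It stays in `[δ, 2δ]`, so that `2 * θ
  -- k` is still at most `4 * δ`.
  set θ : ℕ → ℝ := fun k => ns (σ k + K) / ρ k
  have hρθ : ∀ k, ρ k * θ k = ns (σ k + K) := fun k => mul_div_cancel₀ _ (hρ k).ne'
  have hθ : ∀ k, δ ≤ θ k ∧ θ k ≤ 2 * δ := by
    intro k
    obtain ⟨h1, h2⟩ := hjb (σ k)
    have h3 : θ k = ns (σ k + K) * 2 ^ j (σ k) / (s / 4) := by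
      simp only [θ, ρ, pow_add]
      field_simp
      norm_num
    rw [h3]
    constructor
    · rw [le_div_iff₀ (by positivity)]; linarith
    · rw [div_le_iff₀ (by positivity)]; linarith
  set N : ℕ → ℝ := fun k => Real.sqrt (halfMass f (2 * ρ k))
  have hN : ∀ k, 0 < N k := fun k => Real.sqrt_pos.2 (hpos _ (by have := hρ k; positivity))
  have hsmall : ∀ t, 0 < t → t ≤ 4 * δ → ∀ x ∈ ellip B 1, ‖t • x‖ < 1 := by
    intro t ht ht4 x hx
    rw [norm_smul, Real.norm_eq_abs, abs_of_pos ht]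
    have h1 := norm_le_of_mem_ellip B hx
    rw [mul_one] at h1
    calc t * ‖x‖ ≤ 4 * δ * M := by gcongr
      _ < 1 := hδM
  have hsupp : ∀ t, 0 < t → t ≤ 4 * δ → ∀ x, t • x ∉ Metric.ball (0 : Space n) (9 / 2) →
      (ellip B 1).indicator (1 : Space n → ℝ) x = 0 := by
    intro t ht ht4 x hx
    refine Set.indicator_of_notMem (fun he => hx ?_) _
    rw [mem_ball_zero_iff]
    linarith [hsmall t ht ht4 x he]
  have hJ : ∀ t, 0 < t → t ≤ 4 * δ →
      ellipMass B h t = ((t / (4 * δ)) ^ m) ^ 2 * ellipMass B h (4 * δ) := by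
    intro t ht ht4
    rw [ellipMass, ellipMass, wMass, wMass, ← integral_const_mul]
    refine setIntegral_congr_ae measurableSet_upperHalf ?_
    filter_upwards [ae_smul hWh ht.ne', ae_smul hWh (show 4 * δ ≠ 0 by positivity)] with x h1 h2 hxu
    by_cases hx : x ∈ ellip B 1
    · rw [← h1 ((smul_mem_upperHalf ht).2 hxu) (by simpa using hsmall t ht ht4 x hx),
        ← h2 ((smul_mem_upperHalf (by positivity)).2 hxu)
          (by simpa using hsmall (4 * δ) (by positivity) le_rfl x hx)]
      have h3 := hhom ((4 * δ) • x) (hsmall (4 * δ) (by positivity) le_rfl x hx) (t / (4 * δ))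
        ⟨by positivity, (div_le_one (by positivity)).2 ht4⟩
      rw [smul_smul, div_mul_cancel₀ _ (by positivity)] at h3
      rw [h3]
      ring
    · simp [hx]
  -- If `h` vanished on this ellipsoid, unique continuation would contradict the normalisation
  -- `hone`.
  have hβ0 : 0 < ellipMass B h (4 * δ) := by
    refine lt_of_le_of_ne (ellipMass_nonneg B h _) fun h0 => ?_
    obtain ⟨R, hR, hRB⟩ := exists_ball_subset_ellip B one_pos
    have h1 := halfMass_eq_zero_of_ellipMass B measurableSet_ball hh (by positivity)
      (hsupp (4 * δ) (by positivity) le_rfl) (R := min R 1) (by positivity)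
      ((Metric.ball_subset_ball (min_le_left _ _)).trans hRB) h0.symm
    have h2 := hharm.eq_zero_of_halfMass Metric.isOpen_ball (convex_ball _ _)
      measure_ball_lt_top.ne hh subset_rfl (t := 4 * δ * min R 1) (by positivity) (by
        have : 4 * δ * min R 1 ≤ 1 * 1 := by
          gcongr
          exact min_le_right _ _
        linarith) h1
    have h3 : halfMass h 2 = 0 := by
      refine setIntegral_eq_zero_of_ae_eq_zero ?_
      filter_upwards [ae_smul h2 two_ne_zero] with x hx hxu
      by_cases hxb : (2 : ℝ) • x ∈ Metric.ball (0 : Space n) (9 / 2)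
      · rw [hx ⟨(smul_mem_upperHalf two_pos).2 hxu, hxb⟩]; simp
      · rw [rho_eq_zero_of_notMem two_pos (by norm_num) subset_rfl hxb, zero_mul]
    rw [hone] at h3
    exact one_ne_zero h3
  set A : ℕ → ℝ := fun k => ellipMass B h (θ k)
  have hA : ∀ k, ((1 / 4 : ℝ) ^ m) ^ 2 * ellipMass B h (4 * δ) ≤ A k := by
    intro k
    obtain ⟨h1, h2⟩ := hθ k
    have h3 : (1 : ℝ) / 4 ≤ θ k / (4 * δ) := by
      rw [div_le_div_iff₀ (by norm_num) (by positivity)]; linarith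
    simp only [A]
    rw [hJ (θ k) (by linarith) (by linarith)]
    gcongr
  have hA2 : ∀ k, ellipMass B h (2 * θ k) = l * A k := by
    intro k
    obtain ⟨h1, h2⟩ := hθ k
    simp only [A]
    rw [hJ (θ k) (by linarith) (by linarith), hJ (2 * θ k) (by linarith) (by linarith), hm,
      mul_div_assoc, mul_pow, mul_pow, ← pow_mul 2, mul_comm m 2, pow_mul]
    norm_num
    ring
  have hg : ∀ k, MemLp (fun x => f (ρ k • x) / N k) 2
      (volume.restrict (upperHalf n ∩ Metric.ball 0 (9 / 2))) := fun k =>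
    ((memLp_comp_smul hf (hρ k).ne').mul_const _).restrict _
  -- The masses of the blow-ups converge even at the moving dilations `θ k` and, below, `2 * θ k`.
  have c1 := wMass_sub_tendsto (t := θ) (measurable_ellip_indicator B) (abs_ellip_indicator_le B)
    measurableSet_ball hδ (fun k => (hθ k).1)
    (fun k x hx => hsupp (θ k) (by linarith [(hθ k).1]) (by linarith [(hθ k).2]) x hx) hg hh hlim
  have c2 := wMass_sub_tendsto (t := fun k => 2 * θ k) (measurable_ellip_indicator B)
    (abs_ellip_indicator_le B) measurableSet_ball hδ (fun k => by linarith [(hθ k).1])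
    (fun k x hx => hsupp (2 * θ k) (by linarith [(hθ k).1]) (by linarith [(hθ k).2]) x hx) hg hh hlim
  simp only [wMass_comp_smul_div] at c1 c2
  have hfin := tendsto_ratio_of_close (l := l) (by positivity) hA c1
    (c2.congr fun k => by rw [← hA2]; rfl)
  refine hfin.congr fun k => ?_
  rw [div_div_div_cancel_right₀ (pow_ne_zero 2 (hN k).ne'), hρθ,
    show ρ k * (2 * θ k) = 2 * ns (σ k + K) by rw [← hρθ]; ring]
  rfl

/-! ### Rellich's theorem in the half space -/

theorem eLpNorm_two_sq {α E : Type*} [MeasurableSpace α] [NormedAddCommGroup E] (μ : Measure α)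
    (g : α → E) : eLpNorm g 2 μ ^ 2 = ∫⁻ x, ‖g x‖ₑ ^ 2 ∂μ := by
  have h := eLpNorm_nnreal_pow_eq_lintegral (f := g) (μ := μ) (p := 2) (by norm_num)
  norm_num at h
  exact_mod_cast h

theorem sq_lintegral_le {α : Type*} [MeasurableSpace α] (ν : Measure α) [IsProbabilityMeasure ν]
    {G : α → ℝ≥0∞} (hG : AEMeasurable G ν) : (∫⁻ y, G y ∂ν) ^ 2 ≤ ∫⁻ y, G y ^ 2 ∂ν := by
  have h := ENNReal.lintegral_mul_le_Lp_mul_Lq ν Real.HolderConjugate.two_two hG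
    (aemeasurable_const (b := (1 : ℝ≥0∞)))
  simp only [Pi.mul_apply, mul_one, ENNReal.one_rpow, lintegral_const, measure_univ] at h
  have h2 : ((∫⁻ y, G y ^ (2 : ℝ) ∂ν) ^ (1 / 2 : ℝ)) ^ 2 = ∫⁻ y, G y ^ (2 : ℝ) ∂ν := by
    rw [← ENNReal.rpow_natCast, ← ENNReal.rpow_mul]; norm_num
  calc (∫⁻ y, G y ∂ν) ^ 2 ≤ ((∫⁻ y, G y ^ (2 : ℝ) ∂ν) ^ (1 / 2 : ℝ)) ^ 2 := by gcongr
    _ = ∫⁻ y, G y ^ 2 ∂ν := by rw [h2]; norm_cast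

theorem fderiv_eq_inner_grad (f : Space n → ℝ) (x v : Space n) :
    fderiv ℝ f x v = inner ℝ (grad f x) v := by
  rw [fderiv_apply_eq_sum]
  simp [grad, PiLp.inner_apply, mul_comm]

theorem abs_fderiv_le (f : Space n → ℝ) (x v : Space n) :
    |fderiv ℝ f x v| ≤ ‖grad f x‖ * ‖v‖ := by
  rw [fderiv_eq_inner_grad]
  exact abs_real_inner_le_norm _ _

theorem continuous_grad {f : Space n → ℝ} (hf : ContDiff ℝ ∞ f) : Continuous (grad f) :=
  (PiLp.continuous_toLp 2 _).comp (continuous_pi fun i => (contDiff_pderiv hf i).continuous)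

theorem grad_eq_zero_of_notMem {f : Space n → ℝ} {x : Space n} (hx : x ∉ tsupport f) :
    grad f x = 0 := by
  ext i
  simp [grad, pderiv, fderiv_of_notMem_tsupport ℝ hx]

theorem lintegral_upperHalf_add_le (G : Space n → ℝ≥0∞) {v : Space n}
    (hv : 0 ≤ v (Fin.last n)) :
    ∫⁻ x in upperHalf n, G (x + v) ≤ ∫⁻ x in upperHalf n, G x := by
  rw [← lintegral_indicator measurableSet_upperHalf, ← lintegral_indicator measurableSet_upperHalf,
    ← lintegral_add_right_eq_self ((upperHalf n).indicator G) v]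
  refine lintegral_mono fun x => ?_
  by_cases hx : x ∈ upperHalf n
  · have hxv : x + v ∈ upperHalf n := by
      have hx' : 0 < x (Fin.last n) := hx
      change 0 < x (Fin.last n) + v (Fin.last n)
      linarith
    rw [Set.indicator_of_mem hx, Set.indicator_of_mem hxv]
  · rw [Set.indicator_of_notMem hx]
    exact zero_le

/-- A translation with nonnegative last coordinate keeps the whole segment in the half space. The
rest is the fundamental theorem of calculus along the segment, Jensen's inequality and Tonelli's
theorem. -/
theorem lintegral_sub_translate_le {f : Space n → ℝ} (hf : ContDiff ℝ ∞ f) {v : Space n}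
    (hv : 0 ≤ v (Fin.last n)) :
    ∫⁻ x in upperHalf n, ‖f x - f (x + v)‖ₑ ^ 2 ≤
      ‖v‖ₑ ^ 2 * ∫⁻ x in upperHalf n, ‖grad f x‖ₑ ^ 2 := by
  have : IsProbabilityMeasure (volume.restrict (Set.Ioc (0 : ℝ) 1)) := ⟨by simp⟩
  have hgc := continuous_grad hf
  have hpt : ∀ x, ‖f x - f (x + v)‖ₑ ^ 2 ≤
      ∫⁻ t in Set.Ioc (0 : ℝ) 1, ‖v‖ₑ ^ 2 * ‖grad f (x + t • v)‖ₑ ^ 2 := by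
    intro x
    have hd : ∀ t : ℝ, HasDerivAt (fun t : ℝ => f (x + t • v)) (fderiv ℝ f (x + t • v) v) t := by
      intro t
      have h1 : HasDerivAt (fun t : ℝ => x + t • v) v t := by
        simpa using ((hasDerivAt_id t).smul_const v).const_add x
      exact (hf.differentiable (by simp) _).hasFDerivAt.comp_hasDerivAt t h1
    have hc : Continuous fun t : ℝ => fderiv ℝ f (x + t • v) v := by
      have := hf.continuous_fderiv_apply (by simp)
      exact this.comp (f := fun t : ℝ => (x + t • v, v)) (by fun_prop)
    have hftc := intervalIntegral.integral_eq_sub_of_hasDerivAt (a := 0) (b := 1)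
      (fun t _ => hd t) (hc.intervalIntegrable _ _)
    simp only [one_smul, zero_smul, add_zero] at hftc
    rw [intervalIntegral.integral_of_le zero_le_one] at hftc
    rw [← enorm_neg, neg_sub, ← hftc]
    calc ‖∫ t in Set.Ioc (0 : ℝ) 1, fderiv ℝ f (x + t • v) v‖ₑ ^ 2
        ≤ (∫⁻ t in Set.Ioc (0 : ℝ) 1, ‖fderiv ℝ f (x + t • v) v‖ₑ) ^ 2 := by
          gcongr
          exact enorm_integral_le_lintegral_enorm _
      _ ≤ ∫⁻ t in Set.Ioc (0 : ℝ) 1, ‖fderiv ℝ f (x + t • v) v‖ₑ ^ 2 :=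
          sq_lintegral_le _ hc.enorm.measurable.aemeasurable
      _ ≤ _ := by
          refine lintegral_mono fun t => ?_
          rw [← mul_pow]
          gcongr
          rw [mul_comm, ← ofReal_norm, ← ofReal_norm, ← ofReal_norm,
            ← ENNReal.ofReal_mul (norm_nonneg _)]
          exact ENNReal.ofReal_le_ofReal (abs_fderiv_le f _ v)
  calc ∫⁻ x in upperHalf n, ‖f x - f (x + v)‖ₑ ^ 2
      ≤ ∫⁻ x in upperHalf n, ∫⁻ t in Set.Ioc (0 : ℝ) 1, ‖v‖ₑ ^ 2 * ‖grad f (x + t • v)‖ₑ ^ 2 :=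
        lintegral_mono fun x => hpt x
    _ = ∫⁻ t in Set.Ioc (0 : ℝ) 1, ∫⁻ x in upperHalf n, ‖v‖ₑ ^ 2 * ‖grad f (x + t • v)‖ₑ ^ 2 := by
        refine lintegral_lintegral_swap (Continuous.measurable ?_).aemeasurable
        have h1 : Continuous fun p : Space n × ℝ => ‖grad f (p.1 + p.2 • v)‖ₑ ^ 2 :=
          (ENNReal.continuous_pow 2).comp (hgc.comp (by fun_prop)).enorm
        exact (ENNReal.continuous_const_mul (by simp)).comp h1
    _ ≤ ∫⁻ t in Set.Ioc (0 : ℝ) 1, ‖v‖ₑ ^ 2 * ∫⁻ x in upperHalf n, ‖grad f x‖ₑ ^ 2 := by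
        refine setLIntegral_mono measurable_const fun t ht => ?_
        rw [lintegral_const_mul' _ _ (by simp)]
        refine mul_le_mul' le_rfl ?_
        exact lintegral_upperHalf_add_le (fun x => ‖grad f x‖ₑ ^ 2) (v := t • v)
          (mul_nonneg ht.1.le hv)
    _ = _ := by simp

/-- The uniform distribution on a ball of radius `ε` in the upper half space that touches the
origin. -/
def bump (n : ℕ) (ε : ℝ) : Measure (Space n) :=
  ProbabilityTheory.cond volume (Metric.ball (EuclideanSpace.single (Fin.last n) ε) ε)

theorem isProbabilityMeasure_bump {ε : ℝ} (hε : 0 < ε) : IsProbabilityMeasure (bump n ε) :=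
  ProbabilityTheory.cond_isProbabilityMeasure_of_finite (Metric.measure_ball_pos _ _ hε).ne'
    measure_ball_lt_top.ne

theorem ae_bump {ε : ℝ} :
    ∀ᵐ y ∂bump n ε, 0 ≤ y (Fin.last n) ∧ ‖y‖ ≤ 2 * ε := by
  have h : ∀ᵐ y ∂(volume.restrict
      (Metric.ball (EuclideanSpace.single (Fin.last n) ε : Space n) ε)),
      0 ≤ y (Fin.last n) ∧ ‖y‖ ≤ 2 * ε := by
    refine (ae_restrict_iff' measurableSet_ball).2 (Eventually.of_forall fun y hy => ?_)
    rw [mem_ball_iff_norm] at hy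
    have hε : 0 < ε := (norm_nonneg _).trans_lt hy
    constructor
    · have h1 := PiLp.norm_apply_le (y - EuclideanSpace.single (Fin.last n) ε) (Fin.last n)
      simp only [PiLp.sub_apply, PiLp.single_apply, if_true, Real.norm_eq_abs] at h1
      have := (abs_lt.1 (h1.trans_lt hy)).1
      linarith
    · have h1 := norm_sub_norm_le y (EuclideanSpace.single (Fin.last n) ε)
      rw [PiLp.norm_single, Real.norm_eq_abs, abs_of_pos hε] at h1
      linarith
  exact Measure.ae_smul_measure h _

/-- Jensen's inequality reduces the claim to single translations. The vectors in the support of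
`bump` point into the half space and have length at most `2 * ε`, so `lintegral_sub_translate_le`
applies to each. -/
theorem lintegral_sub_average_le {f : Space n → ℝ} (hf : ContDiff ℝ ∞ f)
    (hfc : HasCompactSupport f) {ε : ℝ} (hε : 0 < ε) :
    ∫⁻ x in upperHalf n, ‖f x - ∫ y, f (x + y) ∂bump n ε‖ₑ ^ 2 ≤
      ENNReal.ofReal (2 * ε) ^ 2 * ∫⁻ x in upperHalf n, ‖grad f x‖ₑ ^ 2 := by
  have := isProbabilityMeasure_bump (n := n) hε
  have hc := hf.continuous
  obtain ⟨M, hM⟩ := hc.bounded_above_of_compact_support hfc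
  have hint : ∀ x, Integrable (fun y => f (x + y)) (bump n ε) := fun x =>
    Integrable.of_bound (hc.comp (by fun_prop)).aestronglyMeasurable M
      (Eventually.of_forall fun y => hM _)
  have hpt : ∀ x, ‖f x - ∫ y, f (x + y) ∂bump n ε‖ₑ ^ 2 ≤
      ∫⁻ y, ‖f x - f (x + y)‖ₑ ^ 2 ∂bump n ε := by
    intro x
    have h1 : f x - ∫ y, f (x + y) ∂bump n ε = ∫ y, (f x - f (x + y)) ∂bump n ε := by
      rw [integral_sub (integrable_const _) (hint x)]
      simp
    rw [h1]
    calc _ ≤ (∫⁻ y, ‖f x - f (x + y)‖ₑ ∂bump n ε) ^ 2 := by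
          gcongr
          exact enorm_integral_le_lintegral_enorm _
      _ ≤ _ := sq_lintegral_le _ (Continuous.enorm (by fun_prop)).measurable.aemeasurable
  calc _ ≤ ∫⁻ x in upperHalf n, ∫⁻ y, ‖f x - f (x + y)‖ₑ ^ 2 ∂bump n ε :=
        lintegral_mono fun x => hpt x
    _ = ∫⁻ y, (∫⁻ x in upperHalf n, ‖f x - f (x + y)‖ₑ ^ 2) ∂bump n ε := by
        refine lintegral_lintegral_swap (Continuous.measurable ?_).aemeasurable
        exact (ENNReal.continuous_pow 2).comp (Continuous.enorm (by fun_prop))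
    _ ≤ ∫⁻ _, (ENNReal.ofReal (2 * ε) ^ 2 * ∫⁻ x in upperHalf n, ‖grad f x‖ₑ ^ 2) ∂bump n ε := by
        refine lintegral_mono_ae ?_
        filter_upwards [ae_bump] with y hy
        refine (lintegral_sub_translate_le hf hy.1).trans ?_
        gcongr
        rw [← ofReal_norm]
        exact ENNReal.ofReal_le_ofReal hy.2
    _ = _ := by simp

theorem lintegral_bump_add {ε : ℝ} (G : Space n → ℝ≥0∞) {x : Space n} (hx : x ∈ upperHalf n) :
    ∫⁻ y, G (x + y) ∂bump n ε ≤
      (volume (Metric.ball (EuclideanSpace.single (Fin.last n) ε : Space n) ε))⁻¹ *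
        ∫⁻ z in upperHalf n, G z := by
  rw [bump, ProbabilityTheory.cond, lintegral_smul_measure, smul_eq_mul]
  refine mul_le_mul' le_rfl ?_
  set S := Metric.ball (EuclideanSpace.single (Fin.last n) ε : Space n) ε
  rw [← lintegral_indicator measurableSet_ball, ← lintegral_indicator measurableSet_upperHalf,
    ← lintegral_add_left_eq_self ((upperHalf n).indicator G) x]
  refine lintegral_mono fun y => ?_
  by_cases hy : y ∈ S
  · rw [Set.indicator_of_mem hy, Set.indicator_of_mem]
    have h1 := PiLp.norm_apply_le (y - EuclideanSpace.single (Fin.last n) ε) (Fin.last n)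
    simp only [PiLp.sub_apply, PiLp.single_apply, if_true, Real.norm_eq_abs] at h1
    have := (abs_lt.1 (h1.trans_lt (mem_ball_iff_norm.1 hy))).1
    have hx' : 0 < x (Fin.last n) := hx
    change 0 < x (Fin.last n) + y (Fin.last n)
    linarith
  · rw [Set.indicator_of_notMem hy]
    exact zero_le

/-- Sequential Banach–Alaoglu in the Hilbert space `L_2`. Weak convergence is recorded only against
indicator functions, since averages over balls are all that is used. -/
theorem exists_subseq_setIntegral_tendsto {μ : Measure (Space n)} [SigmaFinite μ]
    {f : ℕ → Space n → ℝ} (hf : ∀ k, MemLp (f k) 2 μ) {C : ℝ≥0∞} (hC : C ≠ ⊤)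
    (hb : ∀ k, eLpNorm (f k) 2 μ ≤ C) :
    ∃ σ : ℕ → ℕ, StrictMono σ ∧ ∀ E : Set (Space n), MeasurableSet E → μ E ≠ ⊤ →
      ∃ l, Tendsto (fun k => ∫ x in E, f (σ k) x ∂μ) atTop (𝓝 l) := by
  have : Fact ((2 : ℝ≥0∞) ≠ ⊤) := ⟨by simp⟩
  set F : ℕ → WeakDual ℝ (Lp ℝ 2 μ) := fun k =>
    StrongDual.toWeakDual (InnerProductSpace.toDual ℝ _ ((hf k).toLp (f k)))
  have hF : ∀ k, F k ∈ WeakDual.toStrongDual ⁻¹' Metric.closedBall (0 : StrongDual ℝ (Lp ℝ 2 μ))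
      C.toReal := by
    intro k
    rw [Set.mem_preimage, mem_closedBall_zero_iff]
    change ‖InnerProductSpace.toDual ℝ _ ((hf k).toLp (f k))‖ ≤ _
    rw [LinearIsometryEquiv.norm_map, Lp.norm_toLp]
    exact ENNReal.toReal_mono hC (hb k)
  obtain ⟨ψ, -, σ, hσ, hlim⟩ := WeakDual.isSeqCompact_closedBall ℝ (Lp ℝ 2 μ) 0 C.toReal hF
  refine ⟨σ, hσ, fun E hE hμE => ⟨ψ (indicatorConstLp 2 hE hμE 1), ?_⟩⟩
  refine (((WeakDual.eval_continuous (indicatorConstLp 2 hE hμE (1 : ℝ))).tendsto ψ).comp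
    hlim).congr fun k => ?_
  change inner ℝ ((hf (σ k)).toLp (f (σ k))) (indicatorConstLp 2 hE hμE (1 : ℝ)) = _
  rw [real_inner_comm, L2.inner_indicatorConstLp_one]
  exact integral_congr_ae (ae_restrict_of_ae (hf (σ k)).coeFn_toLp)

theorem ball_bump_subset {ε : ℝ} {x : Space n} (hx : x ∈ upperHalf n) :
    Metric.ball (x + EuclideanSpace.single (Fin.last n) ε) ε ⊆ upperHalf n := by
  intro y hy
  rw [mem_ball_iff_norm] at hy
  have h1 := PiLp.norm_apply_le (y - (x + EuclideanSpace.single (Fin.last n) ε)) (Fin.last n)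
  simp only [PiLp.sub_apply, PiLp.add_apply, PiLp.single_apply, if_true, Real.norm_eq_abs] at h1
  have := (abs_lt.1 (h1.trans_lt hy)).1
  have hx' : 0 < x (Fin.last n) := hx
  change 0 < y (Fin.last n)
  linarith

/-- For `x` in the half space the translated ball remains in the half space, so the average is an
integral over a set to which the weak limit applies. -/
theorem integral_bump_add {ε : ℝ} (f : Space n → ℝ) {x : Space n} (hx : x ∈ upperHalf n) :
    ∫ y, f (x + y) ∂bump n ε =
      (volume (Metric.ball (EuclideanSpace.single (Fin.last n) ε : Space n) ε))⁻¹.toReal *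
        ∫ z in Metric.ball (x + EuclideanSpace.single (Fin.last n) ε) ε, f z
          ∂(volume.restrict (upperHalf n)) := by
  rw [bump, ProbabilityTheory.cond, integral_smul_measure, smul_eq_mul,
    Measure.restrict_restrict measurableSet_ball, Set.inter_eq_left.2 (ball_bump_subset hx),
    ← integral_indicator measurableSet_ball, ← integral_indicator measurableSet_ball,
    ← integral_add_left_eq_self
      ((Metric.ball (x + EuclideanSpace.single (Fin.last n) ε) ε).indicator f) x]
  congr 2
  ext y
  by_cases hy : y ∈ Metric.ball (EuclideanSpace.single (Fin.last n) ε : Space n) ε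
  · rw [Set.indicator_of_mem hy, Set.indicator_of_mem]
    simpa [mem_ball_iff_norm] using hy
  · rw [Set.indicator_of_notMem hy, Set.indicator_of_notMem]
    simpa [mem_ball_iff_norm] using hy

/-- Weak convergence makes the averages converge at every point of the half space. By Jensen's
inequality they are bounded uniformly, and they vanish outside the ball of radius `R + 2 * ε`;
dominated convergence gives convergence in `L_2`. -/
theorem exists_tendsto_average {f : ℕ → Space n → ℝ} (hf : ∀ k, ContDiff ℝ ∞ (f k)) {R : ℝ}
    (hs : ∀ k x, R ≤ ‖x‖ → f k x = 0) {C : ℝ≥0∞} (hC : C ≠ ⊤)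
    (hb : ∀ k, ∫⁻ x in upperHalf n, ‖f k x‖ₑ ^ 2 ≤ C)
    (hlim : ∀ E : Set (Space n), MeasurableSet E → volume.restrict (upperHalf n) E ≠ ⊤ →
      ∃ l, Tendsto (fun k => ∫ x in E, f k x ∂(volume.restrict (upperHalf n))) atTop (𝓝 l))
    {ε : ℝ} (hε : 0 < ε) :
    ∃ A : Space n → ℝ, AEStronglyMeasurable A (volume.restrict (upperHalf n)) ∧
      Tendsto (fun k => eLpNorm ((fun x => ∫ y, f k (x + y) ∂bump n ε) - A) 2
        (volume.restrict (upperHalf n))) atTop (𝓝 0) := by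
  have := isProbabilityMeasure_bump (n := n) hε
  set V := volume (Metric.ball (EuclideanSpace.single (Fin.last n) ε : Space n) ε) with hV
  have hV0 : V ≠ 0 := (Metric.measure_ball_pos _ _ hε).ne'
  set g : ℕ → Space n → ℝ := fun k x => ∫ y, f k (x + y) ∂bump n ε with hg
  have hex : ∀ x ∈ upperHalf n, ∃ l, Tendsto (fun k => g k x) atTop (𝓝 l) := by
    intro x hx
    obtain ⟨l, hl⟩ := hlim (Metric.ball (x + EuclideanSpace.single (Fin.last n) ε) ε)
      measurableSet_ball
      ((Measure.restrict_apply_le _ _).trans_lt measure_ball_lt_top).ne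
    refine ⟨V⁻¹.toReal * l, (hl.const_mul _).congr fun k => ?_⟩
    rw [hg]
    exact (integral_bump_add (f k) hx).symm
  choose! A hA using hex
  have hgm : ∀ k, StronglyMeasurable (g k) := fun k => by
    refine StronglyMeasurable.integral_prod_right (f := fun x y => f k (x + y)) ?_
    have := (hf k).continuous
    exact (by fun_prop : Continuous fun p : Space n × Space n =>
      f k (p.1 + p.2)).stronglyMeasurable
  have hAe : ∀ᵐ x ∂volume.restrict (upperHalf n), Tendsto (fun k => g k x) atTop (𝓝 (A x)) :=
    (ae_restrict_iff' measurableSet_upperHalf).2 (Eventually.of_forall hA)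
  have hAm : AEStronglyMeasurable A (volume.restrict (upperHalf n)) :=
    aestronglyMeasurable_of_tendsto_ae atTop (fun k => (hgm k).aestronglyMeasurable) hAe
  refine ⟨A, hAm, ?_⟩
  have hgb : ∀ k, ∀ x ∈ upperHalf n, ‖g k x‖ₑ ^ 2 ≤
      (Metric.closedBall (0 : Space n) (R + 2 * ε)).indicator (fun _ => V⁻¹ * C) x := by
    intro k x hx
    by_cases hxR : x ∈ Metric.closedBall (0 : Space n) (R + 2 * ε)
    · rw [Set.indicator_of_mem hxR]
      calc ‖g k x‖ₑ ^ 2 ≤ (∫⁻ y, ‖f k (x + y)‖ₑ ∂bump n ε) ^ 2 := by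
            gcongr
            exact enorm_integral_le_lintegral_enorm _
        _ ≤ ∫⁻ y, ‖f k (x + y)‖ₑ ^ 2 ∂bump n ε := by
            have := (hf k).continuous
            exact sq_lintegral_le _ (Continuous.enorm (by fun_prop)).measurable.aemeasurable
        _ ≤ V⁻¹ * ∫⁻ z in upperHalf n, ‖f k z‖ₑ ^ 2 :=
            lintegral_bump_add (fun z => ‖f k z‖ₑ ^ 2) hx
        _ ≤ V⁻¹ * C := mul_le_mul' le_rfl (hb k)
    · have h0 : g k x = 0 := by
        refine integral_eq_zero_of_ae ?_
        filter_upwards [ae_bump] with y hy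
        refine hs k _ ?_
        rw [mem_closedBall_zero_iff, not_le] at hxR
        have := norm_sub_le (x + y) y
        rw [add_sub_cancel_right] at this
        linarith [hy.2]
      rw [h0]
      simp
  have hint : ∫⁻ x in upperHalf n,
      4 * (Metric.closedBall (0 : Space n) (R + 2 * ε)).indicator (fun _ => V⁻¹ * C) x ≠ ⊤ := by
    rw [lintegral_const_mul' _ _ (by simp), lintegral_indicator measurableSet_closedBall,
      setLIntegral_const]
    refine ENNReal.mul_ne_top (by simp) (ENNReal.mul_ne_top (ENNReal.mul_ne_top ?_ hC) ?_)
    · simpa using hV0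
    · exact ((Measure.restrict_apply_le _ _).trans_lt
        (isCompact_closedBall _ _).measure_lt_top).ne
  have hdct := tendsto_lintegral_of_dominated_convergence'
    (μ := volume.restrict (upperHalf n)) (F := fun k x => ‖g k x - A x‖ₑ ^ 2) (f := fun _ => 0) _
    (fun k => ((hgm k).aestronglyMeasurable.sub hAm).enorm.pow_const 2) ?_ hint ?_
  · have h2 := (ENNReal.continuous_rpow_const (y := (1 / 2 : ℝ))).tendsto 0 |>.comp
      (by simpa using hdct)
    simp only [one_div, ENNReal.zero_rpow_of_pos (show (0 : ℝ) < 2⁻¹ by norm_num)] at h2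
    refine h2.congr fun k => ?_
    simp only [Function.comp_apply]
    have h3 := eLpNorm_two_sq (volume.restrict (upperHalf n)) (g k - A)
    simp only [Pi.sub_apply] at h3
    rw [← h3, ← ENNReal.rpow_natCast, ← ENNReal.rpow_mul]
    norm_num [hg]
  · intro k
    refine (ae_restrict_iff' measurableSet_upperHalf).2 (Eventually.of_forall fun x hx => ?_)
    set M := (Metric.closedBall (0 : Space n) (R + 2 * ε)).indicator (fun _ => V⁻¹ * C) x
    have hA2 : ‖A x‖ₑ ^ 2 ≤ M :=
      le_of_tendsto (((ENNReal.continuous_pow 2).comp continuous_enorm).tendsto (A x) |>.comp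
        (hA x hx)) (Eventually.of_forall fun k => hgb k x hx)
    calc ‖g k x - A x‖ₑ ^ 2 ≤ (‖g k x‖ₑ + ‖A x‖ₑ) ^ 2 := by
          gcongr
          exact enorm_sub_le
      _ ≤ 2 * (‖g k x‖ₑ ^ 2 + ‖A x‖ₑ ^ 2) := by
          have := ENNReal.rpow_add_le_mul_rpow_add_rpow ‖g k x‖ₑ ‖A x‖ₑ (one_le_two (α := ℝ))
          norm_num at this
          exact_mod_cast this
      _ ≤ 2 * (M + M) := by gcongr; exact hgb k x hx
      _ = 4 * M := by ring
  · filter_upwards [hAe] with x hx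
    have h1 : Tendsto (fun k => g k x - A x) atTop (𝓝 0) := by
      simpa using hx.sub_const (A x)
    have := ((ENNReal.continuous_pow 2).comp continuous_enorm).tendsto (0 : ℝ) |>.comp h1
    simpa [Function.comp_def] using this

/-- Rellich's theorem in the half space. -/
theorem exists_subseq_tendsto_eLpNorm {f : ℕ → Space n → ℝ} (hf : ∀ k, ContDiff ℝ ∞ (f k)) {R : ℝ}
    (hs : ∀ k x, R ≤ ‖x‖ → f k x = 0) {C : ℝ≥0∞} (hC : C ≠ ⊤)
    (hb : ∀ k, ∫⁻ x in upperHalf n, ‖f k x‖ₑ ^ 2 ≤ C)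
    (hg : ∀ k, ∫⁻ x in upperHalf n, ‖grad (f k) x‖ₑ ^ 2 ≤ C) :
    ∃ σ : ℕ → ℕ, StrictMono σ ∧ ∃ h : Space n → ℝ, MemLp h 2 (volume.restrict (upperHalf n)) ∧
      Tendsto (fun k => eLpNorm (f (σ k) - h) 2 (volume.restrict (upperHalf n)))
        atTop (𝓝 0) := by
  have hcs : ∀ k, HasCompactSupport (f k) := fun k =>
    HasCompactSupport.intro (isCompact_closedBall 0 R) fun x hx =>
      hs k x (by rw [mem_closedBall_zero_iff, not_le] at hx; exact hx.le)
  have hmem : ∀ k, MemLp (f k) 2 (volume.restrict (upperHalf n)) := fun k =>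
    ((hf k).continuous.memLp_of_hasCompactSupport (hcs k)).restrict _
  obtain ⟨D, hD, hDb⟩ : ∃ D : ℝ≥0∞, D ≠ ⊤ ∧ ∀ x : ℝ≥0∞, x ^ 2 ≤ C → x ≤ D := by
    refine ⟨C + 1, by simp [hC], fun x hx => ?_⟩
    by_contra! h
    have h1 : 1 ≤ x := le_trans (by simp) h.le
    exact absurd ((le_self_pow₀ h1 two_ne_zero).trans hx) (not_le.2 (lt_of_le_of_lt (by simp) h))
  obtain ⟨σ, hσ, hlim⟩ := exists_subseq_setIntegral_tendsto hmem hD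
    fun k => hDb _ ((eLpNorm_two_sq _ _).trans_le (hb k))
  refine ⟨σ, hσ, ?_⟩
  -- Each function is split into its average and a remainder. The remainder is at most `2 * ε` times
  -- the norm of the gradient, uniformly in `k`, and for fixed `ε` the averages converge.
  have hcau : CauchySeq fun k => (hmem (σ k)).toLp (f (σ k)) := by
    rw [EMetric.cauchySeq_iff]
    intro δ hδ
    obtain ⟨ε, hε, hεδ⟩ : ∃ ε : ℝ, 0 < ε ∧ ENNReal.ofReal (2 * ε) * D < δ / 4 := by
      have h1 : Tendsto (fun ε : ℝ => ENNReal.ofReal (2 * ε) * D) (𝓝[>] 0) (𝓝 0) := by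
        have h2 : Tendsto (fun ε : ℝ => ENNReal.ofReal (2 * ε)) (𝓝[>] 0) (𝓝 0) := by
          have : Continuous fun ε : ℝ => ENNReal.ofReal (2 * ε) :=
            ENNReal.continuous_ofReal.comp (by fun_prop)
          simpa using (this.tendsto 0).mono_left nhdsWithin_le_nhds
        simpa using ENNReal.Tendsto.mul_const h2 (Or.inr hD)
      have h3 := (h1.eventually_lt_const (show 0 < δ / 4 by
        simpa using hδ.ne')).and self_mem_nhdsWithin
      obtain ⟨ε, h4, h5⟩ := h3.exists
      exact ⟨ε, h5, h4⟩
    obtain ⟨A, hAm, hA⟩ := exists_tendsto_average (fun k => hf (σ k)) (fun k => hs (σ k)) hC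
      (fun k => hb (σ k)) hlim hε
    obtain ⟨N, hN⟩ := eventually_atTop.1 (hA.eventually_lt_const (show 0 < δ / 4 by
        simpa using hδ.ne'))
    have := isProbabilityMeasure_bump (n := n) hε
    have hgm : ∀ k, AEStronglyMeasurable (fun x => ∫ y, f k (x + y) ∂bump n ε)
        (volume.restrict (upperHalf n)) := fun k => by
      refine (StronglyMeasurable.integral_prod_right
        (f := fun x y => f k (x + y)) ?_).aestronglyMeasurable
      have := (hf k).continuous
      exact (by fun_prop : Continuous fun p : Space n × Space n =>
        f k (p.1 + p.2)).stronglyMeasurable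
    have hclose : ∀ k, N ≤ k → eLpNorm (f (σ k) - A) 2 (volume.restrict (upperHalf n)) < δ / 2 := by
      intro k hk
      set g := fun x => ∫ y, f (σ k) (x + y) ∂bump n ε with hgdef
      have h1 : eLpNorm (f (σ k) - g) 2 (volume.restrict (upperHalf n)) < δ / 4 := by
        refine lt_of_le_of_lt ?_ hεδ
        have h2 := (eLpNorm_two_sq (volume.restrict (upperHalf n)) (f (σ k) - g)).trans_le
          (lintegral_sub_average_le (hf (σ k)) (hcs (σ k)) hε)
        rw [← eLpNorm_two_sq, ← mul_pow] at h2
        refine ((ENNReal.pow_le_pow_left_iff two_ne_zero).1 h2).trans ?_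
        exact mul_le_mul' le_rfl (hDb _ ((eLpNorm_two_sq _ _).trans_le (hg (σ k))))
      have h3 : f (σ k) - A = (f (σ k) - g) + (g - A) := by simp
      rw [h3]
      refine (eLpNorm_add_le ((hmem _).1.sub (hgm _)) ((hgm _).sub hAm) (by norm_num)).trans_lt ?_
      refine (ENNReal.add_lt_add h1 (hN k hk)).trans_le ?_
      rw [← two_mul, ENNReal.div_eq_inv_mul, ENNReal.div_eq_inv_mul, ← mul_assoc]
      gcongr
      rw [show (4 : ℝ≥0∞) = 2 * 2 by norm_num, ENNReal.mul_inv (by simp) (by simp), ← mul_assoc,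
        ENNReal.mul_inv_cancel (by simp) (by simp), one_mul]
    refine ⟨N, fun k hk l hl => ?_⟩
    rw [Lp.edist_toLp_toLp]
    have h3 : f (σ k) - f (σ l) = (f (σ k) - A) - (f (σ l) - A) := by simp
    rw [h3]
    refine (eLpNorm_sub_le ((hmem _).1.sub hAm) ((hmem _).1.sub hAm) (by norm_num)).trans_lt ?_
    refine (ENNReal.add_lt_add (hclose k hk) (hclose l hl)).trans_le ?_
    rw [ENNReal.add_halves]
  obtain ⟨h, hh⟩ := cauchySeq_tendsto_of_complete hcau
  refine ⟨h, Lp.memLp h, ?_⟩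
  have hh' : Tendsto (fun k => (hmem (σ k)).toLp (f (σ k))) atTop
      (𝓝 ((Lp.memLp h).toLp h)) := by rwa [Lp.toLp_coeFn]
  exact (Lp.tendsto_Lp_iff_tendsto_eLpNorm'' _ _ _ _).1 hh'

/-! ### Vertical lines, Green's identity and passage to the limit -/

/-- The splitting of a point into its last coordinate and its projection to the hyperplane. -/
def splitLast (n : ℕ) : Space n ≃ᵐ ℝ × Bdry n :=
  ((MeasurableEquiv.toLp 2 (Fin (n + 1) → ℝ)).symm.trans
    (MeasurableEquiv.piFinSuccAbove (fun _ => ℝ) (Fin.last n))).trans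
    ((MeasurableEquiv.refl ℝ).prodCongr (MeasurableEquiv.toLp 2 (Fin n → ℝ)))

theorem measurePreserving_splitLast : MeasurePreserving (splitLast n) :=
  ((MeasurePreserving.id volume).prod (PiLp.volume_preserving_toLp (Fin n))).comp
    ((volume_preserving_piFinSuccAbove (fun _ => ℝ) (Fin.last n)).comp
      (PiLp.volume_preserving_ofLp (Fin (n + 1))))

theorem splitLast_symm_apply (p : ℝ × Bdry n) :
    (splitLast n).symm p = incl p.2 + p.1 • EuclideanSpace.single (Fin.last n) 1 := by
  rw [MeasurableEquiv.symm_apply_eq]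
  refine Prod.ext ?_ ?_
  · change p.1 = (incl p.2 + p.1 • EuclideanSpace.single (Fin.last n) (1 : ℝ)) (Fin.last n)
    simp [incl]
  · ext i
    change p.2 i = (incl p.2 + p.1 • EuclideanSpace.single (Fin.last n) (1 : ℝ))
      ((Fin.last n).succAbove i)
    simp [incl, (Fin.castSucc_lt_last i).ne]

theorem mem_upperHalf_incl_add {x' : Bdry n} {t : ℝ} :
    incl x' + t • EuclideanSpace.single (Fin.last n) 1 ∈ upperHalf n ↔ 0 < t := by
  simp [upperHalf, incl]

theorem continuous_incl : Continuous (incl : Bdry n → Space n) := by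
  refine (PiLp.continuous_toLp 2 _).comp (continuous_pi fun i => ?_)
  refine Fin.lastCases ?_ (fun j => ?_) i
  · simpa using continuous_const
  · simpa using PiLp.continuous_apply 2 (fun _ : Fin n => ℝ) j

theorem isometry_incl : Isometry (incl : Bdry n → Space n) := by
  refine Isometry.of_dist_eq fun x y => ?_
  rw [EuclideanSpace.dist_eq, EuclideanSpace.dist_eq, Fin.sum_univ_castSucc]
  simp [incl]

theorem incl_zero : incl (0 : Bdry n) = 0 := by
  ext i
  refine Fin.lastCases ?_ (fun j => ?_) i <;> simp [incl]

theorem lintegral_upperHalf_eq {G : Space n → ℝ≥0∞} (hG : Measurable G) :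
    ∫⁻ x in upperHalf n, G x = ∫⁻ x' : Bdry n, ∫⁻ t in Set.Ioi (0 : ℝ),
      G (incl x' + t • EuclideanSpace.single (Fin.last n) 1) := by
  have hm := hG.indicator (measurableSet_upperHalf (n := n))
  rw [← lintegral_indicator measurableSet_upperHalf,
    ← (measurePreserving_splitLast.symm _).lintegral_comp hm,
    Measure.volume_eq_prod]
  refine (lintegral_prod_symm' _ (hm.comp (splitLast n).symm.measurable)).trans ?_
  refine lintegral_congr fun x' => ?_
  rw [← lintegral_indicator measurableSet_Ioi]
  refine lintegral_congr fun t => ?_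
  rw [Function.comp_apply, splitLast_symm_apply]
  by_cases ht : 0 < t
  · rw [Set.indicator_of_mem (mem_upperHalf_incl_add.2 ht), Set.indicator_of_mem (Set.mem_Ioi.2 ht)]
  · rw [Set.indicator_of_notMem fun h => ht (mem_upperHalf_incl_add.1 h),
      Set.indicator_of_notMem (Set.notMem_Ioi.2 (not_lt.1 ht))]

theorem integral_upperHalf_eq {G : Space n → ℝ} (hG : IntegrableOn G (upperHalf n)) :
    ∫ x in upperHalf n, G x = ∫ x' : Bdry n, ∫ t in Set.Ioi (0 : ℝ),
      G (incl x' + t • EuclideanSpace.single (Fin.last n) 1) := by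
  have hG' := (integrable_indicator_iff measurableSet_upperHalf).2 hG
  have hmp := measurePreserving_splitLast (n := n).symm
  have hint : Integrable (fun p => (upperHalf n).indicator G ((splitLast n).symm p))
      (volume.prod volume) :=
    hmp.integrable_comp_of_integrable hG'
  rw [← integral_indicator measurableSet_upperHalf,
    ← hmp.integral_comp (splitLast n).symm.measurableEmbedding,
    Measure.volume_eq_prod, integral_prod_symm _ hint]
  refine integral_congr_ae (Eventually.of_forall fun x' => ?_)
  simp only
  rw [← integral_indicator measurableSet_Ioi]
  refine integral_congr_ae (Eventually.of_forall fun t => ?_)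
  simp only [splitLast_symm_apply]
  by_cases ht : 0 < t
  · rw [Set.indicator_of_mem (mem_upperHalf_incl_add.2 ht), Set.indicator_of_mem (Set.mem_Ioi.2 ht)]
  · rw [Set.indicator_of_notMem fun h => ht (mem_upperHalf_incl_add.1 h),
      Set.indicator_of_notMem (Set.notMem_Ioi.2 (not_lt.1 ht))]

theorem hasDerivAt_line {F : Space n → ℝ} (hF : Differentiable ℝ F) (x v : Space n) (t : ℝ) :
    HasDerivAt (fun t : ℝ => F (x + t • v)) (fderiv ℝ F (x + t • v) v) t := by
  have h1 : HasDerivAt (fun t : ℝ => x + t • v) v t := by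
    simpa using ((hasDerivAt_id t).smul_const v).const_add x
  exact (hF _).hasFDerivAt.comp_hasDerivAt t h1

theorem hasCompactSupport_line {F : Space n → ℝ} (hFc : HasCompactSupport F) (x' : Bdry n) :
    HasCompactSupport fun t : ℝ => F (incl x' + t • EuclideanSpace.single (Fin.last n) 1) := by
  obtain ⟨R, hR⟩ := hFc.isCompact.isBounded.subset_closedBall (0 : Space n)
  refine HasCompactSupport.intro (isCompact_closedBall (0 : ℝ) R) fun t ht => ?_
  refine image_eq_zero_of_notMem_tsupport fun h => ht ?_
  have h1 := hR h
  rw [mem_closedBall_zero_iff] at h1 ⊢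
  refine le_trans ?_ h1
  have h2 := PiLp.norm_apply_le (incl x' + t • EuclideanSpace.single (Fin.last n) (1 : ℝ))
    (Fin.last n)
  simpa [incl] using h2

theorem contDiff_line {F : Space n → ℝ} {m : WithTop ℕ∞} (hF : ContDiff ℝ m F) (x v : Space n) :
    ContDiff ℝ m fun t : ℝ => F (x + t • v) :=
  hF.comp (contDiff_const.add (contDiff_id.smul contDiff_const))

/-- The fundamental theorem of calculus along the vertical lines of the half space. -/
theorem integral_pderiv_last {F : Space n → ℝ} (hF : ContDiff ℝ 1 F) (hFc : HasCompactSupport F) :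
    ∫ x in upperHalf n, pderiv (Fin.last n) F x = - ∫ x' : Bdry n, F (incl x') := by
  have hc : Continuous (pderiv (Fin.last n) F) :=
    (hF.continuous_fderiv (by simp)).clm_apply continuous_const
  have hcs : HasCompactSupport (pderiv (Fin.last n) F) := hFc.fderiv_apply (𝕜 := ℝ) _
  rw [integral_upperHalf_eq (hc.integrable_of_hasCompactSupport hcs).integrableOn, ← integral_neg]
  refine integral_congr_ae (Eventually.of_forall fun x' => ?_)
  have h := HasCompactSupport.integral_Ioi_deriv_eq
    (contDiff_line hF (incl x') (EuclideanSpace.single (Fin.last n) 1))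
    (hasCompactSupport_line hFc x') 0
  simp only [zero_smul, add_zero] at h
  refine Eq.trans ?_ h
  exact setIntegral_congr_fun measurableSet_Ioi fun t _ =>
    (hasDerivAt_line (hF.differentiable (by simp)) _ _ t).deriv.symm

/-- The boundary values of a function are controlled by its vertical derivative. -/
theorem lintegral_incl_le {F : Space n → ℝ} (hF : ContDiff ℝ 1 F) (hFc : HasCompactSupport F) :
    ∫⁻ x' : Bdry n, ‖F (incl x')‖ₑ ≤ ∫⁻ x in upperHalf n, ‖pderiv (Fin.last n) F x‖ₑ := by
  have hc : Continuous (pderiv (Fin.last n) F) :=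
    (hF.continuous_fderiv (by simp)).clm_apply continuous_const
  rw [lintegral_upperHalf_eq hc.enorm.measurable]
  refine lintegral_mono fun x' => ?_
  have h := HasCompactSupport.integral_Ioi_deriv_eq
    (contDiff_line hF (incl x') (EuclideanSpace.single (Fin.last n) 1))
    (hasCompactSupport_line hFc x') 0
  simp only [zero_smul, add_zero] at h
  rw [← enorm_neg, ← h]
  refine (enorm_integral_le_lintegral_enorm _).trans (le_of_eq ?_)
  refine setLIntegral_congr_fun measurableSet_Ioi fun t _ => ?_
  rw [(hasDerivAt_line (hF.differentiable (by simp)) _ _ t).deriv]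
  rfl

/-- Tangential translations preserve the half space. Its indicator therefore has zero line
derivative in these directions, and integration by parts against it produces no boundary term. -/
theorem integral_pderiv_of_ne {F : Space n → ℝ} (hF : ContDiff ℝ 1 F) (hFc : HasCompactSupport F)
    {i : Fin (n + 1)} (hi : i ≠ Fin.last n) : ∫ x in upperHalf n, pderiv i F x = 0 := by
  have hc : Continuous (pderiv i F) :=
    (hF.continuous_fderiv (by simp)).clm_apply continuous_const
  have hcs : HasCompactSupport (pderiv i F) := hFc.fderiv_apply (𝕜 := ℝ) _
  have hind : ∀ G : Space n → ℝ, (fun x => (upperHalf n).indicator (fun _ => (1 : ℝ)) x * G x) =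
      (upperHalf n).indicator G := by
    intro G
    ext x
    by_cases hx : x ∈ upperHalf n <;> simp [hx]
  have h := integral_bilinear_hasLineDerivAt_right_eq_neg_left_of_integrable (μ := volume)
    (f := (upperHalf n).indicator fun _ => (1 : ℝ)) (f' := fun _ => 0) (g := F) (g' := pderiv i F)
    (v := EuclideanSpace.single i 1) (B := ContinuousLinearMap.mul ℝ ℝ) (by simp)
    (by
      simp only [ContinuousLinearMap.mul_apply']
      rw [hind]
      exact (hc.integrable_of_hasCompactSupport hcs).indicator measurableSet_upperHalf)
    (by
      simp only [ContinuousLinearMap.mul_apply']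
      rw [hind]
      exact (hF.continuous.integrable_of_hasCompactSupport hFc).indicator measurableSet_upperHalf)
    (fun x _ => by
      refine (hasDerivAt_const (0 : ℝ) ((upperHalf n).indicator (fun _ => (1 : ℝ)) x)).congr_of_eventuallyEq
        (Eventually.of_forall fun t => ?_)
      have : x + t • EuclideanSpace.single i (1 : ℝ) ∈ upperHalf n ↔ x ∈ upperHalf n := by
        simp [upperHalf, hi.symm]
      by_cases hx : x ∈ upperHalf n
      · simp [hx, this.2 hx]
      · simp [hx, mt this.1 hx])
    (fun x _ => ((hF.differentiable (by simp)) x).hasFDerivAt.hasLineDerivAt _)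
  simp only [ContinuousLinearMap.mul_apply', zero_mul, integral_zero, neg_zero] at h
  rw [hind, integral_indicator measurableSet_upperHalf] at h
  exact h

/-- Green's first identity in the half space for test functions with vanishing normal
derivative. -/
theorem integral_sum_pderiv_mul_pderiv {g φ : Space n → ℝ} (hg : ContDiff ℝ ∞ g)
    (hφ : ContDiff ℝ ∞ φ) (hφc : HasCompactSupport φ)
    (h0 : ∀ x, x (Fin.last n) = 0 → pderiv (Fin.last n) φ x = 0) :
    ∫ x in upperHalf n, ∑ i, pderiv i g x * pderiv i φ x =
      - ∫ x in upperHalf n, g x * lap φ x := by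
  have hpc : ∀ i, HasCompactSupport (pderiv i φ) := fun i => hφc.fderiv_apply (𝕜 := ℝ) _
  have hppc : ∀ i, HasCompactSupport (pderiv i (pderiv i φ)) :=
    fun i => (hpc i).fderiv_apply (𝕜 := ℝ) _
  have hz : ∀ i, ∫ x in upperHalf n, pderiv i (fun x => g x * pderiv i φ x) x = 0 := by
    intro i
    have hsm : ContDiff ℝ 1 fun x => g x * pderiv i φ x :=
      (hg.mul (contDiff_pderiv hφ i)).of_le (by simp)
    have hcs : HasCompactSupport fun x => g x * pderiv i φ x := (hpc i).mul_left
    by_cases hi : i = Fin.last n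
    -- The boundary term in the normal direction contains the normal derivative of `φ`, which
    -- vanishes by `h0`.
    · subst hi
      rw [integral_pderiv_last hsm hcs, neg_eq_zero]
      refine integral_eq_zero_of_ae (Eventually.of_forall fun x' => ?_)
      simp [h0 (incl x') (by simp [incl])]
    · exact integral_pderiv_of_ne hsm hcs hi
  have hi1 : ∀ i, IntegrableOn (fun x => pderiv i g x * pderiv i φ x) (upperHalf n) := fun i =>
    (((contDiff_pderiv hg i).mul (contDiff_pderiv hφ i)).continuous.integrable_of_hasCompactSupport
      (hpc i).mul_left).integrableOn
  have hi2 : ∀ i, IntegrableOn (fun x => g x * pderiv i (pderiv i φ) x) (upperHalf n) := fun i =>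
    ((hg.mul (contDiff_pderiv (contDiff_pderiv hφ i) i)).continuous.integrable_of_hasCompactSupport
      (hppc i).mul_left).integrableOn
  have hlap : ∀ x, g x * lap φ x = ∑ i, g x * pderiv i (pderiv i φ) x := fun x => by
    rw [lap, Finset.mul_sum]
  simp_rw [hlap]
  rw [integral_finsetSum _ fun i _ => hi1 i, integral_finsetSum _ fun i _ => hi2 i,
    ← Finset.sum_neg_distrib]
  refine Finset.sum_congr rfl fun i _ => ?_
  have h := hz i
  have hpt : ∀ x, pderiv i (fun x => g x * pderiv i φ x) x =
      pderiv i g x * pderiv i φ x + g x * pderiv i (pderiv i φ) x := fun x => by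
    rw [pderiv_mul (hg.differentiable (by simp))
      ((contDiff_pderiv hφ i).differentiable (by simp))]
  simp_rw [hpt] at h
  rw [integral_add (hi1 i) (hi2 i)] at h
  linarith

theorem abs_integral_mul_le {α : Type*} [MeasurableSpace α] {μ : Measure α} {f g : α → ℝ}
    (hf : MemLp f 2 μ) (hg : MemLp g 2 μ) :
    |∫ x, f x * g x ∂μ| ≤ (eLpNorm f 2 μ).toReal * (eLpNorm g 2 μ).toReal := by
  have h := abs_real_inner_le_norm (hf.toLp f) (hg.toLp g)
  rw [L2.inner_def, Lp.norm_toLp, Lp.norm_toLp] at h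
  convert h using 2
  refine integral_congr_ae ?_
  filter_upwards [hf.coeFn_toLp, hg.coeFn_toLp] with x h1 h2
  simp [h1, h2, mul_comm]

/-- Green's identity moves all derivatives onto the test function. Thus `L_2` convergence of the
functions suffices, and nothing is needed about convergence of their gradients. -/
theorem neumannHarmonic_of_tendsto {U : Set (Space n)} {g : ℕ → Space n → ℝ}
    (hg : ∀ k, ContDiff ℝ ∞ (g k)) {h : Space n → ℝ}
    (hgm : ∀ k, MemLp (g k) 2 (volume.restrict (upperHalf n ∩ U)))
    (hh : MemLp h 2 (volume.restrict (upperHalf n ∩ U)))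
    (hlim : Tendsto (fun k => eLpNorm (g k - h) 2 (volume.restrict (upperHalf n ∩ U)))
      atTop (𝓝 0))
    (hφ : ∀ φ, IsTestFunction U φ → Tendsto (fun k => ∫ x in upperHalf n,
      ∑ i, pderiv i (g k) x * pderiv i φ x) atTop (𝓝 0)) :
    NeumannHarmonic U h := by
  intro φ hφU h0
  have hl := contDiff_lap hφU.1
  have hlc : HasCompactSupport (lap φ) :=
    hφU.2.1.of_isClosed_subset (isClosed_tsupport _) (tsupport_lap_subset φ)
  have hlm : MemLp (lap φ) 2 (volume.restrict (upperHalf n ∩ U)) :=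
    (hl.continuous.memLp_of_hasCompactSupport hlc).restrict _
  have h1 : ∀ k, ∫ x in upperHalf n ∩ U, g k x * lap φ x =
      - ∫ x in upperHalf n, ∑ i, pderiv i (g k) x * pderiv i φ x := by
    intro k
    rw [integral_sum_pderiv_mul_pderiv (hg k) hφU.1 hφU.2.1 h0, neg_neg]
    refine (setIntegral_eq_of_subset_of_forall_sdiff_eq_zero measurableSet_upperHalf
      Set.inter_subset_left fun x hx => ?_).symm
    have : x ∉ tsupport (lap φ) := fun hx' =>
      hx.2 ⟨hx.1, hφU.2.2 (tsupport_lap_subset φ hx')⟩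
    rw [image_eq_zero_of_notMem_tsupport this, mul_zero]
  have h2 : Tendsto (fun k => ∫ x in upperHalf n ∩ U, g k x * lap φ x) atTop
      (𝓝 (∫ x in upperHalf n ∩ U, h x * lap φ x)) := by
    rw [tendsto_iff_norm_sub_tendsto_zero]
    have h3 : Tendsto (fun k => (eLpNorm (g k - h) 2 (volume.restrict (upperHalf n ∩ U))).toReal *
        (eLpNorm (lap φ) 2 (volume.restrict (upperHalf n ∩ U))).toReal) atTop (𝓝 0) := by
      have := ((ENNReal.tendsto_toReal ENNReal.zero_ne_top).comp hlim).mul_const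
        (eLpNorm (lap φ) 2 (volume.restrict (upperHalf n ∩ U))).toReal
      simpa using this
    refine squeeze_zero (fun _ => norm_nonneg _) (fun k => ?_) h3
    have h4 := abs_integral_mul_le ((hgm k).sub hh) hlm
    simp only [Pi.sub_apply, sub_mul] at h4
    have h6 := integral_sub ((hgm k).integrable_mul hlm) (hh.integrable_mul hlm)
    simp only [Pi.mul_apply] at h6
    rwa [h6] at h4
  have h5 := (hφ φ hφU).neg
  rw [neg_zero] at h5
  exact tendsto_nhds_unique h2 (h5.congr fun k => (h1 k).symm)

/-! ### Smooth folding and Sobolev's inequality -/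

/-- A smooth approximation of the folding map `(x', x_d) ↦ (x', |x_d|)`. -/
def fold (τ : ℝ) (x : Space n) : Space n :=
  x + (√(x (Fin.last n) ^ 2 + τ ^ 2) - x (Fin.last n)) • EuclideanSpace.single (Fin.last n) 1

theorem fold_apply (τ : ℝ) (x : Space n) (i : Fin (n + 1)) :
    fold τ x i = if i = Fin.last n then √(x (Fin.last n) ^ 2 + τ ^ 2) else x i := by
  by_cases h : i = Fin.last n
  · subst h; simp [fold]
  · simp [fold, h]

theorem norm_le_of_abs_le {x y : Space n} (h : ∀ i, |x i| ≤ |y i|) : ‖x‖ ≤ ‖y‖ := by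
  rw [EuclideanSpace.norm_eq, EuclideanSpace.norm_eq]
  refine Real.sqrt_le_sqrt (Finset.sum_le_sum fun i _ => ?_)
  simp only [Real.norm_eq_abs]
  exact pow_le_pow_left₀ (abs_nonneg _) (h i) 2

/-- This keeps the support of `f ∘ fold τ` inside the unit ball when `f` vanishes outside it. -/
theorem norm_le_norm_fold (τ : ℝ) (x : Space n) : ‖x‖ ≤ ‖fold τ x‖ := by
  refine norm_le_of_abs_le fun i => ?_
  rw [fold_apply]
  split_ifs with h
  · subst h
    rw [abs_of_nonneg (Real.sqrt_nonneg _)]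
    exact Real.abs_le_sqrt (by nlinarith [sq_nonneg τ])
  · rfl

theorem fold_zero_of_mem {x : Space n} (hx : x ∈ upperHalf n) : fold 0 x = x := by
  have hx' : 0 < x (Fin.last n) := hx
  simp [fold, Real.sqrt_sq hx'.le]

theorem fold_zero_refl_of_mem {x : Space n} (hx : x ∈ upperHalf n) : fold 0 (refl n x) = x := by
  have hx' : 0 < x (Fin.last n) := hx
  ext i
  rw [fold_apply]
  simp only [refl_apply]
  split_ifs with h
  · subst h; simp [Real.sqrt_sq hx'.le]
  · rfl

theorem continuous_fold : Continuous fun p : ℝ × Space n => fold p.1 p.2 := by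
  have := continuous_coord (n := n) (Fin.last n)
  unfold fold
  have h1 : Continuous fun p : ℝ × Space n => p.2 (Fin.last n) := this.comp continuous_snd
  fun_prop

theorem hasFDerivAt_fold {τ : ℝ} (hτ : 0 < τ) (x : Space n) :
    HasFDerivAt (fold τ) (ContinuousLinearMap.id ℝ (Space n) +
      ((x (Fin.last n) / √(x (Fin.last n) ^ 2 + τ ^ 2) - 1) •
        (EuclideanSpace.proj (Fin.last n) : Space n →L[ℝ] ℝ)).smulRight
          (EuclideanSpace.single (Fin.last n) 1)) x := by
  have hp : HasFDerivAt (fun x : Space n => x (Fin.last n))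
      (EuclideanSpace.proj (Fin.last n) : Space n →L[ℝ] ℝ) x :=
    (EuclideanSpace.proj (Fin.last n) : Space n →L[ℝ] ℝ).hasFDerivAt
  have hpos : 0 < x (Fin.last n) ^ 2 + τ ^ 2 := by positivity
  have h1 := (((hp.pow 2).add_const (τ ^ 2)).sqrt hpos.ne').sub hp
  refine ((hasFDerivAt_id x).add (h1.smul_const _)).congr_fderiv ?_
  congr 2
  ext v
  simp only [sub_apply, smul_apply, smul_eq_mul]
  field_simp
  norm_num
  ring

theorem contDiff_fold {τ : ℝ} (hτ : 0 < τ) : ContDiff ℝ 1 (fold τ : Space n → Space n) := by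
  have hp : ContDiff ℝ 1 fun x : Space n => x (Fin.last n) :=
    (EuclideanSpace.proj (Fin.last n) : Space n →L[ℝ] ℝ).contDiff
  exact contDiff_id.add (((((hp.pow 2).add contDiff_const).sqrt
    fun x => by positivity).sub hp).smul contDiff_const)

/-- The derivative is diagonal: 1 in the tangential directions and `x_d / √(x_d² + τ²)` in the last
one. -/
theorem norm_fderiv_fold_le {τ : ℝ} (hτ : 0 < τ) (x : Space n) : ‖fderiv ℝ (fold τ) x‖ ≤ 1 := by
  rw [(hasFDerivAt_fold hτ x).fderiv]
  refine ContinuousLinearMap.opNorm_le_bound _ zero_le_one fun v => ?_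
  rw [one_mul]
  refine norm_le_of_abs_le fun i => ?_
  set θ := x (Fin.last n) / √(x (Fin.last n) ^ 2 + τ ^ 2) with hθ
  have hpos : 0 < x (Fin.last n) ^ 2 + τ ^ 2 := by positivity
  have hθ1 : |θ| ≤ 1 := by
    rw [hθ, abs_div, abs_of_pos (Real.sqrt_pos.2 hpos)]
    exact div_le_one_of_le₀ (Real.abs_le_sqrt (by nlinarith)) (Real.sqrt_nonneg _)
  by_cases h : i = Fin.last n
  · subst h
    have h1 : v (Fin.last n) + (θ - 1) * v (Fin.last n) = θ * v (Fin.last n) := by ring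
    have h2 : (EuclideanSpace.proj (Fin.last n) : Space n →L[ℝ] ℝ) v = v (Fin.last n) := rfl
    simp only [add_apply, ContinuousLinearMap.smulRight_apply, smul_apply, PiLp.add_apply,
      PiLp.smul_apply, ContinuousLinearMap.id_apply, h2, smul_eq_mul,
      PiLp.single_apply, if_true, mul_one, h1, abs_mul]
    exact mul_le_of_le_one_left (abs_nonneg _) hθ1
  · simp [h]

theorem norm_fderiv_le_norm_grad (f : Space n → ℝ) (x : Space n) :
    ‖fderiv ℝ f x‖ ≤ ‖grad f x‖ :=
  ContinuousLinearMap.opNorm_le_bound _ (norm_nonneg _) fun v => abs_fderiv_le f x v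

theorem norm_fderiv_comp_fold_le {f : Space n → ℝ} (hf : Differentiable ℝ f) {τ : ℝ} (hτ : 0 < τ)
    (x : Space n) : ‖fderiv ℝ (f ∘ fold τ) x‖ ≤ ‖grad f (fold τ x)‖ := by
  rw [fderiv_comp x (hf _) (hasFDerivAt_fold hτ x).differentiableAt]
  refine (ContinuousLinearMap.opNorm_comp_le _ _).trans ?_
  refine (mul_le_mul (norm_fderiv_le_norm_grad f _) (norm_fderiv_fold_le hτ x) (norm_nonneg _)
    (norm_nonneg _)).trans ?_
  rw [mul_one]

theorem lintegral_fold_zero {H : Space n → ℝ≥0∞} :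
    ∫⁻ x, H (fold 0 x) = 2 * ∫⁻ x in upperHalf n, H x := by
  rw [← lintegral_add_compl _ measurableSet_upperHalf, ae_restrict_compl_upperHalf, two_mul]
  congr 1
  · exact setLIntegral_congr_fun measurableSet_upperHalf fun x hx => by
      rw [fold_zero_of_mem hx]
  · have h := measurePreserving_refl.setLIntegral_comp_preimage_emb
      (refl n).toHomeomorph.measurableEmbedding (fun x => H (fold 0 (refl n x))) (upperHalf n)
    simp only [refl_refl] at h
    rw [h]
    exact setLIntegral_congr_fun measurableSet_upperHalf fun x hx => by
      simp only [fold_zero_refl_of_mem hx]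

/-- Sobolev's inequality in the half space. -/
theorem exists_sobolev (hn : 1 ≤ n) {q : ℝ} (hq : 1 ≤ q)
    (hq2 : 1 / 2 - 1 / ((n : ℝ) + 1) < 1 / q) :
    ∃ K : ℝ≥0∞, K ≠ ⊤ ∧ ∀ f : Space n → ℝ, ContDiff ℝ ∞ f → (∀ x, 1 ≤ ‖x‖ → f x = 0) →
      eLpNorm f (ENNReal.ofReal q) (volume.restrict (upperHalf n)) ≤
        K * eLpNorm (grad f) 2 (volume.restrict (upperHalf n)) := by
  have hn1 : (1 : ℝ) ≤ n := by exact_mod_cast hn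
  have hS : 0 < 1 / q + 1 / ((n : ℝ) + 1) := by positivity
  -- The exponent whose Sobolev conjugate is `q`, raised to at least 1. By `hq2` it is below 2,
  -- hence below the dimension even in the plane, and Hölder's inequality on the unit ball passes
  -- from `L_p` to `L_2`.
  set p : NNReal := Real.toNNReal (max 1 (1 / q + 1 / ((n : ℝ) + 1))⁻¹) with hp
  set q' : NNReal := Real.toNNReal q with hq'
  have hpR : (p : ℝ) = max 1 (1 / q + 1 / ((n : ℝ) + 1))⁻¹ :=
    Real.coe_toNNReal _ (le_max_of_le_left zero_le_one)
  have hqR : (q' : ℝ) = q := Real.coe_toNNReal _ (by linarith)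
  have hp1 : 1 ≤ p := by
    rw [← NNReal.coe_le_coe, hpR]
    exact le_max_left _ _
  have hp2 : (p : ℝ) < 2 := by
    rw [hpR, max_lt_iff]
    refine ⟨by norm_num, ?_⟩
    rw [inv_lt_comm₀ hS (by norm_num)]
    linarith
  have hpinv : (p : ℝ)⁻¹ ≤ 1 / q + 1 / ((n : ℝ) + 1) := by
    rw [hpR]
    exact inv_le_of_inv_le₀ hS (le_max_right _ _)
  set B := Metric.ball (0 : Space n) 1 with hB
  set K₀ := eLpNormLESNormFDerivOfLeConst ℝ (volume : Measure (Space n)) B p q'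
  set K₁ : ℝ≥0∞ := volume B ^ (1 / (p : ℝ) - 1 / 2) with hK₁
  have hK₁t : K₁ ≠ ⊤ := by
    refine ENNReal.rpow_ne_top_of_nonneg ?_ measure_ball_lt_top.ne
    rw [sub_nonneg]
    have hp1' : (1 : ℝ) ≤ p := by exact_mod_cast hp1
    exact one_div_le_one_div_of_le (by linarith) hp2.le
  refine ⟨K₀ * K₁ * 2, by finiteness, fun f hf hf0 => ?_⟩
  have hfc : HasCompactSupport f :=
    HasCompactSupport.intro (isCompact_closedBall (0 : Space n) 1) fun x hx =>
      hf0 x (by rw [mem_closedBall_zero_iff, not_le] at hx; exact hx.le)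
  have hgc := continuous_grad hf
  have hg0 : ∀ x, 1 < ‖x‖ → grad f x = 0 := by
    intro x hx
    refine grad_eq_zero_of_notMem fun h => ?_
    have : tsupport f ⊆ Metric.closedBall 0 1 := by
      refine closure_minimal (fun y hy => ?_) Metric.isClosed_closedBall
      by_contra h'
      rw [mem_closedBall_zero_iff, not_le] at h'
      exact hy (hf0 y h'.le)
    exact absurd (mem_closedBall_zero_iff.1 (this h)) (not_le.2 hx)
  have hgcs : HasCompactSupport (grad f) :=
    HasCompactSupport.intro (isCompact_closedBall (0 : Space n) 1) fun x hx =>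
      hg0 x (by rwa [mem_closedBall_zero_iff, not_le] at hx)
  obtain ⟨M, hM⟩ := hgc.bounded_above_of_compact_support hgcs
  set τ : ℕ → ℝ := fun k => 1 / ((k : ℝ) + 1) with hτ
  have hτ0 : ∀ k, 0 < τ k := fun k => by positivity
  have hτlim : Tendsto τ atTop (𝓝 0) := tendsto_one_div_add_atTop_nhds_zero_nat
  have hfold : ∀ x : Space n, Tendsto (fun k => fold (τ k) x) atTop (𝓝 (fold 0 x)) := fun x =>
    ((continuous_fold.comp (by fun_prop : Continuous fun t : ℝ => (t, x))).tendsto 0).comp hτlim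
  have hfcont : ∀ k, Continuous (fold (τ k) : Space n → Space n) := fun k =>
    (contDiff_fold (hτ0 k)).continuous
  -- The composition `f ∘ fold (τ k)` is `C^1` on the whole space and supported in the unit ball, so
  -- the whole-space inequality applies with constants independent of `k`.
  have hstep : ∀ k, eLpNorm (f ∘ fold (τ k)) (ENNReal.ofReal q) (volume.restrict (upperHalf n)) ≤
      K₀ * K₁ * (∫⁻ x, ‖grad f (fold (τ k) x)‖ₑ ^ 2) ^ (1 / 2 : ℝ) := by
    intro k
    have hc1 : ContDiff ℝ 1 (f ∘ fold (τ k)) :=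
      (hf.of_le (by simp)).comp (contDiff_fold (hτ0 k))
    have hsupp : Function.support (f ∘ fold (τ k)) ⊆ B := by
      intro x hx
      rw [hB, mem_ball_zero_iff]
      by_contra! h
      exact hx (hf0 _ (h.trans (norm_le_norm_fold _ _)))
    have h1 := eLpNorm_le_eLpNorm_fderiv_of_le (volume : Measure (Space n)) hc1 hsupp (p := p)
      (q := q') hp1 (by
        rw [finrank_euclideanSpace_fin, ← NNReal.coe_lt_coe]
        push_cast
        linarith) (by
        rw [finrank_euclideanSpace_fin, hqR, NNReal.coe_inv]
        push_cast
        rw [← one_div q, ← one_div ((n : ℝ) + 1)]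
        linarith) Metric.isBounded_ball
    have h2 : eLpNorm (fderiv ℝ (f ∘ fold (τ k))) p volume ≤
        eLpNorm (fderiv ℝ (f ∘ fold (τ k))) 2 volume * K₁ := by
      have hsub : Function.support (fderiv ℝ (f ∘ fold (τ k))) ⊆ Metric.closedBall 0 1 := by
        refine (support_fderiv_subset ℝ).trans (closure_minimal (hsupp.trans ?_)
          Metric.isClosed_closedBall)
        exact Metric.ball_subset_closedBall
      have h3 := eLpNorm_le_eLpNorm_mul_rpow_measure_univ
        (μ := volume.restrict (Metric.closedBall (0 : Space n) 1))
        (f := fderiv ℝ (f ∘ fold (τ k))) (p := p) (q := 2)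
        (by exact_mod_cast hp2.le) (hc1.continuous_fderiv (by simp)).aestronglyMeasurable
      have h4 : ∀ r : ℝ≥0∞, eLpNorm (fderiv ℝ (f ∘ fold (τ k))) r
          (volume.restrict (Metric.closedBall (0 : Space n) 1)) =
          eLpNorm (fderiv ℝ (f ∘ fold (τ k))) r volume := fun r =>
        eLpNorm_restrict_eq_of_support_subset (ε := Space n →L[ℝ] ℝ) hsub
      rw [h4, h4] at h3
      simpa [hK₁, hB, Measure.addHaar_closedBall_eq_addHaar_ball] using h3
    have h4 : eLpNorm (fderiv ℝ (f ∘ fold (τ k))) 2 volume ≤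
        (∫⁻ x, ‖grad f (fold (τ k) x)‖ₑ ^ 2) ^ (1 / 2 : ℝ) := by
      have h5 : eLpNorm (fderiv ℝ (f ∘ fold (τ k))) 2 volume =
          (eLpNorm (fderiv ℝ (f ∘ fold (τ k))) 2 volume ^ 2) ^ (1 / 2 : ℝ) := by
        rw [← ENNReal.rpow_natCast, ← ENNReal.rpow_mul]
        norm_num
      rw [h5, eLpNorm_two_sq]
      refine ENNReal.rpow_le_rpow (lintegral_mono fun x => ?_) (by norm_num)
      refine pow_le_pow_left' ?_ 2
      rw [← ofReal_norm, ← ofReal_norm]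
      exact ENNReal.ofReal_le_ofReal
        (norm_fderiv_comp_fold_le (hf.differentiable (by simp)) (hτ0 k) x)
    calc eLpNorm (f ∘ fold (τ k)) (ENNReal.ofReal q) (volume.restrict (upperHalf n))
        ≤ eLpNorm (f ∘ fold (τ k)) q' volume := eLpNorm_mono_measure _ Measure.restrict_le_self
      _ ≤ K₀ * (eLpNorm (fderiv ℝ (f ∘ fold (τ k))) 2 volume * K₁) :=
          h1.trans (mul_le_mul' le_rfl h2)
      _ = K₀ * K₁ * eLpNorm (fderiv ℝ (f ∘ fold (τ k))) 2 volume := by ring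
      _ ≤ _ := mul_le_mul' le_rfl h4
  have hdct : Tendsto (fun k => ∫⁻ x, ‖grad f (fold (τ k) x)‖ₑ ^ 2) atTop
      (𝓝 (∫⁻ x, ‖grad f (fold 0 x)‖ₑ ^ 2)) := by
    refine tendsto_lintegral_of_dominated_convergence
      ((Metric.closedBall (0 : Space n) 1).indicator fun _ => ENNReal.ofReal M ^ 2)
      (fun k => ?_) (fun k => Eventually.of_forall fun x => ?_) ?_ ?_
    · exact ((ENNReal.continuous_pow 2).comp (hgc.comp (hfcont k)).enorm).measurable
    · by_cases hx : x ∈ Metric.closedBall (0 : Space n) 1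
      · rw [Set.indicator_of_mem hx]
        refine pow_le_pow_left' ?_ 2
        rw [← ofReal_norm]
        exact ENNReal.ofReal_le_ofReal (hM _)
      · rw [mem_closedBall_zero_iff, not_le] at hx
        simp [hg0 _ (hx.trans_le (norm_le_norm_fold (τ k) x))]
    · rw [lintegral_indicator measurableSet_closedBall, setLIntegral_const]
      have := (isCompact_closedBall (0 : Space n) 1).measure_lt_top (μ := volume)
      finiteness
    · refine Eventually.of_forall fun x => ?_
      have h6 : Continuous fun y => ‖grad f y‖ₑ ^ 2 := (ENNReal.continuous_pow 2).comp hgc.enorm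
      exact (h6.tendsto _).comp (hfold x)
  -- In the limit the folding is exact and covers the half space twice; this accounts for the extra
  -- factor in the constant.
  rw [lintegral_fold_zero (H := fun x => ‖grad f x‖ₑ ^ 2), ← eLpNorm_two_sq] at hdct
  have hlim2 := ENNReal.Tendsto.const_mul (a := (K₀ : ℝ≥0∞) * K₁)
    (((ENNReal.continuous_rpow_const (y := (1 / 2 : ℝ))).tendsto _).comp hdct)
    (Or.inr (by finiteness))
  have h7 := Lp.eLpNorm_lim_le_liminf_eLpNorm (p := ENNReal.ofReal q)
    (μ := volume.restrict (upperHalf n)) (f := fun k => f ∘ fold (τ k))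
    (fun k => (hf.continuous.comp (hfcont k)).aestronglyMeasurable) f
    ((ae_restrict_iff' measurableSet_upperHalf).2 (Eventually.of_forall fun x hx => by
      have := (hf.continuous.tendsto _).comp (hfold x)
      rwa [fold_zero_of_mem hx] at this))
  refine h7.trans ((liminf_le_liminf (Eventually.of_forall hstep)).trans ?_)
  have h8 := hlim2.liminf_eq
  simp only [Function.comp_def] at h8
  rw [h8, ENNReal.mul_rpow_of_nonneg _ _ (by norm_num), ← ENNReal.rpow_natCast,
    ← ENNReal.rpow_mul]
  norm_num
  rw [← mul_assoc]
  refine mul_le_mul' (mul_le_mul' le_rfl ?_) le_rfl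
  calc (2 : ℝ≥0∞) ^ (1 / 2 : ℝ) ≤ 2 ^ (1 : ℝ) :=
        ENNReal.rpow_le_rpow_of_exponent_le (by norm_num) (by norm_num)
    _ = 2 := ENNReal.rpow_one _

/-! ### Form-smallness of potentials and the trace inequality -/

theorem setLIntegral_eq_of_subset {α : Type*} [MeasurableSpace α] {μ : Measure α} {s t : Set α}
    (hs : MeasurableSet s) (ht : MeasurableSet t) (hst : s ⊆ t) {F : α → ℝ≥0∞}
    (hF : ∀ x ∈ t \ s, F x = 0) : ∫⁻ x in s, F x ∂μ = ∫⁻ x in t, F x ∂μ := by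
  rw [← lintegral_indicator hs, ← lintegral_indicator ht]
  refine lintegral_congr fun x => ?_
  by_cases hx : x ∈ s
  · rw [Set.indicator_of_mem hx, Set.indicator_of_mem (hst hx)]
  · by_cases hx' : x ∈ t
    · rw [Set.indicator_of_notMem hx, Set.indicator_of_mem hx', hF x ⟨hx', hx⟩]
    · rw [Set.indicator_of_notMem hx, Set.indicator_of_notMem hx']

theorem eLpNorm_ofReal_rpow {α E : Type*} [MeasurableSpace α] [NormedAddCommGroup E]
    (μ : Measure α) (g : α → E) {q : ℝ} (hq : 0 < q) :
    eLpNorm g (ENNReal.ofReal q) μ = (∫⁻ x, ‖g x‖ₑ ^ q ∂μ) ^ (1 / q) := by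
  rw [eLpNorm_eq_lintegral_rpow_enorm_toReal (by simpa using hq) (by simp),
    ENNReal.toReal_ofReal hq.le]

theorem lintegral_weight_mul_sq_le {α E : Type*} [MeasurableSpace α] [NormedAddCommGroup E]
    {μ : Measure α} {V : α → E} (hV : AEStronglyMeasurable V μ) {f : α → ℝ}
    (hf : AEStronglyMeasurable f μ) {q q' : ℝ} (hq : q.HolderConjugate q') :
    ∫⁻ x, ‖V x‖ₑ * ‖f x‖ₑ ^ 2 ∂μ ≤
      eLpNorm V (ENNReal.ofReal q) μ * eLpNorm f (ENNReal.ofReal (2 * q')) μ ^ 2 := by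
  have h := ENNReal.lintegral_mul_le_Lp_mul_Lq μ hq hV.enorm (hf.enorm.pow_const 2)
  refine h.trans (le_of_eq ?_)
  rw [eLpNorm_ofReal_rpow μ V hq.pos, eLpNorm_ofReal_rpow μ f (by linarith [hq.symm.pos]),
    ← ENNReal.rpow_natCast, ← ENNReal.rpow_mul]
  congr 1
  have h1 : 1 / (2 * q') * ((2 : ℕ) : ℝ) = 1 / q' := by
    have := hq.symm.pos
    push_cast
    field_simp
  rw [h1]
  congr 1
  refine lintegral_congr fun x => ?_
  rw [← ENNReal.rpow_natCast, ← ENNReal.rpow_mul]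
  norm_num

/-- Hölder's inequality on a set of small measure: the strict inequality between the exponents
leaves a positive power of `ν (S r)`. -/
theorem exists_eLpNorm_modulus {α E : Type*} [MeasurableSpace α] [NormedAddCommGroup E]
    {ν : Measure α} {S : ℝ → Set α} (hS : Monotone S)
    (hν : Tendsto (fun r => ν (S r)) (𝓝[>] 0) (𝓝 0)) {V : α → E} {q : ℝ≥0∞} {ρ : ℝ}
    (hV : MemLp V q (ν.restrict (S ρ))) {q₁ : ℝ} (hq₁ : 0 < q₁) (hq : ENNReal.ofReal q₁ < q) :
    ∃ κ : ℝ → ℝ≥0∞, Tendsto κ (𝓝[>] 0) (𝓝 0) ∧ ∀ r ≤ ρ,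
      eLpNorm V (ENNReal.ofReal q₁) (ν.restrict (S r)) ≤ κ r := by
  have hexp : 0 < 1 / q₁ - 1 / q.toReal := by
    rcases eq_or_ne q ⊤ with rfl | hqt
    · simpa using hq₁
    · rw [sub_pos]
      exact one_div_lt_one_div_of_lt hq₁ ((ENNReal.ofReal_lt_iff_lt_toReal hq₁.le hqt).1 hq)
  refine ⟨fun r => eLpNorm V q (ν.restrict (S ρ)) * ν (S r) ^ (1 / q₁ - 1 / q.toReal), ?_,
    fun r hr => ?_⟩
  · have h1 := ((ENNReal.continuous_rpow_const (y := 1 / q₁ - 1 / q.toReal)).tendsto 0).comp hν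
    rw [ENNReal.zero_rpow_of_pos hexp] at h1
    simpa using ENNReal.Tendsto.const_mul h1 (Or.inr hV.2.ne)
  · have hle : ν.restrict (S r) ≤ ν.restrict (S ρ) := Measure.restrict_mono_set ν (hS hr)
    refine (eLpNorm_le_eLpNorm_mul_rpow_measure_univ hq.le (hV.1.mono_measure hle)).trans ?_
    rw [Measure.restrict_apply_univ, ENNReal.toReal_ofReal hq₁.le]
    exact mul_le_mul' (eLpNorm_mono_measure _ hle) le_rfl

theorem enorm_pderiv_le (f : Space n → ℝ) (i : Fin (n + 1)) (x : Space n) :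
    ‖pderiv i f x‖ₑ ≤ ‖fderiv ℝ f x‖ₑ := by
  rw [← ofReal_norm, ← ofReal_norm]
  refine ENNReal.ofReal_le_ofReal ?_
  have := (fderiv ℝ f x).le_opNorm (EuclideanSpace.single i 1)
  simpa [pderiv, PiLp.norm_single] using this

/-- The trace inequality for functions in the half space. -/
theorem exists_trace (hn : 1 ≤ n) {t : ℝ} (ht : 2 ≤ t)
    (ht2 : 1 / 2 - 1 / ((n : ℝ) + 1) < 1 / (2 * (t - 1))) :
    ∃ K : ℝ≥0∞, K ≠ ⊤ ∧ ∀ f : Space n → ℝ, ContDiff ℝ ∞ f → (∀ x, 1 ≤ ‖x‖ → f x = 0) →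
      eLpNorm (fun x' => f (incl x')) (ENNReal.ofReal t) volume ≤
        K * eLpNorm (grad f) 2 (volume.restrict (upperHalf n)) := by
  obtain ⟨K, hK, hKf⟩ := exists_sobolev hn (show 1 ≤ 2 * (t - 1) by linarith) ht2
  refine ⟨(ENNReal.ofReal t * K ^ (t - 1)) ^ (1 / t), ?_, fun f hf hf0 => ?_⟩
  · exact ENNReal.rpow_ne_top_of_nonneg (by positivity)
      (ENNReal.mul_ne_top (by simp) (ENNReal.rpow_ne_top_of_nonneg (by linarith) hK))
  have hfc : HasCompactSupport f :=
    HasCompactSupport.intro (isCompact_closedBall (0 : Space n) 1) fun x hx =>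
      hf0 x (by rw [mem_closedBall_zero_iff, not_le] at hx; exact hx.le)
  have ht0 : 0 < t := by linarith
  have htc : ((Real.toNNReal t : NNReal) : ℝ) = t := Real.coe_toNNReal _ ht0.le
  have hF : ContDiff ℝ 1 fun x => ‖f x‖ ^ t :=
    (hf.of_le (by simp)).norm_rpow (by linarith)
  have hFc : HasCompactSupport fun x => ‖f x‖ ^ t :=
    hfc.comp_left (g := fun y : ℝ => ‖y‖ ^ t) (by simp [Real.zero_rpow ht0.ne'])
  set G := eLpNorm (grad f) 2 (volume.restrict (upperHalf n)) with hG
  -- The function `|f|^t` is integrated along vertical lines, and Cauchy–Schwarz puts the factor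
  -- `|f|^(t-1)` into `L_2`, that is, `f` into `L_{2(t-1)}`, where Sobolev's inequality applies.
  have hstep : ∫⁻ x' : Bdry n, ‖f (incl x')‖ₑ ^ t ≤
      ENNReal.ofReal t * K ^ (t - 1) * G ^ t := by
    calc ∫⁻ x' : Bdry n, ‖f (incl x')‖ₑ ^ t = ∫⁻ x' : Bdry n, ‖‖f (incl x')‖ ^ t‖ₑ := by
          refine lintegral_congr fun x' => ?_
          rw [Real.enorm_rpow_of_nonneg (norm_nonneg _) ht0.le, enorm_norm]
      _ ≤ ∫⁻ x in upperHalf n, ‖pderiv (Fin.last n) (fun x => ‖f x‖ ^ t) x‖ₑ :=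
          lintegral_incl_le hF hFc
      _ ≤ ∫⁻ x in upperHalf n, ENNReal.ofReal t * (‖f x‖ₑ ^ (t - 1) * ‖grad f x‖ₑ) := by
          refine lintegral_mono fun x => (enorm_pderiv_le _ _ _).trans ?_
          have h1 := enorm_fderiv_norm_rpow_le (hf.differentiable (by simp)) (x := x)
            (p := Real.toNNReal t) (by rw [← NNReal.coe_lt_coe, htc]; push_cast; linarith)
          rw [htc, mul_assoc] at h1
          refine h1.trans (mul_le_mul' le_rfl (mul_le_mul' le_rfl ?_))
          rw [← ofReal_norm, ← ofReal_norm]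
          exact ENNReal.ofReal_le_ofReal (norm_fderiv_le_norm_grad f x)
      _ = ENNReal.ofReal t * ∫⁻ x in upperHalf n, ‖f x‖ₑ ^ (t - 1) * ‖grad f x‖ₑ :=
          lintegral_const_mul' _ _ (by simp)
      _ ≤ ENNReal.ofReal t * (eLpNorm f (ENNReal.ofReal (2 * (t - 1)))
            (volume.restrict (upperHalf n)) ^ (t - 1) * G) := by
          refine mul_le_mul' le_rfl ?_
          have h2 := ENNReal.lintegral_mul_le_Lp_mul_Lq (volume.restrict (upperHalf n))
            Real.HolderConjugate.two_two
            (f := fun x => ‖f x‖ₑ ^ (t - 1)) (g := fun x => ‖grad f x‖ₑ)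
            (hf.continuous.enorm.measurable.pow_const _).aemeasurable
            (continuous_grad hf).enorm.measurable.aemeasurable
          refine h2.trans (le_of_eq ?_)
          rw [eLpNorm_ofReal_rpow _ f (by linarith), ← ENNReal.rpow_mul]
          congr 1
          · have h3 : 1 / (2 * (t - 1)) * (t - 1) = 1 / 2 := by
              have : t - 1 ≠ 0 := by linarith
              field_simp
            rw [h3]
            congr 1
            refine lintegral_congr fun x => ?_
            rw [← ENNReal.rpow_mul, mul_comm]
          · rw [hG, eLpNorm_eq_lintegral_rpow_enorm_toReal (by simp) (by simp)]
            simp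
      _ ≤ ENNReal.ofReal t * ((K * G) ^ (t - 1) * G) := by
          refine mul_le_mul' le_rfl (mul_le_mul' ?_ le_rfl)
          exact ENNReal.rpow_le_rpow (hKf f hf hf0) (by linarith)
      _ = _ := by
          rw [ENNReal.mul_rpow_of_nonneg _ _ (by linarith : (0 : ℝ) ≤ t - 1)]
          have h4 : G ^ t = G ^ (t - 1) * G := by
            conv_rhs => rw [← ENNReal.rpow_one G, ← ENNReal.rpow_mul, one_mul]
            rw [← ENNReal.rpow_add_of_nonneg _ _ (by linarith) zero_le_one]
            congr 1
            ring
          rw [h4]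
          ring
  rw [eLpNorm_ofReal_rpow _ _ ht0]
  refine (ENNReal.rpow_le_rpow hstep (by positivity)).trans (le_of_eq ?_)
  rw [ENNReal.mul_rpow_of_nonneg _ _ (by positivity : (0 : ℝ) ≤ 1 / t), ← ENNReal.rpow_mul G,
    mul_one_div_cancel ht0.ne', ENNReal.rpow_one]

theorem monotone_halfBall : Monotone (halfBall n) := fun _ _ h =>
  Set.inter_subset_inter_right _ (Metric.ball_subset_ball h)

theorem monotone_flatBall : Monotone (flatBall n) := fun _ _ h => Metric.ball_subset_ball h

theorem measurableSet_halfBall {r : ℝ} : MeasurableSet (halfBall n r) :=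
  measurableSet_upperHalf.inter measurableSet_ball

theorem tendsto_volume_ball {m : ℕ} (hm : 1 ≤ m) :
    Tendsto (fun r : ℝ => volume (Metric.ball (0 : EuclideanSpace ℝ (Fin m)) r)) (𝓝[>] 0)
      (𝓝 0) := by
  have h1 : ∀ r ∈ Set.Ioi (0 : ℝ), ENNReal.ofReal (r ^ m) *
      volume (Metric.ball (0 : EuclideanSpace ℝ (Fin m)) 1) =
      volume (Metric.ball (0 : EuclideanSpace ℝ (Fin m)) r) := fun r hr => by
    rw [Measure.addHaar_ball_of_pos volume _ hr, finrank_euclideanSpace_fin]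
  refine Tendsto.congr' (eventually_nhdsWithin_of_forall h1) ?_
  have h2 : Tendsto (fun r : ℝ => ENNReal.ofReal (r ^ m)) (𝓝[>] 0) (𝓝 0) := by
    have : Continuous fun r : ℝ => ENNReal.ofReal (r ^ m) :=
      ENNReal.continuous_ofReal.comp (continuous_pow m)
    have h3 := (this.tendsto 0).mono_left (nhdsWithin_le_nhds (s := Set.Ioi 0))
    simpa [zero_pow (Nat.one_le_iff_ne_zero.1 hm)] using h3
  simpa using ENNReal.Tendsto.mul_const h2 (Or.inr measure_ball_lt_top.ne)

/-- A potential in `L_q`, `q > d / 2`, is form-small on small balls. -/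
theorem exists_modulus_interior (hn : 1 ≤ n) {E : Type*} [NormedAddCommGroup E]
    {V : Space n → E} {q : ℝ≥0∞} (hq : ((n + 1 : ℕ) : ℝ≥0∞) / 2 < q) {ρ : ℝ} (hρ : ρ ≤ 1)
    (hV : MemLp V q (volume.restrict (halfBall n ρ))) :
    ∃ κ : ℝ → ℝ≥0∞, Tendsto κ (𝓝[>] 0) (𝓝 0) ∧ ∀ r ≤ ρ, ∀ f : Space n → ℝ, ContDiff ℝ ∞ f →
      (∀ x, r ≤ ‖x‖ → f x = 0) → ∫⁻ x in halfBall n ρ, ‖V x‖ₑ * ‖f x‖ₑ ^ 2 ≤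
        κ r * eLpNorm (grad f) 2 (volume.restrict (upperHalf n)) ^ 2 := by
  have hn1 : (1 : ℝ) ≤ n := by exact_mod_cast hn
  -- An intermediate finite exponent: `q₀ > d / 2` makes `2 q₀'` subcritical for Sobolev's
  -- inequality, and `q > q₀` supplies the factor that tends to zero.
  obtain ⟨q₀, hq₀, hq₀'⟩ := ENNReal.lt_iff_exists_nnreal_btwn.1 hq
  have hq1 : ((n : ℝ) + 1) / 2 < q₀ := by
    have h1 : ENNReal.ofReal (((n : ℝ) + 1) / 2) < q₀ := by
      convert hq₀ using 1
      rw [ENNReal.ofReal_div_of_pos (by norm_num)]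
      congr 1
      · rw [← ENNReal.ofReal_natCast]; push_cast; rfl
      · simp
    rw [← ENNReal.ofReal_coe_nnreal] at h1
    exact (ENNReal.ofReal_lt_ofReal_iff (by linarith [(by positivity : 0 ≤ (n : ℝ)),
      (ENNReal.ofReal_lt_ofReal_iff_of_nonneg (by positivity)).1 h1])).1 h1
  have hconj : (q₀ : ℝ).HolderConjugate (Real.conjExponent q₀) :=
    Real.HolderConjugate.conjExponent (by linarith)
  have hinv := hconj.inv_add_inv_eq_one
  obtain ⟨K, hK, hKf⟩ := exists_sobolev hn (q := 2 * Real.conjExponent q₀)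
    (by linarith [hconj.symm.lt]) (by
      have h1 : 1 / (2 * Real.conjExponent q₀) = (1 - (q₀ : ℝ)⁻¹) / 2 := by
        rw [← eq_sub_of_add_eq' hinv]; field_simp
      have h2 : (q₀ : ℝ)⁻¹ < 2 / ((n : ℝ) + 1) := by
        rw [inv_lt_comm₀ hconj.pos (by positivity), inv_div]
        exact hq1
      rw [h1]
      have h3 : 1 / ((n : ℝ) + 1) = 2 / ((n : ℝ) + 1) / 2 := by ring
      linarith)
  obtain ⟨κ, hκ, hκV⟩ := exists_eLpNorm_modulus (monotone_halfBall (n := n))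
    (tendsto_of_tendsto_of_tendsto_of_le_of_le tendsto_const_nhds
      (tendsto_volume_ball (m := n + 1) (by omega)) (fun _ => zero_le)
      (fun r => measure_mono Set.inter_subset_right)) hV hconj.pos
    (by rwa [ENNReal.ofReal_coe_nnreal])
  refine ⟨fun r => κ r * K ^ 2, by
    simpa using ENNReal.Tendsto.mul_const hκ (Or.inr (ENNReal.pow_ne_top hK)),
    fun r hr f hf hf0 => ?_⟩
  have hle : volume.restrict (halfBall n r) ≤ volume.restrict (halfBall n ρ) :=
    Measure.restrict_mono_set _ (monotone_halfBall hr)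
  have h1 : ∫⁻ x in halfBall n ρ, ‖V x‖ₑ * ‖f x‖ₑ ^ 2 =
      ∫⁻ x in halfBall n r, ‖V x‖ₑ * ‖f x‖ₑ ^ 2 := by
    refine (setLIntegral_eq_of_subset measurableSet_halfBall measurableSet_halfBall
      (monotone_halfBall hr) fun x hx => ?_).symm
    have : r ≤ ‖x‖ := by
      by_contra! h
      exact hx.2 ⟨hx.1.1, mem_ball_zero_iff.2 h⟩
    simp [hf0 x this]
  rw [h1]
  refine (lintegral_weight_mul_sq_le (hV.1.mono_measure hle)
    hf.continuous.aestronglyMeasurable hconj).trans ?_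
  rw [mul_assoc, ← mul_pow]
  refine mul_le_mul' (hκV r hr) (pow_le_pow_left' ?_ 2)
  exact (eLpNorm_mono_measure _ (Measure.restrict_mono_set _ Set.inter_subset_left)).trans
    (hKf f hf fun x hx => hf0 x ((hr.trans hρ).trans hx))

/-- A boundary potential in `L_s`, `s > d - 1`, is form-small on small balls. -/
theorem exists_modulus_boundary (hn : 1 ≤ n) {η : Bdry n → ℝ} {s : ℝ≥0∞} (hs : (n : ℝ≥0∞) < s)
    {ρ : ℝ} (hρ : ρ ≤ 1) (hη : MemLp η s (volume.restrict (flatBall n ρ))) :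
    ∃ κ : ℝ → ℝ≥0∞, Tendsto κ (𝓝[>] 0) (𝓝 0) ∧ ∀ r ≤ ρ, ∀ f : Space n → ℝ, ContDiff ℝ ∞ f →
      (∀ x, r ≤ ‖x‖ → f x = 0) → ∫⁻ x' in flatBall n ρ, ‖η x'‖ₑ * ‖f (incl x')‖ₑ ^ 2 ≤
        κ r * eLpNorm (grad f) 2 (volume.restrict (upperHalf n)) ^ 2 := by
  have hn1 : (1 : ℝ) ≤ n := by exact_mod_cast hn
  obtain ⟨q₀, hq₀, hq₀'⟩ := ENNReal.lt_iff_exists_nnreal_btwn.1 hs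
  have hq1 : (n : ℝ) < q₀ := by exact_mod_cast hq₀
  have hconj : (q₀ : ℝ).HolderConjugate (Real.conjExponent q₀) :=
    Real.HolderConjugate.conjExponent (by linarith)
  have hinv := hconj.inv_add_inv_eq_one
  have hc1 := hconj.symm.lt
  -- With `t = 2 q₀'` the condition on the trace exponent becomes `1 / (q₀ + 1) < 1 / (n + 1)`,
  -- which is `q₀ > d - 1`.
  obtain ⟨K, hK, hKf⟩ := exists_trace hn (t := 2 * Real.conjExponent q₀)
    (by linarith) (by
      have h0 : Real.conjExponent q₀ = q₀ / (q₀ - 1) := rfl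
      have hq0 : (0 : ℝ) < q₀ - 1 := by linarith
      have h1 : 2 * (2 * Real.conjExponent q₀ - 1) = 2 * ((q₀ + 1) / (q₀ - 1)) := by
        rw [h0]; field_simp; ring
      rw [h1]
      have h2 : 1 / (2 * (((q₀ : ℝ) + 1) / (q₀ - 1))) = 1 / 2 - 1 / (q₀ + 1) := by
        field_simp; ring
      rw [h2]
      have := one_div_lt_one_div_of_lt (by positivity : (0 : ℝ) < n + 1)
        (by linarith : (n : ℝ) + 1 < q₀ + 1)
      linarith)
  obtain ⟨κ, hκ, hκV⟩ := exists_eLpNorm_modulus (monotone_flatBall (n := n))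
    (tendsto_volume_ball (m := n) hn) hη hconj.pos (by rwa [ENNReal.ofReal_coe_nnreal])
  refine ⟨fun r => κ r * K ^ 2, by
    simpa using ENNReal.Tendsto.mul_const hκ (Or.inr (ENNReal.pow_ne_top hK)),
    fun r hr f hf hf0 => ?_⟩
  have hle : volume.restrict (flatBall n r) ≤ volume.restrict (flatBall n ρ) :=
    Measure.restrict_mono_set _ (monotone_flatBall hr)
  have h1 : ∫⁻ x' in flatBall n ρ, ‖η x'‖ₑ * ‖f (incl x')‖ₑ ^ 2 =
      ∫⁻ x' in flatBall n r, ‖η x'‖ₑ * ‖f (incl x')‖ₑ ^ 2 := by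
    refine (setLIntegral_eq_of_subset measurableSet_ball measurableSet_ball
      (monotone_flatBall hr) fun x hx => ?_).symm
    have : r ≤ ‖incl x‖ := by
      by_contra! h
      refine hx.2 (mem_ball_zero_iff.2 ?_)
      have h3 := isometry_incl.dist_eq x 0
      rw [incl_zero, dist_zero_right, dist_zero_right] at h3
      rwa [← h3]
    simp [hf0 _ this]
  rw [h1]
  refine (lintegral_weight_mul_sq_le (hη.1.mono_measure hle)
    (hf.continuous.comp continuous_incl).aestronglyMeasurable hconj).trans ?_
  rw [mul_assoc, ← mul_pow]
  refine mul_le_mul' (hκV r hr) (pow_le_pow_left' ?_ 2)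
  exact (eLpNorm_mono_measure _ Measure.restrict_le_self).trans
    (hKf f hf fun x hx => hf0 x ((hr.trans hρ).trans hx))

/-! ### Elliptic matrices and masses weighted by the lower order coefficients -/

theorem inner_toEuclideanLin (M : Matrix (Fin (n + 1)) (Fin (n + 1)) ℝ) (ξ ζ : Space n) :
    inner ℝ (Matrix.toEuclideanLin M ξ) ζ = ∑ i, (∑ j, M i j * ξ j) * ζ i := by
  rw [PiLp.inner_apply]
  refine Finset.sum_congr rfl fun i _ => ?_
  simp [Matrix.toLpLin_apply, Matrix.mulVec, dotProduct, mul_comm]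

theorem inner_toEuclideanLin_self (M : Matrix (Fin (n + 1)) (Fin (n + 1)) ℝ) (ξ : Space n) :
    inner ℝ (Matrix.toEuclideanLin M ξ) ξ = (ξ : Fin (n + 1) → ℝ) ⬝ᵥ (M *ᵥ ξ) := by
  rw [inner_toEuclideanLin]
  simp [Matrix.mulVec, dotProduct, mul_comm]

theorem norm_sq_eq_dotProduct (ξ : Space n) : ‖ξ‖ ^ 2 = (ξ : Fin (n + 1) → ℝ) ⬝ᵥ ξ := by
  rw [EuclideanSpace.norm_sq_eq]
  simp [dotProduct, sq]

/-- A symmetric matrix with spectrum in `[lam, Lam]`. -/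
def Elliptic (lam Lam : ℝ) (M : Matrix (Fin (n + 1)) (Fin (n + 1)) ℝ) : Prop :=
  M.IsSymm ∧ ∀ ξ : Space n, lam * ‖ξ‖ ^ 2 ≤ inner ℝ (Matrix.toEuclideanLin M ξ) ξ ∧
    inner ℝ (Matrix.toEuclideanLin M ξ) ξ ≤ Lam * ‖ξ‖ ^ 2

theorem _root_.Matrix.IsSymm.inner_toEuclideanLin_comm
    {M : Matrix (Fin (n + 1)) (Fin (n + 1)) ℝ} (hM : M.IsSymm) (ξ ζ : Space n) :
    inner ℝ (Matrix.toEuclideanLin M ξ) ζ = inner ℝ (Matrix.toEuclideanLin M ζ) ξ := by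
  rw [inner_toEuclideanLin, inner_toEuclideanLin]
  simp_rw [Finset.sum_mul]
  rw [Finset.sum_comm]
  refine Finset.sum_congr rfl fun i _ => Finset.sum_congr rfl fun j _ => ?_
  rw [← hM.apply i j]
  ring

/-- Cauchy–Schwarz for the positive form of `M`, read off from the discriminant. It gives the
constant `Lam` itself, with no dimensional factor. -/
theorem Elliptic.abs_inner_le {lam Lam : ℝ} (hlam : 0 < lam)
    {M : Matrix (Fin (n + 1)) (Fin (n + 1)) ℝ} (hM : Elliptic lam Lam M) (ξ ζ : Space n) :
    |inner ℝ (Matrix.toEuclideanLin M ξ) ζ| ≤ Lam * (‖ξ‖ * ‖ζ‖) := by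
  have hpos : ∀ ξ : Space n, 0 ≤ inner ℝ (Matrix.toEuclideanLin M ξ) ξ := fun ξ =>
    le_trans (by positivity) (hM.2 ξ).1
  have hcs : inner ℝ (Matrix.toEuclideanLin M ξ) ζ ^ 2 ≤
      inner ℝ (Matrix.toEuclideanLin M ξ) ξ * inner ℝ (Matrix.toEuclideanLin M ζ) ζ := by
    have h := discrim_le_zero (a := inner ℝ (Matrix.toEuclideanLin M ξ) ξ)
      (b := 2 * inner ℝ (Matrix.toEuclideanLin M ξ) ζ)
      (c := inner ℝ (Matrix.toEuclideanLin M ζ) ζ) fun t => by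
        have h1 := hpos (t • ξ + ζ)
        simp only [map_add, map_smul, inner_add_left, inner_add_right, real_inner_smul_left,
          real_inner_smul_right, hM.1.inner_toEuclideanLin_comm ζ ξ] at h1
        linarith
    rw [discrim] at h
    nlinarith
  rcases eq_or_ne ξ 0 with rfl | hξ
  · simp
  have hL : 0 ≤ Lam := by
    have h1 := hM.2 ξ
    have h2 : 0 < ‖ξ‖ ^ 2 := by positivity
    nlinarith
  refine abs_le_of_sq_le_sq ?_ (by positivity)
  refine hcs.trans ?_
  calc _ ≤ (Lam * ‖ξ‖ ^ 2) * (Lam * ‖ζ‖ ^ 2) :=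
        mul_le_mul (hM.2 ξ).2 (hM.2 ζ).2 (hpos ζ) (by positivity)
    _ = _ := by ring

theorem Coefficients.UniformlyElliptic.ae_elliptic {c : Coefficients n} {lam Lam : ℝ}
    (h : c.UniformlyElliptic lam Lam) :
    ∀ᵐ x ∂(volume.restrict (halfBall n 1)), Elliptic lam Lam (c.a x) := by
  filter_upwards [h.2] with x hx
  refine ⟨hx.1, fun ξ => ?_⟩
  rw [inner_toEuclideanLin_self, norm_sq_eq_dotProduct]
  exact hx.2 ξ

theorem grad_mul {f g : Space n → ℝ} (hf : Differentiable ℝ f) (hg : Differentiable ℝ g)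
    (x : Space n) : grad (fun x => f x * g x) x = f x • grad g x + g x • grad f x := by
  ext i
  simp only [grad, pderiv_mul hf hg, PiLp.add_apply, PiLp.smul_apply, smul_eq_mul]
  ring

theorem grad_sub {f g : Space n → ℝ} (hf : Differentiable ℝ f) (hg : Differentiable ℝ g)
    (x : Space n) : grad (f - g) x = grad f x - grad g x := by
  ext i
  simp [grad, pderiv, fderiv_sub (hf x) (hg x)]

theorem lintegral_mul_le_sqrt {α : Type*} [MeasurableSpace α] {μ : Measure α} {A B : α → ℝ≥0∞}
    (hA : AEMeasurable A μ) (hB : AEMeasurable B μ) :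
    ∫⁻ x, A x * B x ∂μ ≤ (∫⁻ x, A x ^ 2 ∂μ) ^ (1 / 2 : ℝ) * (∫⁻ x, B x ^ 2 ∂μ) ^ (1 / 2 : ℝ) := by
  have h := ENNReal.lintegral_mul_le_Lp_mul_Lq μ Real.HolderConjugate.two_two hA hB
  refine h.trans (le_of_eq ?_)
  simp

theorem lintegral_sq_rpow_half {α E : Type*} [MeasurableSpace α] [NormedAddCommGroup E]
    {μ : Measure α} (g : α → E) :
    (∫⁻ x, ‖g x‖ₑ ^ 2 ∂μ) ^ (1 / 2 : ℝ) = eLpNorm g 2 μ := by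
  rw [← eLpNorm_two_sq, ← ENNReal.rpow_natCast, ← ENNReal.rpow_mul]
  norm_num

namespace Coefficients

variable (c : Coefficients n)

/-- The weight by which the lower order coefficients enter the energy estimates. -/
def lowWeight (x : Space n) : ℝ≥0∞ := ‖c.b x‖ₑ ^ 2 + ‖c.W x‖ₑ ^ 2 + ‖c.V x‖ₑ

/-- The square mass of `w` inside and of `T` on the boundary, weighted by the lower order
coefficients. -/
def lowMass (ρ : ℝ) (w : Space n → ℝ) (T : Bdry n → ℝ) : ℝ≥0∞ :=
  (∫⁻ x in halfBall n ρ, c.lowWeight x * ‖w x‖ₑ ^ 2) +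
    ∫⁻ x' in flatBall n ρ, ‖c.η x'‖ₑ * ‖T x'‖ₑ ^ 2

variable {c} {ρ : ℝ} {w : Space n → ℝ} {T : Bdry n → ℝ}

theorem lintegral_mul_norm_le_lowMass {m : Space n → Space n}
    (hm : AEStronglyMeasurable m (volume.restrict (halfBall n ρ)))
    (hmw : ∀ x, ‖m x‖ₑ ^ 2 ≤ c.lowWeight x)
    (hw : AEStronglyMeasurable w (volume.restrict (halfBall n ρ))) {E : Type*}
    [NormedAddCommGroup E] {F : Space n → E}
    (hF : AEStronglyMeasurable F (volume.restrict (halfBall n ρ))) :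
    ∫⁻ x in halfBall n ρ, ‖m x‖ₑ * ‖w x‖ₑ * ‖F x‖ₑ ≤
      c.lowMass ρ w T ^ (1 / 2 : ℝ) * eLpNorm F 2 (volume.restrict (halfBall n ρ)) := by
  refine (lintegral_mul_le_sqrt (hm.enorm.mul hw.enorm) hF.enorm).trans ?_
  rw [lintegral_sq_rpow_half]
  refine mul_le_mul' (ENNReal.rpow_le_rpow ?_ (by norm_num)) le_rfl
  refine le_trans (lintegral_mono fun x => ?_) le_self_add
  rw [Pi.mul_apply, mul_pow]
  exact mul_le_mul' (hmw x) le_rfl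

theorem lintegral_weight_mul_mul_le {α : Type*} [MeasurableSpace α] {μ : Measure α}
    {V f g : α → ℝ} (hV : AEStronglyMeasurable V μ) (hf : AEStronglyMeasurable f μ)
    (hg : AEStronglyMeasurable g μ) :
    ∫⁻ x, ‖V x‖ₑ * ‖f x‖ₑ * ‖g x‖ₑ ∂μ ≤ (∫⁻ x, ‖V x‖ₑ * ‖f x‖ₑ ^ 2 ∂μ) ^ (1 / 2 : ℝ) *
      (∫⁻ x, ‖V x‖ₑ * ‖g x‖ₑ ^ 2 ∂μ) ^ (1 / 2 : ℝ) := by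
  have hV' : AEMeasurable (fun x => ‖V x‖ₑ ^ (1 / 2 : ℝ)) μ := hV.enorm.pow_const _
  have h := lintegral_mul_le_sqrt (hV'.mul hf.enorm) (hV'.mul hg.enorm)
  have hs : ∀ x, ‖V x‖ₑ ^ (1 / 2 : ℝ) * ‖V x‖ₑ ^ (1 / 2 : ℝ) = ‖V x‖ₑ := fun x => by
    rw [← ENNReal.rpow_add_of_nonneg _ _ (by norm_num) (by norm_num)]
    norm_num
  refine le_trans (le_of_eq (lintegral_congr fun x => ?_)) (h.trans (le_of_eq ?_))
  · simp only [Pi.mul_apply]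
    conv_lhs => rw [← hs x]
    ring
  · congr 2
    all_goals
      refine lintegral_congr fun x => ?_
      simp only [Pi.mul_apply, mul_pow]
      rw [sq (‖V x‖ₑ ^ (1 / 2 : ℝ)), hs x]

theorem lintegral_V_le_lowMass (hV : AEStronglyMeasurable c.V (volume.restrict (halfBall n ρ)))
    (hw : AEStronglyMeasurable w (volume.restrict (halfBall n ρ))) {g : Space n → ℝ}
    (hg : AEStronglyMeasurable g (volume.restrict (halfBall n ρ))) {T' : Bdry n → ℝ} :
    ∫⁻ x in halfBall n ρ, ‖c.V x‖ₑ * ‖w x‖ₑ * ‖g x‖ₑ ≤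
      c.lowMass ρ w T ^ (1 / 2 : ℝ) * c.lowMass ρ g T' ^ (1 / 2 : ℝ) := by
  refine (lintegral_weight_mul_mul_le hV hw hg).trans ?_
  refine mul_le_mul' (ENNReal.rpow_le_rpow ?_ (by norm_num))
    (ENNReal.rpow_le_rpow ?_ (by norm_num))
  all_goals
    refine le_trans (lintegral_mono fun x => ?_) le_self_add
    exact mul_le_mul' le_add_self le_rfl

theorem lintegral_η_le_lowMass (hη : AEStronglyMeasurable c.η (volume.restrict (flatBall n ρ)))
    (hT : AEStronglyMeasurable T (volume.restrict (flatBall n ρ))) {T' : Bdry n → ℝ}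
    (hT' : AEStronglyMeasurable T' (volume.restrict (flatBall n ρ))) {g : Space n → ℝ} :
    ∫⁻ x' in flatBall n ρ, ‖c.η x'‖ₑ * ‖T x'‖ₑ * ‖T' x'‖ₑ ≤
      c.lowMass ρ w T ^ (1 / 2 : ℝ) * c.lowMass ρ g T' ^ (1 / 2 : ℝ) := by
  refine (lintegral_weight_mul_mul_le hη hT hT').trans ?_
  exact mul_le_mul' (ENNReal.rpow_le_rpow le_add_self (by norm_num))
    (ENNReal.rpow_le_rpow le_add_self (by norm_num))

/-- The squares of `|b|` and `|W|` lie in `L_{p/2}` with `p / 2 > d / 2`, so they are form-small for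
the same reason as `V`. -/
theorem LowerOrderIntegrable.exists_lowMass_le {p q s : ℝ≥0∞} (hn : 1 ≤ n)
    (hp : ((n + 1 : ℕ) : ℝ≥0∞) < p) (hq : ((n + 1 : ℕ) : ℝ≥0∞) / 2 < q) (hs : (n : ℝ≥0∞) < s)
    (h : c.LowerOrderIntegrable p q s) :
    ∃ κ : ℝ → ℝ≥0∞, Tendsto κ (𝓝[>] 0) (𝓝 0) ∧ ∀ r ≤ 1 / 2, ∀ f : Space n → ℝ, ContDiff ℝ ∞ f →
      (∀ x, r ≤ ‖x‖ → f x = 0) → c.lowMass (1 / 2) f (fun x' => f (incl x')) ≤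
        κ r * eLpNorm (grad f) 2 (volume.restrict (upperHalf n)) ^ 2 := by
  obtain ⟨hb, hW, hV, hη⟩ := h (1 / 2) (by norm_num) (by norm_num)
  have hp2 : ((n + 1 : ℕ) : ℝ≥0∞) / 2 < p / 2 :=
    ENNReal.div_lt_div_right (by norm_num) (by norm_num) hp
  obtain ⟨κ₁, h₁, h₁'⟩ := exists_modulus_interior hn hp2 (by norm_num) (hb.norm_rpow_div 2)
  obtain ⟨κ₂, h₂, h₂'⟩ := exists_modulus_interior hn hp2 (by norm_num) (hW.norm_rpow_div 2)
  obtain ⟨κ₃, h₃, h₃'⟩ := exists_modulus_interior hn hq (by norm_num) hV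
  obtain ⟨κ₄, h₄, h₄'⟩ := exists_modulus_boundary hn hs (by norm_num) hη
  refine ⟨fun r => κ₁ r + κ₂ r + κ₃ r + κ₄ r, by simpa using ((h₁.add h₂).add h₃).add h₄,
    fun r hr f hf hf0 => ?_⟩
  have hfm : AEMeasurable (fun x => ‖f x‖ₑ ^ 2) (volume.restrict (halfBall n (1 / 2))) :=
    (hf.continuous.enorm.measurable.pow_const 2).aemeasurable
  have e₁ := h₁' r hr f hf hf0
  have e₂ := h₂' r hr f hf hf0
  have e₃ := h₃' r hr f hf hf0
  have e₄ := h₄' r hr f hf hf0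
  have hsq : ∀ y : Space n, ‖‖y‖ ^ (2 : ℝ≥0∞).toReal‖ₑ = ‖y‖ₑ ^ 2 := fun y => by
    simp [enorm_pow]
  simp only [hsq] at e₁ e₂
  rw [lowMass, add_mul, add_mul, add_mul]
  refine add_le_add ?_ e₄
  simp only [lowWeight, add_mul]
  have hm₁ : AEMeasurable (fun x => ‖c.b x‖ₑ ^ 2 * ‖f x‖ₑ ^ 2)
    (volume.restrict (halfBall n (1 / 2))) := (hb.1.enorm.pow_const 2).mul hfm
  have hm₂ : AEMeasurable (fun x => ‖c.W x‖ₑ ^ 2 * ‖f x‖ₑ ^ 2)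
    (volume.restrict (halfBall n (1 / 2))) := (hW.1.enorm.pow_const 2).mul hfm
  have hm₃ : AEMeasurable (fun x => ‖c.b x‖ₑ ^ 2 * ‖f x‖ₑ ^ 2 + ‖c.W x‖ₑ ^ 2 * ‖f x‖ₑ ^ 2)
    (volume.restrict (halfBall n (1 / 2))) := hm₁.add hm₂
  rw [lintegral_add_left' hm₃, lintegral_add_left' hm₁]
  exact add_le_add (add_le_add e₁ e₂) e₃

end Coefficients

/-! ### The weak formulation and smooth approximate solutions -/

namespace Coefficients

variable (c : Coefficients n)

/-- The interior density of the weak formulation. -/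
def bulk (w : Space n → ℝ) (Dw : Space n → Space n) (φ : Space n → ℝ) (x : Space n) : ℝ :=
  -inner ℝ (Matrix.toEuclideanLin (c.a x) (Dw x)) (grad φ x) - w x * inner ℝ (c.b x) (grad φ x)
    + inner ℝ (c.W x) (Dw x) * φ x + c.V x * w x * φ x

/-- The weak formulation on the half ball of radius `ρ`. -/
def weakForm (ρ : ℝ) (w : Space n → ℝ) (Dw : Space n → Space n) (T : Bdry n → ℝ)
    (φ : Space n → ℝ) : ℝ :=
  (∫ x in halfBall n ρ, c.bulk w Dw φ x) + ∫ x' in flatBall n ρ, c.η x' * T x' * φ (incl x')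

variable {c}

theorem bulk_eq (w : Space n → ℝ) (Dw : Space n → Space n) (φ : Space n → ℝ) (x : Space n) :
    c.bulk w Dw φ x = -(∑ i, ((∑ j, c.a x i j * Dw x j) + c.b x i * w x) * pderiv i φ x)
          + ((∑ i, c.W x i * Dw x i) + c.V x * w x) * φ x := by
  rw [bulk, inner_toEuclideanLin, PiLp.inner_apply, PiLp.inner_apply]
  have h1 : ∀ i, grad φ x i = pderiv i φ x := fun i => rfl
  simp only [h1, RCLike.inner_apply, conj_trivial, add_mul, Finset.sum_add_distrib, Finset.mul_sum]
  have h2 : ∑ i, c.b x i * w x * pderiv i φ x = ∑ i, w x * (pderiv i φ x * c.b x i) :=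
    Finset.sum_congr rfl fun i _ => by ring
  have h3 : ∑ i, c.W x i * Dw x i = ∑ i, Dw x i * c.W x i :=
    Finset.sum_congr rfl fun i _ => by ring
  rw [h2, h3]
  ring

theorem bulk_sub (w w' : Space n → ℝ) (Dw Dw' : Space n → Space n) (φ : Space n → ℝ)
    (x : Space n) : c.bulk (w - w') (Dw - Dw') φ x = c.bulk w Dw φ x - c.bulk w' Dw' φ x := by
  simp only [bulk, Pi.sub_apply, map_sub, inner_sub_left, inner_sub_right]
  ring

theorem bulk_eq_zero {w : Space n → ℝ} {Dw : Space n → Space n} {φ : Space n → ℝ} {x : Space n}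
    (hx : x ∉ tsupport φ) : c.bulk w Dw φ x = 0 := by
  simp [bulk, grad_eq_zero_of_notMem hx, image_eq_zero_of_notMem_tsupport hx]

theorem norm_incl (x' : Bdry n) : ‖incl x'‖ = ‖x'‖ := by
  have h := isometry_incl.dist_eq x' 0
  rwa [incl_zero, dist_zero_right, dist_zero_right] at h

theorem weakForm_eq_of_le {ρ R : ℝ} (hρ : ρ ≤ R) {w : Space n → ℝ} {Dw : Space n → Space n}
    {T : Bdry n → ℝ} {φ : Space n → ℝ} (hφ : IsTestFunction (Metric.ball 0 ρ) φ) :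
    c.weakForm ρ w Dw T φ = c.weakForm R w Dw T φ := by
  rw [weakForm, weakForm]
  congr 1
  · refine (setIntegral_eq_of_subset_of_forall_sdiff_eq_zero measurableSet_halfBall
      (monotone_halfBall hρ) fun x hx => bulk_eq_zero fun h => hx.2 ⟨hx.1.1, hφ.2.2 h⟩).symm
  · refine (setIntegral_eq_of_subset_of_forall_sdiff_eq_zero measurableSet_ball
      (monotone_flatBall hρ) fun x hx => ?_).symm
    rw [image_eq_zero_of_notMem_tsupport (f := φ), mul_zero]
    intro h
    refine hx.2 (mem_ball_zero_iff.2 ?_)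
    rw [← norm_incl]
    exact mem_ball_zero_iff.1 (hφ.2.2 h)

/-- Measurability of the coefficients in the half ball of radius `ρ`. -/
structure MeasurableOn (c : Coefficients n) (ρ : ℝ) : Prop where
  a : ∀ i j, AEStronglyMeasurable (fun x => c.a x i j) (volume.restrict (halfBall n ρ))
  b : AEStronglyMeasurable c.b (volume.restrict (halfBall n ρ))
  W : AEStronglyMeasurable c.W (volume.restrict (halfBall n ρ))
  V : AEStronglyMeasurable c.V (volume.restrict (halfBall n ρ))
  η : AEStronglyMeasurable c.η (volume.restrict (flatBall n ρ))

variable {ρ : ℝ} {w : Space n → ℝ} {Dw : Space n → Space n} {T : Bdry n → ℝ} {φ : Space n → ℝ}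

theorem MeasurableOn.inner_a (hc : c.MeasurableOn ρ) {F G : Space n → Space n}
    (hF : AEStronglyMeasurable F (volume.restrict (halfBall n ρ)))
    (hG : AEStronglyMeasurable G (volume.restrict (halfBall n ρ))) :
    AEStronglyMeasurable (fun x => inner ℝ (Matrix.toEuclideanLin (c.a x) (F x)) (G x))
      (volume.restrict (halfBall n ρ)) := by
  simp only [inner_toEuclideanLin]
  have hco : ∀ (H : Space n → Space n),
      AEStronglyMeasurable H (volume.restrict (halfBall n ρ)) → ∀ i,
      AEStronglyMeasurable (fun x => H x i) (volume.restrict (halfBall n ρ)) := fun H hH i =>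
    (continuous_coord i).comp_aestronglyMeasurable hH
  exact Finset.aestronglyMeasurable_fun_sum _ fun i _ =>
    (Finset.aestronglyMeasurable_fun_sum _ fun j _ => (hc.a i j).mul (hco F hF j)).mul (hco G hG i)

theorem MeasurableOn.bulk (hc : c.MeasurableOn ρ)
    (hw : AEStronglyMeasurable w (volume.restrict (halfBall n ρ)))
    (hDw : AEStronglyMeasurable Dw (volume.restrict (halfBall n ρ))) (hφ : ContDiff ℝ ∞ φ) :
    AEStronglyMeasurable (c.bulk w Dw φ) (volume.restrict (halfBall n ρ)) := by
  have hg := (continuous_grad hφ).aestronglyMeasurable (μ := volume.restrict (halfBall n ρ))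
  have hp := hφ.continuous.aestronglyMeasurable (μ := volume.restrict (halfBall n ρ))
  exact ((((hc.inner_a hDw hg).neg).sub (hw.mul (hc.b.inner hg))).add
    ((hc.W.inner hDw).mul hp)).add ((hc.V.mul hw).mul hp)

theorem enorm_inner_le (x y : Space n) : ‖inner ℝ x y‖ₑ ≤ ‖x‖ₑ * ‖y‖ₑ := by
  rw [← ofReal_norm, ← ofReal_norm, ← ofReal_norm, ← ENNReal.ofReal_mul (norm_nonneg _)]
  exact ENNReal.ofReal_le_ofReal (norm_inner_le_norm x y)

theorem enorm_bulk_le {lam Lam : ℝ} (hlam : 0 < lam) {x : Space n}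
    (hx : Elliptic lam Lam (c.a x)) :
    ‖c.bulk w Dw φ x‖ₑ ≤ ENNReal.ofReal Lam * (‖Dw x‖ₑ * ‖grad φ x‖ₑ) +
      ‖c.b x‖ₑ * ‖w x‖ₑ * ‖grad φ x‖ₑ + ‖c.W x‖ₑ * ‖φ x‖ₑ * ‖Dw x‖ₑ +
        ‖c.V x‖ₑ * ‖w x‖ₑ * ‖φ x‖ₑ := by
  have h1 : ‖inner ℝ (Matrix.toEuclideanLin (c.a x) (Dw x)) (grad φ x)‖ₑ ≤
      ENNReal.ofReal Lam * (‖Dw x‖ₑ * ‖grad φ x‖ₑ) := by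
    rw [← ofReal_norm, ← ofReal_norm, ← ofReal_norm, ← ENNReal.ofReal_mul (norm_nonneg _),
      ← ENNReal.ofReal_mul' (by positivity)]
    exact ENNReal.ofReal_le_ofReal (hx.abs_inner_le hlam _ _)
  have h2 : ‖w x * inner ℝ (c.b x) (grad φ x)‖ₑ ≤ ‖c.b x‖ₑ * ‖w x‖ₑ * ‖grad φ x‖ₑ := by
    rw [enorm_mul]
    calc _ ≤ ‖w x‖ₑ * (‖c.b x‖ₑ * ‖grad φ x‖ₑ) := mul_le_mul' le_rfl (enorm_inner_le _ _)
      _ = _ := by ring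
  have h3 : ‖inner ℝ (c.W x) (Dw x) * φ x‖ₑ ≤ ‖c.W x‖ₑ * ‖φ x‖ₑ * ‖Dw x‖ₑ := by
    rw [enorm_mul]
    calc _ ≤ ‖c.W x‖ₑ * ‖Dw x‖ₑ * ‖φ x‖ₑ := mul_le_mul' (enorm_inner_le _ _) le_rfl
      _ = _ := by ring
  have h4 : ‖c.V x * w x * φ x‖ₑ = ‖c.V x‖ₑ * ‖w x‖ₑ * ‖φ x‖ₑ := by
    rw [enorm_mul, enorm_mul]
  rw [bulk]
  refine (enorm_add_le _ _).trans (add_le_add ?_ h4.le)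
  refine (enorm_add_le _ _).trans (add_le_add ?_ h3)
  refine enorm_sub_le.trans (add_le_add ?_ h2)
  rwa [enorm_neg]

/-- Cauchy–Schwarz term by term, with the weights distributed between `w` and `φ`. It bounds the
weak form by `‖∇φ‖` times the energy of `w`; for `w` the difference of an approximation and the
solution, this says that the approximation nearly solves the equation. -/
theorem lintegral_bulk_le {lam Lam : ℝ} (hlam : 0 < lam) (hc : c.MeasurableOn ρ)
    (hell : ∀ᵐ x ∂(volume.restrict (halfBall n ρ)), Elliptic lam Lam (c.a x))
    (hw : AEStronglyMeasurable w (volume.restrict (halfBall n ρ)))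
    (hDw : AEStronglyMeasurable Dw (volume.restrict (halfBall n ρ)))
    (hT : AEStronglyMeasurable T (volume.restrict (flatBall n ρ))) (hφ : ContDiff ℝ ∞ φ)
    (hm : c.lowMass ρ φ (fun x' => φ (incl x')) ≤
      eLpNorm (grad φ) 2 (volume.restrict (upperHalf n)) ^ 2) :
    (∫⁻ x in halfBall n ρ, ‖c.bulk w Dw φ x‖ₑ) +
      ∫⁻ x' in flatBall n ρ, ‖c.η x' * T x' * φ (incl x')‖ₑ ≤
      ((ENNReal.ofReal Lam + 1) * eLpNorm Dw 2 (volume.restrict (halfBall n ρ)) +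
        3 * c.lowMass ρ w T ^ (1 / 2 : ℝ)) *
        eLpNorm (grad φ) 2 (volume.restrict (upperHalf n)) := by
  set μ := volume.restrict (halfBall n ρ) with hμ
  set G := eLpNorm (grad φ) 2 (volume.restrict (upperHalf n)) with hG
  set X := eLpNorm Dw 2 μ
  set m := c.lowMass ρ w T ^ (1 / 2 : ℝ)
  have hg := (continuous_grad hφ).aestronglyMeasurable (μ := μ)
  have hp := hφ.continuous.aestronglyMeasurable (μ := μ)
  have hGle : eLpNorm (grad φ) 2 μ ≤ G :=
    eLpNorm_mono_measure _ (Measure.restrict_mono_set _ Set.inter_subset_left)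
  have hφm : c.lowMass ρ φ (fun x' => φ (incl x')) ^ (1 / 2 : ℝ) ≤ G := by
    refine (ENNReal.rpow_le_rpow hm (by norm_num)).trans (le_of_eq ?_)
    rw [← ENNReal.rpow_natCast, ← ENNReal.rpow_mul]
    norm_num
  have e1 : ∫⁻ x, ENNReal.ofReal Lam * (‖Dw x‖ₑ * ‖grad φ x‖ₑ) ∂μ ≤
      ENNReal.ofReal Lam * (X * G) := by
    rw [lintegral_const_mul' _ _ (by simp)]
    refine mul_le_mul' le_rfl ((lintegral_mul_le_sqrt hDw.enorm hg.enorm).trans ?_)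
    rw [lintegral_sq_rpow_half, lintegral_sq_rpow_half]
    exact mul_le_mul' le_rfl hGle
  have e2 : ∫⁻ x, ‖c.b x‖ₑ * ‖w x‖ₑ * ‖grad φ x‖ₑ ∂μ ≤ m * G :=
    (lintegral_mul_norm_le_lowMass hc.b
      (fun x => by rw [lowWeight, add_assoc]; exact le_self_add) hw hg).trans
        (mul_le_mul' le_rfl hGle)
  have e3 : ∫⁻ x, ‖c.W x‖ₑ * ‖φ x‖ₑ * ‖Dw x‖ₑ ∂μ ≤ G * X :=
    (lintegral_mul_norm_le_lowMass hc.W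
      (fun x => by rw [lowWeight, add_right_comm]; exact le_add_self) hp hDw).trans
        (mul_le_mul' hφm le_rfl)
  have e4 : ∫⁻ x, ‖c.V x‖ₑ * ‖w x‖ₑ * ‖φ x‖ₑ ∂μ ≤ m * G :=
    (lintegral_V_le_lowMass hc.V hw hp).trans (mul_le_mul' le_rfl hφm)
  have e5 : ∫⁻ x' in flatBall n ρ, ‖c.η x' * T x' * φ (incl x')‖ₑ ≤ m * G := by
    simp only [enorm_mul]
    exact (lintegral_η_le_lowMass hc.η hT
      (hφ.continuous.comp continuous_incl).aestronglyMeasurable).trans (mul_le_mul' le_rfl hφm)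
  have m1 : AEMeasurable (fun x => ENNReal.ofReal Lam * (‖Dw x‖ₑ * ‖grad φ x‖ₑ)) μ :=
    (hDw.enorm.mul hg.enorm).const_mul _
  have m2 : AEMeasurable (fun x => ‖c.b x‖ₑ * ‖w x‖ₑ * ‖grad φ x‖ₑ) μ :=
    (hc.b.enorm.mul hw.enorm).mul hg.enorm
  have m3 : AEMeasurable (fun x => ‖c.W x‖ₑ * ‖φ x‖ₑ * ‖Dw x‖ₑ) μ :=
    (hc.W.enorm.mul hp.enorm).mul hDw.enorm
  have m12 : AEMeasurable (fun x => ENNReal.ofReal Lam * (‖Dw x‖ₑ * ‖grad φ x‖ₑ) +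
    ‖c.b x‖ₑ * ‖w x‖ₑ * ‖grad φ x‖ₑ) μ := m1.add m2
  have m123 : AEMeasurable (fun x => ENNReal.ofReal Lam * (‖Dw x‖ₑ * ‖grad φ x‖ₑ) +
    ‖c.b x‖ₑ * ‖w x‖ₑ * ‖grad φ x‖ₑ + ‖c.W x‖ₑ * ‖φ x‖ₑ * ‖Dw x‖ₑ) μ := m12.add m3
  calc _ ≤ (ENNReal.ofReal Lam * (X * G) + m * G + G * X + m * G) + m * G := by
        refine add_le_add ?_ e5
        refine (lintegral_mono_ae (hell.mono fun x hx => enorm_bulk_le hlam hx)).trans ?_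
        rw [lintegral_add_left' m123, lintegral_add_left' m12, lintegral_add_left' m1]
        exact add_le_add (add_le_add (add_le_add e1 e2) e3) e4
    _ = _ := by ring

theorem integrable_of_lintegral_bulk {lam Lam : ℝ} (hlam : 0 < lam) (hc : c.MeasurableOn ρ)
    (hell : ∀ᵐ x ∂(volume.restrict (halfBall n ρ)), Elliptic lam Lam (c.a x))
    (hw : AEStronglyMeasurable w (volume.restrict (halfBall n ρ)))
    (hDw : MemLp Dw 2 (volume.restrict (halfBall n ρ)))
    (hT : AEStronglyMeasurable T (volume.restrict (flatBall n ρ))) (hφ : ContDiff ℝ ∞ φ)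
    (hφc : HasCompactSupport φ)
    (hm : c.lowMass ρ φ (fun x' => φ (incl x')) ≤
      eLpNorm (grad φ) 2 (volume.restrict (upperHalf n)) ^ 2) (hwm : c.lowMass ρ w T ≠ ⊤) :
    IntegrableOn (c.bulk w Dw φ) (halfBall n ρ) ∧
      IntegrableOn (fun x' => c.η x' * T x' * φ (incl x')) (flatBall n ρ) := by
  have h := lintegral_bulk_le hlam hc hell hw hDw.1 hT hφ hm
  have hG : eLpNorm (grad φ) 2 (volume.restrict (upperHalf n)) ≠ ⊤ := by
    have hgc : HasCompactSupport (grad φ) :=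
      HasCompactSupport.intro hφc.isCompact fun x hx => grad_eq_zero_of_notMem hx
    exact (((continuous_grad hφ).memLp_of_hasCompactSupport hgc).restrict _).2.ne
  have hfin : ((ENNReal.ofReal Lam + 1) * eLpNorm Dw 2 (volume.restrict (halfBall n ρ)) +
        3 * c.lowMass ρ w T ^ (1 / 2 : ℝ)) *
        eLpNorm (grad φ) 2 (volume.restrict (upperHalf n)) < ⊤ := by
    have h1 := hDw.2.ne
    have h2 := ENNReal.rpow_ne_top_of_nonneg (show (0 : ℝ) ≤ 1 / 2 by norm_num) hwm
    finiteness
  refine ⟨⟨hc.bulk hw hDw.1 hφ, ?_⟩, ⟨(hc.η.mul hT).mul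
    (hφ.continuous.comp continuous_incl).aestronglyMeasurable, ?_⟩⟩
  · exact lt_of_le_of_lt (le_self_add.trans h) hfin
  · exact lt_of_le_of_lt (le_add_self.trans h) hfin

end Coefficients

theorem eLpNorm_upperHalf_eq_halfBall {E : Type*} [NormedAddCommGroup E] {g : Space n → E} {R : ℝ}
    (hg : ∀ x, x ∉ Metric.ball 0 R → g x = 0) {p : ℝ≥0∞} :
    eLpNorm g p (volume.restrict (upperHalf n)) = eLpNorm g p (volume.restrict (halfBall n R)) := by
  have hs : Function.support g ⊆ Metric.ball 0 R := fun x hx => by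
    by_contra h
    exact hx (hg x h)
  have h : eLpNorm g p ((volume.restrict (upperHalf n)).restrict (Metric.ball 0 R)) =
      eLpNorm g p (volume.restrict (upperHalf n)) :=
    eLpNorm_restrict_eq_of_support_subset (ε := E) hs
  rw [← h, Measure.restrict_restrict measurableSet_ball, Set.inter_comm]
  rfl

theorem eLpNorm_smul_le {E : Type*} [NormedAddCommGroup E] [NormedSpace ℝ E] {f : Space n → ℝ}
    {g : Space n → E} {M : ℝ} (hf : ∀ x, |f x| ≤ M) {μ : Measure (Space n)} :
    eLpNorm (fun x => f x • g x) 2 μ ≤ ENNReal.ofReal M * eLpNorm g 2 μ := by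
  refine eLpNorm_le_mul_eLpNorm_of_ae_le_mul (Eventually.of_forall fun x => ?_) 2
  rw [norm_smul]
  exact mul_le_mul_of_nonneg_right (hf x) (norm_nonneg _)

theorem eLpNorm_smul_le' {E : Type*} [NormedAddCommGroup E] [NormedSpace ℝ E] {f : Space n → ℝ}
    {g : Space n → E} {M : ℝ} (hg : ∀ x, ‖g x‖ ≤ M) {μ : Measure (Space n)} :
    eLpNorm (fun x => f x • g x) 2 μ ≤ ENNReal.ofReal M * eLpNorm f 2 μ := by
  refine eLpNorm_le_mul_eLpNorm_of_ae_le_mul (Eventually.of_forall fun x => ?_) 2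
  rw [norm_smul, mul_comm]
  exact mul_le_mul_of_nonneg_right (hg x) (norm_nonneg _)

theorem eLpNorm_grad_mul_le {χ v : Space n → ℝ} (hχ : ContDiff ℝ ∞ χ) (hv : ContDiff ℝ ∞ v)
    {R M : ℝ} (hχs : tsupport χ ⊆ Metric.ball 0 R) (hχ1 : ∀ x, |χ x| ≤ 1)
    (hχM : ∀ x, ‖grad χ x‖ ≤ M) :
    eLpNorm (grad fun x => χ x * v x) 2 (volume.restrict (upperHalf n)) ≤
      eLpNorm (grad v) 2 (volume.restrict (halfBall n R)) +
        ENNReal.ofReal M * eLpNorm v 2 (volume.restrict (halfBall n R)) := by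
  have h1 : (grad fun x => χ x * v x) = (fun x => χ x • grad v x) + fun x => v x • grad χ x := by
    ext1 x
    exact grad_mul (hχ.differentiable (by simp)) (hv.differentiable (by simp)) x
  rw [eLpNorm_upperHalf_eq_halfBall (R := R), h1]
  · have hgv := continuous_grad hv
    have hgχ := continuous_grad hχ
    have hc := hχ.continuous
    have hc' := hv.continuous
    refine (eLpNorm_add_le (Continuous.aestronglyMeasurable (by fun_prop))
      (Continuous.aestronglyMeasurable (by fun_prop)) (by norm_num)).trans (add_le_add ?_ ?_)
    · refine (eLpNorm_smul_le hχ1).trans (le_of_eq ?_)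
      simp
    · exact eLpNorm_smul_le' hχM
  · intro x hx
    have hx' : x ∉ tsupport χ := fun h => hx (hχs h)
    rw [h1, Pi.add_apply, grad_eq_zero_of_notMem hx', image_eq_zero_of_notMem_tsupport hx']
    simp

/-- Fatou's lemma. It transfers weighted bounds from smooth functions to the solution and its trace
without prior integrability. -/
theorem lintegral_weight_le_of_tendsto {α : Type*} [MeasurableSpace α] {μ : Measure α}
    {g : α → ℝ≥0∞} (hg : AEMeasurable g μ) (hgt : ∀ x, g x ≠ ⊤) {w : ℕ → α → ℝ} {w' : α → ℝ}
    (hw : ∀ l, AEStronglyMeasurable (w l) μ)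
    (hlim : ∀ᵐ x ∂μ, Tendsto (fun l => w l x) atTop (𝓝 (w' x))) {B : ℕ → ℝ≥0∞} {B' : ℝ≥0∞}
    (hB : Tendsto B atTop (𝓝 B')) (h : ∀ l, ∫⁻ x, g x * ‖w l x‖ₑ ^ 2 ∂μ ≤ B l) :
    ∫⁻ x, g x * ‖w' x‖ₑ ^ 2 ∂μ ≤ B' := by
  calc ∫⁻ x, g x * ‖w' x‖ₑ ^ 2 ∂μ
      = ∫⁻ x, liminf (fun l => g x * ‖w l x‖ₑ ^ 2) atTop ∂μ := by
        refine lintegral_congr_ae (hlim.mono fun x hx => ?_)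
        have hc : Continuous fun y : ℝ => ‖y‖ₑ ^ 2 :=
          (ENNReal.continuous_pow 2).comp continuous_enorm
        exact (ENNReal.Tendsto.const_mul ((hc.tendsto _).comp hx) (Or.inr (hgt x))).liminf_eq.symm
    _ ≤ liminf (fun l => ∫⁻ x, g x * ‖w l x‖ₑ ^ 2 ∂μ) atTop :=
        lintegral_liminf_le' fun l => hg.mul ((hw l).enorm.pow_const 2)
    _ ≤ liminf B atTop := liminf_le_liminf (Eventually.of_forall h)
    _ = B' := hB.liminf_eq

namespace Coefficients

variable {c : Coefficients n} {ρ : ℝ}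

/-- Multiplication by a cut-off that is 1 on the ball of radius `ρ` and supported in the ball of
radius `2ρ` reduces the claim to `hsmall`; `M` bounds the gradient of the cut-off. -/
theorem exists_lowMass_le_of_cutoff (hρ : 0 < ρ) (hρ4 : ρ ≤ 1 / 4)
    (hsmall : ∀ f : Space n → ℝ, ContDiff ℝ ∞ f → (∀ x, 2 * ρ ≤ ‖x‖ → f x = 0) →
      c.lowMass (1 / 2) f (fun x' => f (incl x')) ≤
        eLpNorm (grad f) 2 (volume.restrict (upperHalf n)) ^ 2) :
    ∃ M : ℝ, ∀ v : Space n → ℝ, ContDiff ℝ ∞ v → c.lowMass ρ v (fun x' => v (incl x')) ≤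
      (eLpNorm (grad v) 2 (volume.restrict (halfBall n 1)) +
        ENNReal.ofReal M * eLpNorm v 2 (volume.restrict (halfBall n 1))) ^ 2 := by
  let χ : ContDiffBump (0 : Space n) := ⟨ρ, 2 * ρ, hρ, by linarith⟩
  have hχ : ContDiff ℝ ∞ χ := χ.contDiff
  have hgcs : HasCompactSupport (grad χ) :=
    HasCompactSupport.intro χ.hasCompactSupport.isCompact fun x hx => grad_eq_zero_of_notMem hx
  obtain ⟨M, hM⟩ := (continuous_grad hχ).bounded_above_of_compact_support hgcs
  refine ⟨M, fun v hv => ?_⟩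
  have hts : tsupport χ ⊆ Metric.ball 0 1 := by
    rw [χ.tsupport_eq]
    exact Metric.closedBall_subset_ball (by change 2 * ρ < 1; linarith)
  have h1 : c.lowMass ρ v (fun x' => v (incl x')) ≤
      c.lowMass (1 / 2) (fun x => χ x * v x) (fun x' => χ (incl x') * v (incl x')) := by
    have hone : ∀ x : Space n, ‖x‖ < ρ → χ x = 1 := fun x hx =>
      χ.one_of_mem_closedBall (mem_closedBall_zero_iff.2 hx.le)
    refine add_le_add ?_ ?_
    · refine Eq.trans_le (b := ∫⁻ x in halfBall n ρ, c.lowWeight x * ‖χ x * v x‖ₑ ^ 2) ?_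
        (lintegral_mono_set (monotone_halfBall (by linarith)))
      refine setLIntegral_congr_fun measurableSet_halfBall fun x hx => ?_
      simp only [hone x (mem_ball_zero_iff.1 hx.2), one_mul]
    · refine Eq.trans_le
        (b := ∫⁻ x' in flatBall n ρ, ‖c.η x'‖ₑ * ‖χ (incl x') * v (incl x')‖ₑ ^ 2) ?_
        (lintegral_mono_set (monotone_flatBall (by linarith)))
      refine setLIntegral_congr_fun measurableSet_ball fun x hx => ?_
      simp only [hone (incl x) (by rw [norm_incl]; exact mem_ball_zero_iff.1 hx), one_mul]
  refine h1.trans ((hsmall _ (hχ.mul hv) fun x hx => ?_).trans (pow_le_pow_left' ?_ 2))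
  · rw [χ.zero_of_le_dist (by rw [dist_zero_right]; exact hx), zero_mul]
  · exact eLpNorm_grad_mul_le hχ hv hts
      (fun x => by rw [abs_of_nonneg χ.nonneg]; exact χ.le_one) hM

theorem IsWeakSolution.weakForm_eq_zero {u : Space n → ℝ} {Du : Space n → Space n}
    {T : Bdry n → ℝ} (hρ : ρ ≤ 1)
    (h : ∀ φ : Space n → ℝ, IsTestFunction (Metric.ball 0 1) φ →
      (∫ x in halfBall n 1,
        (-(∑ i, ((∑ j, c.a x i j * Du x j) + c.b x i * u x) * pderiv i φ x)
          + ((∑ i, c.W x i * Du x i) + c.V x * u x) * φ x))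
      + ∫ x' in flatBall n 1, c.η x' * T x' * φ (incl x') = 0) {φ : Space n → ℝ}
    (hφ : IsTestFunction (Metric.ball 0 ρ) φ) : c.weakForm ρ u Du T φ = 0 := by
  rw [weakForm_eq_of_le hρ hφ, weakForm]
  simp only [bulk_eq]
  exact h φ ⟨hφ.1, hφ.2.1, hφ.2.2.trans (Metric.ball_subset_ball hρ)⟩

theorem exists_seq_tendsto_ae_trace {u : Space n → ℝ} {Du : Space n → Space n} {T : Bdry n → ℝ}
    (hu : HasH1Gradient (halfBall n 1) u Du) (hT : IsTrace u Du T) :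
    ∃ v : ℕ → Space n → ℝ, (∀ k, ContDiff ℝ ∞ (v k)) ∧
      (∀ k, eLpNorm (v k - u) 2 (volume.restrict (halfBall n 1)) ≤ 1) ∧
      (∀ k, eLpNorm (grad (v k) - Du) 2 (volume.restrict (halfBall n 1)) ≤ 1) ∧
      Tendsto (fun k => eLpNorm (v k - u) 2 (volume.restrict (halfBall n 1))) atTop (𝓝 0) ∧
      Tendsto (fun k => eLpNorm (grad (v k) - Du) 2 (volume.restrict (halfBall n 1)))
        atTop (𝓝 0) ∧
      (∀ᵐ x ∂volume.restrict (halfBall n 1), Tendsto (fun k => v k x) atTop (𝓝 (u x))) ∧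
      ∀ᵐ x' ∂volume.restrict (flatBall n 1), Tendsto (fun k => v k (incl x')) atTop (𝓝 (T x')) := by
  obtain ⟨hTm, v, hv, h1, h2, h3⟩ := hT
  obtain ⟨N, hN⟩ := eventually_atTop.1
    ((h1.eventually_le_const zero_lt_one).and (h2.eventually_le_const zero_lt_one))
  have hadd : Tendsto (fun k => N + k) atTop atTop :=
    tendsto_atTop_mono (fun k => Nat.le_add_left k N) tendsto_id
  obtain ⟨σ, hσ, hσu⟩ := (tendstoInMeasure_of_tendsto_eLpNorm two_ne_zero
    (fun k => (hv (N + k)).continuous.aestronglyMeasurable) hu.memLp.1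
    (h1.comp hadd)).exists_seq_tendsto_ae
  obtain ⟨τ, hτ, hτT⟩ := (tendstoInMeasure_of_tendsto_eLpNorm two_ne_zero
    (fun k => ((hv (N + σ k)).continuous.comp continuous_incl).aestronglyMeasurable) hTm.1
    (h3.comp (hadd.comp hσ.tendsto_atTop))).exists_seq_tendsto_ae
  have ht : Tendsto (fun k => N + σ (τ k)) atTop atTop :=
    hadd.comp (hσ.tendsto_atTop.comp hτ.tendsto_atTop)
  exact ⟨fun k => v (N + σ (τ k)), fun k => hv _, fun k => (hN _ (Nat.le_add_right _ _)).1,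
    fun k => (hN _ (Nat.le_add_right _ _)).2, h1.comp ht, h2.comp ht,
    hσu.mono fun x hx => hx.comp hτ.tendsto_atTop, hτT⟩

/-- A weak solution is a limit of smooth functions that solve the equation up to errors that
tend to zero in the dual of the energy space. -/
theorem IsWeakSolution.exists_approx {lam Lam : ℝ} (hlam : 0 < lam) {u : Space n → ℝ}
    (hsol : c.IsWeakSolution u) (hρ : 0 < ρ) (hρ4 : ρ ≤ 1 / 4) (hc : c.MeasurableOn ρ)
    (hell : ∀ᵐ x ∂(volume.restrict (halfBall n ρ)), Elliptic lam Lam (c.a x))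
    (hsmall : ∀ f : Space n → ℝ, ContDiff ℝ ∞ f → (∀ x, 2 * ρ ≤ ‖x‖ → f x = 0) →
      c.lowMass (1 / 2) f (fun x' => f (incl x')) ≤
        eLpNorm (grad f) 2 (volume.restrict (upperHalf n)) ^ 2) :
    ∃ (v : ℕ → Space n → ℝ) (δ : ℕ → ℝ), (∀ k, ContDiff ℝ ∞ (v k)) ∧ (∀ k, 0 ≤ δ k) ∧
      Tendsto δ atTop (𝓝 0) ∧
      Tendsto (fun k => eLpNorm (v k - u) 2 (volume.restrict (halfBall n 1))) atTop (𝓝 0) ∧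
      ∀ k φ, IsTestFunction (Metric.ball 0 ρ) φ →
        |c.weakForm ρ (v k) (grad (v k)) (fun x' => v k (incl x')) φ| ≤
          δ k * (eLpNorm (grad φ) 2 (volume.restrict (upperHalf n))).toReal := by
  obtain ⟨Du, T, hH1, htr, hweak⟩ := hsol
  have hTm : AEStronglyMeasurable T (volume.restrict (flatBall n 1)) := htr.1.1
  obtain ⟨v, hv, hA1, hA1', hA, hA', hae, haeT⟩ := exists_seq_tendsto_ae_trace hH1 htr
  obtain ⟨M, hM⟩ := exists_lowMass_le_of_cutoff hρ hρ4 hsmall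
  set μ := volume.restrict (halfBall n 1) with hμ
  set A := fun k => eLpNorm (v k - u) 2 μ with hAdef
  set A' := fun k => eLpNorm (grad (v k) - Du) 2 μ with hAdef'
  have hle : volume.restrict (halfBall n ρ) ≤ μ :=
    Measure.restrict_mono_set _ (monotone_halfBall (by linarith))
  have hle' : volume.restrict (flatBall n ρ) ≤ volume.restrict (flatBall n 1) :=
    Measure.restrict_mono_set _ (monotone_flatBall (by linarith))
  have hvm : ∀ k, AEStronglyMeasurable (v k) μ := fun k => (hv k).continuous.aestronglyMeasurable
  have hgm : ∀ k, AEStronglyMeasurable (grad (v k)) μ := fun k =>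
    (continuous_grad (hv k)).aestronglyMeasurable
  have hdm : ∀ k, AEStronglyMeasurable (v k - u) μ := fun k => (hvm k).sub hH1.memLp.1
  have hdm' : ∀ k, AEStronglyMeasurable (grad (v k) - Du) μ := fun k =>
    (hgm k).sub hH1.memLp_grad.1
  -- The weighted inequality is available for smooth functions only. It is therefore applied to `v k
  -- - v l`, and Fatou's lemma in `l` then yields the bound for `v k - u`.
  have hpair : ∀ k l, c.lowMass ρ (v k - v l) (fun x' => (v k - v l) (incl x')) ≤
      ((A' k + A' l) + ENNReal.ofReal M * (A k + A l)) ^ 2 := by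
    intro k l
    refine (hM _ ((hv k).sub (hv l))).trans (pow_le_pow_left' (add_le_add ?_
      (mul_le_mul' le_rfl ?_)) 2)
    · have h1 : grad (v k - v l) = (grad (v k) - Du) - (grad (v l) - Du) := by
        ext1 x
        rw [grad_sub ((hv k).differentiable (by simp)) ((hv l).differentiable (by simp))]
        simp
      change eLpNorm (grad (v k - v l)) 2 μ ≤ _
      rw [h1]
      exact eLpNorm_sub_le (hdm' k) (hdm' l) (by norm_num)
    · have h1 : v k - v l = (v k - u) - (v l - u) := by simp
      change eLpNorm (v k - v l) 2 μ ≤ _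
      rw [h1]
      exact eLpNorm_sub_le (hdm k) (hdm l) (by norm_num)
  have hdiff : ∀ k, c.lowMass ρ (v k - u) (fun x' => v k (incl x') - T x') ≤
      2 * (A' k + ENNReal.ofReal M * A k) ^ 2 := by
    intro k
    have hlim : Tendsto (fun l => ((A' k + A' l) + ENNReal.ofReal M * (A k + A l)) ^ 2) atTop
        (𝓝 ((A' k + ENNReal.ofReal M * A k) ^ 2)) := by
      have h1 : Tendsto (fun l => (A' k + A' l) + ENNReal.ofReal M * (A k + A l)) atTop
          (𝓝 ((A' k + 0) + ENNReal.ofReal M * (A k + 0))) :=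
        (hA'.const_add _).add (ENNReal.Tendsto.const_mul (hA.const_add _) (Or.inr (by simp)))
      simp only [add_zero] at h1
      exact ((ENNReal.continuous_pow 2).tendsto _).comp h1
    -- The interior part and the boundary part each inherit the full bound, whence the factor 2.
    rw [two_mul]
    refine add_le_add ?_ ?_
    · refine lintegral_weight_le_of_tendsto (w := fun l => v k - v l) ?_ ?_ ?_ ?_ hlim
        fun l => le_self_add.trans (hpair k l)
      · exact ((hc.b.enorm.pow_const 2).add (hc.W.enorm.pow_const 2)).add hc.V.enorm
      · intro x
        simp [lowWeight]
      · exact fun l => ((hv k).sub (hv l)).continuous.aestronglyMeasurable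
      · filter_upwards [ae_mono hle hae] with x hx
        exact hx.const_sub _
    · refine lintegral_weight_le_of_tendsto (w := fun l x' => (v k - v l) (incl x')) ?_ ?_ ?_ ?_
        hlim fun l => le_add_self.trans (hpair k l)
      · exact hc.η.enorm
      · simp
      · exact fun l =>
          (((hv k).sub (hv l)).continuous.comp continuous_incl).aestronglyMeasurable
      · filter_upwards [ae_mono hle' haeT] with x hx
        exact hx.const_sub _
  -- This bounds the weak form of `v k - u` relative to `‖∇φ‖`; its real value serves as `δ k`.
  set S := fun k => (ENNReal.ofReal Lam + 1) * A' k +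
    3 * (2 * (A' k + ENNReal.ofReal M * A k) ^ 2) ^ (1 / 2 : ℝ) with hS
  have hSlim : Tendsto S atTop (𝓝 0) := by
    have h1 : Tendsto (fun k => A' k + ENNReal.ofReal M * A k) atTop (𝓝 0) := by
      simpa using hA'.add (ENNReal.Tendsto.const_mul hA (Or.inr ENNReal.ofReal_ne_top))
    have h2 : Tendsto (fun k => 2 * (A' k + ENNReal.ofReal M * A k) ^ 2) atTop (𝓝 0) := by
      have := ENNReal.Tendsto.const_mul (a := 2) (((ENNReal.continuous_pow 2).tendsto _).comp h1)
        (Or.inr (by simp))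
      simpa using this
    have h3 := ((ENNReal.continuous_rpow_const (y := (1 / 2 : ℝ))).tendsto _).comp h2
    rw [ENNReal.zero_rpow_of_pos (by norm_num)] at h3
    have h4 := (ENNReal.Tendsto.const_mul (a := ENNReal.ofReal Lam + 1) hA'
      (Or.inr (by finiteness))).add (ENNReal.Tendsto.const_mul (a := 3) h3 (Or.inr (by simp)))
    rw [mul_zero, mul_zero, add_zero] at h4
    exact h4
  have hSfin : ∀ k, S k ≠ ⊤ := by
    intro k
    have h1 : A k ≠ ⊤ := ((hA1 k).trans_lt (by simp)).ne
    have h2 : A' k ≠ ⊤ := ((hA1' k).trans_lt (by simp)).ne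
    have h3 : (2 * (A' k + ENNReal.ofReal M * A k) ^ 2) ^ (1 / 2 : ℝ) ≠ ⊤ :=
      ENNReal.rpow_ne_top_of_nonneg (by norm_num) (by finiteness)
    rw [hS]
    finiteness
  refine ⟨v, fun k => (S k).toReal, hv, fun k => ENNReal.toReal_nonneg, ?_, hA, ?_⟩
  · exact (ENNReal.tendsto_toReal ENNReal.zero_ne_top).comp hSlim
  intro k φ hφ
  have hφs : ∀ x, ρ ≤ ‖x‖ → φ x = 0 := fun x hx => by
    refine image_eq_zero_of_notMem_tsupport fun h => ?_
    exact absurd (mem_ball_zero_iff.1 (hφ.2.2 h)) (not_lt.2 hx)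
  have hm : c.lowMass ρ φ (fun x' => φ (incl x')) ≤
      eLpNorm (grad φ) 2 (volume.restrict (upperHalf n)) ^ 2 := by
    refine le_trans (add_le_add ?_ ?_) (hsmall φ hφ.1 fun x hx => hφs x (by linarith))
    · exact lintegral_mono_set (monotone_halfBall (by linarith))
    · exact lintegral_mono_set (monotone_flatBall (by linarith))
  have hG : eLpNorm (grad φ) 2 (volume.restrict (upperHalf n)) ≠ ⊤ := by
    have hgc : HasCompactSupport (grad φ) :=
      HasCompactSupport.intro hφ.2.1.isCompact fun x hx => grad_eq_zero_of_notMem hx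
    exact (((continuous_grad hφ.1).memLp_of_hasCompactSupport hgc).restrict _).2.ne
  have hA'mem : MemLp (grad (v k) - Du) 2 μ := ⟨hdm' k, (hA1' k).trans_lt (by simp)⟩
  have hgmem : MemLp (grad (v k)) 2 μ := by
    have := hA'mem.add hH1.memLp_grad
    rwa [sub_add_cancel] at this
  have hAmem : MemLp (v k - u) 2 μ := ⟨hdm k, (hA1 k).trans_lt (by simp)⟩
  have hvmem : MemLp (v k) 2 μ := by
    have := hAmem.add hH1.memLp
    rwa [sub_add_cancel] at this
  have hTsub : AEStronglyMeasurable (fun x' => v k (incl x') - T x')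
      (volume.restrict (flatBall n ρ)) :=
    ((hv k).continuous.comp continuous_incl).aestronglyMeasurable.sub (hTm.mono_measure hle')
  obtain ⟨i1, j1⟩ := integrable_of_lintegral_bulk (T := fun x' => v k (incl x')) hlam hc hell
    ((hvm k).mono_measure hle) (hgmem.mono_measure hle)
    ((hv k).continuous.comp continuous_incl).aestronglyMeasurable hφ.1 hφ.2.1 hm (by
      have h1 := hgmem.2.ne
      have h2 := hvmem.2.ne
      exact ((hM (v k) (hv k)).trans_lt (by finiteness)).ne)
  obtain ⟨i2, j2⟩ := integrable_of_lintegral_bulk (T := fun x' => v k (incl x') - T x') hlam hc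
    hell ((hdm k).mono_measure hle) (hA'mem.mono_measure hle) hTsub hφ.1 hφ.2.1 hm (by
      have h1 := hAmem.2.ne
      have h2 := hA'mem.2.ne
      exact ((hdiff k).trans_lt (by finiteness)).ne)
  have hest := lintegral_bulk_le (T := fun x' => v k (incl x') - T x') hlam hc hell
    ((hdm k).mono_measure hle) ((hdm' k).mono_measure hle) hTsub hφ.1 hm
  -- The weak form of `u` vanishes. The integrals may be split because both `v k` and `v k - u` have
  -- finite weighted mass.
  have hkey : c.weakForm ρ (v k) (grad (v k)) (fun x' => v k (incl x')) φ =
      c.weakForm ρ (v k - u) (grad (v k) - Du) (fun x' => v k (incl x') - T x') φ := by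
    have h0 : c.weakForm ρ u Du T φ = 0 := weakForm_eq_zero (by linarith) hweak hφ
    have e1 : ∀ x, c.bulk u Du φ x = c.bulk (v k) (grad (v k)) φ x -
        c.bulk (v k - u) (grad (v k) - Du) φ x := fun x => by
      rw [bulk_sub]; ring
    have e2 : ∀ x', c.η x' * T x' * φ (incl x') = c.η x' * v k (incl x') * φ (incl x') -
        c.η x' * (v k (incl x') - T x') * φ (incl x') := fun x' => by ring
    rw [weakForm] at h0 ⊢
    rw [weakForm]
    simp_rw [e1, e2] at h0
    rw [integral_sub i1 i2, integral_sub j1 j2] at h0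
    linarith
  rw [hkey, ← ENNReal.toReal_mul, ← Real.norm_eq_abs, ← toReal_enorm]
  refine ENNReal.toReal_mono (ENNReal.mul_ne_top (hSfin k) hG) ?_
  calc _ ≤ _ := enorm_add_le _ _
    _ ≤ _ := add_le_add (enorm_integral_le_lintegral_enorm _) (enorm_integral_le_lintegral_enorm _)
    _ ≤ _ := hest
    _ ≤ _ := by
      refine mul_le_mul' (add_le_add (mul_le_mul' le_rfl (eLpNorm_mono_measure _ hle))
        (mul_le_mul' le_rfl (ENNReal.rpow_le_rpow (hdiff k) (by norm_num)))) le_rfl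

end Coefficients

/-! ### Caccioppoli's inequality -/

/-- The `L_2` norm in the upper half space. -/
def hnorm {E : Type*} [NormedAddCommGroup E] (F : Space n → E) : ℝ :=
  (eLpNorm F 2 (volume.restrict (upperHalf n))).toReal

theorem hnorm_nonneg {E : Type*} [NormedAddCommGroup E] (F : Space n → E) : 0 ≤ hnorm F :=
  ENNReal.toReal_nonneg

theorem hnorm_sq {F : Space n → Space n}
    (hF : MemLp F 2 (volume.restrict (upperHalf n))) :
    hnorm F ^ 2 = ∫ x in upperHalf n, ‖F x‖ ^ 2 := by
  rw [hnorm, ← ENNReal.toReal_pow, eLpNorm_two_sq,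
    integral_eq_lintegral_of_nonneg_ae (f := fun x => ‖F x‖ ^ 2) (Eventually.of_forall fun x => by positivity) (hF.1.norm.pow 2)]
  congr 1
  refine lintegral_congr fun x => ?_
  rw [← ofReal_norm, ENNReal.ofReal_pow (norm_nonneg _)]

theorem hnorm_add_le {G H : Space n → Space n} (hG : MemLp G 2 (volume.restrict (upperHalf n)))
    (hH : MemLp H 2 (volume.restrict (upperHalf n))) : hnorm (G + H) ≤ hnorm G + hnorm H := by
  rw [hnorm, hnorm, hnorm, ← ENNReal.toReal_add hG.2.ne hH.2.ne]
  exact ENNReal.toReal_mono (ENNReal.add_ne_top.2 ⟨hG.2.ne, hH.2.ne⟩)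
    (eLpNorm_add_le hG.1 hH.1 (by norm_num))

theorem memLp_grad {f : Space n → ℝ} (hf : ContDiff ℝ ∞ f) (hfc : HasCompactSupport f) :
    MemLp (grad f) 2 (volume.restrict (upperHalf n)) := by
  have hgc : HasCompactSupport (grad f) :=
    HasCompactSupport.intro hfc.isCompact fun x hx => grad_eq_zero_of_notMem hx
  exact ((continuous_grad hf).memLp_of_hasCompactSupport hgc).restrict _

namespace Coefficients

variable {c : Coefficients n} {ρ : ℝ}

variable (c) in
/-- The lower order terms of the weak formulation. -/
def lowDensity (f g : Space n → ℝ) (F H : Space n → Space n) (x : Space n) : ℝ :=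
  -(f x * inner ℝ (c.b x) (F x)) + g x * inner ℝ (c.W x) (H x) + c.V x * f x * g x

/-- The functions `f`, `g` and the fields `F`, `H` are kept separate because the estimate is used
both with `f = g`, in Caccioppoli's inequality, and with `g` a test function, for the frozen
coefficients. -/
theorem lowDensity_estimate (hc : c.MeasurableOn ρ) {f g : Space n → ℝ} (hf : Continuous f)
    (hg : Continuous g) {F H : Space n → Space n}
    (hF : MemLp F 2 (volume.restrict (upperHalf n)))
    (hH : MemLp H 2 (volume.restrict (upperHalf n))) {A B : ℝ} (hA : 0 ≤ A) (hB : 0 ≤ B)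
    (hfA : c.lowMass ρ f (fun x' => f (incl x')) ^ (1 / 2 : ℝ) ≤ ENNReal.ofReal A)
    (hgB : c.lowMass ρ g (fun x' => g (incl x')) ^ (1 / 2 : ℝ) ≤ ENNReal.ofReal B) :
    IntegrableOn (c.lowDensity f g F H) (halfBall n ρ) ∧
      |(∫ x in halfBall n ρ, c.lowDensity f g F H x) +
        ∫ x' in flatBall n ρ, c.η x' * f (incl x') * g (incl x')| ≤
        A * hnorm F + B * hnorm H + 2 * (A * B) := by
  set μ := volume.restrict (halfBall n ρ) with hμ
  have hle : μ ≤ volume.restrict (upperHalf n) :=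
    Measure.restrict_mono_set _ Set.inter_subset_left
  have hfm := hf.aestronglyMeasurable (μ := μ)
  have hgm := hg.aestronglyMeasurable (μ := μ)
  have hFm := hF.1.mono_measure hle
  have hHm := hH.1.mono_measure hle
  have hFn : eLpNorm F 2 μ ≤ ENNReal.ofReal (hnorm F) := by
    rw [hnorm, ENNReal.ofReal_toReal hF.2.ne]
    exact eLpNorm_mono_measure _ hle
  have hHn : eLpNorm H 2 μ ≤ ENNReal.ofReal (hnorm H) := by
    rw [hnorm, ENNReal.ofReal_toReal hH.2.ne]
    exact eLpNorm_mono_measure _ hle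
  have e1 : ∫⁻ x, ‖c.b x‖ₑ * ‖f x‖ₑ * ‖F x‖ₑ ∂μ ≤ ENNReal.ofReal (A * hnorm F) := by
    rw [ENNReal.ofReal_mul hA]
    exact (lintegral_mul_norm_le_lowMass hc.b
      (fun x => by rw [lowWeight, add_assoc]; exact le_self_add) hfm hFm).trans
        (mul_le_mul' hfA hFn)
  have e2 : ∫⁻ x, ‖c.W x‖ₑ * ‖g x‖ₑ * ‖H x‖ₑ ∂μ ≤ ENNReal.ofReal (B * hnorm H) := by
    rw [ENNReal.ofReal_mul hB]
    exact (lintegral_mul_norm_le_lowMass hc.W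
      (fun x => by rw [lowWeight, add_right_comm]; exact le_add_self) hgm hHm).trans
        (mul_le_mul' hgB hHn)
  have e3 : ∫⁻ x, ‖c.V x‖ₑ * ‖f x‖ₑ * ‖g x‖ₑ ∂μ ≤ ENNReal.ofReal (A * B) := by
    rw [ENNReal.ofReal_mul hA]
    exact (lintegral_V_le_lowMass hc.V hfm hgm).trans (mul_le_mul' hfA hgB)
  have e4 : ∫⁻ x' in flatBall n ρ, ‖c.η x' * f (incl x') * g (incl x')‖ₑ ≤
      ENNReal.ofReal (A * B) := by
    rw [ENNReal.ofReal_mul hA]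
    simp only [enorm_mul]
    exact (lintegral_η_le_lowMass hc.η (hf.comp continuous_incl).aestronglyMeasurable
      (hg.comp continuous_incl).aestronglyMeasurable).trans (mul_le_mul' hfA hgB)
  have m1 : AEMeasurable (fun x => ‖c.b x‖ₑ * ‖f x‖ₑ * ‖F x‖ₑ) μ :=
    (hc.b.enorm.mul hfm.enorm).mul hFm.enorm
  have m2 : AEMeasurable (fun x => ‖c.W x‖ₑ * ‖g x‖ₑ * ‖H x‖ₑ) μ :=
    (hc.W.enorm.mul hgm.enorm).mul hHm.enorm
  have m12 : AEMeasurable (fun x => ‖c.b x‖ₑ * ‖f x‖ₑ * ‖F x‖ₑ + ‖c.W x‖ₑ * ‖g x‖ₑ * ‖H x‖ₑ) μ :=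
    m1.add m2
  have e5 : ∫⁻ x, ‖c.lowDensity f g F H x‖ₑ ∂μ ≤
      ENNReal.ofReal (A * hnorm F + B * hnorm H + A * B) := by
    have hF0 := hnorm_nonneg F
    have hH0 := hnorm_nonneg H
    rw [ENNReal.ofReal_add (by positivity) (by positivity),
      ENNReal.ofReal_add (by positivity) (by positivity)]
    refine (lintegral_mono fun x => ?_).trans
      ((lintegral_add_left' m12 fun x => ‖c.V x‖ₑ * ‖f x‖ₑ * ‖g x‖ₑ).trans_le (add_le_add
        ((lintegral_add_left' m1 _).trans_le (add_le_add e1 e2)) e3))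
    refine (enorm_add_le _ _).trans (add_le_add ((enorm_add_le _ _).trans (add_le_add ?_ ?_)) ?_)
    · rw [enorm_neg, enorm_mul]
      calc _ ≤ ‖f x‖ₑ * (‖c.b x‖ₑ * ‖F x‖ₑ) := mul_le_mul' le_rfl (enorm_inner_le _ _)
        _ = _ := by ring
    · rw [enorm_mul]
      calc _ ≤ ‖g x‖ₑ * (‖c.W x‖ₑ * ‖H x‖ₑ) := mul_le_mul' le_rfl (enorm_inner_le _ _)
        _ = _ := by ring
    · rw [enorm_mul, enorm_mul]
  refine ⟨⟨(((hfm.mul (hc.b.inner hFm)).neg).add (hgm.mul (hc.W.inner hHm))).add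
    ((hc.V.mul hfm).mul hgm), e5.trans_lt ENNReal.ofReal_lt_top⟩, ?_⟩
  have hF0 := hnorm_nonneg F
  have hH0 := hnorm_nonneg H
  have h6 : |∫ x in halfBall n ρ, c.lowDensity f g F H x| ≤ A * hnorm F + B * hnorm H + A * B := by
    rw [← Real.norm_eq_abs, ← toReal_enorm]
    exact ENNReal.toReal_le_of_le_ofReal (by positivity)
      ((enorm_integral_le_lintegral_enorm _).trans e5)
  have h7 : |∫ x' in flatBall n ρ, c.η x' * f (incl x') * g (incl x')| ≤ A * B := by
    rw [← Real.norm_eq_abs, ← toReal_enorm]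
    exact ENNReal.toReal_le_of_le_ofReal (by positivity)
      ((enorm_integral_le_lintegral_enorm _).trans e4)
  refine (abs_add_le _ _).trans ?_
  linarith

theorem integrableOn_inner_a {lam Lam : ℝ} (hlam : 0 < lam) (hc : c.MeasurableOn ρ)
    (hell : ∀ᵐ x ∂(volume.restrict (halfBall n ρ)), Elliptic lam Lam (c.a x))
    {F G : Space n → Space n} (hF : MemLp F 2 (volume.restrict (upperHalf n)))
    (hG : MemLp G 2 (volume.restrict (upperHalf n))) :
    IntegrableOn (fun x => inner ℝ (Matrix.toEuclideanLin (c.a x) (F x)) (G x))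
      (halfBall n ρ) := by
  have hle : volume.restrict (halfBall n ρ) ≤ volume.restrict (upperHalf n) :=
    Measure.restrict_mono_set _ Set.inter_subset_left
  have hF' := hF.mono_measure hle
  have hG' := hG.mono_measure hle
  refine Integrable.mono' ((hF'.norm.integrable_mul hG'.norm).const_mul Lam)
    (hc.inner_a hF'.1 hG'.1) (hell.mono fun x hx => ?_)
  exact hx.abs_inner_le hlam _ _

/-- The case `X ≤ Y + δ` is trivial. Otherwise all terms are bounded by multiples of `X²` and `(Y +
δ) X`. Those in `X²` carry a factor `4k ≤ lam / 4` and are absorbed, after which one divides by `X`.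
-/
theorem caccioppoli_arith {lam Lam k δ X Y : ℝ} (hlam : 0 < lam) (hLam : 0 ≤ Lam) (hk0 : 0 ≤ k)
    (hk : k ≤ lam / 16) (hk1 : k ≤ 1) (hδ : 0 ≤ δ) (hX : 0 ≤ X) (hY : 0 ≤ Y)
    (h : lam * X ^ 2 ≤ δ * (X + Y) + Lam * Y ^ 2 + (2 * (k * X * (X + Y)) + 2 * (k * X * (k * X)))) :
    X ≤ (1 + 4 / (3 * lam) * (2 + lam / 8 + Lam)) * (Y + δ) := by
  have hZ : 0 ≤ Y + δ := by linarith
  have hq : 0 ≤ 4 / (3 * lam) * (2 + lam / 8 + Lam) := by positivity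
  rcases le_total X (Y + δ) with hle | hle
  · nlinarith
  have h1 : k * X * (k * X) ≤ k * X * X := by
    have : k * X * (k * X) = k * (k * X * X) := by ring
    rw [this]
    exact mul_le_of_le_one_left (by positivity) hk1
  have h2 : k * X * X ≤ lam / 16 * X * X := by gcongr
  have h3 : k * X * Y ≤ lam / 16 * X * (Y + δ) := by
    refine mul_le_mul (mul_le_mul_of_nonneg_right hk hX) (by linarith) hY (by positivity)
  have h4 : δ * X ≤ (Y + δ) * X := by gcongr; linarith
  have h5 : δ * Y ≤ (Y + δ) * X := mul_le_mul (by linarith) (by linarith) hY hZ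
  have h6 : Y ^ 2 ≤ (Y + δ) * X := by
    rw [sq]
    exact mul_le_mul (by linarith) (by linarith) hY hZ
  have h7 : Lam * Y ^ 2 ≤ Lam * ((Y + δ) * X) := by gcongr
  have h8 : 3 / 4 * lam * X * X ≤ (2 + lam / 8 + Lam) * (Y + δ) * X := by nlinarith
  rcases hX.eq_or_lt with h0 | h0
  · rw [← h0]
    positivity
  have h9 : 3 / 4 * lam * X ≤ (2 + lam / 8 + Lam) * (Y + δ) := le_of_mul_le_mul_right h8 h0
  have h10 : X ≤ 4 / (3 * lam) * (2 + lam / 8 + Lam) * (Y + δ) := by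
    have : X = 4 / (3 * lam) * (3 / 4 * lam * X) := by field_simp
    rw [this, mul_assoc (4 / (3 * lam))]
    gcongr
  nlinarith

/-- Caccioppoli's inequality for functions that nearly solve the equation. -/
theorem caccioppoli {lam Lam : ℝ} (hlam : 0 < lam) (hLam : 0 ≤ Lam) (hc : c.MeasurableOn ρ)
    (hell : ∀ᵐ x ∂(volume.restrict (halfBall n ρ)), Elliptic lam Lam (c.a x)) {k : ℝ}
    (hk0 : 0 ≤ k) (hk : k ≤ lam / 16) (hk1 : k ≤ 1) {r : ℝ} (hr : r ≤ ρ)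
    (hsmall : ∀ f : Space n → ℝ, IsTestFunction (Metric.ball 0 r) f →
      c.lowMass ρ f (fun x' => f (incl x')) ^ (1 / 2 : ℝ) ≤ ENNReal.ofReal (k * hnorm (grad f)))
    {v : Space n → ℝ} (hv : ContDiff ℝ ∞ v) {δ : ℝ} (hδ : 0 ≤ δ)
    (hsol : ∀ φ, IsTestFunction (Metric.ball 0 ρ) φ →
      |c.weakForm ρ v (grad v) (fun x' => v (incl x')) φ| ≤ δ * hnorm (grad φ))
    {ζ : Space n → ℝ} (hζ : IsTestFunction (Metric.ball 0 r) ζ) (hζ1 : ∀ x, |ζ x| ≤ 1) :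
    hnorm (grad fun x => v x * ζ x) ≤ (1 + 4 / (3 * lam) * (2 + lam / 8 + Lam)) *
      (hnorm (fun x => v x • grad ζ x) + δ) := by
  set f : Space n → ℝ := fun x => v x * ζ x with hf
  set F : Space n → Space n := fun x => v x • grad ζ x with hF
  -- The classical test function `v ζ²`.
  set φ : Space n → ℝ := fun x => f x * ζ x with hφ
  have hfs : ContDiff ℝ ∞ f := hv.mul hζ.1
  have hfc : HasCompactSupport f := hζ.2.1.mul_left
  have hft : IsTestFunction (Metric.ball 0 r) f :=
    ⟨hfs, hfc, (tsupport_mul_subset_right).trans hζ.2.2⟩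
  have hφt : IsTestFunction (Metric.ball 0 ρ) φ :=
    ⟨hfs.mul hζ.1, hζ.2.1.mul_left,
      (tsupport_mul_subset_right).trans (hζ.2.2.trans (Metric.ball_subset_ball hr))⟩
  have hdv := hv.differentiable (n := ∞) (by simp)
  have hdζ := hζ.1.differentiable (n := ∞) (by simp)
  have hgf : ∀ x, grad f x = F x + ζ x • grad v x := fun x => grad_mul hdv hdζ x
  have hgφ : ∀ x, grad φ x = ζ x • F x + ζ x • grad f x := fun x => by
    rw [hφ, grad_mul (hfs.differentiable (by simp)) hdζ, hF, smul_smul, mul_comm (ζ x)]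
  have hgfm : MemLp (grad f) 2 (volume.restrict (upperHalf n)) := memLp_grad hfs hfc
  have hFm : MemLp F 2 (volume.restrict (upperHalf n)) := by
    have hc : Continuous F := hv.continuous.smul (continuous_grad hζ.1)
    refine (hc.memLp_of_hasCompactSupport ?_).restrict _
    exact HasCompactSupport.intro hζ.2.1.isCompact fun x hx => by
      simp [hF, grad_eq_zero_of_notMem hx]
  set X := hnorm (grad f) with hX
  set Y := hnorm F with hY
  have hneg : hnorm (-F) = Y := by rw [hY, hnorm, hnorm, eLpNorm_neg]
  have hGφ : hnorm (grad φ) ≤ X + Y := by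
    have h1 : grad φ = (fun x => ζ x • (F + grad f) x) := by
      ext1 x
      rw [hgφ x, Pi.add_apply, smul_add]
    have h2 : hnorm (grad φ) ≤ hnorm (F + grad f) := by
      rw [hnorm, hnorm, h1]
      refine ENNReal.toReal_mono (hFm.add hgfm).2.ne ((eLpNorm_smul_le hζ1).trans (le_of_eq ?_))
      simp
    linarith [hnorm_add_le hFm hgfm]
  -- Since `ζ ∇v = ∇f - F` and `∇φ = ζ (∇f + F)`, the mixed terms cancel by symmetry of `c.a x`,
  -- leaving the difference of the forms of `∇f` and `F`.
  have hbulk : ∀ᵐ x ∂(volume.restrict (halfBall n ρ)), c.bulk v (grad v) φ x =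
      -inner ℝ (Matrix.toEuclideanLin (c.a x) (grad f x)) (grad f x) +
        inner ℝ (Matrix.toEuclideanLin (c.a x) (F x)) (F x) +
        c.lowDensity f f (grad f + F) (grad f + -F) x := by
    filter_upwards [hell] with x hx
    have hsym := hx.1.inner_toEuclideanLin_comm (F x) (grad v x)
    rw [bulk, lowDensity, hgφ x, Pi.add_apply, Pi.add_apply, Pi.neg_apply, hgf x]
    have h1 : F x + ζ x • grad v x + -F x = ζ x • grad v x := by abel
    rw [h1]
    simp only [map_add, map_smul, inner_add_left, inner_add_right, real_inner_smul_left,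
      real_inner_smul_right, hsym, smul_add, hφ, hf]
    ring
  have i1 := integrableOn_inner_a hlam hc hell hgfm hgfm
  have i2 := integrableOn_inner_a hlam hc hell hFm hFm
  have hkX : 0 ≤ k * X := mul_nonneg hk0 (hnorm_nonneg _)
  obtain ⟨i3, hlow⟩ := lowDensity_estimate hc hfs.continuous hfs.continuous (hgfm.add hFm)
    (hgfm.add hFm.neg) hkX hkX (hsmall f hft) (hsmall f hft)
  have hweak := hsol φ hφt
  have hsplit : ∫ x in halfBall n ρ, c.bulk v (grad v) φ x =
      -(∫ x in halfBall n ρ, inner ℝ (Matrix.toEuclideanLin (c.a x) (grad f x)) (grad f x)) +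
        (∫ x in halfBall n ρ, inner ℝ (Matrix.toEuclideanLin (c.a x) (F x)) (F x)) +
        ∫ x in halfBall n ρ, c.lowDensity f f (grad f + F) (grad f + -F) x := by
    rw [integral_congr_ae hbulk, ← integral_neg]
    refine (integral_add (i1.neg.add i2) i3).trans ?_
    congr 1
    exact integral_add i1.neg i2
  rw [weakForm, hsplit] at hweak
  have hη : ∀ x' : Bdry n, c.η x' * v (incl x') * φ (incl x') =
      c.η x' * f (incl x') * f (incl x') := fun x' => by simp only [hφ, hf]; ring
  simp only [hη] at hweak
  have hle : volume.restrict (halfBall n ρ) ≤ volume.restrict (upperHalf n) :=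
    Measure.restrict_mono_set _ Set.inter_subset_left
  have hsqX : ∫ x in halfBall n ρ, ‖grad f x‖ ^ 2 = X ^ 2 := by
    rw [hX, hnorm_sq hgfm]
    refine (setIntegral_eq_of_subset_of_forall_sdiff_eq_zero measurableSet_upperHalf
      Set.inter_subset_left fun x hx => ?_).symm
    rw [grad_eq_zero_of_notMem]
    · simp
    · exact fun h => hx.2 ⟨hx.1, Metric.ball_subset_ball hr (hft.2.2 h)⟩
  have hsqY : ∫ x in halfBall n ρ, ‖F x‖ ^ 2 ≤ Y ^ 2 := by
    rw [hY, hnorm_sq hFm]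
    exact setIntegral_mono_set hFm.norm.integrable_sq
      (Eventually.of_forall fun x => by positivity) (LE.le.eventuallyLE Set.inter_subset_left)
  have hlow1 : lam * X ^ 2 ≤
      ∫ x in halfBall n ρ, inner ℝ (Matrix.toEuclideanLin (c.a x) (grad f x)) (grad f x) := by
    rw [← hsqX, ← integral_const_mul]
    refine integral_mono_ae ((hgfm.mono_measure hle).norm.integrable_sq.const_mul lam) i1 ?_
    exact hell.mono fun x hx => (hx.2 _).1
  have hup : ∫ x in halfBall n ρ, inner ℝ (Matrix.toEuclideanLin (c.a x) (F x)) (F x) ≤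
      Lam * Y ^ 2 := by
    refine le_trans ?_ (mul_le_mul_of_nonneg_left hsqY hLam)
    rw [← integral_const_mul]
    refine integral_mono_ae i2 ((hFm.mono_measure hle).norm.integrable_sq.const_mul Lam) ?_
    exact hell.mono fun x hx => (hx.2 _).2
  have h1 := hnorm_add_le hgfm hFm
  have h2 := hnorm_add_le hgfm hFm.neg
  rw [hneg] at h2
  refine caccioppoli_arith hlam hLam hk0 hk hk1 hδ (hnorm_nonneg _) (hnorm_nonneg _) ?_
  have h3 := (abs_le.1 hweak).1
  have h4 := (abs_le.1 hlow).2
  have h5 : δ * hnorm (grad φ) ≤ δ * (X + Y) := by gcongr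
  have h6 : k * X * hnorm (grad f + F) ≤ k * X * (X + Y) := by gcongr
  have h7 : k * X * hnorm (grad f + -F) ≤ k * X * (X + Y) := by gcongr
  linarith

end Coefficients

/-! ### Freezing the leading coefficients -/

theorem abs_inner_toEuclideanLin_le (M : Matrix (Fin (n + 1)) (Fin (n + 1)) ℝ) (ξ ζ : Space n) :
    |inner ℝ (Matrix.toEuclideanLin M ξ) ζ| ≤ (∑ i, ∑ j, |M i j|) * ‖ξ‖ * ‖ζ‖ := by
  rw [inner_toEuclideanLin, Finset.sum_mul, Finset.sum_mul]
  refine (Finset.abs_sum_le_sum_abs _ _).trans (Finset.sum_le_sum fun i _ => ?_)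
  rw [abs_mul, Finset.sum_mul]
  refine mul_le_mul ((Finset.abs_sum_le_sum_abs _ _).trans (Finset.sum_le_sum fun j _ => ?_))
    (PiLp.norm_apply_le ζ i) (abs_nonneg _) (by positivity)
  rw [abs_mul]
  exact mul_le_mul_of_nonneg_left (PiLp.norm_apply_le ξ j) (abs_nonneg _)

theorem Elliptic.abs_entry_le {lam Lam : ℝ} (hlam : 0 < lam)
    {M : Matrix (Fin (n + 1)) (Fin (n + 1)) ℝ} (hM : Elliptic lam Lam M) (i j : Fin (n + 1)) :
    |M i j| ≤ Lam := by
  have h := hM.abs_inner_le hlam (EuclideanSpace.single j 1) (EuclideanSpace.single i 1)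
  rw [inner_toEuclideanLin] at h
  simpa [PiLp.norm_single] using h

namespace Coefficients

variable {c : Coefficients n} {ρ : ℝ}

variable (c) in
/-- The `L_2` deviation of the leading coefficients from their value at the origin. -/
def oscillation (r : ℝ) : ℝ :=
  ∑ i, ∑ j, (eLpNorm (fun x => c.a x i j - c.a 0 i j) 2 (volume.restrict (halfBall n r))).toReal

theorem memLp_entry {lam Lam : ℝ} (hlam : 0 < lam) (hc : c.MeasurableOn ρ)
    (hell : ∀ᵐ x ∂(volume.restrict (halfBall n ρ)), Elliptic lam Lam (c.a x)) {r : ℝ} (hr : r ≤ ρ)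
    (i j : Fin (n + 1)) :
    MemLp (fun x => c.a x i j - c.a 0 i j) 2 (volume.restrict (halfBall n r)) := by
  have hle : volume.restrict (halfBall n r) ≤ volume.restrict (halfBall n ρ) :=
    Measure.restrict_mono_set _ (monotone_halfBall hr)
  have : IsFiniteMeasure (volume.restrict (halfBall n r)) :=
    ⟨by
      rw [Measure.restrict_apply_univ]
      exact (measure_mono Set.inter_subset_right).trans_lt measure_ball_lt_top⟩
  refine MemLp.sub (MemLp.of_bound ((hc.a i j).mono_measure hle) Lam ?_) (memLp_const _)
  filter_upwards [ae_mono hle hell] with x hx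
  exact hx.abs_entry_le hlam i j

/-- The field `G`, later the gradient of a test function, is bounded pointwise and not only in
`L_2`. This is why an `L_2` bound on the oscillation of the coefficients is enough. -/
theorem integral_deviation_le {lam Lam : ℝ} (hlam : 0 < lam) (hc : c.MeasurableOn ρ)
    (hell : ∀ᵐ x ∂(volume.restrict (halfBall n ρ)), Elliptic lam Lam (c.a x)) {r : ℝ} (hr : r ≤ ρ)
    {F G : Space n → Space n} (hF : MemLp F 2 (volume.restrict (upperHalf n))) {P : ℝ}
    (hP0 : 0 ≤ P) (hP : ∀ x, ‖G x‖ ≤ P) (hG : ∀ x, x ∉ Metric.ball 0 r → G x = 0) :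
    |∫ x in halfBall n ρ, inner ℝ (Matrix.toEuclideanLin (c.a x - c.a 0) (F x)) (G x)| ≤
      P * c.oscillation r * hnorm F := by
  have hle : volume.restrict (halfBall n r) ≤ volume.restrict (upperHalf n) :=
    Measure.restrict_mono_set _ Set.inter_subset_left
  have hF' := hF.mono_measure hle
  have he : ∫ x in halfBall n ρ, inner ℝ (Matrix.toEuclideanLin (c.a x - c.a 0) (F x)) (G x) =
      ∫ x in halfBall n r, inner ℝ (Matrix.toEuclideanLin (c.a x - c.a 0) (F x)) (G x) :=
    setIntegral_eq_of_subset_of_forall_sdiff_eq_zero measurableSet_halfBall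
      (monotone_halfBall hr) fun x hx => by
        rw [hG x fun h => hx.2 ⟨hx.1.1, h⟩, inner_zero_right]
  have hmem : ∀ i j, MemLp (fun x => ‖c.a x i j - c.a 0 i j‖) 2
      (volume.restrict (halfBall n r)) := fun i j => (memLp_entry hlam hc hell hr i j).norm
  have hint : ∀ i j, Integrable (fun x => ‖c.a x i j - c.a 0 i j‖ * ‖F x‖)
      (volume.restrict (halfBall n r)) := fun i j => (hmem i j).integrable_mul hF'.norm
  have hXF : (eLpNorm (fun x => ‖F x‖) 2 (volume.restrict (halfBall n r))).toReal ≤ hnorm F := by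
    rw [eLpNorm_norm]
    exact ENNReal.toReal_mono hF.2.ne (eLpNorm_mono_measure _ hle)
  have hij : ∀ i j, ∫ x in halfBall n r, ‖c.a x i j - c.a 0 i j‖ * ‖F x‖ ≤
      (eLpNorm (fun x => c.a x i j - c.a 0 i j) 2
          (volume.restrict (halfBall n r))).toReal * hnorm F := by
    intro i j
    refine (le_abs_self _).trans ((abs_integral_mul_le (hmem i j) hF'.norm).trans ?_)
    rw [eLpNorm_norm (fun x => c.a x i j - c.a 0 i j)]
    exact mul_le_mul_of_nonneg_left hXF ENNReal.toReal_nonneg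
  have hpt : ∀ x, ‖inner ℝ (Matrix.toEuclideanLin (c.a x - c.a 0) (F x)) (G x)‖ ≤
      P * ∑ i, ∑ j, ‖c.a x i j - c.a 0 i j‖ * ‖F x‖ := by
    intro x
    refine (abs_inner_toEuclideanLin_le (c.a x - c.a 0) (F x) (G x)).trans ?_
    have h1 : ∑ i, ∑ j, ‖c.a x i j - c.a 0 i j‖ * ‖F x‖ =
        (∑ i, ∑ j, |(c.a x - c.a 0) i j|) * ‖F x‖ := by
      simp only [Finset.sum_mul, Matrix.sub_apply, Real.norm_eq_abs]
    rw [h1, mul_comm P]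
    exact mul_le_mul_of_nonneg_left (hP x) (by positivity)
  have hint2 : ∀ i, Integrable (fun x => ∑ j, ‖c.a x i j - c.a 0 i j‖ * ‖F x‖)
      (volume.restrict (halfBall n r)) := fun i => integrable_finsetSum _ fun j _ => hint i j
  have hsum : ∫ x in halfBall n r, P * ∑ i, ∑ j, ‖c.a x i j - c.a 0 i j‖ * ‖F x‖ =
      P * ∑ i, ∑ j, ∫ x in halfBall n r, ‖c.a x i j - c.a 0 i j‖ * ‖F x‖ := by
    rw [integral_const_mul, integral_finsetSum _ fun i _ => hint2 i]
    congr 1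
    exact Finset.sum_congr rfl fun i _ => integral_finsetSum _ fun j _ => hint i j
  rw [he, ← Real.norm_eq_abs]
  refine (norm_integral_le_of_norm_le ((integrable_finsetSum _ fun i _ => hint2 i).const_mul P)
    (Eventually.of_forall hpt)).trans ?_
  rw [hsum, mul_assoc]
  refine mul_le_mul_of_nonneg_left ?_ hP0
  simp only [oscillation, Finset.sum_mul]
  exact Finset.sum_le_sum fun i _ => Finset.sum_le_sum fun j _ => hij i j

/-- Functions that nearly solve the equation are nearly harmonic for the frozen coefficients. -/
theorem abs_integral_frozen_le {lam Lam : ℝ} (hlam : 0 < lam) (hc : c.MeasurableOn ρ)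
    (hell : ∀ᵐ x ∂(volume.restrict (halfBall n ρ)), Elliptic lam Lam (c.a x)) {k : ℝ}
    (hk0 : 0 ≤ k) (hk1 : k ≤ 1) {r : ℝ} (hr : r ≤ ρ)
    (hsmall : ∀ f : Space n → ℝ, IsTestFunction (Metric.ball 0 r) f →
      c.lowMass ρ f (fun x' => f (incl x')) ^ (1 / 2 : ℝ) ≤ ENNReal.ofReal (k * hnorm (grad f)))
    {v : Space n → ℝ} (hv : ContDiff ℝ ∞ v) {δ : ℝ}
    (hsol : ∀ φ, IsTestFunction (Metric.ball 0 ρ) φ →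
      |c.weakForm ρ v (grad v) (fun x' => v (incl x')) φ| ≤ δ * hnorm (grad φ))
    {ζ : Space n → ℝ} (hζ : IsTestFunction (Metric.ball 0 r) ζ) {φ : Space n → ℝ}
    (hφ : IsTestFunction (Metric.ball 0 r) φ) (hζφ : ∀ x ∈ tsupport φ, ζ =ᶠ[𝓝 x] 1) {P : ℝ}
    (hP0 : 0 ≤ P) (hP : ∀ x, ‖grad φ x‖ ≤ P) :
    |∫ x in upperHalf n,
        inner ℝ (Matrix.toEuclideanLin (c.a 0) (grad (fun x => v x * ζ x) x)) (grad φ x)| ≤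
      (δ + 4 * k * hnorm (grad fun x => v x * ζ x)) * hnorm (grad φ) +
        P * c.oscillation r * hnorm (grad fun x => v x * ζ x) := by
  set f : Space n → ℝ := fun x => v x * ζ x with hf
  have hfs : ContDiff ℝ ∞ f := hv.mul hζ.1
  have hfc : HasCompactSupport f := hζ.2.1.mul_left
  have hft : IsTestFunction (Metric.ball 0 r) f :=
    ⟨hfs, hfc, (tsupport_mul_subset_right).trans hζ.2.2⟩
  have hgf := memLp_grad hfs hfc
  have hgφ := memLp_grad hφ.1 hφ.2.1
  -- The cut-off is 1 near the support of `φ`, so `v` may be replaced there by the compactly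
  -- supported `f`, gradients included.
  have hfv : ∀ x ∈ tsupport φ, f x = v x ∧ grad f x = grad v x := by
    intro x hx
    have h1 : f =ᶠ[𝓝 x] v := by
      filter_upwards [hζφ x hx] with y hy
      simp [hf, hy]
    refine ⟨h1.eq_of_nhds, ?_⟩
    ext i
    simp only [grad, pderiv, h1.fderiv_eq]
  have hbulk : ∀ x, c.bulk v (grad v) φ x =
      -inner ℝ (Matrix.toEuclideanLin (c.a x) (grad f x)) (grad φ x) +
        c.lowDensity f φ (grad φ) (grad f) x := by
    intro x
    by_cases hx : x ∈ tsupport φ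
    · rw [bulk, lowDensity, (hfv x hx).1, (hfv x hx).2]
      ring
    · rw [bulk_eq_zero hx, lowDensity, grad_eq_zero_of_notMem hx,
        image_eq_zero_of_notMem_tsupport hx]
      simp
  have i1 := integrableOn_inner_a hlam hc hell hgf hgφ
  set X := hnorm (grad f) with hX
  set G := hnorm (grad φ) with hG
  have hX0 : 0 ≤ X := hnorm_nonneg _
  have hG0 : 0 ≤ G := hnorm_nonneg _
  obtain ⟨i2, hlow⟩ := lowDensity_estimate hc hfs.continuous hφ.1.continuous hgφ hgf
    (mul_nonneg hk0 hX0) (mul_nonneg hk0 hG0) (hsmall f hft) (hsmall φ hφ)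
  have hweak := hsol φ ⟨hφ.1, hφ.2.1, hφ.2.2.trans (Metric.ball_subset_ball hr)⟩
  have hη : ∀ x' : Bdry n, c.η x' * v (incl x') * φ (incl x') =
      c.η x' * f (incl x') * φ (incl x') := fun x' => by
    by_cases hx : incl x' ∈ tsupport φ
    · rw [(hfv _ hx).1]
    · rw [image_eq_zero_of_notMem_tsupport hx, mul_zero, mul_zero]
  have hsplit : ∫ x in halfBall n ρ, c.bulk v (grad v) φ x =
      -(∫ x in halfBall n ρ, inner ℝ (Matrix.toEuclideanLin (c.a x) (grad f x)) (grad φ x)) +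
        ∫ x in halfBall n ρ, c.lowDensity f φ (grad φ) (grad f) x := by
    rw [integral_congr_ae (Eventually.of_forall hbulk), ← integral_neg]
    exact integral_add i1.neg i2
  rw [weakForm, hsplit] at hweak
  simp only [hη] at hweak
  have hdev := integral_deviation_le hlam hc hell hr hgf hP0 hP
    fun x hx => grad_eq_zero_of_notMem fun h => hx (hφ.2.2 h)
  have hA : ∫ x in upperHalf n, inner ℝ (Matrix.toEuclideanLin (c.a 0) (grad f x)) (grad φ x) =
      ∫ x in halfBall n ρ, inner ℝ (Matrix.toEuclideanLin (c.a 0) (grad f x)) (grad φ x) :=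
    setIntegral_eq_of_subset_of_forall_sdiff_eq_zero measurableSet_upperHalf
      Set.inter_subset_left fun x hx => by
        rw [grad_eq_zero_of_notMem (f := φ), inner_zero_right]
        exact fun h => hx.2 ⟨hx.1, Metric.ball_subset_ball hr (hφ.2.2 h)⟩
  have hcont : Continuous fun x =>
      inner ℝ (Matrix.toEuclideanLin (c.a 0) (grad f x)) (grad φ x) :=
    ((LinearMap.continuous_of_finiteDimensional _).comp (continuous_grad hfs)).inner
      (continuous_grad hφ.1)
  have i3 : IntegrableOn (fun x =>
      inner ℝ (Matrix.toEuclideanLin (c.a 0) (grad f x)) (grad φ x)) (halfBall n ρ) := by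
    refine (hcont.integrable_of_hasCompactSupport ?_).integrableOn
    exact HasCompactSupport.intro hφ.2.1.isCompact fun x hx => by
      rw [grad_eq_zero_of_notMem hx, inner_zero_right]
  have hsub : ∫ x in halfBall n ρ,
      inner ℝ (Matrix.toEuclideanLin (c.a x - c.a 0) (grad f x)) (grad φ x) =
      (∫ x in halfBall n ρ, inner ℝ (Matrix.toEuclideanLin (c.a x) (grad f x)) (grad φ x)) -
        ∫ x in halfBall n ρ, inner ℝ (Matrix.toEuclideanLin (c.a 0) (grad f x)) (grad φ x) := by
    rw [← integral_sub i1 i3]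
    refine integral_congr_ae (Eventually.of_forall fun x => ?_)
    simp only [map_sub, LinearMap.sub_apply, inner_sub_left]
  rw [hsub] at hdev
  rw [hA]
  -- With `k ≤ 1` the two zero order terms are also at most `k X G`; with the two first order terms
  -- this gives the factor 4.
  have hkk : k * X * (k * G) ≤ k * X * G := by
    have : k * X * (k * G) = k * (k * X * G) := by ring
    rw [this]
    exact mul_le_of_le_one_left (by positivity) hk1
  rw [abs_le] at hweak hlow hdev ⊢
  constructor <;> nlinarith

end Coefficients

/-! ### Linear changes of variables and rescaled estimates -/

/-- The square root of the Jacobian of a linear map. -/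
def jac (M : Space n ≃L[ℝ] Space n) : ℝ :=
  √|LinearMap.det ((M : Space n →L[ℝ] Space n) : Space n →ₗ[ℝ] Space n)|

theorem det_ne_zero (M : Space n ≃L[ℝ] Space n) :
    LinearMap.det ((M : Space n →L[ℝ] Space n) : Space n →ₗ[ℝ] Space n) ≠ 0 :=
  (LinearEquiv.isUnit_det' M.toLinearEquiv).ne_zero

theorem jac_pos (M : Space n ≃L[ℝ] Space n) : 0 < jac M :=
  Real.sqrt_pos.2 (abs_pos.2 (det_ne_zero M))

theorem jac_sq (M : Space n ≃L[ℝ] Space n) :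
    jac M ^ 2 = |LinearMap.det ((M : Space n →L[ℝ] Space n) : Space n →ₗ[ℝ] Space n)| :=
  Real.sq_sqrt (abs_nonneg _)

theorem map_volume (M : Space n ≃L[ℝ] Space n) :
    Measure.map M volume = ENNReal.ofReal ((jac M ^ 2)⁻¹) • (volume : Measure (Space n)) := by
  rw [jac_sq, ← abs_inv]
  exact Measure.map_linearMap_addHaar_eq_smul_addHaar volume (det_ne_zero M)

theorem measurableEmbedding_equiv (M : Space n ≃L[ℝ] Space n) : MeasurableEmbedding M :=
  M.toHomeomorph.measurableEmbedding

theorem eLpNorm_restrict_eq_jac_mul {E : Type*} [NormedAddCommGroup E] (M : Space n ≃L[ℝ] Space n)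
    (F : Space n → E) (S : Set (Space n)) :
    eLpNorm F 2 (volume.restrict S) =
      ENNReal.ofReal (jac M) * eLpNorm (fun y => F (M y)) 2 (volume.restrict (M ⁻¹' S)) := by
  have hJ := jac_pos M
  have h1 : eLpNorm (fun y => F (M y)) 2 (volume.restrict (M ⁻¹' S)) =
      eLpNorm F 2 ((Measure.map M volume).restrict S) := by
    rw [(measurableEmbedding_equiv M).restrict_map,
      (measurableEmbedding_equiv M).eLpNorm_map_measure]
    rfl
  rw [h1, map_volume, Measure.restrict_smul, eLpNorm_smul_measure_of_ne_top (by simp),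
    smul_eq_mul, ← mul_assoc]
  have h2 : ENNReal.ofReal ((jac M ^ 2)⁻¹) ^ (1 / (2 : ℝ≥0∞)).toReal =
      ENNReal.ofReal (jac M)⁻¹ := by
    rw [ENNReal.ofReal_rpow_of_pos (by positivity)]
    congr 1
    rw [← inv_pow]
    have : (1 / (2 : ℝ≥0∞)).toReal = 1 / 2 := by simp
    rw [this, ← Real.sqrt_eq_rpow, Real.sqrt_sq (by positivity)]
  rw [h2, ← ENNReal.ofReal_mul hJ.le, mul_inv_cancel₀ hJ.ne', ENNReal.ofReal_one, one_mul]

theorem integral_restrict_eq_jac_mul (M : Space n ≃L[ℝ] Space n) (F : Space n → ℝ)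
    (S : Set (Space n)) :
    ∫ x in S, F x = jac M ^ 2 * ∫ y in M ⁻¹' S, F (M y) := by
  have hJ := jac_pos M
  rw [← (measurableEmbedding_equiv M).integral_map (g := F),
    ← (measurableEmbedding_equiv M).restrict_map, map_volume, Measure.restrict_smul,
    integral_smul_measure, ENNReal.toReal_ofReal (by positivity), smul_eq_mul, ← mul_assoc,
    mul_inv_cancel₀ (by positivity), one_mul]

theorem hnorm_eq_jac_mul {E : Type*} [NormedAddCommGroup E] {M : Space n ≃L[ℝ] Space n}
    (hM : ∀ y, M y ∈ upperHalf n ↔ y ∈ upperHalf n) (F : Space n → E) :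
    hnorm F = jac M * hnorm fun y => F (M y) := by
  have h : M ⁻¹' upperHalf n = upperHalf n := Set.ext hM
  rw [hnorm, hnorm, eLpNorm_restrict_eq_jac_mul M, h, ENNReal.toReal_mul,
    ENNReal.toReal_ofReal (jac_pos M).le]

theorem hnorm_le_mul {E E' : Type*} [NormedAddCommGroup E] [NormedAddCommGroup E']
    {F : Space n → E} {G : Space n → E'} (hG : MemLp G 2 (volume.restrict (upperHalf n))) {C : ℝ}
    (hC : 0 ≤ C) (h : ∀ x, ‖F x‖ ≤ C * ‖G x‖) : hnorm F ≤ C * hnorm G := by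
  rw [hnorm, hnorm, ← ENNReal.toReal_ofReal hC, ← ENNReal.toReal_mul]
  refine ENNReal.toReal_mono (ENNReal.mul_ne_top (by simp) hG.2.ne) ?_
  exact eLpNorm_le_mul_eLpNorm_of_ae_le_mul (Eventually.of_forall h) 2

theorem grad_comp_equiv (M : Space n ≃L[ℝ] Space n) {F : Space n → ℝ} (hF : Differentiable ℝ F)
    (y : Space n) : grad (fun y => F (M y)) y =
      ContinuousLinearMap.adjoint (M : Space n →L[ℝ] Space n) (grad F (M y)) := by
  refine ext_inner_right ℝ fun v => ?_
  rw [ContinuousLinearMap.adjoint_inner_left, ← fderiv_eq_inner_grad, ← fderiv_eq_inner_grad]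
  have h : HasFDerivAt (fun y => F (M y)) ((fderiv ℝ F (M y)).comp (M : Space n →L[ℝ] Space n)) y :=
    (hF (M y)).hasFDerivAt.comp y M.hasFDerivAt
  rw [h.fderiv]
  rfl

theorem contDiff_comp_equiv (M : Space n ≃L[ℝ] Space n) {F : Space n → ℝ} (hF : ContDiff ℝ ∞ F) :
    ContDiff ℝ ∞ fun y => F (M y) := hF.comp M.contDiff

theorem IsTestFunction.comp_equiv_symm {M : Space n ≃L[ℝ] Space n} {U V : Set (Space n)}
    {Z : Space n → ℝ} (hZ : IsTestFunction U Z) (hUV : ∀ y ∈ U, M y ∈ V) :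
    IsTestFunction V fun x => Z (M.symm x) := by
  have hts : tsupport (fun x => Z (M.symm x)) = M.symm ⁻¹' tsupport Z :=
    tsupport_comp_eq_preimage Z M.symm.toHomeomorph
  refine ⟨contDiff_comp_equiv M.symm hZ.1, hZ.2.1.comp_homeomorph M.symm.toHomeomorph, ?_⟩
  rw [hts]
  intro x hx
  have := hUV _ (hZ.2.2 hx)
  rwa [M.apply_symm_apply] at this

section Rescaling

variable {M : Space n ≃L[ℝ] Space n} {a b r₀ r δ : ℝ} {U : Set (Space n)} {v : Space n → ℝ}

/-- Caccioppoli's inequality for the transported cut-off. The factor `r₀` gained by differentiating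
the rescaled function cancels against `r₀⁻¹` from the gradient of the transported cut-off, and the
Jacobians cancel too; only the error `δ` keeps the factor `r₀ / jac M`. -/
theorem hnorm_grad_rescaled_le (hM : ∀ y, M y ∈ upperHalf n ↔ y ∈ upperHalf n) (hr₀ : 0 < r₀)
    (ha0 : 0 ≤ a) (hb0 : 0 ≤ b)
    (ha : ∀ ξ, ‖ContinuousLinearMap.adjoint (M : Space n →L[ℝ] Space n) ξ‖ ≤ a * r₀ * ‖ξ‖)
    (hb : ∀ ξ, r₀ * ‖ξ‖ ≤ b * ‖ContinuousLinearMap.adjoint (M : Space n →L[ℝ] Space n) ξ‖)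
    (hU : MeasurableSet U) (hUb : Bornology.IsBounded U) {Z : Space n → ℝ}
    (hZ : IsTestFunction U Z) (hZ1 : ∀ x, |Z x| ≤ 1) {P : ℝ} (hP0 : 0 ≤ P)
    (hZP : ∀ x, ‖grad Z x‖ ≤ P) (hMU : ∀ y ∈ U, M y ∈ Metric.ball 0 r) (hv : ContDiff ℝ ∞ v)
    {K : ℝ} (hK : 0 ≤ K)
    (hcac : ∀ ζ, IsTestFunction (Metric.ball 0 r) ζ → (∀ x, |ζ x| ≤ 1) →
      hnorm (grad fun x => v x * ζ x) ≤ K * (hnorm (fun x => v x • grad ζ x) + δ)) :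
    hnorm (grad fun y => v (M y) * Z y) ≤ a * K * (b * P *
      (eLpNorm (fun y => v (M y)) 2 (volume.restrict (upperHalf n ∩ U))).toReal +
        r₀ * (δ / jac M)) := by
  set J := jac M with hJdef
  have hJ : 0 < J := jac_pos M
  set ζ : Space n → ℝ := fun x => Z (M.symm x) with hζ
  have hζt : IsTestFunction (Metric.ball 0 r) ζ := hZ.comp_equiv_symm hMU
  have hζM : ∀ y, ζ (M y) = Z y := fun y => by simp [hζ]
  have hZζ : Z = fun y => ζ (M y) := by ext y; rw [hζM]
  set f : Space n → ℝ := fun x => v x * ζ x with hf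
  have hfs : ContDiff ℝ ∞ f := hv.mul hζt.1
  have hfc : HasCompactSupport f := hζt.2.1.mul_left
  have hg : (fun y => v (M y) * Z y) = fun y => f (M y) := by
    ext y
    simp [hf, hζM]
  have hgrad : ∀ y, grad (fun y => v (M y) * Z y) y =
      ContinuousLinearMap.adjoint (M : Space n →L[ℝ] Space n) (grad f (M y)) := fun y => by
    rw [hg]
    exact grad_comp_equiv M (hfs.differentiable (by simp)) y
  have hgradZ : ∀ y, grad Z y =
      ContinuousLinearMap.adjoint (M : Space n →L[ℝ] Space n) (grad ζ (M y)) := fun y => by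
    conv_lhs => rw [hZζ]
    exact grad_comp_equiv M (hζt.1.differentiable (by simp)) y
  have hgc : HasCompactSupport (grad f) :=
    HasCompactSupport.intro hfc.isCompact fun x hx => grad_eq_zero_of_notMem hx
  have hgfM : MemLp (fun y => grad f (M y)) 2 (volume.restrict (upperHalf n)) :=
    (((continuous_grad hfs).comp M.continuous).memLp_of_hasCompactSupport
      (hgc.comp_homeomorph M.toHomeomorph)).restrict _
  have h1 : hnorm (grad fun y => v (M y) * Z y) ≤ a * r₀ * (hnorm (grad f) / J) := by
    refine (hnorm_le_mul hgfM (C := a * r₀) (by positivity) fun y => ?_).trans (le_of_eq ?_)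
    · rw [hgrad y]
      exact ha _
    · rw [hnorm_eq_jac_mul hM (grad f), ← hJdef]
      field_simp
  have hvM : Continuous fun y => v (M y) := hv.continuous.comp M.continuous
  have hind : MemLp (U.indicator fun y => v (M y)) 2 (volume.restrict (upperHalf n)) := by
    obtain ⟨R, hR⟩ := hUb.subset_closedBall 0
    obtain ⟨C, hC⟩ := (isCompact_closedBall (0 : Space n) R).exists_bound_of_continuousOn
      hvM.continuousOn
    rw [memLp_indicator_iff_restrict hU]
    have : IsFiniteMeasure ((volume.restrict (upperHalf n)).restrict U) := ⟨by
      rw [Measure.restrict_apply_univ]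
      exact (Measure.restrict_apply_le _ _).trans_lt hUb.measure_lt_top⟩
    refine MemLp.of_bound hvM.aestronglyMeasurable C ?_
    filter_upwards [ae_restrict_mem hU] with y hy using hC y (hR hy)
  have h2 : hnorm (fun x => v x • grad ζ x) ≤ J * (b / r₀ * P *
      (eLpNorm (fun y => v (M y)) 2 (volume.restrict (upperHalf n ∩ U))).toReal) := by
    rw [hnorm_eq_jac_mul hM]
    refine mul_le_mul_of_nonneg_left ?_ hJ.le
    refine (hnorm_le_mul hind (C := b / r₀ * P) (by positivity) fun y => ?_).trans (le_of_eq ?_)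
    · rw [norm_smul]
      by_cases hy : y ∈ U
      · rw [Set.indicator_of_mem hy, mul_comm]
        refine mul_le_mul_of_nonneg_right ?_ (norm_nonneg _)
        have h3 := hb (grad ζ (M y))
        rw [← hgradZ y] at h3
        rw [div_mul_eq_mul_div, le_div_iff₀ hr₀, mul_comm]
        exact h3.trans (mul_le_mul_of_nonneg_left (hZP y) hb0)
      · have hz : grad Z y = 0 := grad_eq_zero_of_notMem fun h => hy (hZ.2.2 h)
        have h3 := hb (grad ζ (M y))
        rw [← hgradZ y, hz, norm_zero, mul_zero] at h3
        have h4 : ‖grad ζ (M y)‖ = 0 :=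
          le_antisymm (nonpos_of_mul_nonpos_right h3 hr₀) (norm_nonneg _)
        rw [h4, mul_zero]
        positivity
    · rw [hnorm, eLpNorm_indicator_eq_eLpNorm_restrict hU, Measure.restrict_restrict hU,
        Set.inter_comm]
  set E := (eLpNorm (fun y => v (M y)) 2 (volume.restrict (upperHalf n ∩ U))).toReal
  have h3 := hcac ζ hζt fun x => hZ1 _
  calc _ ≤ a * r₀ * (hnorm (grad f) / J) := h1
    _ ≤ a * r₀ * (K * (J * (b / r₀ * P * E) + δ) / J) := by
        gcongr
        exact h3.trans (by gcongr)
    _ = _ := by field_simp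

/-- By `hA` the map `M` carries the form of `A` to a multiple of the Dirichlet form. The oscillation
enters as `o / jac M`, that is, divided by the square root of a volume, and this is exactly what
continuity in the `L_2`-mean controls. -/
theorem abs_integral_rescaled_le {A : Matrix (Fin (n + 1)) (Fin (n + 1)) ℝ}
    (hM : ∀ y, M y ∈ upperHalf n ↔ y ∈ upperHalf n) (hr₀ : 0 < r₀) (hb0 : 0 ≤ b)
    (hA : ∀ ξ ζ, inner ℝ (ContinuousLinearMap.adjoint (M : Space n →L[ℝ] Space n) ξ)
      (ContinuousLinearMap.adjoint (M : Space n →L[ℝ] Space n) ζ) =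
        r₀ ^ 2 * inner ℝ (Matrix.toEuclideanLin A ξ) ζ)
    (hb : ∀ ξ, r₀ * ‖ξ‖ ≤ b * ‖ContinuousLinearMap.adjoint (M : Space n →L[ℝ] Space n) ξ‖)
    {Z : Space n → ℝ} (hZ : IsTestFunction U Z) (hMU : ∀ y ∈ U, M y ∈ Metric.ball 0 r)
    (hv : ContDiff ℝ ∞ v) {k o : ℝ} (hδ : 0 ≤ δ) (hk : 0 ≤ k) (ho : 0 ≤ o)
    (hfroz : ∀ ζ φ P, IsTestFunction (Metric.ball 0 r) ζ → IsTestFunction (Metric.ball 0 r) φ →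
      (∀ x ∈ tsupport φ, ζ =ᶠ[𝓝 x] 1) → 0 ≤ P → (∀ x, ‖grad φ x‖ ≤ P) →
      |∫ x in upperHalf n,
        inner ℝ (Matrix.toEuclideanLin A (grad (fun x => v x * ζ x) x)) (grad φ x)| ≤
      (δ + 4 * k * hnorm (grad fun x => v x * ζ x)) * hnorm (grad φ) +
        P * o * hnorm (grad fun x => v x * ζ x))
    {Φ : Space n → ℝ} (hΦ : IsTestFunction U Φ) (hZΦ : ∀ y ∈ tsupport Φ, Z =ᶠ[𝓝 y] 1) {P : ℝ}
    (hP0 : 0 ≤ P) (hΦP : ∀ x, ‖grad Φ x‖ ≤ P) :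
    |∫ y in upperHalf n, inner ℝ (grad (fun y => v (M y) * Z y) y) (grad Φ y)| ≤
      b * (r₀ * (δ / jac M)) * hnorm (grad Φ) +
        4 * k * b ^ 2 * hnorm (grad fun y => v (M y) * Z y) * hnorm (grad Φ) +
        b ^ 2 * P * (o / jac M) * hnorm (grad fun y => v (M y) * Z y) := by
  set J := jac M with hJdef
  have hJ : 0 < J := jac_pos M
  set ζ : Space n → ℝ := fun x => Z (M.symm x) with hζ
  set φ : Space n → ℝ := fun x => Φ (M.symm x) with hφ
  have hζt : IsTestFunction (Metric.ball 0 r) ζ := hZ.comp_equiv_symm hMU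
  have hφt : IsTestFunction (Metric.ball 0 r) φ := hΦ.comp_equiv_symm hMU
  set f : Space n → ℝ := fun x => v x * ζ x with hf
  have hfs : ContDiff ℝ ∞ f := hv.mul hζt.1
  set g : Space n → ℝ := fun y => v (M y) * Z y with hgdef
  have hgs : ContDiff ℝ ∞ g := (contDiff_comp_equiv M hv).mul hZ.1
  have hgc : HasCompactSupport g := hZ.2.1.mul_left
  have hg : g = fun y => f (M y) := by
    ext y
    simp [hgdef, hf, hζ]
  have hΦφ : Φ = fun y => φ (M y) := by ext y; simp [hφ]
  have hgradg : ∀ y, grad g y =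
      ContinuousLinearMap.adjoint (M : Space n →L[ℝ] Space n) (grad f (M y)) := fun y => by
    rw [hg]
    exact grad_comp_equiv M (hfs.differentiable (by simp)) y
  have hgradΦ : ∀ y, grad Φ y =
      ContinuousLinearMap.adjoint (M : Space n →L[ℝ] Space n) (grad φ (M y)) := fun y => by
    conv_lhs => rw [hΦφ]
    exact grad_comp_equiv M (hφt.1.differentiable (by simp)) y
  have hpre : M ⁻¹' upperHalf n = upperHalf n := Set.ext hM
  have hint : ∫ y in upperHalf n, inner ℝ (grad g y) (grad Φ y) = r₀ ^ 2 / J ^ 2 *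
      ∫ x in upperHalf n, inner ℝ (Matrix.toEuclideanLin A (grad f x)) (grad φ x) := by
    rw [integral_restrict_eq_jac_mul M
        fun x => inner ℝ (Matrix.toEuclideanLin A (grad f x)) (grad φ x),
      hpre, ← hJdef, ← mul_assoc, div_mul_cancel₀ _ (by positivity),
      ← integral_const_mul]
    refine integral_congr_ae (Eventually.of_forall fun y => ?_)
    simp only [hgradg, hgradΦ, hA]
  have hone : ∀ x ∈ tsupport φ, ζ =ᶠ[𝓝 x] 1 := by
    intro x hx
    have hts : tsupport φ = M.symm ⁻¹' tsupport Φ :=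
      tsupport_comp_eq_preimage Φ M.symm.toHomeomorph
    rw [hts] at hx
    exact (M.symm.continuous.tendsto x).eventually (hZΦ _ hx)
  have hcomp : ∀ F G : Space n → Space n, MemLp G 2 (volume.restrict (upperHalf n)) →
      (∀ y, G y = ContinuousLinearMap.adjoint (M : Space n →L[ℝ] Space n) (F (M y))) →
      hnorm F ≤ J * (b / r₀ * hnorm G) := by
    intro F G hG hFG
    rw [hnorm_eq_jac_mul hM]
    refine mul_le_mul_of_nonneg_left (hnorm_le_mul hG (by positivity) fun y => ?_) hJ.le
    rw [hFG y, div_mul_eq_mul_div, le_div_iff₀ hr₀, mul_comm]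
    exact hb _
  have hX : hnorm (grad f) ≤ J * (b / r₀ * hnorm (grad g)) :=
    hcomp _ _ (memLp_grad hgs hgc) hgradg
  have hG : hnorm (grad φ) ≤ J * (b / r₀ * hnorm (grad Φ)) :=
    hcomp _ _ (memLp_grad hΦ.1 hΦ.2.1) hgradΦ
  have hPφ : ∀ x, ‖grad φ x‖ ≤ b / r₀ * P := by
    intro x
    have h1 := hb (grad φ x)
    have h2 := hgradΦ (M.symm x)
    rw [M.apply_symm_apply] at h2
    rw [← h2] at h1
    rw [div_mul_eq_mul_div, le_div_iff₀ hr₀, mul_comm]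
    exact h1.trans (mul_le_mul_of_nonneg_left (hΦP _) hb0)
  have h := hfroz ζ φ (b / r₀ * P) hζt hφt hone (by positivity) hPφ
  rw [hint, abs_mul, abs_of_nonneg (by positivity : 0 ≤ r₀ ^ 2 / J ^ 2)]
  have hg0 := hnorm_nonneg (grad g)
  have hΦ0 := hnorm_nonneg (grad Φ)
  calc _ ≤ r₀ ^ 2 / J ^ 2 * ((δ + 4 * k * (J * (b / r₀ * hnorm (grad g)))) *
        (J * (b / r₀ * hnorm (grad Φ))) + b / r₀ * P * o * (J * (b / r₀ * hnorm (grad g)))) := by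
        refine mul_le_mul_of_nonneg_left (h.trans ?_) (by positivity)
        have := hnorm_nonneg (grad φ)
        gcongr
    _ = _ := by
        field_simp

end Rescaling

/-! ### Local estimates in small half balls -/

theorem toReal_eLpNorm_sq {α : Type*} [MeasurableSpace α] {μ : Measure α} {f : α → ℝ}
    (hf : MemLp f 2 μ) : (eLpNorm f 2 μ).toReal ^ 2 = ∫ x, f x ^ 2 ∂μ := by
  rw [← ENNReal.toReal_pow, eLpNorm_two_sq, integral_eq_lintegral_of_nonneg_ae
    (Eventually.of_forall fun x => sq_nonneg _) (hf.1.pow 2)]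
  congr 1
  refine lintegral_congr fun x => ?_
  rw [← ofReal_norm, ← ENNReal.ofReal_pow (norm_nonneg _), Real.norm_eq_abs, sq_abs]

namespace Coefficients

variable {c : Coefficients n} {ρ : ℝ}

theorem oscillation_nonneg (r : ℝ) : 0 ≤ c.oscillation r :=
  Finset.sum_nonneg fun _ _ => Finset.sum_nonneg fun _ _ => ENNReal.toReal_nonneg

/-- The squared `L_2` norm over the half ball is its volume times the mean square deviation, and the
volume is at most a constant times `r ^ (n + 1)`. The quotient is thus bounded by the root of a
multiple of the mean. -/
theorem MeanContinuousAtZero.tendsto_oscillation {lam Lam : ℝ} (hlam : 0 < lam) (hρ : 0 < ρ)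
    (hc : c.MeasurableOn ρ)
    (hell : ∀ᵐ x ∂(volume.restrict (halfBall n ρ)), Elliptic lam Lam (c.a x))
    (hmean : c.MeanContinuousAtZero) :
    Tendsto (fun r => c.oscillation r / √(r ^ (n + 1))) (𝓝[>] 0) (𝓝 0) := by
  set V : ℝ := volume.real (Metric.ball (0 : Space n) 1) with hV
  have hentry : ∀ i j, Tendsto (fun r => (eLpNorm (fun x => c.a x i j - c.a 0 i j) 2
      (volume.restrict (halfBall n r))).toReal / √(r ^ (n + 1))) (𝓝[>] 0) (𝓝 0) := by
    intro i j
    have hlim : Tendsto (fun r => √(V * ⨍ x in halfBall n r, |c.a x i j - c.a 0 i j| ^ 2))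
        (𝓝[>] 0) (𝓝 0) := by
      have := ((hmean i j).const_mul V).sqrt
      rwa [mul_zero, Real.sqrt_zero] at this
    refine squeeze_zero' (Eventually.of_forall fun r => by positivity) ?_ hlim
    filter_upwards [Ioc_mem_nhdsGT hρ] with r hr
    have hr0 : 0 < r := hr.1
    have hfin : volume (halfBall n r) ≠ ⊤ :=
      ((measure_mono Set.inter_subset_right).trans_lt measure_ball_lt_top).ne
    have h1 := toReal_eLpNorm_sq (memLp_entry hlam hc hell hr.2 i j)
    have h2 := measure_smul_setAverage (μ := volume)
      (fun x => |c.a x i j - c.a 0 i j| ^ 2) hfin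
    have h3 : volume.real (halfBall n r) ≤ r ^ (n + 1) * V := by
      have h4 := congrArg ENNReal.toReal
        (Measure.addHaar_ball (volume : Measure (Space n)) 0 hr0.le)
      rw [finrank_euclideanSpace_fin, ENNReal.toReal_mul,
        ENNReal.toReal_ofReal (by positivity)] at h4
      change volume.real (Metric.ball (0 : Space n) r) = _ * V at h4
      rw [← h4]
      exact measureReal_mono Set.inter_subset_right measure_ball_lt_top.ne
    have h5 : 0 ≤ ⨍ x in halfBall n r, |c.a x i j - c.a 0 i j| ^ 2 :=
      integral_nonneg fun x => by positivity
    refine Real.le_sqrt_of_sq_le ?_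
    rw [div_pow, Real.sq_sqrt (by positivity), div_le_iff₀ (by positivity), h1]
    simp only [sq_abs, smul_eq_mul] at h2 h5 ⊢
    rw [← h2]
    calc _ ≤ (r ^ (n + 1) * V) * _ := mul_le_mul_of_nonneg_right h3 h5
      _ = _ := by ring
  have h := tendsto_finsetSum Finset.univ fun i _ =>
    tendsto_finsetSum Finset.univ fun j _ => hentry i j
  simp only [Finset.sum_const_zero] at h
  refine h.congr fun r => ?_
  rw [oscillation, Finset.sum_div]
  exact Finset.sum_congr rfl fun i _ => (Finset.sum_div _ _ _).symm

/-- Energy estimates for smooth approximations of a weak solution in small half balls. -/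
theorem IsWeakSolution.exists_local_estimates {lam Lam : ℝ} (hlam : 0 < lam) (hLam : 0 ≤ Lam)
    (hell : c.UniformlyElliptic lam Lam) {p q s : ℝ≥0∞} (hn : 1 ≤ n)
    (hp : ((n + 1 : ℕ) : ℝ≥0∞) < p) (hq : ((n + 1 : ℕ) : ℝ≥0∞) / 2 < q) (hs : (n : ℝ≥0∞) < s)
    (hlow : c.LowerOrderIntegrable p q s) (hmean : c.MeanContinuousAtZero) {u : Space n → ℝ}
    (hsol : c.IsWeakSolution u) :
    ∃ (ρ K : ℝ) (k : ℝ → ℝ) (v : ℕ → Space n → ℝ) (δ : ℕ → ℝ), 0 < ρ ∧ ρ ≤ 1 ∧ 0 ≤ K ∧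
      (∀ r, 0 ≤ k r) ∧ Tendsto k (𝓝[>] 0) (𝓝 0) ∧ (∀ j, ContDiff ℝ ∞ (v j)) ∧ (∀ j, 0 ≤ δ j) ∧
      Tendsto δ atTop (𝓝 0) ∧
      Tendsto (fun j => eLpNorm (v j - u) 2 (volume.restrict (halfBall n 1))) atTop (𝓝 0) ∧
      Tendsto (fun r => c.oscillation r / √(r ^ (n + 1))) (𝓝[>] 0) (𝓝 0) ∧
      ∀ r, 0 < r → r ≤ ρ → ∀ j,
        (∀ ζ, IsTestFunction (Metric.ball 0 r) ζ → (∀ x, |ζ x| ≤ 1) →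
          hnorm (grad fun x => v j x * ζ x) ≤ K * (hnorm (fun x => v j x • grad ζ x) + δ j)) ∧
        ∀ ζ φ P, IsTestFunction (Metric.ball 0 r) ζ → IsTestFunction (Metric.ball 0 r) φ →
          (∀ x ∈ tsupport φ, ζ =ᶠ[𝓝 x] 1) → 0 ≤ P → (∀ x, ‖grad φ x‖ ≤ P) →
          |∫ x in upperHalf n, inner ℝ
            (Matrix.toEuclideanLin (c.a 0) (grad (fun x => v j x * ζ x) x)) (grad φ x)| ≤
          (δ j + 4 * k r * hnorm (grad fun x => v j x * ζ x)) * hnorm (grad φ) +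
            P * c.oscillation r * hnorm (grad fun x => v j x * ζ x) := by
  obtain ⟨κ, hκ, hκle⟩ := hlow.exists_lowMass_le hn hp hq hs
  -- The threshold below which Caccioppoli's inequality absorbs the lower order terms. It appears
  -- squared because `κ` controls squared norms.
  set ε : ℝ := min (lam / 16) 1 with hε
  have hε0 : 0 < ε := lt_min (by positivity) one_pos
  have hκε : ∀ᶠ r in 𝓝[>] (0 : ℝ), κ r ≤ ENNReal.ofReal (ε ^ 2) :=
    (hκ.eventually_lt_const (ENNReal.ofReal_pos.2 (by positivity))).mono fun _ h => h.le
  obtain ⟨R, hR, hκR⟩ := mem_nhdsGT_iff_exists_Ioc_subset.1 hκε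
  have hR0 : 0 < R := hR
  -- The approximation argument uses cut-offs supported in the ball of radius `2ρ`, so `κ` must be
  -- small up to that radius.
  set ρ : ℝ := min (R / 2) (1 / 4) with hρdef
  have hρ : 0 < ρ := lt_min (by positivity) (by norm_num)
  have hρ4 : ρ ≤ 1 / 4 := min_le_right _ _
  have hρR : 2 * ρ ≤ R := by linarith [min_le_left (R / 2) (1 / 4)]
  have hκ' : ∀ r, 0 < r → r ≤ 2 * ρ → κ r ≤ ENNReal.ofReal (ε ^ 2) :=
    fun r h0 h1 => hκR ⟨h0, h1.trans hρR⟩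
  have hle : volume.restrict (halfBall n ρ) ≤ volume.restrict (halfBall n 1) :=
    Measure.restrict_mono_set _ (monotone_halfBall (by linarith))
  have hell' : ∀ᵐ x ∂(volume.restrict (halfBall n ρ)), Elliptic lam Lam (c.a x) :=
    ae_mono hle hell.ae_elliptic
  obtain ⟨hb, hW, hV, hη⟩ := hlow ρ hρ (by linarith)
  have hc : c.MeasurableOn ρ :=
    ⟨fun i j => (hell.1 i j).mono_measure hle, hb.1, hW.1, hV.1, hη.1⟩
  obtain ⟨v, δ, hv, hδ, hδ0, hvu, hweak⟩ := hsol.exists_approx hlam hρ hρ4 hc hell' (by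
    intro f hf hf0
    refine (hκle (2 * ρ) (by linarith) f hf hf0).trans ?_
    refine mul_le_of_le_one_left' ((hκ' _ (by positivity) le_rfl).trans ?_)
    rw [ENNReal.ofReal_le_one]
    exact pow_le_one₀ hε0.le (min_le_right _ _))
  have hk0 : Tendsto (fun r => √(κ r).toReal) (𝓝[>] 0) (𝓝 0) := by
    have := ((ENNReal.tendsto_toReal ENNReal.zero_ne_top).comp hκ).sqrt
    simpa using this
  refine ⟨ρ, 1 + 4 / (3 * lam) * (2 + lam / 8 + Lam), fun r => √(κ r).toReal, v, δ, hρ,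
    by linarith, by positivity, fun r => Real.sqrt_nonneg _, hk0, hv, hδ, hδ0, hvu,
    hmean.tendsto_oscillation hlam hρ hc hell', fun r hr hrρ j => ?_⟩
  have hκr : κ r ≠ ⊤ := ne_top_of_le_ne_top ENNReal.ofReal_ne_top (hκ' r hr (by linarith))
  have hkε : √(κ r).toReal ≤ ε := by
    refine Real.sqrt_le_iff.2 ⟨hε0.le, ?_⟩
    exact ENNReal.toReal_le_of_le_ofReal (by positivity) (hκ' r hr (by linarith))
  have hsmall : ∀ f : Space n → ℝ, IsTestFunction (Metric.ball 0 r) f →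
      c.lowMass ρ f (fun x' => f (incl x')) ^ (1 / 2 : ℝ) ≤
        ENNReal.ofReal (√(κ r).toReal * hnorm (grad f)) := by
    intro f hf
    have hf0 : ∀ x, r ≤ ‖x‖ → f x = 0 := fun x hx =>
      image_eq_zero_of_notMem_tsupport fun h => by
        have := mem_ball_zero_iff.1 (hf.2.2 h)
        linarith
    have h1 : c.lowMass ρ f (fun x' => f (incl x')) ≤ c.lowMass (1 / 2) f fun x' => f (incl x') :=
      add_le_add (lintegral_mono_set (monotone_halfBall (by linarith)))
        (lintegral_mono_set (monotone_flatBall (by linarith)))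
    have h2 := h1.trans (hκle r (by linarith) f hf.1 hf0)
    have h3 : eLpNorm (grad f) 2 (volume.restrict (upperHalf n)) =
        ENNReal.ofReal (hnorm (grad f)) :=
      (ENNReal.ofReal_toReal (memLp_grad hf.1 hf.2.1).2.ne).symm
    refine (ENNReal.rpow_le_rpow h2 (by norm_num)).trans (le_of_eq ?_)
    rw [h3, ← ENNReal.ofReal_toReal hκr, ← ENNReal.ofReal_pow (hnorm_nonneg _),
      ← ENNReal.ofReal_mul ENNReal.toReal_nonneg,
      ENNReal.ofReal_rpow_of_nonneg (by positivity) (by norm_num), ← Real.sqrt_eq_rpow,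
      Real.sqrt_mul ENNReal.toReal_nonneg, Real.sqrt_sq (hnorm_nonneg _),
      ENNReal.toReal_ofReal ENNReal.toReal_nonneg]
  exact ⟨fun ζ hζ hζ1 => caccioppoli hlam hLam hc hell' (Real.sqrt_nonneg _)
      (hkε.trans (min_le_left _ _)) (hkε.trans (min_le_right _ _)) hrρ hsmall (hv j) (hδ j)
      (hweak j) hζ hζ1,
    fun ζ φ P hζ hφ hζφ hP0 hP => abs_integral_frozen_le hlam hc hell' (Real.sqrt_nonneg _)
      (hkε.trans (min_le_right _ _)) hrρ hsmall (hv j) (hweak j) hζ hφ hζφ hP0 hP⟩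

end Coefficients

/-! ### Compactness of blow-ups -/

/-- The linear map `y ↦ L (r y)`. -/
def scaled (L : Space n ≃L[ℝ] Space n) {r : ℝ} (hr : 0 < r) : Space n ≃L[ℝ] Space n :=
  (ContinuousLinearEquiv.smulLeft (Units.mk0 r hr.ne')).trans L

section Scaled

variable (L : Space n ≃L[ℝ] Space n) {r : ℝ} (hr : 0 < r)

theorem coe_scaled : (scaled L hr : Space n →L[ℝ] Space n) = r • (L : Space n →L[ℝ] Space n) := by
  ext1 y
  exact map_smul L r y

theorem adjoint_scaled (ξ : Space n) :
    ContinuousLinearMap.adjoint (scaled L hr : Space n →L[ℝ] Space n) ξ =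
      r • ContinuousLinearMap.adjoint (L : Space n →L[ℝ] Space n) ξ := by
  rw [coe_scaled, map_smulₛₗ]
  simp

theorem jac_scaled : jac (scaled L hr) = √(r ^ (n + 1)) * jac L := by
  have h : ((scaled L hr : Space n →L[ℝ] Space n) : Space n →ₗ[ℝ] Space n) =
      r • ((L : Space n →L[ℝ] Space n) : Space n →ₗ[ℝ] Space n) := by
    rw [coe_scaled]
    rfl
  rw [jac, jac, h, LinearMap.det_smul, finrank_euclideanSpace_fin, abs_mul,
    abs_of_pos (by positivity : 0 < r ^ (n + 1)), Real.sqrt_mul (by positivity)]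

theorem norm_le_adjoint_symm_mul (ξ : Space n) :
    ‖ξ‖ ≤ ‖ContinuousLinearMap.adjoint (L.symm : Space n →L[ℝ] Space n)‖ *
      ‖ContinuousLinearMap.adjoint (L : Space n →L[ℝ] Space n) ξ‖ := by
  have h : ContinuousLinearMap.adjoint (L.symm : Space n →L[ℝ] Space n)
      (ContinuousLinearMap.adjoint (L : Space n →L[ℝ] Space n) ξ) = ξ := by
    refine ext_inner_right ℝ fun v => ?_
    rw [ContinuousLinearMap.adjoint_inner_left, ContinuousLinearMap.adjoint_inner_left]
    simp
  conv_lhs => rw [← h]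
  exact ContinuousLinearMap.le_opNorm _ _

end Scaled

theorem grad_const_mul {f : Space n → ℝ} (hf : Differentiable ℝ f) (c : ℝ) (x : Space n) :
    grad (fun x => c * f x) x = c • grad f x := by
  refine ext_inner_right ℝ fun v => ?_
  rw [inner_smul_left, ← fderiv_eq_inner_grad, ← fderiv_eq_inner_grad, fderiv_const_mul (hf x)]
  rfl

theorem hnorm_const_smul {E : Type*} [NormedAddCommGroup E] [NormedSpace ℝ E] (F : Space n → E)
    {c : ℝ} (hc : 0 ≤ c) : hnorm (fun x => c • F x) = c * hnorm F := by
  have : eLpNorm (fun x => c • F x) 2 (volume.restrict (upperHalf n)) =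
      ‖c‖ₑ * eLpNorm F 2 (volume.restrict (upperHalf n)) := eLpNorm_const_smul c F 2 _
  rw [hnorm, this, ENNReal.toReal_mul, toReal_enorm, Real.norm_of_nonneg hc, hnorm]

section SingleScale

variable {L : Space n ≃L[ℝ] Space n} {A : Matrix (Fin (n + 1)) (Fin (n + 1)) ℝ} {u : Space n → ℝ}
  {v : ℕ → Space n → ℝ} {δ : ℕ → ℝ} {K k o r t N C : ℝ} {U U' : Set (Space n)} {Z : Space n → ℝ}

/-- A smooth cut-off approximation of the solution, rescaled to unit size. -/
theorem exists_rescaled_approx (hL : ∀ y, L y ∈ upperHalf n ↔ y ∈ upperHalf n)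
    (hLA : ∀ ξ ζ, inner ℝ (ContinuousLinearMap.adjoint (L : Space n →L[ℝ] Space n) ξ)
      (ContinuousLinearMap.adjoint (L : Space n →L[ℝ] Space n) ζ) =
        inner ℝ (Matrix.toEuclideanLin A ξ) ζ)
    (hu : MemLp u 2 (volume.restrict (halfBall n 1))) (hv : ∀ j, ContDiff ℝ ∞ (v j))
    (hδ : ∀ j, 0 ≤ δ j) (hδ0 : Tendsto δ atTop (𝓝 0))
    (hvu : Tendsto (fun j => eLpNorm (v j - u) 2 (volume.restrict (halfBall n 1))) atTop (𝓝 0))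
    (hK : 0 ≤ K) (hk : 0 ≤ k) (ho : 0 ≤ o) (hr : 0 < r) (hN : 0 < N) (ht1 : t ≤ 1)
    (hU : MeasurableSet U) (hUb : Bornology.IsBounded U)
    (hLU : ∀ y ∈ U, L (r • y) ∈ Metric.ball 0 t) (hU'm : MeasurableSet U')
    (hU' : closure U' ⊆ U)
    (hcac : ∀ j ζ, IsTestFunction (Metric.ball 0 t) ζ → (∀ x, |ζ x| ≤ 1) →
      hnorm (grad fun x => v j x * ζ x) ≤ K * (hnorm (fun x => v j x • grad ζ x) + δ j))
    (hfroz : ∀ j ζ φ P, IsTestFunction (Metric.ball 0 t) ζ → IsTestFunction (Metric.ball 0 t) φ →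
      (∀ x ∈ tsupport φ, ζ =ᶠ[𝓝 x] 1) → 0 ≤ P → (∀ x, ‖grad φ x‖ ≤ P) →
      |∫ x in upperHalf n,
        inner ℝ (Matrix.toEuclideanLin A (grad (fun x => v j x * ζ x) x)) (grad φ x)| ≤
      (δ j + 4 * k * hnorm (grad fun x => v j x * ζ x)) * hnorm (grad φ) +
        P * o * hnorm (grad fun x => v j x * ζ x))
    (hZ : IsTestFunction U Z) (hZ1 : ∀ x, |Z x| ≤ 1) (hZU' : ∀ y ∈ closure U', Z =ᶠ[𝓝 y] 1) {Q : ℝ}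
    (hQ0 : 0 ≤ Q) (hQ : ∀ x, ‖grad Z x‖ ≤ Q)
    (hC : ∫ y in upperHalf n ∩ U, (halfBall n 1).indicator u (L (r • y)) ^ 2 ≤ C * N ^ 2)
    {ε a b : ℝ} (hε : 0 < ε)
    (ha : a = ‖ContinuousLinearMap.adjoint (L : Space n →L[ℝ] Space n)‖)
    (hb : b = ‖ContinuousLinearMap.adjoint (L.symm : Space n →L[ℝ] Space n)‖) :
    ∃ g : Space n → ℝ, ContDiff ℝ ∞ g ∧ tsupport g ⊆ tsupport Z ∧
      eLpNorm g 2 (volume.restrict (upperHalf n)) ≤ ENNReal.ofReal (√C + ε) ∧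
      hnorm (grad g) ≤ a * K * (b * Q * (√C + ε) + ε) ∧
      eLpNorm (fun y => (halfBall n 1).indicator u (L (r • y)) / N - g y) 2
        (volume.restrict (upperHalf n ∩ U')) ≤ ENNReal.ofReal ε ∧
      ∀ Φ P, IsTestFunction U' Φ → 0 ≤ P → (∀ x, ‖grad Φ x‖ ≤ P) →
        |∫ y in upperHalf n, inner ℝ (grad g y) (grad Φ y)| ≤ b * ε * hnorm (grad Φ) +
          4 * k * b ^ 2 * hnorm (grad g) * hnorm (grad Φ) +
          b ^ 2 * P * (o / (√(r ^ (n + 1)) * jac L)) * hnorm (grad g) := by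
  set M := scaled L hr with hMdef
  set J := jac M with hJdef
  have hJ : 0 < J := jac_pos M
  have hMap : ∀ y, M y = L (r • y) := fun y => rfl
  have hM : ∀ y, M y ∈ upperHalf n ↔ y ∈ upperHalf n := by
    intro y
    rw [hMap, hL, smul_mem_upperHalf hr]
  have ha0 : 0 ≤ a := ha ▸ norm_nonneg _
  have hb0 : 0 ≤ b := hb ▸ norm_nonneg _
  have hMa : ∀ ξ, ‖ContinuousLinearMap.adjoint (M : Space n →L[ℝ] Space n) ξ‖ ≤ a * r * ‖ξ‖ := by
    intro ξ
    rw [hMdef, adjoint_scaled, norm_smul, Real.norm_of_nonneg hr.le, ha, mul_comm _ r, mul_assoc]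
    exact mul_le_mul_of_nonneg_left (ContinuousLinearMap.le_opNorm _ _) hr.le
  have hMb : ∀ ξ, r * ‖ξ‖ ≤ b * ‖ContinuousLinearMap.adjoint (M : Space n →L[ℝ] Space n) ξ‖ := by
    intro ξ
    rw [hMdef, adjoint_scaled, norm_smul, Real.norm_of_nonneg hr.le, hb, mul_left_comm]
    exact mul_le_mul_of_nonneg_left (norm_le_adjoint_symm_mul L ξ) hr.le
  have hMA : ∀ ξ ζ, inner ℝ (ContinuousLinearMap.adjoint (M : Space n →L[ℝ] Space n) ξ)
      (ContinuousLinearMap.adjoint (M : Space n →L[ℝ] Space n) ζ) =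
        r ^ 2 * inner ℝ (Matrix.toEuclideanLin A ξ) ζ := by
    intro ξ ζ
    rw [hMdef, adjoint_scaled, adjoint_scaled, inner_smul_left, inner_smul_right, hLA]
    simp only [conj_trivial]
    ring
  set μ := volume.restrict (upperHalf n ∩ U) with hμ
  have hmU : MeasurableSet (upperHalf n ∩ U) := measurableSet_upperHalf.inter hU
  have hmU' : MeasurableSet (upperHalf n ∩ U') := measurableSet_upperHalf.inter hU'm
  have hmem : ∀ y ∈ upperHalf n ∩ U, M y ∈ halfBall n 1 := fun y hy =>
    ⟨(hM y).2 hy.1, Metric.ball_subset_ball ht1 (hLU y hy.2)⟩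
  -- The index is chosen after `r` and `N`, so that both approximation errors are small compared
  -- with the normalisation and the Jacobian.
  obtain ⟨j, hj1, hj2⟩ : ∃ j, eLpNorm (v j - u) 2 (volume.restrict (halfBall n 1)) ≤
      ENNReal.ofReal (J * (N * ε)) ∧ δ j ≤ J * (N * ε) / r := by
    have h1 := hvu.eventually_lt_const
      (ENNReal.ofReal_pos.2 (by positivity : 0 < J * (N * ε)))
    have h2 := hδ0.eventually_lt_const (by positivity : 0 < J * (N * ε) / r)
    obtain ⟨j, h3, h4⟩ := (h1.and h2).exists
    exact ⟨j, h3.le, h4.le⟩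
  have hcomp : ∀ w : Space n → ℝ, ENNReal.ofReal J * eLpNorm (fun y => w (M y)) 2 μ ≤
      eLpNorm w 2 (volume.restrict (halfBall n 1)) := by
    intro w
    rw [eLpNorm_restrict_eq_jac_mul M w (halfBall n 1)]
    exact mul_le_mul' le_rfl (eLpNorm_mono_measure _ (Measure.restrict_mono_set _ hmem))
  have hJe : ENNReal.ofReal J ≠ 0 := (ENNReal.ofReal_pos.2 hJ).ne'
  have hdiff : eLpNorm (fun y => v j (M y) - u (M y)) 2 μ ≤ ENNReal.ofReal (N * ε) := by
    have h1 := (hcomp (v j - u)).trans hj1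
    rw [ENNReal.ofReal_mul hJ.le] at h1
    exact (ENNReal.mul_le_mul_iff_right hJe ENNReal.ofReal_ne_top).1 h1
  have huMm : AEStronglyMeasurable (fun y => u (M y)) μ := by
    have h1 : AEStronglyMeasurable (fun y => u (M y)) (volume.restrict (M ⁻¹' halfBall n 1)) := by
      have h2 : AEStronglyMeasurable u ((Measure.map M volume).restrict (halfBall n 1)) := by
        rw [map_volume, Measure.restrict_smul]
        exact hu.1.smul_measure _
      rw [(measurableEmbedding_equiv M).restrict_map] at h2
      exact h2.comp_measurable M.continuous.measurable
    exact h1.mono_measure (Measure.restrict_mono_set _ hmem)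
  have huM : MemLp (fun y => u (M y)) 2 μ := by
    refine ⟨huMm, ?_⟩
    by_contra h
    have h1 := (hcomp u).trans_lt hu.2
    rw [not_lt_top_iff.1 h, ENNReal.mul_top hJe] at h1
    exact absurd h1 (lt_irrefl _)
  have huC : eLpNorm (fun y => u (M y)) 2 μ ≤ ENNReal.ofReal (N * √C) := by
    refine (ENNReal.le_ofReal_iff_toReal_le huM.2.ne (by positivity)).2 ?_
    have h1 : ∫ y, u (M y) ^ 2 ∂μ ≤ C * N ^ 2 := by
      refine (le_of_eq (setIntegral_congr_fun hmU fun y hy => ?_)).trans hC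
      simp only [← hMap, Set.indicator_of_mem (hmem y hy)]
    rw [← toReal_eLpNorm_sq huM] at h1
    refine (Real.le_sqrt_of_sq_le h1).trans (le_of_eq ?_)
    rw [mul_comm C, Real.sqrt_mul (by positivity), Real.sqrt_sq hN.le]
  have hvMc : Continuous fun y => v j (M y) := (hv j).continuous.comp M.continuous
  have hvC : eLpNorm (fun y => v j (M y)) 2 μ ≤ ENNReal.ofReal (N * (√C + ε)) := by
    have h1 : (fun y => v j (M y)) = (fun y => u (M y)) + fun y => v j (M y) - u (M y) := by
      ext y
      simp
    rw [h1, mul_add, ENNReal.ofReal_add (by positivity) (by positivity)]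
    exact (eLpNorm_add_le huMm (hvMc.aestronglyMeasurable.sub huMm) (by norm_num)).trans
      (add_le_add huC hdiff)
  -- The rescaled approximation is cut off by `Z`, which is 1 near the closure of `U'`; dividing by
  -- `N` gives the required function.
  set G : Space n → ℝ := fun y => v j (M y) * Z y with hG
  have hGs : ContDiff ℝ ∞ G := (contDiff_comp_equiv M (hv j)).mul hZ.1
  have hGd : Differentiable ℝ G := hGs.differentiable (by simp)
  set g : Space n → ℝ := fun y => N⁻¹ * G y with hg
  have hgrad : ∀ y, grad g y = N⁻¹ • grad G y := fun y => grad_const_mul hGd _ y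
  have hgrad' : grad g = fun y => N⁻¹ • grad G y := funext hgrad
  have hgn : hnorm (grad g) = N⁻¹ * hnorm (grad G) := by
    rw [hgrad', hnorm_const_smul _ (by positivity)]
  have hts : tsupport G ⊆ tsupport Z := tsupport_mul_subset_right
  have hgZ : ∀ y, y ∉ U → g y = 0 := fun y hy => by
    have : Z y = 0 := image_eq_zero_of_notMem_tsupport fun h => hy (hZ.2.2 h)
    simp [hg, hG, this]
  have hδJ : r * (δ j / J) ≤ N * ε := by
    rw [le_div_iff₀ hr] at hj2
    rw [mul_div_assoc', div_le_iff₀ hJ]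
    linarith
  refine ⟨g, contDiff_const.mul hGs, tsupport_mul_subset_right.trans hts, ?_, ?_, ?_, ?_⟩
  · have h1 : eLpNorm g 2 (volume.restrict (upperHalf n)) = eLpNorm g 2 μ := by
      have h2 := eLpNorm_restrict_eq_of_support_subset (ε := ℝ) (s := U) (f := g) (p := 2)
        (μ := volume.restrict (upperHalf n)) (fun y hy => by_contra fun h => hy (hgZ y h))
      rw [← h2, Measure.restrict_restrict hU, Set.inter_comm]
    have h2 : eLpNorm g 2 μ ≤ ENNReal.ofReal N⁻¹ * eLpNorm (fun y => v j (M y)) 2 μ := by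
      refine eLpNorm_le_mul_eLpNorm_of_ae_le_mul (Eventually.of_forall fun y => ?_) 2
      simp only [hg, hG, norm_mul, Real.norm_eq_abs, abs_of_pos (inv_pos.2 hN)]
      refine mul_le_mul_of_nonneg_left ?_ (by positivity)
      exact mul_le_of_le_one_right (abs_nonneg _) (hZ1 y)
    rw [h1]
    refine (h2.trans (mul_le_mul' le_rfl hvC)).trans (le_of_eq ?_)
    rw [← ENNReal.ofReal_mul (by positivity), inv_mul_cancel_left₀ hN.ne']
  · rw [hgn]
    have h1 := hnorm_grad_rescaled_le hM hr ha0 hb0 hMa hMb hU hUb hZ hZ1 hQ0 hQ hLU (hv j) hK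
      (hcac j)
    have h2 : (eLpNorm (fun y => v j (M y)) 2 μ).toReal ≤ N * (√C + ε) :=
      ENNReal.toReal_le_of_le_ofReal (by positivity) hvC
    rw [inv_mul_le_iff₀ hN]
    calc _ ≤ a * K * (b * Q * (N * (√C + ε)) + N * ε) := by
          refine h1.trans ?_
          gcongr
      _ = _ := by ring
  · have h1 : eLpNorm (fun y => (halfBall n 1).indicator u (L (r • y)) / N - g y) 2
        (volume.restrict (upperHalf n ∩ U')) ≤ ENNReal.ofReal N⁻¹ *
          eLpNorm (fun y => v j (M y) - u (M y)) 2 (volume.restrict (upperHalf n ∩ U')) := by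
      refine eLpNorm_le_mul_eLpNorm_of_ae_le_mul (Eventually.mono (ae_restrict_of_ae_restrict_of_subset
        (Set.inter_subset_inter_right _ (subset_closure.trans hU')) (ae_restrict_mem hmU) |>.and
        (ae_restrict_of_forall_mem hmU' fun y hy => hy)) fun y hy => ?_) 2
      have hZy : Z y = 1 := (hZU' y (subset_closure hy.2.2)).eq_of_nhds
      rw [← hMap, Set.indicator_of_mem (hmem y hy.1)]
      simp only [hg, hG, hZy, mul_one, Real.norm_eq_abs]
      rw [← abs_of_pos (inv_pos.2 hN), ← abs_mul, abs_of_pos (inv_pos.2 hN), ← abs_neg]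
      refine le_of_eq (congrArg _ ?_)
      ring
    refine h1.trans ((mul_le_mul' le_rfl ((eLpNorm_mono_measure _ (Measure.restrict_mono_set _
      (Set.inter_subset_inter_right _ (subset_closure.trans hU')))).trans hdiff)).trans
      (le_of_eq ?_))
    rw [← ENNReal.ofReal_mul (by positivity), inv_mul_cancel_left₀ hN.ne']
  · intro Φ P hΦ hP0 hP
    have h1 := abs_integral_rescaled_le hM hr hb0 hMA hMb hZ hLU (hv j) (hδ j) hk ho (hfroz j)
      ⟨hΦ.1, hΦ.2.1, hΦ.2.2.trans (subset_closure.trans hU')⟩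
      (fun y hy => hZU' y (subset_closure (hΦ.2.2 hy))) hP0 hP
    have h2 : ∫ y in upperHalf n, inner ℝ (grad g y) (grad Φ y) =
        N⁻¹ * ∫ y in upperHalf n, inner ℝ (grad G y) (grad Φ y) := by
      rw [← integral_const_mul]
      simp only [hgrad, inner_smul_left, conj_trivial]
    have hΦ0 := hnorm_nonneg (grad Φ)
    rw [h2, abs_mul, abs_of_pos (inv_pos.2 hN), inv_mul_le_iff₀ hN, ← jac_scaled L hr, ← hMdef]
    refine h1.trans ?_
    rw [← hG, (eq_inv_mul_iff_mul_eq₀ hN.ne').1 hgn |>.symm]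
    have h3 : b * (r * (δ j / jac M)) * hnorm (grad Φ) ≤ b * (N * ε) * hnorm (grad Φ) := by
      gcongr
    refine (add_le_add (add_le_add h3 le_rfl) le_rfl).trans (le_of_eq ?_)
    ring

end SingleScale

theorem exists_testFunction_eq_one {U K : Set (Space n)} (hU : IsOpen U)
    (hUb : Bornology.IsBounded U) (hK : IsClosed K) (hKU : K ⊆ U) :
    ∃ Z : Space n → ℝ, IsTestFunction U Z ∧ (∀ x, |Z x| ≤ 1) ∧ ∀ y ∈ K, Z =ᶠ[𝓝 y] 1 := by
  obtain ⟨f, hf0, hf1, hf⟩ := exists_contMDiffMap_zero_one_nhds_of_isClosed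
    (modelWithCornersSelf ℝ (Space n)) (n := ⊤) hU.isClosed_compl hK
    (Set.disjoint_left.2 fun x hx hxK => hx (hKU hxK))
  have hts : tsupport f ⊆ U := by
    intro x hx
    by_contra hxU
    have h1 : ∀ᶠ y in 𝓝 x, f y = 0 := (eventually_nhdsSet_iff_forall.1 hf0) x hxU
    exact (notMem_tsupport_iff_eventuallyEq.2 h1) hx
  refine ⟨f, ⟨f.contMDiff.contDiff, ?_, hts⟩, fun x => ?_, fun y hy => ?_⟩
  · exact Metric.isCompact_of_isClosed_isBounded (isClosed_tsupport _) (hUb.subset hts)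
  · rw [abs_of_nonneg (hf x).1]
    exact (hf x).2
  · exact (eventually_nhdsSet_iff_forall.1 hf1) y hy

theorem inner_grad_eq_sum (f g : Space n → ℝ) (x : Space n) :
    inner ℝ (grad f x) (grad g x) = ∑ i, pderiv i f x * pderiv i g x := by
  simp [PiLp.inner_apply, grad, mul_comm]

theorem exists_norm_grad_le {Φ : Space n → ℝ} (hΦ : ContDiff ℝ ∞ Φ) (hc : HasCompactSupport Φ) :
    ∃ P, 0 ≤ P ∧ ∀ x, ‖grad Φ x‖ ≤ P := by
  obtain ⟨P, hP⟩ := (HasCompactSupport.intro hc.isCompact fun x hx =>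
    grad_eq_zero_of_notMem hx).exists_bound_of_continuous (continuous_grad hΦ)
  exact ⟨P, (norm_nonneg _).trans (hP 0), hP⟩

theorem memLp_indicator_comp (L : Space n ≃L[ℝ] Space n) {u : Space n → ℝ} {S : Set (Space n)}
    (hS : MeasurableSet S) (hu : MemLp u 2 (volume.restrict S)) :
    MemLp (fun y => S.indicator u (L y)) 2 := by
  have h1 : MemLp (S.indicator u) 2 (Measure.map L volume) := by
    rw [map_volume]
    exact ((memLp_indicator_iff_restrict hS).2 hu).smul_measure ENNReal.ofReal_ne_top
  exact (measurableEmbedding_equiv L).memLp_map_measure_iff.1 h1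

/-- Compactness of the blow-ups of a function that satisfies local energy estimates. -/
theorem blowupCompact_of_estimates {L : Space n ≃L[ℝ] Space n}
    {A : Matrix (Fin (n + 1)) (Fin (n + 1)) ℝ} {u : Space n → ℝ}
    {v : ℕ → Space n → ℝ} {δ : ℕ → ℝ} {ρ K : ℝ} {k o : ℝ → ℝ}
    (hL : ∀ y, L y ∈ upperHalf n ↔ y ∈ upperHalf n)
    (hLA : ∀ ξ ζ, inner ℝ (ContinuousLinearMap.adjoint (L : Space n →L[ℝ] Space n) ξ)
      (ContinuousLinearMap.adjoint (L : Space n →L[ℝ] Space n) ζ) =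
        inner ℝ (Matrix.toEuclideanLin A ξ) ζ)
    (hu : MemLp u 2 (volume.restrict (halfBall n 1))) (hv : ∀ j, ContDiff ℝ ∞ (v j))
    (hδ : ∀ j, 0 ≤ δ j) (hδ0 : Tendsto δ atTop (𝓝 0))
    (hvu : Tendsto (fun j => eLpNorm (v j - u) 2 (volume.restrict (halfBall n 1))) atTop (𝓝 0))
    (hρ : 0 < ρ) (hρ1 : ρ ≤ 1) (hK : 0 ≤ K) (hk : ∀ t, 0 ≤ k t) (hk0 : Tendsto k (𝓝[>] 0) (𝓝 0))
    (ho : ∀ t, 0 ≤ o t) (ho0 : Tendsto (fun t => o t / √(t ^ (n + 1))) (𝓝[>] 0) (𝓝 0))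
    (hest : ∀ t, 0 < t → t ≤ ρ → ∀ j,
      (∀ ζ, IsTestFunction (Metric.ball 0 t) ζ → (∀ x, |ζ x| ≤ 1) →
        hnorm (grad fun x => v j x * ζ x) ≤ K * (hnorm (fun x => v j x • grad ζ x) + δ j)) ∧
      ∀ ζ φ P, IsTestFunction (Metric.ball 0 t) ζ → IsTestFunction (Metric.ball 0 t) φ →
        (∀ x ∈ tsupport φ, ζ =ᶠ[𝓝 x] 1) → 0 ≤ P → (∀ x, ‖grad φ x‖ ≤ P) →
        |∫ x in upperHalf n, inner ℝ
          (Matrix.toEuclideanLin A (grad (fun x => v j x * ζ x) x)) (grad φ x)| ≤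
        (δ j + 4 * k t * hnorm (grad fun x => v j x * ζ x)) * hnorm (grad φ) +
          P * o t * hnorm (grad fun x => v j x * ζ x)) :
    BlowupCompact fun y => (halfBall n 1).indicator u (L y) := by
  intro r N U U' C hr hr0 hN hU hUb hU' hcl hC
  obtain ⟨R, hR, hUR⟩ := hUb.subset_ball_lt 0 0
  -- Chosen so that `L (r • y)` lies in the ball of radius `r * B` for every `y` in `U`.
  set B : ℝ := ‖(L : Space n →L[ℝ] Space n)‖ * R + 1 with hB
  have hB0 : 0 < B := by positivity
  have ht0 : Tendsto (fun i => r i * B) atTop (𝓝[>] 0) := by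
    refine tendsto_nhdsWithin_iff.2 ⟨?_, Eventually.of_forall fun i => mul_pos (hr i) hB0⟩
    simpa using hr0.mul_const B
  -- From this index on, the rescaled domains fit into the ball of radius `ρ`, where the local
  -- estimates hold.
  obtain ⟨k₀, hk₀⟩ := eventually_atTop.1 (ht0.eventually (Ioc_mem_nhdsGT hρ))
  obtain ⟨Z, hZ, hZ1, hZU'⟩ := exists_testFunction_eq_one hU hUb isClosed_closure hcl
  obtain ⟨Q, hQ0, hQ⟩ := exists_norm_grad_le hZ.1 hZ.2.1
  set a := ‖ContinuousLinearMap.adjoint (L : Space n →L[ℝ] Space n)‖ with ha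
  set b := ‖ContinuousLinearMap.adjoint (L.symm : Space n →L[ℝ] Space n)‖ with hb
  have hmU' : MeasurableSet (upperHalf n ∩ U') :=
    measurableSet_upperHalf.inter hU'.measurableSet
  have hstep := fun i : ℕ => exists_rescaled_approx (r := r (i + k₀)) (t := r (i + k₀) * B)
    (N := N (i + k₀)) (k := k (r (i + k₀) * B)) (o := o (r (i + k₀) * B)) hL hLA hu hv hδ hδ0 hvu
    hK (hk _) (ho _) (hr _) (hN _) ((hk₀ _ (Nat.le_add_left _ _)).2.trans hρ1) hU.measurableSet hUb
    (fun y hy => by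
      rw [mem_ball_zero_iff, map_smul, norm_smul, Real.norm_of_nonneg (hr _).le]
      refine mul_lt_mul_of_pos_left ?_ (hr _)
      have h1 : ‖L y‖ ≤ ‖(L : Space n →L[ℝ] Space n)‖ * ‖y‖ :=
        ContinuousLinearMap.le_opNorm (L : Space n →L[ℝ] Space n) y
      have h2 : ‖y‖ ≤ R := (mem_ball_zero_iff.1 (hUR hy)).le
      have h3 := mul_le_mul_of_nonneg_left h2 (norm_nonneg (L : Space n →L[ℝ] Space n))
      linarith)
    hU'.measurableSet hcl
    (fun j => (hest _ (hk₀ _ (Nat.le_add_left _ _)).1 (hk₀ _ (Nat.le_add_left _ _)).2 j).1)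
    (fun j => (hest _ (hk₀ _ (Nat.le_add_left _ _)).1 (hk₀ _ (Nat.le_add_left _ _)).2 j).2)
    hZ hZ1 hZU' hQ0 hQ (hC _) (Nat.one_div_pos_of_nat (α := ℝ) (n := i)) ha hb
  choose g hgs hgt hgL hgG hgU hgΦ using hstep
  have hε1 : ∀ i : ℕ, 1 / ((i : ℝ) + 1) ≤ 1 := fun i => by
    rw [div_le_one (by positivity)]
    linarith [(Nat.cast_nonneg i : (0 : ℝ) ≤ i)]
  have hgc : ∀ i, HasCompactSupport (g i) := fun i =>
    hZ.2.1.of_isClosed_subset (isClosed_tsupport _) (hgt i)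
  set X : ℝ := a * K * (b * Q * (√C + 1) + 1) with hX
  have hX0 : 0 ≤ X := by positivity
  have hgX : ∀ i, hnorm (grad (g i)) ≤ X := fun i => by
    refine (hgG i).trans ?_
    have := hε1 i
    rw [hX]
    gcongr
  -- Rellich's theorem is applied to the smooth cut-off approximations, which are bounded together
  -- with their gradients in `L_2`. The blow-ups differ from them on `U'` by at most `1 / (i + 1)`.
  obtain ⟨σ, hσ, h, hh, hlim⟩ := exists_subseq_tendsto_eLpNorm hgs (R := R)
    (C := ENNReal.ofReal (√C + 1) ^ 2 + ENNReal.ofReal X ^ 2)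
    (fun i x hx => image_eq_zero_of_notMem_tsupport fun hx' => by
      have := mem_ball_zero_iff.1 (hUR (hZ.2.2 (hgt i hx')))
      linarith)
    (by simp)
    (fun i => by
      rw [← eLpNorm_two_sq]
      refine le_add_right (pow_le_pow_left' ((hgL i).trans (ENNReal.ofReal_le_ofReal ?_)) 2)
      linarith [hε1 i])
    (fun i => by
      rw [← eLpNorm_two_sq]
      refine le_add_left (pow_le_pow_left' ?_ 2)
      rw [← ENNReal.ofReal_toReal (memLp_grad (hgs i) (hgc i)).2.ne]
      exact ENNReal.ofReal_le_ofReal (hgX i))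
  have hle : volume.restrict (upperHalf n ∩ U') ≤ volume.restrict (upperHalf n) :=
    Measure.restrict_mono_set _ Set.inter_subset_left
  have hgm : ∀ i, MemLp (g i) 2 (volume.restrict (upperHalf n ∩ U')) := fun i =>
    ((hgs i).continuous.memLp_of_hasCompactSupport (hgc i)).restrict _
  have hhm : MemLp h 2 (volume.restrict (upperHalf n ∩ U')) := hh.mono_measure hle
  have hlim' : Tendsto (fun i => eLpNorm (g (σ i) - h) 2 (volume.restrict (upperHalf n ∩ U')))
      atTop (𝓝 0) :=
    tendsto_of_tendsto_of_tendsto_of_le_of_le tendsto_const_nhds hlim (fun _ => zero_le)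
      fun i => eLpNorm_mono_measure _ hle
  have hε0 : Tendsto (fun i => 1 / ((σ i : ℝ) + 1)) atTop (𝓝 0) :=
    tendsto_one_div_add_atTop_nhds_zero_nat.comp hσ.tendsto_atTop
  have htσ : Tendsto (fun i => r (σ i + k₀) * B) atTop (𝓝[>] 0) :=
    ht0.comp ((tendsto_add_atTop_nat k₀).comp hσ.tendsto_atTop)
  refine ⟨fun i => σ i + k₀, fun i j hij => Nat.add_lt_add_right (hσ hij) _, h, hhm, ?_, ?_⟩
  · have hfm := memLp_indicator_comp L measurableSet_halfBall hu
    have hfi : ∀ i, MemLp (fun x => (halfBall n 1).indicator u (L (r i • x)) / N i) 2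
        (volume.restrict (upperHalf n ∩ U')) := fun i => by
      simpa only [div_eq_inv_mul] using
        ((memLp_comp_smul hfm (hr i).ne').const_mul (N i)⁻¹).restrict (upperHalf n ∩ U')
    have hnn : Tendsto (fun i => eLpNorm (fun x => (halfBall n 1).indicator u
        (L (r (σ i + k₀) • x)) / N (σ i + k₀) - h x) 2 (volume.restrict (upperHalf n ∩ U')))
        atTop (𝓝 0) := by
      have h1 := (ENNReal.tendsto_ofReal hε0).add hlim'
      rw [ENNReal.ofReal_zero, add_zero] at h1
      refine tendsto_of_tendsto_of_tendsto_of_le_of_le tendsto_const_nhds h1 (fun _ => zero_le)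
        fun i => ?_
      have h2 : (fun x => (halfBall n 1).indicator u (L (r (σ i + k₀) • x)) / N (σ i + k₀) - h x) =
          (fun x => (halfBall n 1).indicator u (L (r (σ i + k₀) • x)) / N (σ i + k₀) - g (σ i) x) +
            (g (σ i) - h) := by
        ext x
        simp
      simp only [h2]
      exact (eLpNorm_add_le ((hfi _).sub (hgm _)).1 ((hgm _).sub hhm).1 (by norm_num)).trans
        (add_le_add (hgU (σ i)) le_rfl)
    have h3 := ((ENNReal.tendsto_toReal ENNReal.zero_ne_top).comp hnn).pow 2
    rw [ENNReal.toReal_zero, zero_pow two_ne_zero] at h3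
    exact h3.congr fun i => toReal_eLpNorm_sq ((hfi _).sub hhm)
  · refine neumannHarmonic_of_tendsto (fun i => hgs (σ i)) (fun i => hgm (σ i)) hhm hlim'
      fun Φ hΦ => ?_
    obtain ⟨P, hP0, hP⟩ := exists_norm_grad_le hΦ.1 hΦ.2.1
    have hk' := hk0.comp htσ
    have ho' := ho0.comp htσ
    have hbound : Tendsto (fun i => b * (1 / ((σ i : ℝ) + 1)) * hnorm (grad Φ) +
        4 * k (r (σ i + k₀) * B) * b ^ 2 * X * hnorm (grad Φ) +
        b ^ 2 * P * (o (r (σ i + k₀) * B) / √((r (σ i + k₀) * B) ^ (n + 1)) *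
          (√(B ^ (n + 1)) / jac L)) * X) atTop (𝓝 0) := by
      have h1 := (((hε0.const_mul b).mul_const (hnorm (grad Φ))).add
        ((((hk'.const_mul 4).mul_const (b ^ 2)).mul_const X).mul_const (hnorm (grad Φ)))).add
        (((ho'.mul_const (√(B ^ (n + 1)) / jac L)).const_mul (b ^ 2 * P)).mul_const X)
      simpa using h1
    refine squeeze_zero_norm (fun i => ?_) hbound
    simp only [← inner_grad_eq_sum]
    refine (hgΦ (σ i) Φ P hΦ hP0 hP).trans ?_
    have hΦ0 := hnorm_nonneg (grad Φ)
    have hjL := jac_pos L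
    have hri := hr (σ i + k₀)
    -- The oscillation is taken at radius `r B` but normalised at radius `r`; the two normalisations
    -- differ by a fixed factor.
    have hosc : o (r (σ i + k₀) * B) / (√(r (σ i + k₀) ^ (n + 1)) * jac L) =
        o (r (σ i + k₀) * B) / √((r (σ i + k₀) * B) ^ (n + 1)) * (√(B ^ (n + 1)) / jac L) := by
      rw [mul_pow, Real.sqrt_mul (by positivity)]
      have h1 : 0 < √(B ^ (n + 1)) := Real.sqrt_pos.2 (by positivity)
      field_simp
    rw [← hosc]
    have h1 := hgX (σ i)
    have h2 := hk (r (σ i + k₀) * B)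
    have h3 := ho (r (σ i + k₀) * B)
    gcongr

/-! ### The matrices `Θ` and `Ψ_A` -/

section LinearAlgebra

variable {A S : Matrix (Fin (n + 1)) (Fin (n + 1)) ℝ} {lam Lam : ℝ}

theorem Elliptic.posDef (hlam : 0 < lam) (hA : Elliptic lam Lam A) : A.PosDef := by
  refine Matrix.PosDef.of_dotProduct_mulVec_pos ?_ fun x hx => ?_
  · rw [Matrix.IsHermitian, Matrix.conjTranspose_eq_transpose_of_trivial]
    exact hA.1
  · have h := (hA.2 (WithLp.toLp 2 x)).1
    rw [inner_toEuclideanLin_self] at h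
    have hx' : 0 < ‖WithLp.toLp 2 x‖ := norm_pos_iff.2 fun h0 => hx (by simpa using h0)
    refine lt_of_lt_of_le ?_ h
    positivity

theorem thetaMatrix_last (j : Fin (n + 1)) :
    thetaMatrix A (Fin.last n) j = (1 : Matrix (Fin (n + 1)) (Fin (n + 1)) ℝ) (Fin.last n) j := by
  by_cases h : Fin.last n = j
  · subst h
    simp [thetaMatrix]
  · simp [thetaMatrix, h, Ne.symm h]

theorem det_thetaMatrix : (thetaMatrix A).det = 1 := by
  rw [Matrix.det_of_isUpperTriangular]
  · simp [thetaMatrix]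
  · intro i j hij
    have hij' : j < i := hij
    have h1 : i ≠ j := hij'.ne'
    have h2 : j ≠ Fin.last n := (hij'.trans_le (Fin.le_last i)).ne
    simp [thetaMatrix, h1, h2]

/-- Conjugation by `Θ` decouples the last coordinate. -/
theorem conj_thetaMatrix_last (hA : A.IsSymm) (hd : A (Fin.last n) (Fin.last n) ≠ 0)
    (j : Fin (n + 1)) : (thetaMatrix A * A * (thetaMatrix A)ᵀ) (Fin.last n) j =
      if j = Fin.last n then A (Fin.last n) (Fin.last n) else 0 := by
  have h1 : ∀ k, (thetaMatrix A * A) (Fin.last n) k = A (Fin.last n) k := by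
    intro k
    simp only [Matrix.mul_apply, thetaMatrix_last]
    simp [Matrix.one_apply]
  rw [Matrix.mul_apply]
  simp only [h1, Matrix.transpose_apply]
  by_cases hj : j = Fin.last n
  · subst hj
    simp only [thetaMatrix_last]
    simp [Matrix.one_apply]
  · rw [if_neg hj]
    have h2 : ∀ k, A (Fin.last n) k * thetaMatrix A j k =
        (if k = j then A (Fin.last n) j else 0) + if k = Fin.last n then
          -A (Fin.last n) j else 0 := by
      intro k
      by_cases hkj : k = j
      · subst hkj
        simp [thetaMatrix, hj]
      · by_cases hkn : k = Fin.last n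
        · subst hkn
          rw [thetaMatrix, Matrix.of_apply, if_neg hj, if_pos rfl, if_neg hkj, if_pos rfl,
            ← hA.apply j]
          field_simp
          ring
        · rw [thetaMatrix, Matrix.of_apply, if_neg (Ne.symm hkj), if_neg hkn, if_neg hkj,
            if_neg hkn]
          simp
    simp only [h2, Finset.sum_add_distrib, Finset.sum_ite_eq', Finset.mem_univ, if_true,
      add_neg_cancel]

/-- An eigenvector of `S²` is an eigenvector of the positive semidefinite matrix `S`. -/
theorem mulVec_eq_of_mul_self {x : Fin (n + 1) → ℝ} {a : ℝ} (hS : S.PosSemidef) (ha : 0 < a)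
    (hx : (S * S) *ᵥ x = a • x) : S *ᵥ x = √a • x := by
  set w := S *ᵥ x - √a • x with hw
  have hSw : S *ᵥ w = -(√a • w) := by
    rw [hw, Matrix.mulVec_sub, Matrix.mulVec_mulVec, hx, Matrix.mulVec_smul, smul_sub, smul_smul,
      Real.mul_self_sqrt ha.le]
    abel
  have h1 := hS.dotProduct_mulVec_nonneg w
  rw [hSw, star_trivial, dotProduct_neg, dotProduct_smul, smul_eq_mul] at h1
  have h2 : 0 ≤ w ⬝ᵥ w := by
    simpa using dotProduct_star_self_nonneg w
  have h3 : w ⬝ᵥ w = 0 := by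
    have := Real.sqrt_pos.2 ha
    nlinarith
  exact sub_eq_zero.1 (dotProduct_self_eq_zero.1 h3)

-- By `conj_thetaMatrix_last` the last basis vector is an eigenvector of `Θ A Θᵀ`, hence also of its
-- square root `S`, with eigenvalue `√a_dd`. By symmetry the last row of `S` is a positive multiple
-- of that of the identity, so `S` preserves the half space.
open scoped MatrixOrder Matrix.Norms.L2Operator in
theorem exists_psiMatrix_factor (hlam : 0 < lam) (hA : Elliptic lam Lam A) :
    ∃ (S : Matrix (Fin (n + 1)) (Fin (n + 1)) ℝ) (l : ℝ), 0 < l ∧ S.IsSymm ∧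
      S * S = thetaMatrix A * A * (thetaMatrix A)ᵀ ∧ psiMatrix A = S * thetaMatrix A ∧
      (∀ j, S (Fin.last n) j = if j = Fin.last n then l else 0) ∧ IsUnit S.det := by
  have hpd := hA.posDef hlam
  have hdd : 0 < A (Fin.last n) (Fin.last n) := hpd.diag_pos
  set H := thetaMatrix A * A * (thetaMatrix A)ᵀ with hH
  have hHs : H.PosSemidef := by
    have := hpd.posSemidef.mul_mul_conjTranspose_same (thetaMatrix A)
    rwa [Matrix.conjTranspose_eq_transpose_of_trivial] at this
  have hH0 : 0 ≤ H := Matrix.nonneg_iff_posSemidef.2 hHs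
  have hSS : CFC.sqrt H * CFC.sqrt H = H := CFC.sqrt_mul_sqrt_self H hH0
  have hSp : (CFC.sqrt H).PosSemidef := Matrix.nonneg_iff_posSemidef.1 (CFC.sqrt_nonneg H)
  have hSsym : (CFC.sqrt H).IsSymm := by
    have := hSp.1
    rwa [Matrix.IsHermitian, Matrix.conjTranspose_eq_transpose_of_trivial] at this
  have hHsym : H.IsSymm := by
    have := hHs.1
    rwa [Matrix.IsHermitian, Matrix.conjTranspose_eq_transpose_of_trivial] at this
  refine ⟨CFC.sqrt H, √(A (Fin.last n) (Fin.last n)), Real.sqrt_pos.2 hdd, hSsym, hSS, rfl,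
    fun j => ?_, ?_⟩
  · have h1 : (CFC.sqrt H * CFC.sqrt H) *ᵥ Pi.single (Fin.last n) 1 =
        A (Fin.last n) (Fin.last n) • Pi.single (Fin.last n) 1 := by
      rw [hSS]
      ext i
      rw [Matrix.mulVec_single_one, Matrix.col_apply, ← hHsym.apply, hH,
        conj_thetaMatrix_last hA.1 hdd.ne']
      simp [Pi.single_apply]
    have h2 := congrFun (mulVec_eq_of_mul_self hSp hdd h1) j
    rw [Matrix.mulVec_single_one, Matrix.col_apply] at h2
    rw [← hSsym.apply, h2]
    simp [Pi.single_apply]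
  · have h1 : IsUnit H.det := by
      rw [hH, Matrix.det_mul, Matrix.det_mul, Matrix.det_transpose, det_thetaMatrix, one_mul,
        mul_one]
      exact hpd.det_pos.ne'.isUnit
    rw [← hSS, Matrix.det_mul] at h1
    exact isUnit_of_mul_isUnit_left h1

/-- The continuous linear equivalence given by an invertible matrix. -/
def matrixEquiv (M : Matrix (Fin (n + 1)) (Fin (n + 1)) ℝ) (hM : IsUnit M.det) :
    Space n ≃L[ℝ] Space n :=
  (LinearEquiv.ofLinearMap (Matrix.toEuclideanLin M) (Matrix.toEuclideanLin M⁻¹)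
    (by rw [← Matrix.toLpLin_mul_same, Matrix.mul_nonsing_inv _ hM, Matrix.toLpLin_one])
    (by rw [← Matrix.toLpLin_mul_same, Matrix.nonsing_inv_mul _ hM,
      Matrix.toLpLin_one])).toContinuousLinearEquiv

theorem matrixEquiv_apply (M : Matrix (Fin (n + 1)) (Fin (n + 1)) ℝ) (hM : IsUnit M.det)
    (x : Space n) : matrixEquiv M hM x = Matrix.toEuclideanLin M x := rfl

theorem toEuclideanLin_coord (M : Matrix (Fin (n + 1)) (Fin (n + 1)) ℝ) (x : Space n)
    (i : Fin (n + 1)) : Matrix.toEuclideanLin M x i = ∑ j, M i j * x j := by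
  simp [Matrix.toLpLin_apply, Matrix.mulVec, dotProduct]

theorem adjoint_matrixEquiv (M : Matrix (Fin (n + 1)) (Fin (n + 1)) ℝ) (hM : IsUnit M.det)
    (ξ : Space n) :
    ContinuousLinearMap.adjoint (matrixEquiv M hM : Space n →L[ℝ] Space n) ξ =
      Matrix.toEuclideanLin Mᵀ ξ := by
  refine ext_inner_right ℝ fun y => ?_
  rw [ContinuousLinearMap.adjoint_inner_left, inner_toEuclideanLin, real_inner_comm]
  change inner ℝ (Matrix.toEuclideanLin M y) ξ = _
  rw [inner_toEuclideanLin]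
  simp_rw [Finset.sum_mul]
  rw [Finset.sum_comm]
  refine Finset.sum_congr rfl fun i _ => Finset.sum_congr rfl fun j _ => ?_
  rw [Matrix.transpose_apply]
  ring

theorem matrixEquiv_mem_upperHalf {M : Matrix (Fin (n + 1)) (Fin (n + 1)) ℝ} (hM : IsUnit M.det)
    {l : ℝ} (hl : 0 < l) (h : ∀ j, M (Fin.last n) j = if j = Fin.last n then l else 0)
    (x : Space n) : matrixEquiv M hM x ∈ upperHalf n ↔ x ∈ upperHalf n := by
  have h1 : matrixEquiv M hM x (Fin.last n) = l * x (Fin.last n) := by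
    rw [matrixEquiv_apply, toEuclideanLin_coord]
    simp [h]
  change 0 < matrixEquiv M hM x (Fin.last n) ↔ 0 < x (Fin.last n)
  rw [h1, mul_pos_iff_of_pos_left hl]

/-- Linear coordinates in which the matrix `A` becomes the identity and the half space is
preserved, together with the map `Ψ_A`. -/
theorem exists_normalizing_equiv (hlam : 0 < lam) (hA : Elliptic lam Lam A) :
    ∃ L Ψ : Space n ≃L[ℝ] Space n, (∀ y, L y ∈ upperHalf n ↔ y ∈ upperHalf n) ∧
      (∀ y, Ψ y ∈ upperHalf n ↔ y ∈ upperHalf n) ∧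
      (∀ y, Ψ y = Matrix.toEuclideanLin (psiMatrix A) y) ∧
      ∀ ξ ζ, inner ℝ (ContinuousLinearMap.adjoint (L : Space n →L[ℝ] Space n) ξ)
        (ContinuousLinearMap.adjoint (L : Space n →L[ℝ] Space n) ζ) =
          inner ℝ (Matrix.toEuclideanLin A ξ) ζ := by
  obtain ⟨S, l, hl, hS, hSS, hΨ, hSl, hSu⟩ := exists_psiMatrix_factor hlam hA
  set Θ := thetaMatrix A with hΘ
  have hΘu : IsUnit Θ.det := by
    rw [hΘ, det_thetaMatrix]
    exact isUnit_one
  have hΨu : IsUnit (psiMatrix A).det := by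
    rw [hΨ, Matrix.det_mul]
    exact hSu.mul hΘu
  have hLu : IsUnit (Θ⁻¹ * S).det := by
    rw [Matrix.det_mul]
    exact (Matrix.isUnit_nonsing_inv_det _ hΘu).mul hSu
  have hinv : ∀ j, Θ⁻¹ (Fin.last n) j =
      (1 : Matrix (Fin (n + 1)) (Fin (n + 1)) ℝ) (Fin.last n) j := by
    intro j
    have h1 := congrFun (congrFun (Matrix.mul_nonsing_inv Θ hΘu) (Fin.last n)) j
    rw [Matrix.mul_apply] at h1
    rw [← h1]
    simp only [hΘ, thetaMatrix_last]
    simp [Matrix.one_apply]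
  -- The witness is `L = Θ⁻¹ S`: then `L Lᵀ = Θ⁻¹ (Θ A Θᵀ) (Θ⁻¹)ᵀ = A`. Both `L` and `Ψ_A = S Θ`
  -- have last row `l` times that of the identity.
  refine ⟨matrixEquiv _ hLu, matrixEquiv _ hΨu, matrixEquiv_mem_upperHalf hLu hl fun j => ?_,
    matrixEquiv_mem_upperHalf hΨu hl fun j => ?_, fun y => rfl, fun ξ ζ => ?_⟩
  · rw [Matrix.mul_apply]
    simp only [hinv]
    simp [Matrix.one_apply, hSl]
  · rw [hΨ, Matrix.mul_apply]
    simp only [hSl]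
    simp [hΘ, thetaMatrix_last, Matrix.one_apply, eq_comm]
  · have hLL : (Θ⁻¹ * S) * (Θ⁻¹ * S)ᵀ = A := by
      rw [Matrix.transpose_mul, hS, mul_assoc, ← mul_assoc S, hSS, ← mul_assoc, ← mul_assoc,
        ← mul_assoc, Matrix.nonsing_inv_mul _ hΘu, one_mul, mul_assoc, ← Matrix.transpose_mul,
        Matrix.nonsing_inv_mul _ hΘu, Matrix.transpose_one, mul_one]
    rw [ContinuousLinearMap.adjoint_inner_right, adjoint_matrixEquiv]
    change inner ℝ (Matrix.toEuclideanLin (Θ⁻¹ * S) (Matrix.toEuclideanLin (Θ⁻¹ * S)ᵀ ξ)) ζ = _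
    rw [← LinearMap.comp_apply, ← Matrix.toLpLin_mul_same, hLL]

end LinearAlgebra

/-! ### Ellipticity of the value at the origin -/

theorem volume_halfBall_pos {r : ℝ} (hr : 0 < r) : 0 < volume (halfBall n r) := by
  have hopen : IsOpen (halfBall n r) := (isOpen_upperHalf).inter Metric.isOpen_ball
  refine hopen.measure_pos volume ⟨EuclideanSpace.single (Fin.last n) (r / 2), ?_, ?_⟩
  · simpa using hr
  · rw [mem_ball_zero_iff, PiLp.norm_single, Real.norm_of_nonneg (by positivity)]
    linarith

/-- The value at the origin of mean continuous elliptic coefficients is elliptic. -/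
theorem Coefficients.UniformlyElliptic.elliptic_zero {c : Coefficients n} {lam Lam : ℝ}
    (hlam : 0 < lam) (hell : c.UniformlyElliptic lam Lam) (hmean : c.MeanContinuousAtZero) :
    Elliptic lam Lam (c.a 0) := by
  set S : ℝ → ℝ := fun r => ∑ i, ∑ j, ⨍ x in halfBall n r, |c.a x i j - c.a 0 i j| ^ 2 with hS
  have hS0 : Tendsto S (𝓝[>] 0) (𝓝 0) := by
    have h := tendsto_finsetSum Finset.univ fun i _ =>
      tendsto_finsetSum Finset.univ fun j _ => hmean i j
    simpa only [Finset.sum_const_zero] using h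
  -- The almost everywhere condition says nothing about the value at 0. In each small half ball
  -- there is a point where the matrix is elliptic and deviates from that value by no more than the
  -- average; ellipticity is a closed condition and survives as `r` tends to 0.
  have hex : ∀ r ∈ Set.Ioc (0 : ℝ) 1, ∃ M, Elliptic lam Lam M ∧
      ∀ i j, |M i j - c.a 0 i j| ^ 2 ≤ S r := by
    intro r hr
    have hle : volume.restrict (halfBall n r) ≤ volume.restrict (halfBall n 1) :=
      Measure.restrict_mono_set _ (monotone_halfBall hr.2)
    have hfin : IsFiniteMeasure (volume.restrict (halfBall n r)) :=
      ⟨by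
        rw [Measure.restrict_apply_univ]
        exact (measure_mono Set.inter_subset_right).trans_lt measure_ball_lt_top⟩
    have hne : volume.restrict (halfBall n r) ≠ 0 := by
      rw [Ne, Measure.restrict_eq_zero]
      exact (volume_halfBall_pos hr.1).ne'
    have hae := ae_mono hle hell.ae_elliptic
    have hint : ∀ i j, Integrable (fun x => |c.a x i j - c.a 0 i j| ^ 2)
        (volume.restrict (halfBall n r)) := by
      intro i j
      have hm : MemLp (fun x => c.a x i j - c.a 0 i j) 2 (volume.restrict (halfBall n r)) := by
        refine MemLp.sub (MemLp.of_bound ((hell.1 i j).mono_measure hle) Lam ?_) (memLp_const _)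
        filter_upwards [hae] with x hx
        exact hx.abs_entry_le hlam i j
      simpa only [sq_abs] using hm.integrable_sq
    obtain ⟨x, hx, hxS⟩ := exists_notMem_null_le_average hne
      (integrable_finsetSum Finset.univ fun i _ =>
        integrable_finsetSum Finset.univ fun j _ => hint i j) hae
    refine ⟨c.a x, not_not.1 hx, fun i j => ?_⟩
    have hSr : ⨍ x in halfBall n r, ∑ i, ∑ j, |c.a x i j - c.a 0 i j| ^ 2 = S r := by
      rw [hS, setAverage_eq, integral_finsetSum _ fun i _ =>
        integrable_finsetSum Finset.univ fun j _ => hint i j, Finset.smul_sum]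
      refine Finset.sum_congr rfl fun i _ => ?_
      rw [integral_finsetSum _ fun j _ => hint i j, Finset.smul_sum]
      exact Finset.sum_congr rfl fun j _ => (setAverage_eq _ _ _).symm
    rw [← hSr]
    refine le_trans ?_ hxS
    refine le_trans ?_ (Finset.single_le_sum (f := fun i => ∑ j, |c.a x i j - c.a 0 i j| ^ 2)
      (fun i _ => Finset.sum_nonneg fun j _ => by positivity) (Finset.mem_univ i))
    exact Finset.single_le_sum (f := fun j => |c.a x i j - c.a 0 i j| ^ 2)
      (fun j _ => by positivity) (Finset.mem_univ j)
  choose! M hM hMS using hex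
  have hev : ∀ᶠ r in 𝓝[>] (0 : ℝ), r ∈ Set.Ioc (0 : ℝ) 1 := Ioc_mem_nhdsGT one_pos
  have hlim : ∀ i j, Tendsto (fun r => M r i j) (𝓝[>] 0) (𝓝 (c.a 0 i j)) := by
    intro i j
    rw [tendsto_iff_norm_sub_tendsto_zero]
    have h1 := hS0.sqrt
    rw [Real.sqrt_zero] at h1
    refine squeeze_zero' (Eventually.of_forall fun r => norm_nonneg _) ?_ h1
    filter_upwards [hev] with r hr
    exact Real.le_sqrt_of_sq_le (hMS r hr i j)
  have hlim' : ∀ ξ : Space n, Tendsto (fun r => inner ℝ (Matrix.toEuclideanLin (M r) ξ) ξ) (𝓝[>] 0)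
      (𝓝 (inner ℝ (Matrix.toEuclideanLin (c.a 0) ξ) ξ)) := by
    intro ξ
    simp only [inner_toEuclideanLin]
    exact tendsto_finsetSum _ fun i _ =>
      (tendsto_finsetSum _ fun j _ => (hlim i j).mul_const (ξ j)).mul_const (ξ i)
  refine ⟨Matrix.IsSymm.ext fun i j => ?_, fun ξ => ⟨?_, ?_⟩⟩
  · refine tendsto_nhds_unique ((hlim j i).congr' ?_) (hlim i j)
    filter_upwards [hev] with r hr using (hM r hr).1.apply i j
  · refine ge_of_tendsto (hlim' ξ) ?_
    filter_upwards [hev] with r hr using ((hM r hr).2 ξ).1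
  · refine le_of_tendsto (hlim' ξ) ?_
    filter_upwards [hev] with r hr using ((hM r hr).2 ξ).2

/-! ### Averages over `Ψ_A(B_r^+)` -/

section Averages

variable {A : Matrix (Fin (n + 1)) (Fin (n + 1)) ℝ} {L Ψ : Space n ≃L[ℝ] Space n}

/-- The normalising map `L` and the map `Ψ` are different, so in the normalised coordinates these
sets are half ellipsoids; this is why the dichotomy is formulated for ellipsoids. -/
theorem preimage_psiHalfBall (hL : ∀ y, L y ∈ upperHalf n ↔ y ∈ upperHalf n)
    (hΨ : ∀ y, Ψ y ∈ upperHalf n ↔ y ∈ upperHalf n)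
    (hΨA : ∀ y, Ψ y = Matrix.toEuclideanLin (psiMatrix A) y) (r : ℝ) :
    L ⁻¹' psiHalfBall A r = upperHalf n ∩ ellip (L.trans Ψ.symm) r := by
  ext y
  have h1 : Ψ.symm (L y) ∈ upperHalf n ↔ y ∈ upperHalf n := by
    rw [← hΨ, Ψ.apply_symm_apply, hL]
  constructor
  · rintro ⟨x, hx, hxy⟩
    rw [← hΨA] at hxy
    have h2 : Ψ.symm (L y) = x := by rw [← hxy, Ψ.symm_apply_apply]
    refine ⟨h1.1 (h2 ▸ hx.1), ?_⟩
    change ‖Ψ.symm (L y)‖ < r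
    rw [h2]
    exact mem_ball_zero_iff.1 hx.2
  · rintro ⟨hy, hyr⟩
    refine ⟨Ψ.symm (L y), ⟨h1.2 hy, mem_ball_zero_iff.2 hyr⟩, ?_⟩
    rw [← hΨA, Ψ.apply_symm_apply]

theorem setIntegral_psiHalfBall (hL : ∀ y, L y ∈ upperHalf n ↔ y ∈ upperHalf n)
    (hΨ : ∀ y, Ψ y ∈ upperHalf n ↔ y ∈ upperHalf n)
    (hΨA : ∀ y, Ψ y = Matrix.toEuclideanLin (psiMatrix A) y) (u : Space n → ℝ) {r : ℝ}
    (hr : 0 < r) : ∫ x in psiHalfBall A r, u x ^ 2 =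
      jac L ^ 2 * (r ^ (n + 1) * ellipMass (L.trans Ψ.symm) (fun y => u (L y)) r) := by
  rw [integral_restrict_eq_jac_mul L, preimage_psiHalfBall hL hΨ hΨA]
  have h := setIntegral_ellip_eq (L.trans Ψ.symm) (fun y => u (L y)) hr 1
  simp only [one_smul, mul_one] at h
  rw [h]

theorem ellipMass_one_pos (B : Space n ≃L[ℝ] Space n) (t : ℝ) :
    0 < ellipMass B (fun _ => 1) t := by
  have h := setIntegral_ellip_eq B (fun _ => (1 : ℝ)) one_pos t
  simp only [one_pow, one_mul, integral_const, smul_eq_mul, mul_one,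
    measureReal_restrict_apply_univ] at h
  rw [← h]
  obtain ⟨R, hR, hRB⟩ := exists_ball_subset_ellip B one_pos
  refine ENNReal.toReal_pos (((volume_halfBall_pos hR).trans_le (measure_mono
    (Set.inter_subset_inter_right _ hRB))).ne') ?_
  exact ((isBounded_ellip B 1).subset Set.inter_subset_right).measure_lt_top.ne

/-- The volume of `Ψ_A(B_t^+)` is a constant times `t ^ (n + 1)`, the same power as in the scaling
of the integral. The averages are thus `ellipMass` up to a common factor, which cancels in the
quotient. -/
theorem logDoublingIndex_eq (hL : ∀ y, L y ∈ upperHalf n ↔ y ∈ upperHalf n)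
    (hΨ : ∀ y, Ψ y ∈ upperHalf n ↔ y ∈ upperHalf n)
    (hΨA : ∀ y, Ψ y = Matrix.toEuclideanLin (psiMatrix A) y) (u : Space n → ℝ) {r : ℝ}
    (hr : 0 < r) : logDoublingIndex A u r = Real.logb 2 √(
      ellipMass (L.trans Ψ.symm) (fun y => u (L y)) (2 * r) /
        ellipMass (L.trans Ψ.symm) (fun y => u (L y)) r) := by
  set B := L.trans Ψ.symm with hB
  have havg : ∀ t, 0 < t → ⨍ x in psiHalfBall A t, |u x| ^ 2 =
      ellipMass B (fun y => u (L y)) t / ellipMass B (fun _ => 1) 1 := by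
    intro t ht
    have hvol := setIntegral_psiHalfBall hL hΨ hΨA (fun _ => 1) ht
    simp only [one_pow, integral_const, smul_eq_mul, mul_one,
      measureReal_restrict_apply_univ] at hvol
    have hone : ellipMass B (fun _ => 1) t = ellipMass B (fun _ => 1) 1 := rfl
    have hJ := jac_pos L
    have hW := ellipMass_one_pos B 1
    simp only [sq_abs]
    rw [setAverage_eq, setIntegral_psiHalfBall hL hΨ hΨA u ht, hvol, ← hB, hone, smul_eq_mul]
    field_simp
  rw [logDoublingIndex, havg _ hr, havg _ (by positivity),
    div_div_div_cancel_right₀ (ellipMass_one_pos B 1).ne']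

/-- The truncation makes `u` square integrable on the whole space. It is invisible at small radii,
because `L` maps the dilated half ellipsoid into the unit half ball. -/
theorem ellipMass_indicator_eventuallyEq (B : Space n ≃L[ℝ] Space n)
    (hL : ∀ y, L y ∈ upperHalf n ↔ y ∈ upperHalf n) (u : Space n → ℝ) :
    ∀ᶠ r in 𝓝[>] (0 : ℝ), ellipMass B (fun y => (halfBall n 1).indicator u (L y)) r =
      ellipMass B (fun y => u (L y)) r := by
  set a := ‖(L : Space n →L[ℝ] Space n)‖ * ‖(B.symm : Space n →L[ℝ] Space n)‖ with ha
  have hlim : Tendsto (fun r : ℝ => a * r) (𝓝[>] 0) (𝓝 0) := by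
    have := (tendsto_id.const_mul a : Tendsto (fun r : ℝ => a * r) (𝓝 0) (𝓝 (a * 0)))
    rw [mul_zero] at this
    exact this.mono_left nhdsWithin_le_nhds
  filter_upwards [hlim.eventually_lt_const one_pos, self_mem_nhdsWithin] with r hr hr0
  have hr0' : 0 < r := hr0
  refine setIntegral_congr_fun measurableSet_upperHalf fun x hx => ?_
  by_cases hxB : x ∈ ellip B 1
  · have hmem : L (r • x) ∈ halfBall n 1 := by
      refine ⟨(hL _).2 ((smul_mem_upperHalf hr0').2 hx), mem_ball_zero_iff.2 ?_⟩
      rw [map_smul, norm_smul, Real.norm_of_nonneg hr0'.le]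
      have h1 : ‖L x‖ ≤ ‖(L : Space n →L[ℝ] Space n)‖ * ‖x‖ :=
        ContinuousLinearMap.le_opNorm (L : Space n →L[ℝ] Space n) x
      have h2 := norm_le_of_mem_ellip B hxB
      rw [mul_one] at h2
      have h3 : ‖L x‖ ≤ a :=
        h1.trans (mul_le_mul_of_nonneg_left h2 (norm_nonneg _))
      linarith [mul_le_mul_of_nonneg_left h3 hr0'.le]
    simp only [Set.indicator_of_mem hmem]
  · simp only [Set.indicator_of_notMem hxB, zero_mul]

theorem not_ae_zero_indicator_comp (hL : ∀ y, L y ∈ upperHalf n ↔ y ∈ upperHalf n)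
    {u : Space n → ℝ}
    (hne : ∀ r : ℝ, 0 < r → ¬ u =ᵐ[volume.restrict (halfBall n r)] 0) {r : ℝ} (hr : 0 < r) :
    ¬ ∀ᵐ y, y ∈ upperHalf n → y ∈ Metric.ball 0 r → (halfBall n 1).indicator u (L y) = 0 := by
  intro h
  have hq : Measure.QuasiMeasurePreserving (L.symm : Space n → Space n) :=
    ⟨L.symm.continuous.measurable, by
      rw [map_volume]
      exact Measure.smul_absolutelyContinuous⟩
  have h1 := hq.ae h
  obtain ⟨R, hR, hRr⟩ := Metric.isOpen_iff.1 (Metric.isOpen_ball.preimage L.symm.continuous)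
    (0 : Space n) (show (0 : Space n) ∈ L.symm ⁻¹' Metric.ball 0 r by simpa using hr)
  refine hne (min R 1) (lt_min hR one_pos) ?_
  rw [Filter.EventuallyEq, ae_restrict_iff' measurableSet_halfBall]
  filter_upwards [h1] with x hx hxm
  have h2 : L.symm x ∈ upperHalf n := by
    rw [← hL, L.apply_symm_apply]
    exact hxm.1
  have h3 := hx h2 (hRr (Metric.ball_subset_ball (min_le_left _ _) hxm.2))
  rwa [L.apply_symm_apply, Set.indicator_of_mem (monotone_halfBall (min_le_right _ _) hxm)] at h3

end Averages

theorem tendsto_logb_sqrt_of_dichotomy {q : ℝ → ℝ} {l : Filter ℝ}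
    (h : Tendsto q l atTop ∨ ∃ m : ℕ, Tendsto q l (𝓝 (4 ^ m))) :
    Tendsto (fun r => Real.logb 2 √(q r)) l atTop ∨
      ∃ m : ℕ, Tendsto (fun r => Real.logb 2 √(q r)) l (𝓝 (m : ℝ)) := by
  rcases h with h | ⟨m, h⟩
  · exact Or.inl ((Real.tendsto_logb_atTop one_lt_two).comp (Real.tendsto_sqrt_atTop.comp h))
  · refine Or.inr ⟨m, ?_⟩
    have h4 : √((4 : ℝ) ^ m) = 2 ^ m := by
      rw [show (4 : ℝ) = 2 ^ 2 by norm_num, ← pow_mul, mul_comm, pow_mul,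
        Real.sqrt_sq (by positivity)]
    have h1 : Tendsto (fun r => Real.log √(q r) / Real.log 2) l
        (𝓝 (Real.log (2 ^ m) / Real.log 2)) := by
      have := h.sqrt
      rw [h4] at this
      exact (this.log (by positivity)).div_const _
    rwa [Real.log_pow, mul_div_cancel_right₀ _ (Real.log_pos one_lt_two).ne'] at h1

end RobinHalfSpace

end

/-! ### Conclusion -/

theorem lemma3p1 (n : ℕ) (hn : 2 ≤ n + 1) (c : RobinHalfSpace.Coefficients n)
    (lam Lam : ℝ) (hlam : 0 < lam) (hLam : lam < Lam) (hell : c.UniformlyElliptic lam Lam)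
    (p q s : ENNReal) (hp : ((n + 1 : ℕ) : ENNReal) < p) (hq : ((n + 1 : ℕ) : ENNReal) / 2 < q)
    (hs : (n : ENNReal) < s) (hlow : c.LowerOrderIntegrable p q s)
    (hmean : c.MeanContinuousAtZero)
    (u : RobinHalfSpace.Space n → ℝ)
    (hu : RobinHalfSpace.MemH1 (RobinHalfSpace.halfBall n 1) u)
    (hsol : c.IsWeakSolution u)
    (hne : ∀ r : ℝ, 0 < r →
      ¬ (u =ᵐ[MeasureTheory.volume.restrict (RobinHalfSpace.halfBall n r)] 0)) :
    Filter.Tendsto (fun r : ℝ => RobinHalfSpace.logDoublingIndex (c.a 0) u r)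
        (nhdsWithin 0 (Set.Ioi 0)) Filter.atTop ∨
      ∃ m : ℕ, Filter.Tendsto (fun r : ℝ => RobinHalfSpace.logDoublingIndex (c.a 0) u r)
        (nhdsWithin 0 (Set.Ioi 0)) (nhds (m : ℝ)) := by
  open RobinHalfSpace in
  obtain ⟨Du, hDu⟩ := hu
  obtain ⟨L, Ψ, hL, hΨ, hΨA, hLA⟩ := exists_normalizing_equiv hlam (hell.elliptic_zero hlam hmean)
  obtain ⟨ρ, K, k, v, δ, hρ, hρ1, hK, hk, hk0, hv, hδ, hδ0, hvu, hosc, hest⟩ :=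
    hsol.exists_local_estimates hlam (hlam.trans hLam).le hell (by omega) hp hq hs hlow hmean
  have hbc := blowupCompact_of_estimates hL hLA hDu.memLp hv hδ hδ0 hvu hρ hρ1 hK hk hk0
    Coefficients.oscillation_nonneg hosc hest
  have hdich := tendsto_logb_sqrt_of_dichotomy (ellipMass_ratio_dichotomy
    (memLp_indicator_comp L measurableSet_halfBall hDu.memLp) hbc
    (fun r hr => not_ae_zero_indicator_comp hL hne hr) (L.trans Ψ.symm))
  have hev := ellipMass_indicator_eventuallyEq (L.trans Ψ.symm) hL u
  -- The truncation must be harmless at both radii `r` and `2r` of the quotient.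
  have h2 : Tendsto (fun r : ℝ => 2 * r) (𝓝[>] 0) (𝓝[>] 0) := by
    refine tendsto_nhdsWithin_iff.2 ⟨?_, ?_⟩
    · have : Tendsto (fun r : ℝ => 2 * r) (𝓝 0) (𝓝 (2 * 0)) := tendsto_id.const_mul 2
      rw [mul_zero] at this
      exact this.mono_left nhdsWithin_le_nhds
    · filter_upwards [self_mem_nhdsWithin] with r hr
      have hr' : 0 < r := hr
      exact Set.mem_Ioi.2 (by positivity)
  have heq : (fun r => Real.logb 2 √(
      ellipMass (L.trans Ψ.symm) (fun y => (halfBall n 1).indicator u (L y)) (2 * r) /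
        ellipMass (L.trans Ψ.symm) (fun y => (halfBall n 1).indicator u (L y)) r)) =ᶠ[𝓝[>] 0]
      fun r => logDoublingIndex (c.a 0) u r := by
    filter_upwards [hev, h2.eventually hev, self_mem_nhdsWithin] with r h1 h3 hr
    rw [logDoublingIndex_eq hL hΨ hΨA u hr, h1, h3]
  exact hdich.imp (fun h => h.congr' heq) fun ⟨m, h⟩ => ⟨m, h.congr' heq⟩
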